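/- **Setting.** For integers $\lambda_1\ge\dots\ge\lambda_N$ let $s_\lambda(x_1,\dots,x_N)=\det[x_i^{\lambda_j+N-j}]/\prod_{i<j}(x_i-x_j)$ be the rational Schur function (a Laurent polynomial), and $S_\lambda(x;N,1)=s_\lambda(x,1^{N-1})/s_\lambda(1^N)$. Let $\lambda(N)$ be such an $N$-tuple for every $N$ in a sequence of sizes increasing to infinity, and let $f:[0,1]\to\mathbb R$. Put $$\mathcal F(w;f)=\int_0^1\ln(w-f(t)-1+t)\,dt,\qquad \mathcal F'(w;f)=\int_0^1\frac{dt}{w-f(t)-1+t},\qquad \mathcal F''=(\mathcal F')',$$ $$R_1(\lambda,f)=\sum_{j=1}^N\Big|\frac{\lambda_j}{N}-f(j/N)\Big|,\quad R_\infty(\lambda,f)=\sup_{1\le j\le N}\Big|\frac{\lambda_j}{N}-f(j/N)\Big|,\quad Q(w;\lambda,f)=\sum_{j=1}^N\ln\Big(1+\frac{f(j/N)-\lambda_j/N}{w-f(j/N)-1+j/N}\Big),$$ with principal logarithms. A critical point for $y$ is a solution $w_0$ of $\mathcal F'(w_0;f)=y$ (with absolutely convergent integral). Say that $w_0$ is *admissible*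 if $w_0\notin[\lambda_N(N)/N,\ \lambda_1(N)/N+1]$ for all large $N$. **(1) Logarithmic asymptotics, real $y$.** Let $f$ be piecewise continuous, $R_\infty(\lambda(N),f)$ bounded and $R_1(\lambda(N),f)/N\to0$. Let $y\in\mathbb R\setminus\{0\}$ have a real admissible critical point $w_0$. Then $S_{\lambda(N)}(e^y;N,1)>0$ for large $N$ and $$\lim_{N\to\infty}\frac{\ln S_{\lambda(N)}(e^y;N,1)}{N}=yw_0-\int_0^1\ln|w_0-f(t)-1+t|\,dt-1-\ln|e^y-1|.$$ **(2) Refined asymptotics, real $y$.** Let $f$ be twice differentiable on $[0,1]$, let $\mathcal M\subset\mathbb C$ be open and suppose that $\exp Q(w;\lambda(N),f)\to g(w)$ uniformly on $\mathcal M$. Let $K\subset\mathbb R\setminus\{0\}$ be compact such that every $y\in K$ has a real admissible critical point $w_0=w_0(y)\in\mathcal M$ with $g(w_0)\ne0$ and $\mathcal F''(w_0;f)\ne0$. Then, uniformly in $y\in K$, $$S_{\lambda(N)}(e^y;N,1)=\sqrt{-\frac{w_0-f(0)-1}{\mathcal F''(w_0;f)\,(w_0-f(1))}}\;\frac1{g(w_0)}\;\frac{\exp\!\big(N(yw_0-\int_0^1\ln|w_0-f(t)-1+t|\,dt)\big)}{e^N\,|e^y-1|^{N-1}}\,(1+o(1)),$$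 with the positive square root. (For a single $y$ take $K=\{y\}$.) **(3) Complex $y$.** Let $f$ be weakly decreasing and let $w_0$ be an admissible critical point for $y\in\mathbb C$. Suppose that there is a steepest descent contour, i.e. a simple piecewise smooth curve $\gamma:\mathbb R\to\mathbb C$ such that: $\gamma(0)=w_0$; $\mathcal F''(w_0;f)\neq0$ and $\gamma'(0)$ is a nonzero real multiple of $\mathcal F''(w_0;f)^{-1/2}$; $\operatorname{Re}(y\gamma(s)-\mathcal F(\gamma(s);f))$ has a strict global maximum at $s=0$, in the sense that for every $\varepsilon>0$ its supremum over $|s|\ge\varepsilon$ is smaller than its value at $0$; and $\int_{-\infty}^\infty\exp(\operatorname{Re}(y\gamma(s)-\mathcal F(\gamma(s);f)))\,|\gamma'(s)|\,ds<\infty$. Suppose further that the contour of integration can be deformed to $\gamma$: $\gamma$ stays at a positive distance, uniform in all large $N$, from the points $\frac{\lambda_j(N)+N-j}{N}$, and for all large $N$ the integral of $e^{Nyw}\big/\prod_{j=1}^N\big(w-\frac{\lambda_j(N)+N-j}{N}\big)$ over $\gamma$ converges absolutely and equals its integral over a positively oriented circle around $0$ enclosing all these points. * If $f$ is piecewise continuous,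 $R_\infty(\lambda(N),f)$ is bounded and $R_1(\lambda(N),f)/N\to0$, then $S_{\lambda(N)}(e^y;N,1)\neq0$ for large $N$ and, for suitable values of the logarithm of $S_{\lambda(N)}(e^y;N,1)$, $$\lim_{N\to\infty}\frac{\ln S_{\lambda(N)}(e^y;N,1)}{N}=yw_0-\mathcal F(w_0;f)-1-\ln(e^y-1).$$ * If $f$ is twice differentiable on $[0,1]$ and $\exp Q(w;\lambda(N),f)\to g(w)$ uniformly on an open set containing $w_0$, with $g(w_0)\ne0$, then $$S_{\lambda(N)}(e^y;N,1)=r\,\frac1{g(w_0)}\,\frac{\exp(N(yw_0-\mathcal F(w_0;f)))}{e^N(e^y-1)^{N-1}}\,(1+o(1)),$$ where $r$ is the square root of $-\frac{w_0-f(0)-1}{\mathcal F''(w_0;f)(w_0-f(1))}$ given by $r=\sigma^{-1}\exp\big(\tfrac12[\ln(w_0-f(0)-1)-\ln(w_0-f(1))]\big)$, $\sigma^2=-\mathcal F''(w_0;f)$, with the sign of $\sigma$ such that $\gamma'(0)\,\sigma\in i\,\mathbb R_{>0}$. -/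

import Mathlib

open Filter Topology

namespace SchurAsymp

/-- The alternant `det [X_i ^ (μ_j)]`. -/
noncomputable def alternant {N : ℕ} (μ : Fin N → ℕ) : MvPolynomial (Fin N) ℤ :=
  (Matrix.of fun i j : Fin N => (MvPolynomial.X i : MvPolynomial (Fin N) ℤ) ^ μ j).det

/-- The Vandermonde product `∏_{i<j} (X_i - X_j)`. -/
noncomputable def vandermondeProd (N : ℕ) : MvPolynomial (Fin N) ℤ :=
  ∏ p ∈ Finset.univ.filter (fun p : Fin N × Fin N => p.1 < p.2),
    (MvPolynomial.X p.1 - MvPolynomial.X p.2)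

theorem irreducible_X_sub_X {N : ℕ} {i j : Fin N} (h : i ≠ j) :
    Irreducible (MvPolynomial.X i - MvPolynomial.X j : MvPolynomial (Fin N) ℤ) := by
  have := MvPolynomial.irreducible_mul_X_add (R := ℤ) (1 : MvPolynomial (Fin N) ℤ)
    (-MvPolynomial.X j) i one_ne_zero (by simp) (by
      rw [MvPolynomial.vars_neg, MvPolynomial.vars_X]; simpa using h) isRelPrime_one_left
  simpa [sub_eq_add_neg] using this

/-- The Vandermonde product divides every alternant. -/
theorem vandermondeProd_dvd_alternant {N : ℕ} (μ : Fin N → ℕ) :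
    vandermondeProd N ∣ alternant μ := by
  apply Finset.prod_dvd_of_isRelPrime
  · rintro ⟨i, j⟩ hp ⟨k, l⟩ hq hne
    simp only [Finset.coe_filter, Finset.mem_univ, true_and, Set.mem_ofPred_eq] at hp hq
    refine (irreducible_X_sub_X hp.ne).isRelPrime_iff_not_dvd.mpr fun ⟨r, hr⟩ => ?_
    have h1 := congrArg (MvPolynomial.eval (fun m : Fin N => if m = j then (i : ℤ) else (m : ℤ))) hr
    simp only [MvPolynomial.eval_sub, MvPolynomial.eval_X, map_mul, if_true, hp.ne, if_false,
      sub_self, zero_mul] at h1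
    have h2 : (if k = j then (i : ℤ) else (k : ℤ)) = if l = j then (i : ℤ) else (l : ℤ) := by
      linarith
    simp only [ne_eq, Prod.mk.injEq, not_and] at hne
    split_ifs at h2 with ha hb hb <;> simp only [Nat.cast_inj, Fin.val_inj] at h2 <;> omega
  · rintro ⟨i, j⟩ hp
    simp only [Finset.mem_filter, Finset.mem_univ, true_and] at hp
    rw [← Ideal.mem_span_singleton, ← Ideal.Quotient.eq_zero_iff_mem, alternant, RingHom.map_det]
    refine Matrix.det_zero_of_row_eq hp.ne ?_
    funext k
    simp only [RingHom.mapMatrix_apply, Matrix.map_apply, Matrix.of_apply, map_pow]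
    congr 1
    rw [Ideal.Quotient.eq, Ideal.mem_span_singleton]

/-- The quotient `det [X_i ^ μ_j] / ∏_{i<j} (X_i - X_j)`, a symmetric polynomial. -/
noncomputable def bialternant {N : ℕ} (μ : Fin N → ℕ) : MvPolynomial (Fin N) ℤ :=
  Classical.choose (vandermondeProd_dvd_alternant μ)

theorem vandermondeProd_mul_bialternant {N : ℕ} (μ : Fin N → ℕ) :
    vandermondeProd N * bialternant μ = alternant μ :=
  (Classical.choose_spec (vandermondeProd_dvd_alternant μ)).symm

/-- A shift that makes all parts of `lam` nonnegative. -/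
def sigShift {N : ℕ} (lam : Fin N → ℤ) : ℕ := ∑ i, (lam i).natAbs

/-- The rational Schur function: the Laurent polynomial
`s_λ = (∏ x_i)^{-m} s_{λ + m}`, where `λ + m` has nonnegative parts. -/
noncomputable def schur {K : Type*} [Field K] {N : ℕ} (lam : Fin N → ℤ) (x : Fin N → K) : K :=
  (∏ i, x i) ^ (-(sigShift lam : ℤ)) *
    MvPolynomial.aeval x
      (bialternant fun j : Fin N => (lam j + (sigShift lam : ℤ) + ((N : ℤ) - 1 - (j : ℤ))).toNat)

/-- Weyl's character formula: at pairwise distinct nonzero points `schur` is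
`det [x_i ^ (λ_j + N - j)] / ∏_{i<j} (x_i - x_j)` (here `j` runs from `0` to `N - 1`). -/
theorem schur_eq_det_div {K : Type*} [Field K] {N : ℕ} (lam : Fin N → ℤ) (x : Fin N → K)
    (h0 : ∀ i, x i ≠ 0) (hx : Function.Injective x) :
    schur lam x =
      (Matrix.of fun i j : Fin N => x i ^ (lam j + ((N : ℤ) - 1 - (j : ℤ)))).det /
        ∏ p ∈ Finset.univ.filter (fun p : Fin N × Fin N => p.1 < p.2), (x p.1 - x p.2) := by
  have hV : (∏ p ∈ Finset.univ.filter (fun p : Fin N × Fin N => p.1 < p.2), (x p.1 - x p.2)) ≠ 0 := by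
    refine Finset.prod_ne_zero_iff.mpr fun p hp => sub_ne_zero.mpr fun h => ?_
    simp only [Finset.mem_filter, Finset.mem_univ, true_and] at hp
    exact hp.ne (hx h)
  set m := sigShift lam with hm
  have hP : (∏ i, x i) ≠ 0 := Finset.prod_ne_zero_iff.mpr fun i _ => h0 i
  have key := congrArg (MvPolynomial.aeval x) (vandermondeProd_mul_bialternant
    (fun j : Fin N => (lam j + (m : ℤ) + ((N : ℤ) - 1 - (j : ℤ))).toNat))
  rw [map_mul, alternant, vandermondeProd, map_prod, AlgHom.map_det] at key
  simp only [map_sub, MvPolynomial.aeval_X] at key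
  have hexp : ∀ j : Fin N,
      (((lam j + (m : ℤ) + ((N : ℤ) - 1 - (j : ℤ))).toNat : ℕ) : ℤ)
        = m + (lam j + ((N : ℤ) - 1 - (j : ℤ))) := by
    intro j
    have h1 : (lam j).natAbs ≤ m :=
      Finset.single_le_sum (f := fun i => (lam i).natAbs) (fun _ _ => Nat.zero_le _)
        (Finset.mem_univ j)
    have := j.2
    omega
  have hmat : (AlgHom.mapMatrix (MvPolynomial.aeval x : MvPolynomial (Fin N) ℤ →ₐ[ℤ] K)
      (Matrix.of fun i j : Fin N => (MvPolynomial.X i : MvPolynomial (Fin N) ℤ) ^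
        (lam j + (m : ℤ) + ((N : ℤ) - 1 - (j : ℤ))).toNat))
      = Matrix.of fun i j : Fin N => x i ^ (m : ℤ) *
        (Matrix.of fun i j : Fin N => x i ^ (lam j + ((N : ℤ) - 1 - (j : ℤ)))) i j := by
    ext i j
    simp only [AlgHom.mapMatrix_apply, Matrix.map_apply, Matrix.of_apply, map_pow,
      MvPolynomial.aeval_X]
    rw [← zpow_natCast, hexp, zpow_add₀ (h0 i)]
  rw [hmat, Matrix.det_mul_column] at key
  rw [schur, ← hm, eq_div_iff hV, mul_assoc, mul_comm (MvPolynomial.aeval x _), key, ← mul_assoc,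
    zpow_neg, Finset.prod_zpow, inv_mul_cancel₀ (zpow_ne_zero _ hP), one_mul]

/-- The normalized Schur function `S_λ(x; N, 1) = s_λ(x, 1, …, 1) / s_λ(1, …, 1)`. -/
noncomputable def normSchur {K : Type*} [Field K] {N : ℕ} (lam : Fin N → ℤ) (x : K) : K :=
  schur lam (fun i : Fin N => if (i : ℕ) = 0 then x else 1) / schur lam (fun _ : Fin N => (1 : K))

/-- `R_1(λ, f) = ∑_{j=1}^N |λ_j / N - f (j / N)|`; the index `i : Fin N` stands for `j = i + 1`. -/
noncomputable def R1 {N : ℕ} (lam : Fin N → ℤ) (f : ℝ → ℝ) : ℝ :=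
  ∑ i : Fin N, |(lam i : ℝ) / N - f (((i : ℕ) + 1 : ℝ) / N)|

/-- `R_∞(λ, f) = sup_{j=1..N} |λ_j / N - f (j / N)|`. -/
noncomputable def Rinf {N : ℕ} (lam : Fin N → ℤ) (f : ℝ → ℝ) : ℝ :=
  ⨆ i : Fin N, |(lam i : ℝ) / N - f (((i : ℕ) + 1 : ℝ) / N)|

/-- The interval `[λ_N / N, λ_1 / N + 1]`: `λ_N` and `λ_1` are the least and the greatest part. -/
def sigInterval {N : ℕ} (lam : Fin N → ℤ) : Set ℝ :=
  {x | (∃ i, (lam i : ℝ) / N ≤ x) ∧ ∃ i, x ≤ (lam i : ℝ) / N + 1}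

/-- `Q(w; λ, f) = ∑_{j=1}^N ln (1 + (f (j/N) - λ_j/N) / (w - f (j/N) - 1 + j/N))`. -/
noncomputable def Q {N : ℕ} (lam : Fin N → ℤ) (f : ℝ → ℝ) (w : ℂ) : ℂ :=
  ∑ i : Fin N, Complex.log (1 +
    ((f (((i : ℕ) + 1 : ℝ) / N) : ℂ) - (lam i : ℂ) / N) /
      (w - (f (((i : ℕ) + 1 : ℝ) / N) : ℂ) - 1 + ((i : ℕ) + 1 : ℂ) / N))

/-- `F(w; f) = ∫_0^1 ln (w - f(t) - 1 + t) dt`, with the principal branch of the logarithm. -/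
noncomputable def F (f : ℝ → ℝ) (w : ℂ) : ℂ :=
  ∫ t in (0 : ℝ)..1, Complex.log (w - (f t : ℂ) - 1 + (t : ℂ))

/-- The derivative `F'(w; f) = ∫_0^1 dt / (w - f(t) - 1 + t)`, in the form that does not depend on
a branch of the logarithm. -/
noncomputable def dF (f : ℝ → ℝ) (w : ℂ) : ℂ :=
  ∫ t in (0 : ℝ)..1, 1 / (w - (f t : ℂ) - 1 + (t : ℂ))

/-- The second derivative `F''(w; f)`. -/
noncomputable def d2F (f : ℝ → ℝ) (w : ℂ) : ℂ := deriv (dF f) w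

/-- `w` solves `∫_0^1 dt / (w - f(t) - 1 + t) = y`, i.e. it is a critical point of `y w - F(w; f)`;
the integral is required to converge. -/
def IsCriticalPoint (f : ℝ → ℝ) (y w : ℂ) : Prop :=
  IntervalIntegrable (fun t : ℝ => 1 / (w - (f t : ℂ) - 1 + (t : ℂ))) MeasureTheory.volume 0 1 ∧
    dF f w = y

/-- `f` is piecewise continuous on `[0, 1]`: continuous off a finite set, with finite one-sided
limits everywhere. -/
def PiecewiseContinuous (f : ℝ → ℝ) : Prop :=
  ∃ D : Set ℝ, D.Finite ∧
    (∀ t ∈ Set.Icc (0 : ℝ) 1, t ∉ D → ContinuousWithinAt f (Set.Icc 0 1) t) ∧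
    ∀ t ∈ Set.Icc (0 : ℝ) 1,
      (∃ l, Tendsto f (𝓝[Set.Icc 0 1 ∩ Set.Ioi t] t) (𝓝 l)) ∧
      ∃ l, Tendsto f (𝓝[Set.Icc 0 1 ∩ Set.Iio t] t) (𝓝 l)

/-- `f` is twice differentiable on `[0, 1]`. -/
def TwiceDifferentiable (f : ℝ → ℝ) : Prop :=
  DifferentiableOn ℝ f (Set.Icc 0 1) ∧
    DifferentiableOn ℝ (derivWithin f (Set.Icc 0 1)) (Set.Icc 0 1)

/-- A piecewise smooth (piecewise `C¹`) curve `γ : ℝ → ℂ`: continuous, `C¹` off a set that is finite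
in every bounded interval, with one-sided limits of the derivative everywhere. -/
def PiecewiseSmooth (γ : ℝ → ℂ) : Prop :=
  Continuous γ ∧ ∃ D : Set ℝ, (∀ a b : ℝ, (D ∩ Set.Icc a b).Finite) ∧
    (∀ s, s ∉ D → ContDiffAt ℝ 1 γ s) ∧
    ∀ s, (∃ l, Tendsto (deriv γ) (𝓝[>] s) (𝓝 l)) ∧ ∃ l, Tendsto (deriv γ) (𝓝[<] s) (𝓝 l)

/-- `γ` is a steepest descent contour for `f`, `y` and the critical point `w₀`. The global maximum
of `Re (y γ(s) - F(γ(s); f))` at `s = 0` is strict and is not approached at the ends of the contour: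
away from `s = 0` the function stays below its maximum by a fixed amount. -/
structure IsSteepestDescentContour (f : ℝ → ℝ) (y w₀ : ℂ) (γ : ℝ → ℂ) : Prop where
  simple : Function.Injective γ
  piecewise_smooth : PiecewiseSmooth γ
  base : γ 0 = w₀
  d2F_ne_zero : d2F f w₀ ≠ 0
  tangent : ∃ c : ℝ, c ≠ 0 ∧ HasDerivAt γ ((c : ℂ) * d2F f w₀ ^ (-(1 / 2) : ℂ)) 0
  max : ∀ ε > 0, ∃ δ > 0, ∀ s : ℝ, ε ≤ |s| →
    (y * γ s - F f (γ s)).re ≤ (y * w₀ - F f w₀).re - δ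
  integrable : MeasureTheory.Integrable
    (fun s : ℝ => Real.exp ((y * γ s - F f (γ s)).re) * ‖deriv γ s‖)

/-- The poles `(λ_j + N - j) / N`, `j = 1, …, N`. -/
noncomputable def pole {N : ℕ} (lam : Fin N → ℤ) (i : Fin N) : ℝ :=
  ((lam i : ℝ) + N - ((i : ℕ) + 1)) / N

/-- The integrand `exp (N y w) / ∏_j (w - (λ_j + N - j) / N)` of the contour integral for
`S_λ(e^y; N, 1)` (in the variable `w = z / N`). -/
noncomputable def integrand {N : ℕ} (lam : Fin N → ℤ) (y w : ℂ) : ℂ :=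
  Complex.exp (N * y * w) / ∏ i : Fin N, (w - (pole lam i : ℂ))

/-- The integral of `integrand lam y` over `γ` converges absolutely and has the same value as the
integral over the positively oriented circles that enclose all the poles. -/
def SameContourIntegral {N : ℕ} (lam : Fin N → ℤ) (y : ℂ) (γ : ℝ → ℂ) : Prop :=
  MeasureTheory.Integrable (fun s : ℝ => integrand lam y (γ s) * deriv γ s) ∧
    ∀ R : ℝ, 0 < R → (∀ i, |pole lam i| < R) →
      ∫ s : ℝ, integrand lam y (γ s) * deriv γ s = ∮ w in C(0, R), integrand lam y w

/-- For all large `k` the contour that encloses all the poles can be deformed to `γ` without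
changing the value of the integral. As `γ` is fixed and the poles move with `k`, the contour has to
stay at a positive distance from them, uniformly in `k`. -/
def DeformableTo {ν : ℕ → ℕ} (lam : ∀ k, Fin (ν k) → ℤ) (y : ℂ) (γ : ℝ → ℂ) : Prop :=
  (∃ d > 0, ∀ᶠ k in atTop, ∀ (s : ℝ) (i : Fin (ν k)), d ≤ ‖γ s - (pole (lam k) i : ℂ)‖) ∧
    ∀ᶠ k in atTop, SameContourIntegral (lam k) y γ

/-- The main term for real `y` (with `N = ν k`):
`√(-(w₀ - f(0) - 1) / (F''(w₀) (w₀ - f(1)))) · exp (N (y w₀ - ∫ ln |w₀ - f(t) - 1 + t| dt))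
  / (e^N |e^y - 1|^(N-1)) · 1 / g(w₀)`. Note that `Re F(w₀) = ∫ ln |w₀ - f(t) - 1 + t| dt`. -/
noncomputable def realMainTerm (N : ℕ) (f : ℝ → ℝ) (g : ℂ → ℂ) (y w₀ : ℝ) : ℂ :=
  ((Real.sqrt (-((w₀ - f 0 - 1) / ((d2F f w₀).re * (w₀ - f 1)))) *
      (Real.exp (N * (y * w₀ - (F f w₀).re)) /
        (Real.exp N * |Real.exp y - 1| ^ ((N : ℤ) - 1))) : ℝ) : ℂ) / g w₀

/-- The main term for complex `y`, where `r` is the square root of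
`-(w₀ - f(0) - 1) / (F''(w₀) (w₀ - f(1)))`. -/
noncomputable def complexMainTerm (N : ℕ) (f : ℝ → ℝ) (g : ℂ → ℂ) (y w₀ r : ℂ) : ℂ :=
  r * (Complex.exp (N * (y * w₀ - F f w₀)) /
    (Complex.exp N * (Complex.exp y - 1) ^ ((N : ℤ) - 1))) / g w₀

/-- `r` is the square root of `-(w₀ - f(0) - 1) / (F''(w₀) (w₀ - f(1)))` on the branch that belongs
to a contour through `w₀` with tangent vector `v` there. Writing
`r = exp ((ln (w₀ - f(0) - 1) - ln (w₀ - f(1))) / 2) / σ` with principal logarithms,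
`σ ^ 2 = - F''(w₀)`, and `v σ` lies on the upper half of the imaginary axis. -/
def IsBranchOfRoot (f : ℝ → ℝ) (w₀ v r : ℂ) : Prop :=
  ∃ σ : ℂ, σ ^ 2 = -d2F f w₀ ∧ 0 < (v * σ).im ∧
    r = Complex.exp ((Complex.log (w₀ - f 0 - 1) - Complex.log (w₀ - f 1)) / 2) / σ

theorem IsBranchOfRoot.sq {f : ℝ → ℝ} {w₀ v r : ℂ} (h : IsBranchOfRoot f w₀ v r)
    (h0 : w₀ - f 0 - 1 ≠ 0) (h1 : w₀ - f 1 ≠ 0) :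
    r ^ 2 = -((w₀ - f 0 - 1) / (d2F f w₀ * (w₀ - f 1))) := by
  obtain ⟨σ, hσ, -, rfl⟩ := h
  rw [div_pow, hσ, ← Complex.exp_nat_mul]
  have : ((2 : ℕ) : ℂ) * ((Complex.log (w₀ - f 0 - 1) - Complex.log (w₀ - f 1)) / 2)
      = Complex.log (w₀ - f 0 - 1) - Complex.log (w₀ - f 1) := by push_cast; ring
  rw [this, Complex.exp_sub, Complex.exp_log h0, Complex.exp_log h1, div_div, mul_neg, div_neg,
    mul_comm]

end SchurAsymp

namespace SchurAsymp

theorem det_vandermonde_cons {R : Type*} [CommRing R] {n : ℕ} (a : R) (u : Fin n → R) :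
    (Matrix.vandermonde (Fin.cons a u : Fin (n + 1) → R)).det =
      (∏ k, (u k - a)) * (Matrix.vandermonde u).det := by
  rw [Matrix.det_vandermonde, Matrix.det_vandermonde]
  simp [Fin.prod_univ_succ, Fin.prod_Ioi_succ]

theorem det_vandermonde_succAbove {R : Type*} [CommRing R] {n : ℕ} (v : Fin (n + 1) → R)
    (j : Fin (n + 1)) :
    (-1) ^ (j : ℕ) * (Matrix.vandermonde v).det =
      (∏ k, (v (j.succAbove k) - v j)) * (Matrix.vandermonde fun k => v (j.succAbove k)).det := by
  rw [← det_vandermonde_cons]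
  have h := Matrix.det_permute (j.cycleRange.symm) (Matrix.vandermonde v)
  rw [Equiv.Perm.sign_symm, Fin.sign_cycleRange] at h
  push_cast at h
  rw [← h]
  congr 1
  ext i k
  refine Fin.cases ?_ (fun i => ?_) i <;> simp [Matrix.vandermonde_apply]

theorem prod_pairs_eq {R : Type*} [CommRing R] {n : ℕ} (F : Fin n → Fin n → R) :
    ∏ p ∈ Finset.univ.filter (fun p : Fin n × Fin n => p.1 < p.2), F p.1 p.2 =
      ∏ i, ∏ j ∈ Finset.Ioi i, F i j := by
  rw [Finset.prod_filter, ← Finset.univ_product_univ, Finset.prod_product]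
  refine Finset.prod_congr rfl fun i _ => ?_
  rw [← Finset.prod_filter]
  refine Finset.prod_congr ?_ fun _ _ => rfl
  ext; simp

theorem prod_pairs_cons {R : Type*} [CommRing R] {n : ℕ} (a : R) (u : Fin n → R) :
    ∏ p ∈ Finset.univ.filter (fun p : Fin (n + 1) × Fin (n + 1) => p.1 < p.2),
      ((Fin.cons a u : Fin (n + 1) → R) p.1 - (Fin.cons a u : Fin (n + 1) → R) p.2) =
      (∏ k, (a - u k)) *
      ∏ p ∈ Finset.univ.filter (fun p : Fin n × Fin n => p.1 < p.2), (u p.1 - u p.2) := by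
  rw [prod_pairs_eq (fun i j => (Fin.cons a u : Fin (n + 1) → R) i -
    (Fin.cons a u : Fin (n + 1) → R) j), prod_pairs_eq (fun i j => u i - u j)]
  simp [Fin.prod_univ_succ, Fin.prod_Ioi_succ]

/-- The exponents `λ_j + N - j`. -/
def shiftedPart {N : ℕ} (lam : Fin N → ℤ) (j : Fin N) : ℤ := lam j + ((N : ℤ) - 1 - (j : ℤ))

theorem det_cons_geometric {K : Type*} [Field K] {n : ℕ} (l : Fin (n + 1) → ℤ) (x q : K)
    (hq : q ≠ 0) (hv : Function.Injective fun j => q ^ l j) :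
    (Matrix.of fun i j : Fin (n + 1) =>
      (Fin.cons x (fun i : Fin n => q ^ ((i : ℕ) + 1)) : Fin (n + 1) → K) i ^ l j).det =
    (Matrix.vandermonde fun j => q ^ l j).det *
      ∑ j, x ^ l j * ((∏ k, q ^ l (j.succAbove k)) /
        ∏ k, (q ^ l (j.succAbove k) - q ^ l j)) := by
  rw [Matrix.det_succ_row_zero, Finset.mul_sum]
  refine Finset.sum_congr rfl fun j _ => ?_
  have hne : ∏ k, (q ^ l (j.succAbove k) - q ^ l j) ≠ 0 :=
    Finset.prod_ne_zero_iff.mpr fun k _ => sub_ne_zero.mpr fun h =>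
      Fin.succAbove_ne j k (hv h)
  have h1 := det_vandermonde_succAbove (fun j => q ^ l j) j
  have h2 : ((Matrix.of fun i j : Fin (n + 1) =>
      (Fin.cons x (fun i : Fin n => q ^ ((i : ℕ) + 1)) : Fin (n + 1) → K) i ^ l j).submatrix
        Fin.succ j.succAbove).det = (∏ k, q ^ l (j.succAbove k)) *
        (Matrix.vandermonde fun k => q ^ l (j.succAbove k)).det := by
    rw [← Matrix.det_mul_column, ← Matrix.det_transpose]
    congr 1
    ext i k
    simp only [Matrix.transpose_apply, Matrix.submatrix_apply, Matrix.of_apply, Fin.cons_succ,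
      Matrix.vandermonde_apply]
    rw [← zpow_natCast, ← zpow_natCast, ← zpow_mul, ← zpow_mul, ← zpow_add₀ hq]
    congr 1; push_cast; ring
  rw [h2]
  simp only [Matrix.of_apply, Fin.cons_zero]
  have h3 : ((-1 : K) ^ (j : ℕ)) * (-1) ^ (j : ℕ) = 1 := by
    rw [← mul_pow]; simp
  have h4 : (Matrix.vandermonde fun k => q ^ l (j.succAbove k)).det =
      (-1) ^ (j : ℕ) * (Matrix.vandermonde fun j => q ^ l j).det /
        ∏ k, (q ^ l (j.succAbove k) - q ^ l j) := by
    rw [h1, mul_comm, mul_div_assoc, div_self hne, mul_one]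
  rw [h4]
  linear_combination (x ^ l j * (∏ k, q ^ l (j.succAbove k)) *
    (Matrix.vandermonde fun j => q ^ l j).det / ∏ k, (q ^ l (j.succAbove k) - q ^ l j)) * h3

theorem continuousAt_schur {N : ℕ} (lam : Fin N → ℤ) (x : Fin N → ℂ) (h0 : ∀ i, x i ≠ 0) :
    ContinuousAt (schur lam) x := by
  unfold schur
  refine ContinuousAt.mul ?_ ?_
  · exact ContinuousAt.zpow₀ (by fun_prop) _ (Or.inl (Finset.prod_ne_zero_iff.mpr fun i _ => h0 i))
  · simp only [MvPolynomial.aeval_def, MvPolynomial.eval₂_eq']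
    exact (continuous_finsetSum _ fun d _ => continuous_const.mul
      (continuous_finsetProd _ fun i _ => (continuous_apply i).pow _)).continuousAt

theorem schur_map {N : ℕ} (lam : Fin N → ℤ) (x : Fin N → ℝ) :
    schur lam (fun i => (x i : ℂ)) = ((schur lam x : ℝ) : ℂ) := by
  unfold schur
  push_cast
  congr 1
  have := MvPolynomial.aeval_algebraMap_apply (R := ℤ) ℂ x
    (bialternant fun j : Fin N => (lam j + (sigShift lam : ℤ) + ((N : ℤ) - 1 - (j : ℤ))).toNat)
  exact this

theorem normSchur_ofReal {N : ℕ} (lam : Fin N → ℤ) (x : ℝ) :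
    normSchur lam (x : ℂ) = ((normSchur lam x : ℝ) : ℂ) := by
  unfold normSchur
  push_cast
  rw [← schur_map, ← schur_map]
  congr 2
  ext i; split_ifs <;> simp

end SchurAsymp

namespace SchurAsymp

theorem tendsto_exp_sub_exp_div (a b : ℂ) :
    Tendsto (fun t : ℝ => (Complex.exp (t * a) - Complex.exp (t * b)) / t) (𝓝[≠] 0)
      (𝓝 (a - b)) := by
  have h : HasDerivAt (fun t : ℝ => Complex.exp (t * a) - Complex.exp (t * b)) (a - b) 0 := by
    have h1 : ∀ c : ℂ, HasDerivAt (fun t : ℝ => Complex.exp (t * c)) c 0 := fun c => by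
      have := ((hasDerivAt_id (0 : ℝ)).ofReal_comp.mul_const c).cexp
      simpa using this
    exact (h1 a).sub (h1 b)
  refine h.tendsto_slope_zero.congr fun t => ?_
  simp [div_eq_inv_mul]

theorem shiftedPart_strictAnti {N : ℕ} {lam : Fin N → ℤ} (h : Antitone lam) :
    StrictAnti (shiftedPart lam) := by
  intro i j hij
  have h1 := h hij.le
  have h2 : (i : ℕ) < j := hij
  unfold shiftedPart
  omega

theorem tendsto_exp_ratio {a b c d : ℂ} (h : c ≠ d) :
    Tendsto (fun t : ℝ => (Complex.exp (t * a) - Complex.exp (t * b)) /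
      (Complex.exp (t * c) - Complex.exp (t * d))) (𝓝[≠] 0) (𝓝 ((a - b) / (c - d))) := by
  refine ((tendsto_exp_sub_exp_div a b).div (tendsto_exp_sub_exp_div c d)
    (sub_ne_zero.mpr h)).congr' ?_
  filter_upwards [self_mem_nhdsWithin] with t ht
  have : (t : ℂ) ≠ 0 := by simpa using ht
  simp only [Pi.div_apply]
  rw [div_div_div_cancel_right₀ this]

theorem exp_injective_of {t : ℝ} (ht : t ≠ 0) {ι : Type*} {l : ι → ℤ}
    (hl : Function.Injective l) : Function.Injective fun j => Complex.exp t ^ l j := by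
  intro i j hij
  simp only [← Complex.ofReal_exp] at hij
  norm_cast at hij
  rw [← Real.rpow_intCast, ← Real.rpow_intCast, ← Real.exp_mul, ← Real.exp_mul,
    Real.exp_eq_exp] at hij
  exact hl (by exact_mod_cast mul_left_cancel₀ ht hij)

theorem tendsto_exp_pow (l : ℤ) :
    Tendsto (fun t : ℝ => Complex.exp t ^ l) (𝓝[≠] 0) (𝓝 1) := by
  have : ContinuousAt (fun t : ℝ => Complex.exp t ^ l) 0 :=
    ContinuousAt.zpow₀ (by fun_prop) _ (Or.inl (Complex.exp_ne_zero _))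
  have h := this.tendsto
  simp only [Complex.ofReal_zero, Complex.exp_zero, one_zpow] at h
  exact h.mono_left nhdsWithin_le_nhds

theorem schur_one_ne_zero {n : ℕ} {lam : Fin (n + 1) → ℤ} (hlam : Antitone lam) :
    schur lam (fun _ => (1 : ℂ)) ≠ 0 := by
  have hl := (shiftedPart_strictAnti hlam).injective
  have h1 : Tendsto (fun t : ℝ => schur lam (fun i : Fin (n + 1) => Complex.exp t ^ ((i : ℕ) : ℤ)))
      (𝓝[≠] 0) (𝓝 (schur lam (fun _ => (1 : ℂ)))) :=
    (continuousAt_schur lam _ (by simp)).tendsto.comp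
      (tendsto_pi_nhds.mpr fun i => tendsto_exp_pow _)
  have h2 : Tendsto (fun t : ℝ => ∏ p ∈ Finset.univ.filter
      (fun p : Fin (n + 1) × Fin (n + 1) => p.1 < p.2),
      ((Complex.exp (t * shiftedPart lam p.2) - Complex.exp (t * shiftedPart lam p.1)) /
        (Complex.exp (t * (p.1 : ℕ)) - Complex.exp (t * (p.2 : ℕ))))) (𝓝[≠] 0)
      (𝓝 (∏ p ∈ Finset.univ.filter (fun p : Fin (n + 1) × Fin (n + 1) => p.1 < p.2),
        (((shiftedPart lam p.2 : ℂ) - shiftedPart lam p.1) / ((p.1 : ℕ) - (p.2 : ℕ))))) := by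
    refine tendsto_finsetProd _ fun p hp => tendsto_exp_ratio ?_
    simp only [Finset.mem_filter, Finset.mem_univ, true_and] at hp
    exact_mod_cast (show (p.1 : ℕ) < p.2 from hp).ne
  have h3 := tendsto_nhds_unique (h1.congr' ?_) h2
  · rw [h3]
    refine Finset.prod_ne_zero_iff.mpr fun p hp => ?_
    simp only [Finset.mem_filter, Finset.mem_univ, true_and] at hp
    refine div_ne_zero (sub_ne_zero.mpr ?_) (sub_ne_zero.mpr ?_)
    · exact_mod_cast fun h => hp.ne' (hl h)
    · exact_mod_cast (show (p.1 : ℕ) < p.2 from hp).ne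
  · filter_upwards [self_mem_nhdsWithin] with t ht
    have hnode : Function.Injective fun i : Fin (n + 1) => Complex.exp t ^ ((i : ℕ) : ℤ) :=
      exp_injective_of ht fun i j h => by simpa [Fin.val_inj] using h
    rw [schur_eq_det_div lam _ (fun i => zpow_ne_zero _ (Complex.exp_ne_zero _)) hnode,
      Finset.prod_div_distrib]
    congr 1
    · rw [prod_pairs_eq fun i j => Complex.exp (t * shiftedPart lam j) -
        Complex.exp (t * shiftedPart lam i), ← Matrix.det_vandermonde
        (fun j => Complex.exp (t * shiftedPart lam j)), ← Matrix.det_transpose]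
      congr 1
      ext i j
      simp only [Matrix.transpose_apply, Matrix.of_apply, Matrix.vandermonde_apply]
      rw [mul_comm (t : ℂ), Complex.exp_int_mul, ← zpow_natCast, ← zpow_mul, ← zpow_mul, mul_comm]
      rfl
    · refine Finset.prod_congr rfl fun p _ => ?_
      simp only [mul_comm (t : ℂ), Complex.exp_nat_mul, zpow_natCast]

/-- `S_λ(x; N, 1)` as a sum of residues. -/
theorem normSchur_eq_sum {n : ℕ} {lam : Fin (n + 1) → ℤ} (hlam : Antitone lam) {x : ℂ}
    (h0 : x ≠ 0) (h1 : x ≠ 1) :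
    normSchur lam x = n.factorial / (x - 1) ^ n *
      ∑ j, x ^ shiftedPart lam j /
        ∏ k, ((shiftedPart lam j : ℂ) - shiftedPart lam (j.succAbove k)) := by
  have hl := (shiftedPart_strictAnti hlam).injective
  have hlim : ∀ z : ℂ, z ≠ 0 → Tendsto (fun t : ℝ => schur lam
      (Fin.cons z (fun i : Fin n => Complex.exp t ^ ((i : ℕ) + 1)) : Fin (n + 1) → ℂ)) (𝓝[≠] 0)
      (𝓝 (schur lam (fun i : Fin (n + 1) => if (i : ℕ) = 0 then z else 1))) := by
    intro z hz
    refine (continuousAt_schur lam _ ?_).tendsto.comp (tendsto_pi_nhds.mpr fun i => ?_)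
    · intro i; split_ifs <;> simp [hz]
    · refine Fin.cases ?_ (fun i => ?_) i
      · simp
      · simpa [← zpow_natCast] using (tendsto_exp_pow ((i : ℕ) + 1 : ℕ))
  have hone : (fun i : Fin (n + 1) => if (i : ℕ) = 0 then (1 : ℂ) else 1) = fun _ => 1 := by
    ext; simp
  have hL : Tendsto (fun t : ℝ => schur lam
      (Fin.cons x (fun i : Fin n => Complex.exp t ^ ((i : ℕ) + 1)) : Fin (n + 1) → ℂ) / schur lam
      (Fin.cons 1 (fun i : Fin n => Complex.exp t ^ ((i : ℕ) + 1)) : Fin (n + 1) → ℂ)) (𝓝[≠] 0)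
      (𝓝 (normSchur lam x)) := by
    have h2 := hlim 1 one_ne_zero
    rw [hone] at h2
    exact (hlim x h0).div h2 (schur_one_ne_zero hlam)
  have hR : Tendsto (fun t : ℝ => (∏ k : Fin n, (x - Complex.exp t ^ ((k : ℕ) + 1)))⁻¹ *
      ∑ j, x ^ shiftedPart lam j * ((∏ k, Complex.exp t ^ shiftedPart lam (j.succAbove k)) *
        ∏ k : Fin n, ((Complex.exp (t * (0 : ℂ)) - Complex.exp (t * ((k : ℕ) + 1 : ℕ))) /
          (Complex.exp (t * shiftedPart lam (j.succAbove k)) -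
            Complex.exp (t * shiftedPart lam j))))) (𝓝[≠] 0)
      (𝓝 ((∏ _k : Fin n, (x - 1))⁻¹ *
        ∑ j, x ^ shiftedPart lam j * ((∏ _k : Fin n, (1 : ℂ)) *
        ∏ k : Fin n, ((0 - ((k : ℕ) + 1 : ℕ)) /
          ((shiftedPart lam (j.succAbove k) : ℂ) - shiftedPart lam j))))) := by
    refine Tendsto.mul (Tendsto.inv₀ (tendsto_finsetProd _ fun k _ => ?_) ?_)
      (tendsto_finsetSum _ fun j _ => tendsto_const_nhds.mul (Tendsto.mul
        (tendsto_finsetProd _ fun k _ => tendsto_exp_pow _)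
        (tendsto_finsetProd _ fun k _ => tendsto_exp_ratio ?_)))
    · exact tendsto_const_nhds.sub (by simpa [← zpow_natCast] using tendsto_exp_pow ((k : ℕ) + 1 : ℕ))
    · exact Finset.prod_ne_zero_iff.mpr fun _ _ => sub_ne_zero.mpr h1
    · exact_mod_cast fun h => Fin.succAbove_ne j k (hl h)
  have hev : ∀ᶠ t : ℝ in 𝓝[≠] 0, ∀ k : Fin n, x ≠ Complex.exp t ^ ((k : ℕ) + 1) := by
    refine eventually_all.mpr fun k => ?_
    have := tendsto_exp_pow ((k : ℕ) + 1 : ℕ)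
    simp only [zpow_natCast] at this
    filter_upwards [this.eventually_ne h1.symm] with t ht using ht.symm
  rw [tendsto_nhds_unique (hL.congr' ?_) hR]
  · rw [Finset.prod_const, Finset.card_univ, Fintype.card_fin, div_mul_eq_mul_div, div_eq_inv_mul,
      Finset.mul_sum (_ : Finset (Fin (n + 1))) _ (n.factorial : ℂ)]
    congr 1
    refine Finset.sum_congr rfl fun j _ => ?_
    rw [Finset.prod_const_one, one_mul, Finset.prod_div_distrib, ← mul_div_assoc, ← mul_div_assoc,
      mul_comm (x ^ _)]
    have e1 : ∏ k : Fin n, ((0 : ℂ) - ((k : ℕ) + 1 : ℕ)) = (-1) ^ n * n.factorial := by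
      rw [← Fin.prod_univ_eq_prod_range (fun k => k + 1) n |>.trans
        (Finset.prod_range_add_one_eq_factorial n)]
      push_cast
      rw [show ((-1 : ℂ)) ^ n = ∏ _k : Fin n, (-1 : ℂ) by simp, ← Finset.prod_mul_distrib]
      exact Finset.prod_congr rfl fun _ _ => by ring
    have e2 : ∏ k, ((shiftedPart lam (j.succAbove k) : ℂ) - shiftedPart lam j) =
        (-1) ^ n * ∏ k, ((shiftedPart lam j : ℂ) - shiftedPart lam (j.succAbove k)) := by
      rw [show ((-1 : ℂ)) ^ n = ∏ _k : Fin n, (-1 : ℂ) by simp, ← Finset.prod_mul_distrib]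
      exact Finset.prod_congr rfl fun _ _ => by ring
    rw [e1, e2, mul_assoc, mul_div_mul_left _ _ (pow_ne_zero _ (by norm_num))]
  · filter_upwards [self_mem_nhdsWithin, hev] with t ht hxt
    have hq := Complex.exp_ne_zero t
    have hnode : Function.Injective fun i : Fin n => Complex.exp t ^ ((i : ℕ) + 1) := by
      have := exp_injective_of ht (l := fun i : Fin n => ((i : ℕ) + 1 : ℤ))
        fun i j h => by simpa [Fin.val_inj] using h
      exact_mod_cast this
    have hone : ∀ k : Fin n, (1 : ℂ) ≠ Complex.exp t ^ ((k : ℕ) + 1) := by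
      intro k hk
      have := exp_injective_of ht (l := fun i : Fin (n + 1) => ((i : ℕ) : ℤ))
        (fun i j h => by simpa [Fin.val_inj] using h) (a₁ := 0) (a₂ := k.succ)
        (by simpa [← zpow_natCast] using hk)
      exact (Fin.succ_ne_zero k) this.symm
    have hx := schur_eq_det_div lam
        (Fin.cons x (fun i : Fin n => Complex.exp t ^ ((i : ℕ) + 1)) : Fin (n + 1) → ℂ)
        (fun i => by refine Fin.cases ?_ (fun i => ?_) i <;> simp [h0])
        (Fin.cons_injective_iff.mpr ⟨fun ⟨k, hk⟩ => hxt k hk.symm, hnode⟩)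
    rw [prod_pairs_cons] at hx
    have h1' := schur_eq_det_div lam
        (Fin.cons 1 (fun i : Fin n => Complex.exp t ^ ((i : ℕ) + 1)) : Fin (n + 1) → ℂ)
        (fun i => by refine Fin.cases ?_ (fun i => ?_) i <;> simp)
        (Fin.cons_injective_iff.mpr ⟨fun ⟨k, hk⟩ => hone k hk.symm, hnode⟩)
    rw [prod_pairs_cons] at h1'
    have hv := exp_injective_of ht hl
    have hd1 := det_cons_geometric (shiftedPart lam) x (Complex.exp t) hq hv
    have hd2 : (Matrix.of fun i j : Fin (n + 1) =>
      (Fin.cons 1 (fun i : Fin n => Complex.exp t ^ ((i : ℕ) + 1)) : Fin (n + 1) → ℂ) i ^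
        shiftedPart lam j).det = (Matrix.vandermonde fun j => Complex.exp t ^ shiftedPart lam j).det := by
      rw [← Matrix.det_transpose]
      congr 1
      ext i j
      refine Fin.cases ?_ (fun j => ?_) j
      · simp
      · simp only [Matrix.transpose_apply, Matrix.of_apply, Fin.cons_succ, Matrix.vandermonde_apply,
          Fin.val_succ, ← zpow_natCast, ← zpow_mul]
        rw [mul_comm]
    unfold shiftedPart at hd1 hd2
    rw [hd1] at hx
    rw [hd2] at h1'
    rw [hx, h1']
    have n1 : (Matrix.vandermonde fun j => Complex.exp t ^ shiftedPart lam j).det ≠ 0 :=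
      Matrix.det_vandermonde_ne_zero_iff.mpr hv
    have n2 : ∏ p ∈ Finset.univ.filter (fun p : Fin n × Fin n => p.1 < p.2),
        (Complex.exp t ^ ((p.1 : ℕ) + 1) - Complex.exp t ^ ((p.2 : ℕ) + 1)) ≠ 0 := by
      refine Finset.prod_ne_zero_iff.mpr fun p hp => sub_ne_zero.mpr fun h => ?_
      simp only [Finset.mem_filter, Finset.mem_univ, true_and] at hp
      exact hp.ne (hnode h)
    have n3 : ∏ k : Fin n, (1 - Complex.exp t ^ ((k : ℕ) + 1)) ≠ 0 :=
      Finset.prod_ne_zero_iff.mpr fun k _ => sub_ne_zero.mpr (hone k)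
    have n4 : ∏ k : Fin n, (x - Complex.exp t ^ ((k : ℕ) + 1)) ≠ 0 :=
      Finset.prod_ne_zero_iff.mpr fun k _ => sub_ne_zero.mpr (hxt k)
    unfold shiftedPart at n1 ⊢
    set A := (Matrix.vandermonde fun j => Complex.exp t ^ (lam j + (((n + 1 : ℕ) : ℤ) - 1 - (j : ℤ)))).det
    set D := ∏ p ∈ Finset.univ.filter (fun p : Fin n × Fin n => p.1 < p.2),
        (Complex.exp t ^ ((p.1 : ℕ) + 1) - Complex.exp t ^ ((p.2 : ℕ) + 1))
    have e3 : ∀ a b c d e : ℂ, a ≠ 0 → b ≠ 0 → d ≠ 0 → e ≠ 0 →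
        a * c / (e * b) / (a / (d * b)) = e⁻¹ * (c * d) := by
      intros; field_simp
    rw [e3 _ _ _ _ _ n1 n2 n3 n4, Finset.sum_mul]
    congr 1
    refine Finset.sum_congr rfl fun j _ => ?_
    rw [mul_assoc, Finset.prod_div_distrib]
    simp only [mul_comm (t : ℂ), zero_mul, Complex.exp_zero, Complex.exp_int_mul,
      Complex.exp_nat_mul]
    ring

end SchurAsymp

namespace SchurAsymp

open MeasureTheory Finset

variable {ι : Type*} [DecidableEq ι]

theorem nodalWeight_insert {F : Type*} [Field F] {s : Finset ι} {a : ι} (p : ι → F) (ha : a ∉ s)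
    {j : ι} (hj : j ∈ s) :
    Lagrange.nodalWeight (insert a s) p j = (p j - p a)⁻¹ * Lagrange.nodalWeight s p j := by
  have haj : a ≠ j := fun h => ha (h ▸ hj)
  rw [Lagrange.nodalWeight, erase_insert_of_ne haj, prod_insert (by simp [ha])]
  rfl

theorem sum_nodalWeight_div {F : Type*} [Field F] {s : Finset ι} (hs : s.Nonempty) (p : ι → F)
    (hp : Set.InjOn p s) {z : F} (hz : ∀ j ∈ s, z ≠ p j) :
    ∑ j ∈ s, Lagrange.nodalWeight s p j / (z - p j) = (∏ j ∈ s, (z - p j))⁻¹ := by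
  have h := Lagrange.eval_interpolate_not_at_node (r := 1) hz
  rw [Lagrange.interpolate_one hp hs, Polynomial.eval_one, Lagrange.eval_nodal] at h
  simp only [Pi.one_apply, mul_one, ← div_eq_mul_inv] at h
  exact (inv_eq_of_mul_eq_one_right h.symm).symm

/-- The divided difference of `t ↦ exp (u t)` at the nodes `p j`, `j ∈ s`. -/
noncomputable def ddExp (s : Finset ι) (p : ι → ℝ) (u : ℝ) : ℝ :=
  ∑ j ∈ s, Lagrange.nodalWeight s p j * Real.exp (u * p j)

/-- The divided difference of `t ↦ exp (u t)` for complex `u`. -/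
noncomputable def ddExpC (s : Finset ι) (p : ι → ℝ) (u : ℂ) : ℂ :=
  ∑ j ∈ s, ((Lagrange.nodalWeight s p j : ℝ) : ℂ) * Complex.exp (u * p j)

theorem ddExpC_ofReal (s : Finset ι) (p : ι → ℝ) (u : ℝ) :
    ddExpC s p u = (ddExp s p u : ℂ) := by
  simp [ddExpC, ddExp]

theorem ofReal_nodalWeight (s : Finset ι) (p : ι → ℝ) (j : ι) :
    ((Lagrange.nodalWeight s p j : ℝ) : ℂ) = Lagrange.nodalWeight s (fun i => (p i : ℂ)) j := by
  simp [Lagrange.nodalWeight]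

theorem sum_nodalWeight_div_complex {s : Finset ι} (hs : s.Nonempty) {p : ι → ℝ}
    (hp : Set.InjOn p s) {z : ℂ} (hz : ∀ j ∈ s, z ≠ p j) :
    ∑ j ∈ s, ((Lagrange.nodalWeight s p j : ℝ) : ℂ) / (z - p j) = (∏ j ∈ s, (z - p j))⁻¹ := by
  simp only [ofReal_nodalWeight]
  exact sum_nodalWeight_div hs _ (fun i hi j hj h => hp hi hj (Complex.ofReal_injective h)) hz

theorem integral_exp_convolution {a b : ℝ} (h : a ≠ b) (u : ℝ) :
    ∫ v in (0 : ℝ)..u, Real.exp (v * a) * Real.exp (b * (u - v)) =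
      (a - b)⁻¹ * (Real.exp (u * a) - Real.exp (u * b)) := by
  have hab : a - b ≠ 0 := sub_ne_zero.mpr h
  have hd : ∀ v ∈ Set.uIcc 0 u, HasDerivAt
      (fun v => (a - b)⁻¹ * Real.exp (v * a + b * (u - v)))
      (Real.exp (v * a) * Real.exp (b * (u - v))) v := by
    intro v _
    have h1 : HasDerivAt (fun v : ℝ => v * a + b * (u - v)) (a - b) v := by
      have := ((hasDerivAt_id v).mul_const a).add (((hasDerivAt_id v).const_sub u).const_mul b)
      refine this.congr_deriv ?_
      ring
    refine (h1.exp.const_mul _).congr_deriv ?_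
    rw [Real.exp_add]
    field_simp
  rw [intervalIntegral.integral_eq_sub_of_hasDerivAt hd
    (Continuous.intervalIntegrable (by fun_prop) _ _)]
  simp only [sub_self, mul_zero, add_zero, zero_mul, zero_add, sub_zero]
  rw [mul_comm b]; ring

theorem continuous_ddExp (s : Finset ι) (p : ι → ℝ) : Continuous (ddExp s p) := by
  unfold ddExp; fun_prop

theorem ddExp_insert {s : Finset ι} (hs : s.Nonempty) {a : ι} (ha : a ∉ s) {p : ι → ℝ}
    (hp : Set.InjOn p (insert a s : Finset ι)) (u : ℝ) :
    ddExp (insert a s) p u = ∫ v in (0 : ℝ)..u, ddExp s p v * Real.exp (p a * (u - v)) := by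
  have hne : ∀ j ∈ s, p j ≠ p a := fun j hj h =>
    ha (hp (by simp [hj]) (by simp) h ▸ hj)
  have h1 : (fun v => ddExp s p v * Real.exp (p a * (u - v))) = fun v =>
      ∑ j ∈ s, Lagrange.nodalWeight s p j * (Real.exp (v * p j) * Real.exp (p a * (u - v))) := by
    ext v; rw [ddExp, sum_mul]; simp only [mul_assoc]
  rw [h1, intervalIntegral.integral_finsetSum
    (fun j _ => Continuous.intervalIntegrable (by fun_prop) _ _)]
  simp only [intervalIntegral.integral_const_mul]
  rw [ddExp, sum_insert ha]
  have h2 : Lagrange.nodalWeight (insert a s) p a =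
      -∑ j ∈ s, Lagrange.nodalWeight s p j * (p j - p a)⁻¹ := by
    have := sum_nodalWeight_div hs p (hp.mono (by simp)) (z := p a) fun j hj => (hne j hj).symm
    rw [Lagrange.nodalWeight, erase_insert ha, prod_inv_distrib, ← this, ← sum_neg_distrib]
    refine sum_congr rfl fun j _ => ?_
    rw [div_eq_mul_inv, ← neg_sub (p j), inv_neg, mul_neg]
  rw [h2, neg_mul, sum_mul, ← sum_neg_distrib, ← sum_add_distrib]
  refine sum_congr rfl fun j hj => ?_
  rw [nodalWeight_insert p ha hj, integral_exp_convolution (hne j hj)]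
  ring

theorem ddExp_singleton (a : ι) (p : ι → ℝ) (u : ℝ) : ddExp {a} p u = Real.exp (u * p a) := by
  simp [ddExp, Lagrange.nodalWeight]

theorem ddExp_pos {s : Finset ι} (hs : s.Nonempty) {p : ι → ℝ} (hp : Set.InjOn p s) :
    ∀ u : ℝ, 0 < u → 0 < ddExp s p u := by
  induction hs using Finset.Nonempty.cons_induction with
  | singleton a => intro u _; rw [ddExp_singleton]; exact Real.exp_pos _
  | cons a s ha hs ih =>
    intro u hu
    rw [cons_eq_insert] at hp ⊢
    rw [ddExp_insert hs ha hp]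
    have ih' := ih (hp.mono (by simp))
    exact intervalIntegral.intervalIntegral_pos_of_pos_on
      (Continuous.intervalIntegrable ((continuous_ddExp s p).mul (by fun_prop)) _ _)
      (fun v hv => mul_pos (ih' v hv.1) (Real.exp_pos _)) hu

theorem ddExp_mul_ge {s : Finset ι} (hs : s.Nonempty) {p : ι → ℝ} (hp : Set.InjOn p s) {m : ℝ}
    (hm : ∀ j ∈ s, m ≤ p j) {c : ℝ} (hc : 1 ≤ c) :
    ∀ u : ℝ, 0 < u →
      c ^ (s.card - 1) * Real.exp ((c - 1) * u * m) * ddExp s p u ≤ ddExp s p (c * u) := by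
  have hc0 : 0 < c := by linarith
  induction hs using Finset.Nonempty.cons_induction with
  | singleton a =>
    intro u hu
    rw [ddExp_singleton, ddExp_singleton, card_singleton, Nat.sub_self, pow_zero, one_mul,
      ← Real.exp_add, Real.exp_le_exp]
    have := hm a (by simp)
    nlinarith [mul_nonneg (sub_nonneg.mpr hc) hu.le]
  | cons a s ha hs ih =>
    intro u hu
    have hcard := card_cons ha
    have hspos : 0 < s.card := hs.card_pos
    rw [cons_eq_insert] at hp hm hcard ⊢
    have ih' := ih (hp.mono (by simp)) (fun j hj => hm j (by simp [hj]))
    rw [ddExp_insert hs ha hp, ddExp_insert hs ha hp, hcard]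
    have h1 : ∫ v in (0 : ℝ)..(c * u), ddExp s p v * Real.exp (p a * (c * u - v)) =
        c * ∫ v in (0 : ℝ)..u, ddExp s p (c * v) * Real.exp (p a * (c * u - c * v)) := by
      have := intervalIntegral.mul_integral_comp_mul_left (a := 0) (b := u)
        (f := fun v => ddExp s p v * Real.exp (p a * (c * u - v))) c
      rw [mul_zero] at this
      exact this.symm
    rw [h1, show s.card + 1 - 1 = (s.card - 1) + 1 by omega, pow_succ, ← intervalIntegral.integral_const_mul,
      ← intervalIntegral.integral_const_mul]
    have hcont := continuous_ddExp s p
    refine intervalIntegral.integral_mono_on_of_le_Ioo hu.le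
      (Continuous.intervalIntegrable (by fun_prop) _ _)
      (Continuous.intervalIntegrable (by fun_prop) _ _) fun v hv => ?_
    have h2 := ih' v hv.1
    have h3 : Real.exp ((c - 1) * (u - v) * m) * Real.exp (p a * (u - v)) ≤
        Real.exp (p a * (c * u - c * v)) := by
      rw [← Real.exp_add, Real.exp_le_exp]
      have := hm a (by simp)
      nlinarith [mul_nonneg (sub_nonneg.mpr hc) (sub_nonneg.mpr hv.2.le)]
    have h4 : 0 < ddExp s p v := ddExp_pos hs (hp.mono (by simp)) v hv.1
    calc c ^ (s.card - 1) * c * Real.exp ((c - 1) * u * m) *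
          (ddExp s p v * Real.exp (p a * (u - v)))
        = c * ((c ^ (s.card - 1) * Real.exp ((c - 1) * v * m) * ddExp s p v) *
          (Real.exp ((c - 1) * (u - v) * m) * Real.exp (p a * (u - v)))) := by
          rw [show (c - 1) * u * m = (c - 1) * v * m + (c - 1) * (u - v) * m by ring,
            Real.exp_add]
          ring
      _ ≤ c * (ddExp s p (c * v) * Real.exp (p a * (c * u - c * v))) := by
          refine mul_le_mul_of_nonneg_left (mul_le_mul h2 h3 (by positivity) ?_) hc0.le
          exact (ddExp_pos hs (hp.mono (by simp)) _ (mul_pos hc0 hv.1)).le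

theorem sum_nodalWeight_eq_zero {s : Finset ι} (hs : 1 < s.card) {p : ι → ℝ}
    (hp : Set.InjOn p s) : ∑ j ∈ s, Lagrange.nodalWeight s p j = 0 := by
  obtain ⟨a, ha, b, hb, hab⟩ := one_lt_card.mp hs
  have h := ddExp_insert (s := s.erase a) ⟨b, by simp [hb, hab.symm]⟩ (a := a) (by simp) (p := p)
    (by rwa [insert_erase ha]) 0
  rw [insert_erase ha] at h
  simpa [ddExp] using h

theorem ddExp_neg (s : Finset ι) (p : ι → ℝ) (u : ℝ) :
    ddExp s (fun i => -p i) (-u) = (-1) ^ (s.card - 1) * ddExp s p u := by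
  rw [ddExp, ddExp, mul_sum]
  refine sum_congr rfl fun j hj => ?_
  have : Lagrange.nodalWeight s (fun i => -p i) j =
      (-1) ^ (s.card - 1) * Lagrange.nodalWeight s p j := by
    rw [Lagrange.nodalWeight, Lagrange.nodalWeight, ← card_erase_of_mem hj, ← prod_const,
      ← prod_mul_distrib]
    refine prod_congr rfl fun i _ => ?_
    rw [← neg_sub', inv_neg]; ring
  rw [this, mul_assoc]
  congr 3
  ring

theorem circleIntegral_exp_div_prod {s : Finset ι} (hs : s.Nonempty) {p : ι → ℝ}
    (hp : Set.InjOn p s) {R : ℝ} (hR : ∀ j ∈ s, |p j| < R) (u : ℂ) :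
    ∮ w in C(0, R), Complex.exp (u * w) / ∏ j ∈ s, (w - p j) =
      2 * Real.pi * Complex.I * ddExpC s p u := by
  have hR0 : 0 < R := by
    obtain ⟨j, hj⟩ := hs
    exact (abs_nonneg _).trans_lt (hR j hj)
  have hball : ∀ j ∈ s, (p j : ℂ) ∈ Metric.ball (0 : ℂ) R := fun j hj => by
    simpa using hR j hj
  have hsph : ∀ w ∈ Metric.sphere (0 : ℂ) R, ∀ j ∈ s, w ≠ p j := by
    rintro w hw j hj rfl
    have := hR j hj
    simp at hw
    linarith
  have h1 : ∮ w in C(0, R), Complex.exp (u * w) / ∏ j ∈ s, (w - p j) =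
      ∮ w in C(0, R), ∑ j ∈ s, ((Lagrange.nodalWeight s p j : ℝ) : ℂ) *
        ((w - p j)⁻¹ • Complex.exp (u * w)) := by
    refine circleIntegral.integral_congr hR0.le fun w hw => ?_
    rw [div_eq_mul_inv, ← sum_nodalWeight_div_complex hs hp (hsph w hw), mul_sum]
    refine sum_congr rfl fun j _ => ?_
    rw [smul_eq_mul]; ring
  rw [h1, circleIntegral.integral_fun_sum, ddExpC, mul_sum]
  · refine sum_congr rfl fun j hj => ?_
    have h2 := DiffContOnCl.circleIntegral_sub_inv_smul (f := fun w => Complex.exp (u * w))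
      (c := 0) (R := R) (w := p j) (Differentiable.diffContOnCl (by fun_prop)) (hball j hj)
    have h3 : ∮ w in C(0, R), ((Lagrange.nodalWeight s p j : ℝ) : ℂ) *
        ((w - p j)⁻¹ • Complex.exp (u * w)) = ((Lagrange.nodalWeight s p j : ℝ) : ℂ) *
        ∮ w in C(0, R), ((w - p j)⁻¹ • Complex.exp (u * w)) := by
      exact circleIntegral.integral_smul ((Lagrange.nodalWeight s p j : ℝ) : ℂ)
        (fun w => (w - p j)⁻¹ • Complex.exp (u * w)) 0 R
    rw [h3, h2, smul_eq_mul]; ring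
  · intro j hj
    refine ContinuousOn.circleIntegrable hR0.le (continuousOn_const.mul (ContinuousOn.smul
      (ContinuousOn.inv₀ (by fun_prop) fun w hw => sub_ne_zero.mpr (hsph w hw j hj)) (by fun_prop)))

end SchurAsymp

namespace SchurAsymp

open MeasureTheory Finset

variable {ι : Type*} [DecidableEq ι]

theorem norm_one_add_I_mul_sq (x : ℝ) : ‖1 + Complex.I * x‖ ^ 2 = 1 + x ^ 2 := by
  rw [← Complex.normSq_eq_norm_sq, Complex.normSq_apply]
  simp
  ring

theorem one_add_sq_le_norm_prod {ι : Type*} {s : Finset ι} (hs : 1 < s.card) {a : ι → ℝ} {A : ℝ}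
    (ha : ∀ j ∈ s, 0 < a j) (hA : ∀ j ∈ s, a j ≤ A) (t : ℝ) :
    1 + t ^ 2 / A ^ 2 ≤ ‖∏ j ∈ s, (1 + Complex.I * (t / a j : ℝ))‖ := by
  have h : (1 + t ^ 2 / A ^ 2) ^ 2 ≤ ‖∏ j ∈ s, (1 + Complex.I * (t / a j : ℝ))‖ ^ 2 := by
    rw [norm_prod, ← prod_pow]
    simp only [norm_one_add_I_mul_sq]
    calc (1 + t ^ 2 / A ^ 2) ^ 2 ≤ (1 + t ^ 2 / A ^ 2) ^ s.card :=
          pow_le_pow_right₀ (by simp; positivity) hs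
      _ = ∏ j ∈ s, (1 + t ^ 2 / A ^ 2) := by simp
      _ ≤ _ := by
        refine prod_le_prod (fun j _ => by positivity) fun j hj => ?_
        rw [div_pow]
        have := ha j hj
        have := hA j hj
        gcongr
  exact (sq_le_sq₀ (by positivity) (norm_nonneg _)).mp h

theorem integrable_inv_one_add_div_sq {A : ℝ} (hA : 0 < A) :
    Integrable (fun t : ℝ => (1 + t ^ 2 / A ^ 2)⁻¹) := by
  have := integrable_inv_one_add_sq.comp_mul_left' (inv_ne_zero hA.ne')
  refine this.congr (ae_of_all _ fun t => ?_)
  simp only []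
  congr 2; rw [mul_pow, inv_pow, div_eq_inv_mul]

theorem continuous_inv_prod {ι : Type*} (s : Finset ι) (a : ι → ℝ) :
    Continuous fun t : ℝ => (∏ j ∈ s, (1 + Complex.I * (t / a j : ℝ)))⁻¹ := by
  refine Continuous.inv₀ (by fun_prop) fun t => prod_ne_zero_iff.mpr fun j _ h => ?_
  have := norm_one_add_I_mul_sq (t / a j)
  rw [h] at this
  have h2 := sq_nonneg (t / a j)
  simp at this
  linarith

theorem integrable_inv_prod {ι : Type*} {s : Finset ι} (hs : 1 < s.card) {a : ι → ℝ}
    (ha : ∀ j ∈ s, 0 < a j) :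
    Integrable fun t : ℝ => (∏ j ∈ s, (1 + Complex.I * (t / a j : ℝ)))⁻¹ := by
  obtain ⟨A, hA⟩ : ∃ A, ∀ j ∈ s, a j ≤ A :=
    ⟨∑ j ∈ s, a j, fun j hj => single_le_sum (fun i hi => (ha i hi).le) hj⟩
  have hA0 : 0 < A := by
    obtain ⟨j, hj⟩ := card_pos.mp (zero_lt_one.trans hs)
    exact (ha j hj).trans_le (hA j hj)
  refine (integrable_inv_one_add_div_sq hA0).mono' (continuous_inv_prod s a).aestronglyMeasurable
    (ae_of_all _ fun t => ?_)
  rw [norm_inv]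
  exact inv_anti₀ (by positivity) (one_add_sq_le_norm_prod hs ha hA t)

theorem ddExp_eq_integral {s : Finset ι} (hs : 1 < s.card) {p : ι → ℝ} (hp : Set.InjOn p s)
    {w : ℝ} (hw : ∀ j ∈ s, p j < w) {u : ℝ} (hu : 0 < u) :
    ((ddExp s p u * (∏ j ∈ s, (w - p j)) * Real.exp (-(u * w)) : ℝ) : ℂ) =
      (1 / (2 * Real.pi) : ℝ) * ∫ t : ℝ, Complex.exp (Complex.I * (u * t : ℝ)) *
        (∏ j ∈ s, (1 + Complex.I * (t / (w - p j) : ℝ)))⁻¹ := by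
  have hsne : s.Nonempty := card_pos.mp (zero_lt_one.trans hs)
  set f : ℝ → ℂ := (Set.Ioi (0 : ℝ)).indicator
    fun v => ((ddExp s p v * Real.exp (-(v * w)) : ℝ) : ℂ) with hf
  have hre : ∀ j ∈ s, ∀ ξ : ℝ, ((p j : ℂ) - w - 2 * Real.pi * ξ * Complex.I).re < 0 := by
    intro j hj ξ
    have := hw j hj
    simp
    linarith
  have hfint : Integrable f := by
    rw [hf, integrable_indicator_iff measurableSet_Ioi]
    have : ∀ v : ℝ, ((ddExp s p v * Real.exp (-(v * w)) : ℝ) : ℂ) =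
        ∑ j ∈ s, ((Lagrange.nodalWeight s p j : ℝ) : ℂ) * Complex.exp (((p j : ℂ) - w) * v) := by
      intro v
      rw [ddExp, sum_mul]
      push_cast
      refine sum_congr rfl fun j _ => ?_
      rw [mul_assoc, ← Complex.exp_add]
      congr 2; ring
    simp only [this]
    refine integrable_finsetSum _ fun j hj => Integrable.const_mul ?_ _
    exact integrableOn_exp_mul_complex_Ioi (by simpa using hre j hj 0) 0
  have hFT : ∀ ξ : ℝ, FourierTransform.fourier f ξ =
      ((∏ j ∈ s, (w - p j) : ℝ) : ℂ)⁻¹ *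
        (∏ j ∈ s, (1 + Complex.I * ((2 * Real.pi * ξ) / (w - p j) : ℝ)))⁻¹ := by
    intro ξ
    rw [Real.fourier_real_eq_integral_exp_smul]
    have h1 : (fun v : ℝ => Complex.exp (↑(-2 * Real.pi * v * ξ) * Complex.I) • f v) =
        (Set.Ioi (0 : ℝ)).indicator fun v => ∑ j ∈ s, ((Lagrange.nodalWeight s p j : ℝ) : ℂ) *
          Complex.exp (((p j : ℂ) - w - 2 * Real.pi * ξ * Complex.I) * v) := by
      ext v
      by_cases hv : v ∈ Set.Ioi (0 : ℝ)
      · rw [hf, Set.indicator_of_mem hv, Set.indicator_of_mem hv, ddExp, sum_mul, smul_eq_mul]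
        push_cast
        rw [mul_sum]
        refine sum_congr rfl fun j _ => ?_
        rw [mul_left_comm, ← Complex.exp_add, mul_assoc, ← Complex.exp_add]
        congr 2; ring
      · rw [hf, Set.indicator_of_notMem hv, Set.indicator_of_notMem hv, smul_zero]
    rw [h1, integral_indicator measurableSet_Ioi, integral_finsetSum _ fun j hj =>
      (integrableOn_exp_mul_complex_Ioi (hre j hj ξ) 0).const_mul _]
    simp only [integral_const_mul]
    have h2 : ∀ j ∈ s, (w + 2 * Real.pi * ξ * Complex.I : ℂ) ≠ p j := by
      intro j hj h
      have := hre j hj ξ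
      rw [← h] at this
      simp at this
    have h3 := sum_nodalWeight_div_complex hsne hp h2
    rw [← mul_inv, Complex.ofReal_prod, ← prod_mul_distrib]
    have h4 : ∀ j ∈ s, ((w - p j : ℝ) : ℂ) * (1 + Complex.I * ((2 * Real.pi * ξ) / (w - p j) : ℝ)) =
        w + 2 * Real.pi * ξ * Complex.I - p j := by
      intro j hj
      have h5 : (w - p j : ℂ) ≠ 0 := by
        exact_mod_cast (sub_pos.mpr (hw j hj)).ne'
      push_cast
      field_simp
      ring
    rw [prod_congr rfl h4, ← h3]
    refine sum_congr rfl fun j hj => ?_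
    rw [integral_exp_mul_complex_Ioi (hre j hj ξ)]
    simp only [Complex.ofReal_zero, mul_zero, Complex.exp_zero]
    rw [show (p j : ℂ) - w - 2 * Real.pi * ξ * Complex.I =
      -(w + 2 * Real.pi * ξ * Complex.I - p j) by ring, neg_div_neg_eq, mul_one_div]
  have hpi : (2 * Real.pi) ≠ 0 := by positivity
  have hpos : ∀ j ∈ s, 0 < w - p j := fun j hj => sub_pos.mpr (hw j hj)
  have hFTint : Integrable (FourierTransform.fourier f) := by
    have h := ((integrable_inv_prod hs hpos).comp_mul_left' hpi).const_mul
      ((∏ j ∈ s, (w - p j) : ℝ) : ℂ)⁻¹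
    exact h.congr (ae_of_all _ fun ξ => (hFT ξ).symm)
  have hcont : ContinuousAt f u := by
    have h1 : ContinuousAt (fun v => ((ddExp s p v * Real.exp (-(v * w)) : ℝ) : ℂ)) u := by
      have := continuous_ddExp s p
      fun_prop
    refine h1.congr ?_
    filter_upwards [Ioi_mem_nhds hu] with v hv
    rw [hf, Set.indicator_of_mem hv]
  have hinv := hfint.fourierInv_fourier_eq hFTint hcont
  rw [Real.fourierInv_eq'] at hinv
  simp only [hFT] at hinv
  have hfu : f u = ((ddExp s p u * Real.exp (-(u * w)) : ℝ) : ℂ) := by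
    rw [hf, Set.indicator_of_mem (Set.mem_Ioi.mpr hu)]
  have hP : ((∏ j ∈ s, (w - p j) : ℝ) : ℂ) ≠ 0 := by
    exact_mod_cast prod_ne_zero_iff.mpr fun j hj => (hpos j hj).ne'
  have hsub := Measure.integral_comp_mul_left (fun t : ℝ => Complex.exp (Complex.I * (u * t : ℝ)) *
        (∏ j ∈ s, (1 + Complex.I * (t / (w - p j) : ℝ)))⁻¹) (2 * Real.pi)
  rw [abs_of_pos (by positivity)] at hsub
  rw [one_div, ← Complex.real_smul, ← hsub]
  rw [hfu] at hinv
  rw [mul_right_comm, Complex.ofReal_mul, ← hinv, mul_comm, ← integral_const_mul]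
  congr 1
  ext ξ
  simp only [smul_eq_mul, RCLike.inner_apply, conj_trivial]
  rw [mul_left_comm, ← mul_assoc ((∏ j ∈ s, (w - p j) : ℝ) : ℂ), mul_inv_cancel₀ hP, one_mul]
  congr 2
  push_cast; ring

end SchurAsymp

namespace SchurAsymp

open MeasureTheory

theorem norm_log_one_add_sub_quadratic_le {x : ℂ} (hx : ‖x‖ ≤ 1 / 2) :
    ‖Complex.log (1 + x) - (x - x ^ 2 / 2)‖ ≤ ‖x‖ ^ 3 := by
  have h := Complex.norm_log_sub_logTaylor_le 2 (z := x) (by linarith)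
  have h1 : Complex.logTaylor (2 + 1) x = x - x ^ 2 / 2 := by
    simp [Complex.logTaylor, Finset.sum_range_succ]
    ring
  rw [h1] at h
  refine h.trans ?_
  have h2 : (1 - ‖x‖)⁻¹ ≤ 2 := by
    rw [inv_le_comm₀ (by linarith) (by norm_num)]
    linarith
  have h3 := pow_nonneg (norm_nonneg x) 3
  norm_num
  nlinarith [mul_le_mul_of_nonneg_left h2 h3]

theorem exists_fun_of_eventually {α β : Type*} [Nonempty β] {l : Filter α} {P : α → β → Prop}
    (h : ∀ᶠ i in l, ∃ b, P i b) : ∃ f : α → β, ∀ᶠ i in l, P i (f i) := by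
  classical
  refine ⟨fun i => if h : ∃ b, P i b then h.choose else Classical.arbitrary β, h.mono fun i hi => ?_⟩
  simp only [dif_pos hi]
  exact hi.choose_spec

/-- Quadratic expansion of the exponent of `e^{n y z} / ∏ (1 + z / a_j)`. -/
theorem exists_exponent {n : ℕ} (a : Fin n → ℂ) {ρ : ℝ} (hρ : 0 < ρ) (ha : ∀ j, ρ ≤ ‖a j‖)
    (y z : ℂ) (hz : ‖z‖ ≤ ρ / 2) :
    ∃ E : ℂ, ‖E‖ ≤ n * (‖z‖ / ρ) ^ 3 ∧
      Complex.exp (n * y * z) * (∏ j, (1 + z / a j))⁻¹ =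
        Complex.exp ((n * y - ∑ j, (a j)⁻¹) * z + (∑ j, (a j)⁻¹ ^ 2) * z ^ 2 / 2 + E) := by
  have hza : ∀ j, ‖z / a j‖ ≤ ‖z‖ / ρ := fun j => by
    rw [norm_div]
    exact div_le_div_of_nonneg_left (norm_nonneg _) hρ (ha j)
  have hhalf : ‖z‖ / ρ ≤ 1 / 2 := by rw [div_le_iff₀ hρ]; linarith
  refine ⟨-∑ j, (Complex.log (1 + z / a j) - (z / a j - (z / a j) ^ 2 / 2)), ?_, ?_⟩
  · rw [norm_neg]
    refine (norm_sum_le _ _).trans ?_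
    calc ∑ j, ‖Complex.log (1 + z / a j) - (z / a j - (z / a j) ^ 2 / 2)‖
        ≤ ∑ _j : Fin n, (‖z‖ / ρ) ^ 3 := Finset.sum_le_sum fun j _ =>
          (norm_log_one_add_sub_quadratic_le ((hza j).trans hhalf)).trans
            (pow_le_pow_left₀ (norm_nonneg _) (hza j) 3)
      _ = _ := by simp
  · have hne : ∀ j, 1 + z / a j ≠ 0 := fun j h => by
      have h1 : z / a j = -1 := by linear_combination h
      have := (hza j).trans hhalf
      rw [h1] at this
      norm_num at this
    have h1 : ∏ j, (1 + z / a j) = Complex.exp (∑ j, Complex.log (1 + z / a j)) := by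
      rw [Complex.exp_sum]
      exact Finset.prod_congr rfl fun j _ => (Complex.exp_log (hne j)).symm
    rw [h1, ← Complex.exp_neg, ← Complex.exp_add]
    congr 1
    rw [Finset.sum_sub_distrib, Finset.sum_sub_distrib]
    have h2 : ∑ j, z / a j = (∑ j, (a j)⁻¹) * z := by
      rw [Finset.sum_mul]; exact Finset.sum_congr rfl fun j _ => by rw [div_eq_inv_mul]
    have h3 : ∑ j, (z / a j) ^ 2 / 2 = (∑ j, (a j)⁻¹ ^ 2) * z ^ 2 / 2 := by
      rw [Finset.sum_mul, Finset.sum_div]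
      exact Finset.sum_congr rfl fun j _ => by ring
    rw [h2, h3]
    ring

section Laplace

variable {α : Type*} {l : Filter α} {n : α → ℕ} {a : ∀ i, Fin (n i) → ℂ} {y : α → ℂ} {v : ℂ}
  {ρ κ : ℝ}

/-- The integrand `e^{n y z} / ∏ (1 + z / a_j)` on the scale `z = v τ / √n`. -/
noncomputable def scaled {n : ℕ} (a : Fin n → ℂ) (y v : ℂ) (τ : ℝ) : ℂ :=
  Complex.exp (n * y * (v * (τ / √n : ℝ))) * (∏ j, (1 + v * (τ / √n : ℝ) / a j))⁻¹

theorem exists_scaled_exponent {n : ℕ} (hn : 0 < n) (a : Fin n → ℂ) {ρ : ℝ} (hρ : 0 < ρ)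
    (ha : ∀ j, ρ ≤ ‖a j‖) (y v : ℂ) (τ : ℝ) (hz : ‖v‖ * |τ| / √n ≤ ρ / 2) :
    ∃ E : ℂ, ‖E‖ ≤ (‖v‖ / ρ) ^ 3 * |τ| ^ 3 / √n ∧
      scaled a y v τ = Complex.exp (√n * (y - (∑ j, (a j)⁻¹) / n) * (v * τ) +
        v ^ 2 * ((∑ j, (a j)⁻¹ ^ 2) / n) * τ ^ 2 / 2 + E) := by
  have hs : 0 < √(n : ℝ) := Real.sqrt_pos.mpr (by exact_mod_cast hn)
  have hnorm : ‖v * (τ / √n : ℝ)‖ = ‖v‖ * |τ| / √n := by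
    rw [norm_mul, Complex.norm_real, Real.norm_eq_abs, abs_div, abs_of_pos hs, mul_div_assoc]
  obtain ⟨E, hE, h⟩ := exists_exponent a hρ ha y (v * (τ / √n : ℝ)) (by rwa [hnorm])
  refine ⟨E, hE.trans (le_of_eq ?_), h.trans ?_⟩
  · have hsq : (n : ℝ) = √n ^ 2 := (Real.sq_sqrt (Nat.cast_nonneg n)).symm
    rw [hnorm]
    nth_rewrite 1 [hsq]
    field_simp
  · congr 2
    have hsq : (n : ℂ) = (√n : ℂ) ^ 2 := by
      exact_mod_cast (Real.sq_sqrt (Nat.cast_nonneg n)).symm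
    have hs' : (√n : ℂ) ≠ 0 := by exact_mod_cast hs.ne'
    push_cast
    rw [hsq]
    field_simp

theorem tendsto_scaled (hn : Tendsto n l atTop) (hρ : 0 < ρ)
    (ha : ∀ᶠ i in l, ∀ j, ρ ≤ ‖a i j‖)
    (h1 : Tendsto (fun i => (√(n i) : ℂ) * (y i - (∑ j, (a i j)⁻¹) / n i)) l (𝓝 0))
    (h2 : Tendsto (fun i => v ^ 2 * ((∑ j, (a i j)⁻¹ ^ 2) / n i)) l (𝓝 (-κ : ℝ))) (τ : ℝ) :
    Tendsto (fun i => scaled (a i) (y i) v τ) l (𝓝 (Real.exp (-(κ / 2) * τ ^ 2) : ℝ)) := by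
  have hsq : Tendsto (fun i => √(n i : ℝ)) l atTop :=
    Real.tendsto_sqrt_atTop.comp (tendsto_natCast_atTop_atTop.comp hn)
  have hz : Tendsto (fun i => ‖v‖ * |τ| / √(n i)) l (𝓝 0) := hsq.const_div_atTop _
  have hev : ∀ᶠ i in l, ∃ E : ℂ, ‖E‖ ≤ (‖v‖ / ρ) ^ 3 * |τ| ^ 3 / √(n i) ∧
      scaled (a i) (y i) v τ = Complex.exp (√(n i) * (y i - (∑ j, (a i j)⁻¹) / n i) * (v * τ) +
        v ^ 2 * ((∑ j, (a i j)⁻¹ ^ 2) / n i) * τ ^ 2 / 2 + E) := by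
    filter_upwards [ha, hn.eventually_gt_atTop 0, hz.eventually_le_const (half_pos hρ)] with i hi hi2 hi3
    exact exists_scaled_exponent hi2 (a i) hρ hi (y i) v τ hi3
  obtain ⟨E, hE⟩ : ∃ E : α → ℂ, ∀ᶠ i in l, ‖E i‖ ≤ (‖v‖ / ρ) ^ 3 * |τ| ^ 3 / √(n i) ∧
      scaled (a i) (y i) v τ = Complex.exp (√(n i) * (y i - (∑ j, (a i j)⁻¹) / n i) * (v * τ) +
        v ^ 2 * ((∑ j, (a i j)⁻¹ ^ 2) / n i) * τ ^ 2 / 2 + E i) :=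
    exists_fun_of_eventually hev
  have hE0 : Tendsto E l (𝓝 0) :=
    squeeze_zero_norm' (hE.mono fun i hi => hi.1) (hsq.const_div_atTop _)
  have hlim := ((h1.mul_const (v * τ)).add ((h2.mul_const ((τ : ℂ) ^ 2)).div_const 2)).add hE0
  refine (hlim.cexp.congr' (hE.mono fun i hi => hi.2.symm)).trans_eq ?_
  rw [Complex.ofReal_exp]
  congr 2
  push_cast
  ring

theorem continuous_scaled_on {n : ℕ} (a : Fin n → ℂ) (hn : 0 < n) {ρ : ℝ} (hρ : 0 < ρ)
    (ha : ∀ j, ρ ≤ ‖a j‖) (y v : ℂ) :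
    ContinuousOn (scaled a y v) {τ | ‖v‖ * |τ| / √n ≤ ρ / 2} := by
  have hs : 0 < √(n : ℝ) := Real.sqrt_pos.mpr (by exact_mod_cast hn)
  unfold scaled
  refine ContinuousOn.mul (by fun_prop) (ContinuousOn.inv₀ (by fun_prop) fun τ hτ => ?_)
  refine Finset.prod_ne_zero_iff.mpr fun j _ h => ?_
  have h1 : v * (τ / √n : ℝ) / a j = -1 := by linear_combination h
  have h2 := congrArg norm h1
  rw [norm_div, norm_mul, Complex.norm_real, Real.norm_eq_abs, abs_div, abs_of_pos hs,
    ← mul_div_assoc, norm_neg, norm_one] at h2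
  have h3 : ‖v‖ * |τ| / √n ≤ ρ / 2 := hτ
  have h4 := ha j
  rw [div_eq_one_iff_eq (by linarith)] at h2
  linarith

theorem integrable_exp_abs_sub_sq (hκ : 0 < κ) :
    Integrable fun τ : ℝ => Real.exp (|τ| - κ * τ ^ 2) := by
  have h0 : Integrable fun τ : ℝ => Real.exp (-(κ / 2) * τ ^ 2) * Real.exp (1 / (2 * κ)) :=
    (integrable_exp_neg_mul_sq (half_pos hκ)).mul_const _
  refine h0.mono' (by fun_prop) (ae_of_all _ fun τ => ?_)
  rw [Real.norm_eq_abs, abs_of_pos (Real.exp_pos _), ← Real.exp_add, Real.exp_le_exp]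
  have h1 : κ * (1 / (2 * κ)) = 1 / 2 := by field_simp
  have h2 := sq_abs τ
  have h3 : 0 ≤ κ * (κ * |τ| - 1) ^ 2 := by positivity
  have h4 : |τ| ≤ κ / 2 * |τ| ^ 2 + 1 / (2 * κ) := by
    have : κ / 2 * |τ| ^ 2 + 1 / (2 * κ) - |τ| = (κ * |τ| - 1) ^ 2 / (2 * κ) := by
      field_simp; ring
    have h5 : 0 ≤ (κ * |τ| - 1) ^ 2 / (2 * κ) := by positivity
    linarith
  rw [h2] at h4
  linarith

/-- Laplace's method on a small segment in the direction `v`. -/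
theorem tendsto_integral_scaled [l.IsCountablyGenerated] (hn : Tendsto n l atTop) (hρ : 0 < ρ)
    (hκ : 0 < κ) (ha : ∀ᶠ i in l, ∀ j, ρ ≤ ‖a i j‖)
    (h1 : Tendsto (fun i => (√(n i) : ℂ) * (y i - (∑ j, (a i j)⁻¹) / n i)) l (𝓝 0))
    (h2 : Tendsto (fun i => v ^ 2 * ((∑ j, (a i j)⁻¹ ^ 2) / n i)) l (𝓝 (-κ : ℝ)))
    {η : ℝ} (hη : 0 < η) (hη1 : ‖v‖ * η ≤ ρ / 2) (hη2 : (‖v‖ / ρ) ^ 3 * η ≤ κ / 8) :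
    Tendsto (fun i => ∫ τ in Set.Icc (-(η * √(n i))) (η * √(n i)), scaled (a i) (y i) v τ) l
      (𝓝 (√(2 * Real.pi / κ) : ℝ)) := by
  have hsq : Tendsto (fun i => √(n i : ℝ)) l atTop :=
    Real.tendsto_sqrt_atTop.comp (tendsto_natCast_atTop_atTop.comp hn)
  have hlim : ∫ τ : ℝ, ((Real.exp (-(κ / 2) * τ ^ 2) : ℝ) : ℂ) = (√(2 * Real.pi / κ) : ℝ) := by
    rw [integral_complex_ofReal, integral_gaussian]
    congr 2
    field_simp
  rw [← hlim]
  simp only [← integral_indicator (measurableSet_Icc (α := ℝ))]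
  have hsmall : ∀ i, 0 < n i → ∀ τ ∈ Set.Icc (-(η * √(n i))) (η * √(n i)),
      ‖v‖ * |τ| / √(n i) ≤ ρ / 2 ∧ |τ| / √(n i) ≤ η := by
    intro i hi τ hτ
    have hs : 0 < √(n i : ℝ) := Real.sqrt_pos.mpr (by exact_mod_cast hi)
    have h3 : |τ| / √(n i) ≤ η := by
      rw [div_le_iff₀ hs]; exact abs_le.mpr hτ
    refine ⟨?_, h3⟩
    rw [mul_div_assoc]
    exact (mul_le_mul_of_nonneg_left h3 (norm_nonneg _)).trans hη1
  refine tendsto_integral_filter_of_dominated_convergence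
    (fun τ => Real.exp (|τ| - κ / 4 * τ ^ 2)) ?_ ?_ (integrable_exp_abs_sub_sq (by linarith)) ?_
  · filter_upwards [ha, hn.eventually_gt_atTop 0] with i hi hi0
    exact (aestronglyMeasurable_indicator_iff measurableSet_Icc).mpr
        (((continuous_scaled_on (a i) hi0 hρ hi (y i) v).mono
          fun τ hτ => (hsmall i hi0 τ hτ).1).aestronglyMeasurable measurableSet_Icc)
  · have e1 : ∀ᶠ i in l, ‖(√(n i) : ℂ) * (y i - (∑ j, (a i j)⁻¹) / n i)‖ * ‖v‖ < 1 := by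
      have := h1.norm.mul_const ‖v‖
      rw [norm_zero, zero_mul] at this
      exact this.eventually_lt_const one_pos
    have e2 : ∀ᶠ i in l, (v ^ 2 * ((∑ j, (a i j)⁻¹ ^ 2) / n i)).re < -(3 / 4 * κ) := by
      have := (Complex.continuous_re.tendsto _).comp h2
      exact this.eventually_lt_const (by simp; linarith)
    filter_upwards [ha, hn.eventually_gt_atTop 0, e1, e2] with i hi hi0 hi1 hi2
    refine ae_of_all _ fun τ => ?_
    by_cases hτ : τ ∈ Set.Icc (-(η * √(n i))) (η * √(n i))
    · rw [Set.indicator_of_mem hτ]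
      obtain ⟨hs1, hs2⟩ := hsmall i hi0 τ hτ
      obtain ⟨E, hE, h⟩ := exists_scaled_exponent hi0 (a i) hρ hi (y i) v τ hs1
      rw [h, Complex.norm_exp, Real.exp_le_exp, Complex.add_re, Complex.add_re]
      have t1 : (√(n i) * (y i - (∑ j, (a i j)⁻¹) / n i) * (v * τ) : ℂ).re ≤ |τ| := by
        refine (Complex.re_le_norm _).trans ?_
        rw [norm_mul, norm_mul v, Complex.norm_real, Real.norm_eq_abs, ← mul_assoc]
        exact mul_le_of_le_one_left (abs_nonneg _) hi1.le
      have t2 : (v ^ 2 * ((∑ j, (a i j)⁻¹ ^ 2) / n i) * τ ^ 2 / 2).re ≤ -(3 / 8 * κ) * τ ^ 2 := by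
        have : (v ^ 2 * ((∑ j, (a i j)⁻¹ ^ 2) / n i) * τ ^ 2 / 2).re =
            (v ^ 2 * ((∑ j, (a i j)⁻¹ ^ 2) / n i)).re * (τ ^ 2 / 2) := by
          rw [mul_div_assoc, show ((τ : ℂ) ^ 2 / 2) = ((τ ^ 2 / 2 : ℝ) : ℂ) by push_cast; ring,
            Complex.re_mul_ofReal]
        rw [this]
        nlinarith [mul_le_mul_of_nonneg_right hi2.le (by positivity : (0 : ℝ) ≤ τ ^ 2 / 2)]
      have t3 : E.re ≤ κ / 8 * τ ^ 2 := by
        refine (Complex.re_le_norm _).trans (hE.trans ?_)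
        calc (‖v‖ / ρ) ^ 3 * |τ| ^ 3 / √(n i)
            = (‖v‖ / ρ) ^ 3 * (|τ| / √(n i)) * |τ| ^ 2 := by ring
          _ ≤ (‖v‖ / ρ) ^ 3 * η * |τ| ^ 2 := by gcongr
          _ ≤ κ / 8 * |τ| ^ 2 := by gcongr
          _ = _ := by rw [sq_abs]
      linarith
    · rw [Set.indicator_of_notMem hτ, norm_zero]
      exact (Real.exp_pos _).le
  · refine ae_of_all _ fun τ => ?_
    refine (tendsto_scaled hn hρ ha h1 h2 τ).congr' ?_
    have : Tendsto (fun i => η * √(n i : ℝ)) l atTop := hsq.const_mul_atTop hη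
    filter_upwards [this.eventually_ge_atTop |τ|] with i hi
    rw [Set.indicator_of_mem]
    exact abs_le.mp hi

end Laplace

end SchurAsymp

namespace SchurAsymp

open MeasureTheory

section RealLaplace

variable {α : Type*} {l : Filter α} {n : α → ℕ} {p : ∀ i, Fin (n i) → ℝ} {w y : α → ℝ} {ρ m : ℝ}

/-- A Gaussian-free domination of the characteristic function, from Bernoulli's inequality. -/
theorem le_norm_prod_one_add_I {n : ℕ} (hn : 0 < n) {a : Fin n → ℝ} {ρ m : ℝ} (hρ : 0 < ρ)
    (ha : ∀ j, ρ ≤ a j) (hm : m / 2 ≤ (∑ j, (a j)⁻¹ ^ 2) / n) (hm1 : 4 ≤ ρ ^ 2 * n * m) (τ : ℝ) :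
    1 + m / 4 * τ ^ 2 ≤ ‖∏ j, (1 + Complex.I * (τ / √n / a j : ℝ))‖ := by
  have hn' : (0 : ℝ) < n := by exact_mod_cast hn
  have hm0 : 0 < m := by
    by_contra h
    have : ρ ^ 2 * n * m ≤ 0 := mul_nonpos_of_nonneg_of_nonpos (by positivity) (not_lt.mp h)
    linarith
  set x : ℝ := τ ^ 2 / (n * ρ ^ 2) with hx
  have hx0 : 0 ≤ x := by positivity
  set e : ℝ := ρ ^ 2 * ∑ j, (a j)⁻¹ ^ 2 with he
  have he2 : ρ ^ 2 * n * m / 2 ≤ e := by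
    rw [le_div_iff₀ hn'] at hm
    rw [he]
    nlinarith [sq_nonneg ρ]
  have h1 : (1 + x) ^ e ≤ ‖∏ j, (1 + Complex.I * (τ / √n / a j : ℝ))‖ ^ 2 := by
    rw [norm_prod, ← Finset.prod_pow, he, Finset.mul_sum, Real.rpow_sum_of_pos (by linarith)]
    refine Finset.prod_le_prod (fun j _ => by positivity) fun j _ => ?_
    have haj : 0 < a j := hρ.trans_le (ha j)
    have hle : ρ ^ 2 * (a j)⁻¹ ^ 2 ≤ 1 := by
      rw [inv_pow, ← div_eq_mul_inv, div_le_one (by positivity)]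
      exact pow_le_pow_left₀ hρ.le (ha j) 2
    refine (rpow_one_add_le_one_add_mul_self (by linarith) (by positivity) hle).trans ?_
    rw [norm_one_add_I_mul_sq, hx, div_pow, div_pow, Real.sq_sqrt hn'.le]
    apply le_of_eq
    field_simp
  have h2 : (1 + m / 4 * τ ^ 2) ^ 2 ≤ (1 + x) ^ e := by
    have h3 : 1 + e / 2 * x ≤ (1 + x) ^ (e / 2) :=
      one_add_mul_self_le_rpow_one_add (by linarith) (by linarith)
    have h4 : m / 4 * τ ^ 2 ≤ e / 2 * x := by
      calc m / 4 * τ ^ 2 = (ρ ^ 2 * n * m / 2) / 2 * x := by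
            rw [hx]; field_simp; ring
        _ ≤ _ := by gcongr
    calc (1 + m / 4 * τ ^ 2) ^ 2 ≤ ((1 + x) ^ (e / 2)) ^ 2 :=
          pow_le_pow_left₀ (by positivity) (by linarith) 2
      _ = (1 + x) ^ e := by
          rw [← Real.rpow_natCast, ← Real.rpow_mul (by linarith)]
          congr 1; push_cast; ring
  exact (sq_le_sq₀ (by positivity) (norm_nonneg _)).mp (h2.trans h1)

/-- Local central limit theorem for divided differences of the exponential function. -/
theorem tendsto_ddExp [l.IsCountablyGenerated] (hn : Tendsto n l atTop) (hρ : 0 < ρ) (hm : 0 < m)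
    (hp : ∀ᶠ i in l, Function.Injective (p i)) (hy : ∀ᶠ i in l, 0 < y i)
    (hw : ∀ᶠ i in l, ∀ j, ρ ≤ w i - p i j)
    (h1 : Tendsto (fun i => √(n i) * (y i - (∑ j, (w i - p i j)⁻¹) / n i)) l (𝓝 0))
    (h2 : Tendsto (fun i => (∑ j, (w i - p i j)⁻¹ ^ 2) / n i) l (𝓝 m)) :
    Tendsto (fun i => √(n i) * (ddExp Finset.univ (p i) (n i * y i) * (∏ j, (w i - p i j)) *
      Real.exp (-(n i * y i * w i)))) l (𝓝 (1 / √(2 * Real.pi * m))) := by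
  set a : ∀ i, Fin (n i) → ℂ := fun i j => ((w i - p i j : ℝ) : ℂ) with ha
  have hscaled : ∀ i τ, scaled (a i) (y i) Complex.I τ =
      Complex.exp (Complex.I * (n i * y i * (τ / √(n i)) : ℝ)) *
        (∏ j, (1 + Complex.I * (τ / √(n i) / (w i - p i j) : ℝ)))⁻¹ := by
    intro i τ
    rw [scaled]
    congr 1
    · congr 1; push_cast; ring
    · congr 2; ext j; rw [ha]; push_cast; ring
  have key : Tendsto (fun i => ∫ τ : ℝ, scaled (a i) (y i) Complex.I τ) l
      (𝓝 (∫ τ : ℝ, ((Real.exp (-(m / 2) * τ ^ 2) : ℝ) : ℂ))) := by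
    refine tendsto_integral_filter_of_dominated_convergence (fun τ => (1 + m / 4 * τ ^ 2)⁻¹)
      ?_ ?_ ?_ ?_
    · refine Eventually.of_forall fun i => Continuous.aestronglyMeasurable ?_
      rw [show scaled (a i) (y i) Complex.I = _ from funext (hscaled i)]
      have := (continuous_inv_prod Finset.univ (fun j => w i - p i j)).comp
        (continuous_id.div_const (√(n i : ℝ)))
      exact Continuous.mul (by fun_prop) this
    · have hbig : ∀ᶠ i in l, 4 ≤ ρ ^ 2 * n i * m := by
        have : Tendsto (fun i => ρ ^ 2 * (n i : ℝ) * m) l atTop :=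
          ((tendsto_natCast_atTop_atTop.comp hn).const_mul_atTop (by positivity)).atTop_mul_const hm
        exact this.eventually_ge_atTop 4
      filter_upwards [hw, hn.eventually_gt_atTop 0, hbig,
        h2.eventually_const_le (half_lt_self hm)] with i hi hi0 hi1 hi2
      refine ae_of_all _ fun τ => ?_
      rw [hscaled, norm_mul, mul_comm Complex.I, Complex.norm_exp_ofReal_mul_I, one_mul, norm_inv]
      exact inv_anti₀ (by positivity) (le_norm_prod_one_add_I hi0 hρ hi hi2 hi1 τ)
    · have := integrable_inv_one_add_div_sq (A := 2 / √m) (by positivity)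
      refine this.congr (ae_of_all _ fun τ => ?_)
      simp only []
      rw [div_pow, Real.sq_sqrt hm.le]
      congr 2
      field_simp
      norm_num
    · refine ae_of_all _ fun τ => tendsto_scaled hn hρ ?_ ?_ ?_ τ
      · filter_upwards [hw] with i hi j
        rw [ha, Complex.norm_real]
        exact (hi j).trans (le_abs_self _)
      · have := (Complex.continuous_ofReal.tendsto _).comp h1
        rw [Complex.ofReal_zero] at this
        refine this.congr fun i => ?_
        simp [ha]
      · have := (Complex.continuous_ofReal.tendsto _).comp h2.neg
        refine this.congr fun i => ?_
        simp [ha]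
  have hlim : ∫ τ : ℝ, ((Real.exp (-(m / 2) * τ ^ 2) : ℝ) : ℂ) = (√(2 * Real.pi / m) : ℝ) := by
    rw [integral_complex_ofReal, integral_gaussian]
    congr 2
    field_simp
  rw [hlim] at key
  have hfin : Tendsto (fun i => (((√(n i) * (ddExp Finset.univ (p i) (n i * y i) *
      (∏ j, (w i - p i j)) * Real.exp (-(n i * y i * w i))) : ℝ)) : ℂ)) l
      (𝓝 ((1 / √(2 * Real.pi * m) : ℝ) : ℂ)) := by
    have hc : ((1 / √(2 * Real.pi * m) : ℝ) : ℂ) =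
        (1 / (2 * Real.pi) : ℝ) * (√(2 * Real.pi / m) : ℝ) := by
      rw [← Complex.ofReal_mul]
      congr 1
      rw [Real.sqrt_div (by positivity), Real.sqrt_mul (by positivity)]
      have : √(2 * Real.pi) * √(2 * Real.pi) = 2 * Real.pi := Real.mul_self_sqrt (by positivity)
      have h3 : 0 < √(2 * Real.pi) := by positivity
      have h4 : 0 < √m := by positivity
      field_simp
      linear_combination -this
    rw [hc]
    refine (key.const_mul _).congr' ?_
    filter_upwards [hw, hn.eventually_gt_atTop 1, hp, hy] with i hi hi0 hpi hyi
    have hs : 0 < √(n i : ℝ) := Real.sqrt_pos.mpr (by exact_mod_cast (zero_lt_one.trans hi0))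
    have hni : (0 : ℝ) < n i := by exact_mod_cast (zero_lt_one.trans hi0)
    have h := ddExp_eq_integral (s := Finset.univ) (by simpa using hi0) (hpi.injOn)
      (fun j _ => by linarith [hi j] : ∀ j ∈ Finset.univ, p i j < w i) (u := n i * y i)
      (mul_pos hni hyi)
    rw [Complex.ofReal_mul (√(n i : ℝ)), h]
    have hsub := Measure.integral_comp_div (fun t : ℝ => Complex.exp (Complex.I *
      (n i * y i * t : ℝ)) * (∏ j, (1 + Complex.I * (t / (w i - p i j) : ℝ)))⁻¹) (√(n i : ℝ))
    simp only [hscaled]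
    rw [hsub, abs_of_pos hs, Complex.real_smul]
    ring
  have := (Complex.continuous_re.tendsto _).comp hfin
  simpa only [Function.comp_def, Complex.ofReal_re] using this

theorem tendsto_ddExp_of_neg [l.IsCountablyGenerated] (hn : Tendsto n l atTop) (hρ : 0 < ρ)
    (hm : 0 < m) (hp : ∀ᶠ i in l, Function.Injective (p i)) (hy : ∀ᶠ i in l, y i < 0)
    (hw : ∀ᶠ i in l, ∀ j, ρ ≤ p i j - w i)
    (h1 : Tendsto (fun i => √(n i) * (y i - (∑ j, (w i - p i j)⁻¹) / n i)) l (𝓝 0))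
    (h2 : Tendsto (fun i => (∑ j, (w i - p i j)⁻¹ ^ 2) / n i) l (𝓝 m)) :
    Tendsto (fun i => -(√(n i) * (ddExp Finset.univ (p i) (n i * y i) * (∏ j, (w i - p i j)) *
      Real.exp (-(n i * y i * w i))))) l (𝓝 (1 / √(2 * Real.pi * m))) := by
  have hflip : ∀ i j, -w i - -p i j = -(w i - p i j) := fun i j => by ring
  have h := tendsto_ddExp (p := fun i j => -p i j) (w := fun i => -w i) (y := fun i => -y i) hn hρ
    hm (hp.mono fun i hi => neg_injective.comp hi) (hy.mono fun i hi => by linarith)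
    (hw.mono fun i hi j => by linarith [hi j]) ?_ ?_
  · refine h.congr' ?_
    filter_upwards [hn.eventually_gt_atTop 0] with i hi
    rw [mul_neg, ddExp_neg]
    simp only [hflip, Finset.card_univ, Fintype.card_fin]
    have hprod : ∏ j, -(w i - p i j) = (-1) ^ n i * ∏ j, (w i - p i j) := by
      rw [Finset.prod_neg]; simp
    rw [hprod]
    have hsign : ((-1 : ℝ)) ^ (n i - 1) * (-1) ^ n i = -1 := by
      obtain ⟨k, hk⟩ : ∃ k, n i = k + 1 := ⟨n i - 1, by omega⟩
      rw [hk, Nat.add_sub_cancel, pow_succ, ← mul_assoc, ← mul_pow]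
      simp
    rw [show -(↑(n i) * y i) * -w i = n i * y i * w i by ring]
    linear_combination (√(n i) * ddExp Finset.univ (p i) (n i * y i) * (∏ j, (w i - p i j)) *
      Real.exp (-(n i * y i * w i))) * hsign
  · have := h1.neg
    rw [neg_zero] at this
    refine this.congr fun i => ?_
    simp only [hflip, inv_neg, Finset.sum_neg_distrib]
    ring
  · refine h2.congr fun i => ?_
    simp only [hflip, inv_neg, neg_sq]

end RealLaplace

end SchurAsymp

namespace SchurAsymp

open MeasureTheory

/-- The step function on `(0, 1]` with value `g i` on `(i / n, (i + 1) / n]`. -/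
noncomputable def stepFn {E : Type*} [Zero E] {n : ℕ} (g : Fin n → E) (t : ℝ) : E :=
  if h : ⌈n * t⌉₊ - 1 < n then g ⟨⌈n * t⌉₊ - 1, h⟩ else 0

theorem stepFn_eq {E : Type*} [Zero E] {n : ℕ} (g : Fin n → E) (i : Fin n) {t : ℝ}
    (ht : t ∈ Set.Ioc ((i : ℝ) / n) (((i : ℝ) + 1) / n)) : stepFn g t = g i := by
  have hn : (0 : ℝ) < n := by exact_mod_cast (Nat.zero_le _).trans_lt i.2
  have h1 : ⌈n * t⌉₊ = (i : ℕ) + 1 := by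
    rw [Nat.ceil_eq_iff (by simp)]
    have h2 := ht.1
    have h3 := ht.2
    rw [div_lt_iff₀ hn] at h2
    rw [le_div_iff₀ hn] at h3
    constructor
    · rw [Nat.add_sub_cancel]; linarith
    · push_cast; linarith
  have h2 : ⌈n * t⌉₊ - 1 = i := by omega
  unfold stepFn
  rw [dif_pos (by rw [h2]; exact i.2)]
  congr 1
  exact Fin.ext h2

theorem exists_cell {n : ℕ} (hn : 0 < n) {t : ℝ} (ht : t ∈ Set.Ioc (0 : ℝ) 1) :
    ∃ i : Fin n, t ∈ Set.Ioc ((i : ℝ) / n) (((i : ℝ) + 1) / n) := by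
  have hn' : (0 : ℝ) < n := by exact_mod_cast hn
  have hpos : 0 < n * t := mul_pos hn' ht.1
  have h1 : 0 < ⌈n * t⌉₊ := Nat.ceil_pos.mpr hpos
  have h2 : ⌈n * t⌉₊ ≤ n := Nat.ceil_le.mpr (by nlinarith [ht.2])
  refine ⟨⟨⌈n * t⌉₊ - 1, by omega⟩, ?_, ?_⟩
  · rw [div_lt_iff₀ hn']
    have := Nat.ceil_lt_add_one hpos.le
    have h3 : ((⌈n * t⌉₊ - 1 : ℕ) : ℝ) = ⌈n * t⌉₊ - 1 := by
      rw [Nat.cast_sub h1]; simp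
    simp only [h3]
    linarith
  · rw [le_div_iff₀ hn']
    have := Nat.le_ceil (n * t)
    have h3 : ((⌈n * t⌉₊ - 1 : ℕ) : ℝ) = ⌈n * t⌉₊ - 1 := by
      rw [Nat.cast_sub h1]; simp
    simp only [h3]
    linarith

theorem integrable_stepFn_aux {E : Type*} [NormedAddCommGroup E] {n : ℕ}
    (g : Fin n → E) (i : Fin n) :
    IntervalIntegrable (stepFn g) volume ((i : ℕ) / n : ℝ) (((i : ℕ) + 1 : ℕ) / n : ℝ) := by
  have hle : ((i : ℕ) / n : ℝ) ≤ (((i : ℕ) + 1 : ℕ) / n : ℝ) := by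
    gcongr; simp
  have : IntervalIntegrable (fun _ : ℝ => g i) volume ((i : ℕ) / n : ℝ)
      (((i : ℕ) + 1 : ℕ) / n : ℝ) := intervalIntegrable_const
  refine this.congr fun t ht => ?_
  rw [Set.uIoc_of_le hle] at ht
  exact (stepFn_eq g i (by simpa using ht)).symm

theorem intervalIntegrable_stepFn {E : Type*} [NormedAddCommGroup E] {n : ℕ} (hn : 0 < n)
    (g : Fin n → E) : IntervalIntegrable (stepFn g) volume 0 1 := by
  have h := IntervalIntegrable.trans_iterate (a := fun k : ℕ => (k / n : ℝ)) (n := n)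
    (f := stepFn g) (μ := volume) fun k hk => integrable_stepFn_aux g ⟨k, hk⟩
  have hn' : (n : ℝ) ≠ 0 := by exact_mod_cast hn.ne'
  simpa [hn'] using h

theorem integral_stepFn {E : Type*} [NormedAddCommGroup E] [NormedSpace ℝ E] [CompleteSpace E]
    {n : ℕ} (hn : 0 < n) (g : Fin n → E) :
    ∫ t in (0 : ℝ)..1, stepFn g t = (n : ℝ)⁻¹ • ∑ i, g i := by
  have h := intervalIntegral.sum_integral_adjacent_intervals (a := fun k : ℕ => (k / n : ℝ))
    (n := n) (f := stepFn g) (μ := volume) fun k hk => integrable_stepFn_aux g ⟨k, hk⟩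
  have hn' : (n : ℝ) ≠ 0 := by exact_mod_cast hn.ne'
  simp only [CharP.cast_eq_zero, zero_div, div_self hn'] at h
  rw [← h, ← Fin.sum_univ_eq_sum_range (fun k => ∫ t in ((k : ℕ) / n : ℝ)..((k + 1 : ℕ) / n : ℝ),
    stepFn g t), Finset.smul_sum]
  refine Finset.sum_congr rfl fun i _ => ?_
  have hle : ((i : ℕ) / n : ℝ) ≤ (((i : ℕ) + 1 : ℕ) / n : ℝ) := by
    gcongr; simp
  rw [intervalIntegral.integral_congr_ae (g := fun _ => g i) (ae_of_all _ fun t ht => ?_),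
    intervalIntegral.integral_const]
  · congr 1; push_cast; ring
  · rw [Set.uIoc_of_le hle] at ht
    exact stepFn_eq g i (by simpa using ht)

theorem stepFn_comp {E F : Type*} [Zero E] [Zero F] {n : ℕ} (hn : 0 < n) (g : Fin n → E)
    (φ : E → F) {t : ℝ} (ht : t ∈ Set.Ioc (0 : ℝ) 1) :
    stepFn (fun i => φ (g i)) t = φ (stepFn g t) := by
  obtain ⟨i, hi⟩ := exists_cell hn ht
  rw [stepFn_eq _ i hi, stepFn_eq _ i hi]

/-- Closeness of the empirical data `p` to the profile `h` in `L¹(0, 1)`. -/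
noncomputable def stepDist {n : ℕ} (p : Fin n → ℝ) (h : ℝ → ℝ) : ℝ :=
  ∫ t in (0 : ℝ)..1, |stepFn p t - h t|

theorem norm_mean_sub_integral_le {E : Type*} [NormedAddCommGroup E] [NormedSpace ℝ E]
    [CompleteSpace E] {n : ℕ} (hn : 0 < n) {p : Fin n → ℝ} {h : ℝ → ℝ}
    (hint : IntervalIntegrable h volume 0 1) {S : Set ℝ} {φ : ℝ → E} {K : ℝ}
    (hφ : ∀ x ∈ S, ∀ y ∈ S, ‖φ x - φ y‖ ≤ K * |x - y|) (hp : ∀ j, p j ∈ S)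
    (hS : ∀ᵐ t, t ∈ Set.Ioc (0 : ℝ) 1 → h t ∈ S)
    (hφh : IntervalIntegrable (fun t => φ (h t)) volume 0 1) :
    ‖(n : ℝ)⁻¹ • ∑ j, φ (p j) - ∫ t in (0 : ℝ)..1, φ (h t)‖ ≤ K * stepDist p h := by
  rw [← integral_stepFn hn, ← intervalIntegral.integral_sub (intervalIntegrable_stepFn hn _) hφh,
    stepDist, ← intervalIntegral.integral_const_mul]
  refine intervalIntegral.norm_integral_le_of_norm_le zero_le_one ?_
    (((intervalIntegrable_stepFn hn p).sub hint).abs.const_mul K)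
  filter_upwards [hS] with t ht htI
  rw [stepFn_comp hn p φ htI]
  refine hφ _ ?_ _ (ht htI)
  obtain ⟨i, hi⟩ := exists_cell hn htI
  rw [stepFn_eq _ i hi]
  exact hp i

theorem tendsto_mean {E : Type*} [NormedAddCommGroup E] [NormedSpace ℝ E]
    [CompleteSpace E] {α : Type*} {l : Filter α} {n : α → ℕ} (hn : Tendsto n l atTop)
    {p : ∀ i, Fin (n i) → ℝ} {h : ℝ → ℝ}
    (hint : IntervalIntegrable h volume 0 1) (hd : Tendsto (fun i => stepDist (p i) h) l (𝓝 0))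
    {S : Set ℝ} {φ : ℝ → E} {K : ℝ}
    (hφ : ∀ x ∈ S, ∀ y ∈ S, ‖φ x - φ y‖ ≤ K * |x - y|) (hp : ∀ᶠ i in l, ∀ j, p i j ∈ S)
    (hS : ∀ᵐ t, t ∈ Set.Ioc (0 : ℝ) 1 → h t ∈ S)
    (hφh : IntervalIntegrable (fun t => φ (h t)) volume 0 1) :
    Tendsto (fun i => (n i : ℝ)⁻¹ • ∑ j, φ (p i j)) l (𝓝 (∫ t in (0 : ℝ)..1, φ (h t))) := by
  rw [tendsto_iff_norm_sub_tendsto_zero]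
  have h1 := hd.const_mul K
  rw [mul_zero] at h1
  refine squeeze_zero' (Eventually.of_forall fun i => norm_nonneg _) ?_ h1
  filter_upwards [hn.eventually_gt_atTop 0, hp] with i hi hpi
  exact norm_mean_sub_integral_le hi hint hφ hpi hS hφh

theorem PiecewiseContinuous.exists_bound {f : ℝ → ℝ} (hf : PiecewiseContinuous f) :
    ∃ B, ∀ t ∈ Set.Icc (0 : ℝ) 1, |f t| ≤ B := by
  obtain ⟨D, -, -, hlim⟩ := hf
  refine isCompact_Icc.induction_on (p := fun s => ∃ B, ∀ t ∈ s, |f t| ≤ B) ⟨0, by simp⟩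
    (fun s t hst ⟨B, hB⟩ => ⟨B, fun x hx => hB x (hst hx)⟩)
    (fun s t ⟨B, hB⟩ ⟨C, hC⟩ => ⟨max B C, ?_⟩) fun t ht => ?_
  · rintro x (hx | hx)
    · exact (hB x hx).trans (le_max_left _ _)
    · exact (hC x hx).trans (le_max_right _ _)
  · obtain ⟨⟨l1, h1⟩, l2, h2⟩ := hlim t ht
    have e1 := h1.abs.eventually_le_const (lt_add_one |l1|)
    have e2 := h2.abs.eventually_le_const (lt_add_one |l2|)
    rw [eventually_nhdsWithin_iff] at e1 e2
    refine ⟨_, inter_mem_nhdsWithin _ (e1.and e2),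
      max |f t| (max (|l1| + 1) (|l2| + 1)), ?_⟩
    rintro x ⟨hx, hx1, hx2⟩
    rcases lt_trichotomy x t with hxt | rfl | hxt
    · exact (hx2 ⟨hx, hxt⟩).trans ((le_max_right _ _).trans (le_max_right _ _))
    · exact le_max_left _ _
    · exact (hx1 ⟨hx, hxt⟩).trans ((le_max_left _ _).trans (le_max_right _ _))

theorem PiecewiseContinuous.aestronglyMeasurable {f : ℝ → ℝ} (hf : PiecewiseContinuous f) :
    AEStronglyMeasurable f (volume.restrict (Set.Ioc (0 : ℝ) 1)) := by
  obtain ⟨D, hD, hc, -⟩ := hf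
  have h1 : ContinuousOn f (Set.Ioc 0 1 \ D) := fun t ht =>
    (hc t ⟨ht.1.1.le, ht.1.2⟩ ht.2).mono fun x hx => ⟨hx.1.1.le, hx.1.2⟩
  have h2 := h1.aestronglyMeasurable (μ := volume) (measurableSet_Ioc.diff hD.measurableSet)
  rwa [Measure.restrict_congr_set (sdiff_null_ae_eq_self (hD.measure_zero _))] at h2

theorem intervalIntegrable_of_bound {E : Type*} [NormedAddCommGroup E] {f : ℝ → E}
    (hm : AEStronglyMeasurable f (volume.restrict (Set.Ioc (0 : ℝ) 1))) {B : ℝ}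
    (hB : ∀ᵐ t, t ∈ Set.Ioc (0 : ℝ) 1 → ‖f t‖ ≤ B) : IntervalIntegrable f volume 0 1 := by
  rw [intervalIntegrable_iff_integrableOn_Ioc_of_le zero_le_one]
  refine (integrable_const B).mono' hm ?_
  rwa [ae_restrict_iff' measurableSet_Ioc]

theorem PiecewiseContinuous.intervalIntegrable {f : ℝ → ℝ} (hf : PiecewiseContinuous f) :
    IntervalIntegrable f volume 0 1 := by
  obtain ⟨B, hB⟩ := hf.exists_bound
  exact intervalIntegrable_of_bound hf.aestronglyMeasurable
    (ae_of_all _ fun t ht => hB t ⟨ht.1.le, ht.2⟩)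

theorem PiecewiseContinuous.tendsto_stepDist {f : ℝ → ℝ} (hf : PiecewiseContinuous f)
    {α : Type*} {l : Filter α} [l.IsCountablyGenerated] {n : α → ℕ} (hn : Tendsto n l atTop) :
    Tendsto (fun i => stepDist (fun j : Fin (n i) => f ((j + 1 : ℝ) / n i)) f) l (𝓝 0) := by
  obtain ⟨B, hB⟩ := hf.exists_bound
  have hcell : ∀ i, 0 < n i → ∀ t ∈ Set.Ioc (0 : ℝ) 1, ∃ s ∈ Set.Icc (0 : ℝ) 1,
      |s - t| ≤ 1 / n i ∧ stepFn (fun j : Fin (n i) => f ((j + 1 : ℝ) / n i)) t = f s := by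
    intro i hi t ht
    obtain ⟨j, hj⟩ := exists_cell hi ht
    have hn' : (0 : ℝ) < n i := by exact_mod_cast hi
    refine ⟨((j : ℝ) + 1) / n i, ⟨by positivity, ?_⟩, ?_, stepFn_eq _ j hj⟩
    · rw [div_le_one hn']; exact_mod_cast j.2
    · rw [abs_of_nonneg (by linarith [hj.2])]
      have := hj.1
      rw [add_div]
      linarith
  have hpt : ∀ᵐ t, t ∈ Set.uIoc (0 : ℝ) 1 → Tendsto (fun i =>
      |stepFn (fun j : Fin (n i) => f ((j + 1 : ℝ) / n i)) t - f t|) l (𝓝 0) := by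
    obtain ⟨D, hD, hc, -⟩ := hf
    filter_upwards [hD.countable.ae_notMem volume] with t htD ht
    rw [Set.uIoc_of_le zero_le_one] at ht
    have hct := hc t ⟨ht.1.le, ht.2⟩ htD
    rw [Metric.tendsto_nhds]
    intro ε hε
    obtain ⟨δ, hδ, hδε⟩ := Metric.continuousWithinAt_iff.mp hct ε hε
    have hsmall : Tendsto (fun i => 1 / (n i : ℝ)) l (𝓝 0) :=
      tendsto_one_div_atTop_nhds_zero_nat.comp hn
    filter_upwards [hn.eventually_gt_atTop 0, hsmall.eventually_lt_const hδ] with i hi hi2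
    obtain ⟨s, hs, hst, hs2⟩ := hcell i hi t ht
    rw [hs2, Real.dist_eq, sub_zero, abs_abs]
    exact hδε hs (hst.trans_lt hi2)
  have h := intervalIntegral.tendsto_integral_filter_of_dominated_convergence
    (μ := volume) (a := 0) (b := 1) (l := l) (f := fun _ => (0 : ℝ))
    (F := fun i t => |stepFn (fun j : Fin (n i) => f ((j + 1 : ℝ) / n i)) t - f t|)
    (fun _ => 2 * B) ?_ ?_ intervalIntegrable_const hpt
  · simpa [stepDist] using h
  · filter_upwards [hn.eventually_gt_atTop 0] with i hi
    exact (((intervalIntegrable_stepFn hi _).sub hf.intervalIntegrable).abs).def'.aestronglyMeasurable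
  · filter_upwards [hn.eventually_gt_atTop 0] with i hi
    refine ae_of_all _ fun t ht => ?_
    rw [Set.uIoc_of_le zero_le_one] at ht
    obtain ⟨s, hs, -, hs2⟩ := hcell i hi t ht
    rw [hs2, Real.norm_eq_abs, abs_abs]
    have := hB s hs
    have := hB t ⟨ht.1.le, ht.2⟩
    refine (abs_sub _ _).trans (by linarith)

theorem stepDist_add_le {n : ℕ} (hn : 0 < n) (p q : Fin n → ℝ) {h : ℝ → ℝ}
    (hint : IntervalIntegrable h volume 0 1) :
    stepDist p h ≤ (n : ℝ)⁻¹ * ∑ j, |p j - q j| + stepDist q h := by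
  have h1 := integral_stepFn hn fun j => |p j - q j|
  rw [smul_eq_mul] at h1
  have hq := ((intervalIntegrable_stepFn hn q).sub hint).abs
  rw [← h1, stepDist, stepDist, ← intervalIntegral.integral_add (intervalIntegrable_stepFn hn _) hq]
  refine intervalIntegral.integral_mono_on_of_le_Ioo zero_le_one
    ((intervalIntegrable_stepFn hn p).sub hint).abs ((intervalIntegrable_stepFn hn _).add hq) ?_
  intro t ht
  obtain ⟨i, hi⟩ := exists_cell hn ⟨ht.1, ht.2.le⟩
  rw [stepFn_eq _ i hi, stepFn_eq _ i hi, stepFn_eq _ i hi]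
  exact abs_sub_le _ _ _

theorem stepDist_nonneg {n : ℕ} (p : Fin n → ℝ) (h : ℝ → ℝ) : 0 ≤ stepDist p h :=
  intervalIntegral.integral_nonneg zero_le_one fun _ _ => abs_nonneg _

theorem tendsto_stepDist_parts {f : ℝ → ℝ} (hf : PiecewiseContinuous f) {ν : ℕ → ℕ}
    (hν : Tendsto ν atTop atTop) {lam : ∀ k, Fin (ν k) → ℤ}
    (hR : Tendsto (fun k => R1 (lam k) f / (ν k : ℝ)) atTop (𝓝 0)) :
    Tendsto (fun k => stepDist (fun j => (lam k j : ℝ) / ν k) f) atTop (𝓝 0) := by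
  have h := hR.add (hf.tendsto_stepDist hν)
  rw [add_zero] at h
  refine squeeze_zero' (Eventually.of_forall fun k => stepDist_nonneg _ _) ?_ h
  filter_upwards [hν.eventually_gt_atTop 0] with k hk
  refine (stepDist_add_le hk _ (fun j : Fin (ν k) => f ((j + 1 : ℝ) / ν k))
    hf.intervalIntegrable).trans_eq ?_
  rw [R1, div_eq_inv_mul]

theorem tendsto_stepDist_pole {f : ℝ → ℝ} (hf : PiecewiseContinuous f) {ν : ℕ → ℕ}
    (hν : Tendsto ν atTop atTop) {lam : ∀ k, Fin (ν k) → ℤ}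
    (hR : Tendsto (fun k => R1 (lam k) f / (ν k : ℝ)) atTop (𝓝 0)) :
    Tendsto (fun k => stepDist (pole (lam k)) (fun t => f t + 1 - t)) atTop (𝓝 0) := by
  have h := (tendsto_stepDist_parts hf hν hR).add (tendsto_one_div_atTop_nhds_zero_nat.comp hν)
  rw [add_zero] at h
  refine squeeze_zero' (Eventually.of_forall fun k => stepDist_nonneg _ _) ?_ h
  filter_upwards [hν.eventually_gt_atTop 0] with k hk
  have hk' : (0 : ℝ) < ν k := by exact_mod_cast hk
  have i1 := ((intervalIntegrable_stepFn hk (fun j => (lam k j : ℝ) / ν k)).sub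
    hf.intervalIntegrable).abs
  have i2 : IntervalIntegrable (fun t : ℝ => f t + 1 - t) volume 0 1 :=
    (hf.intervalIntegrable.add intervalIntegrable_const).sub
      (continuous_id.intervalIntegrable _ _)
  have i3 : IntervalIntegrable (fun _ : ℝ => 1 / (ν k : ℝ)) volume 0 1 := intervalIntegrable_const
  have e : ((fun x : ℕ => 1 / (x : ℝ)) ∘ ν) k = ∫ _t in (0 : ℝ)..1, 1 / (ν k : ℝ) := by
    simp
  rw [Function.comp_apply] at e
  simp only [Function.comp_apply]
  rw [stepDist, stepDist, e, ← intervalIntegral.integral_add i1 i3]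
  refine intervalIntegral.integral_mono_on_of_le_Ioo zero_le_one
    ((intervalIntegrable_stepFn hk _).sub i2).abs (i1.add i3) ?_
  intro t ht
  obtain ⟨i, hi⟩ := exists_cell hk ⟨ht.1, ht.2.le⟩
  rw [stepFn_eq _ i hi, stepFn_eq _ i hi, pole]
  have e2 : ((lam k i : ℝ) + ν k - ((i : ℕ) + 1)) / ν k - (f t + 1 - t) =
      ((lam k i : ℝ) / ν k - f t) + (t - ((i : ℕ) + 1) / ν k) := by
    field_simp; ring
  rw [e2]
  refine (abs_add_le _ _).trans (add_le_add_right ?_ _)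
  rw [abs_sub_comm, abs_of_nonneg (by linarith [hi.2])]
  have := hi.1
  rw [add_div]
  linarith

end SchurAsymp

namespace SchurAsymp

open MeasureTheory

theorem intervalIntegral_pos_of_ae_pos {g : ℝ → ℝ} (hg : IntervalIntegrable g volume 0 1)
    (hpos : ∀ᵐ t, t ∈ Set.Ioc (0 : ℝ) 1 → 0 < g t) : 0 < ∫ t in (0 : ℝ)..1, g t := by
  rw [intervalIntegral.integral_of_le zero_le_one]
  have h1 : 0 ≤ᵐ[volume.restrict (Set.Ioc (0 : ℝ) 1)] g :=
    (ae_restrict_iff' measurableSet_Ioc).mpr (hpos.mono fun t ht h => (ht h).le)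
  rw [setIntegral_pos_iff_support_of_nonneg_ae h1 hg.1]
  have h2 : (Set.Ioc (0 : ℝ) 1 : Set ℝ) ≤ᵐ[volume] (Function.support g ∩ Set.Ioc 0 1 : Set ℝ) := by
    filter_upwards [hpos] with t ht h using ⟨(ht h).ne', h⟩
  refine lt_of_lt_of_le ?_ (measure_mono_ae h2)
  simp

theorem abs_log_sub_log_le {a b c : ℝ} (hc : 0 < c) (ha : c ≤ a) (hb : c ≤ b) :
    |Real.log a - Real.log b| ≤ |a - b| / c := by
  have key : ∀ a b : ℝ, c ≤ a → c ≤ b → Real.log a - Real.log b ≤ |a - b| / c := by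
    intro a b ha hb
    have ha0 := hc.trans_le ha
    have hb0 := hc.trans_le hb
    rw [← Real.log_div ha0.ne' hb0.ne']
    refine (Real.log_le_sub_one_of_pos (div_pos ha0 hb0)).trans ?_
    have : a / b - 1 = (a - b) / b := by field_simp
    rw [this]
    exact div_le_div₀ (abs_nonneg _) (le_abs_self _) hc hb
  refine abs_le.mpr ⟨?_, key a b ha hb⟩
  have := key b a hb ha
  rw [abs_sub_comm]
  linarith

theorem abs_inv_sub_inv_le {a b c : ℝ} (hc : 0 < c) (ha : c ≤ a) (hb : c ≤ b) :
    |a⁻¹ - b⁻¹| ≤ |a - b| / c ^ 2 := by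
  have ha0 := hc.trans_le ha
  have hb0 := hc.trans_le hb
  rw [inv_sub_inv ha0.ne' hb0.ne', abs_div, abs_of_pos (mul_pos ha0 hb0), abs_sub_comm, sq]
  exact div_le_div_of_nonneg_left (abs_nonneg _) (by positivity)
    (mul_le_mul ha hb hc.le ha0.le)

section LogAsymptotics

variable {α : Type*} {l : Filter α} {n : α → ℕ} {p : ∀ i, Fin (n i) → ℝ} {h : ℝ → ℝ}
  {w₀ B : ℝ}

theorem ddExp_le_of_bound {n : ℕ} {p : Fin n → ℝ} (hn : 1 < n) (hp : Function.Injective p)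
    {w A : ℝ} (hw : ∀ j, p j < w) (hA : ∀ j, w - p j ≤ A) {u : ℝ} (hu : 0 < u) :
    ddExp Finset.univ p u * (∏ j, (w - p j)) * Real.exp (-(u * w)) ≤
      1 / (2 * Real.pi) * ∫ t : ℝ, (1 + t ^ 2 / A ^ 2)⁻¹ := by
  have hA0 : 0 < A := (sub_pos.mpr (hw ⟨0, by omega⟩)).trans_le (hA ⟨0, by omega⟩)
  have h := ddExp_eq_integral (s := Finset.univ) (by simpa using hn) hp.injOn
    (fun j _ => hw j) hu
  refine (le_abs_self _).trans ?_
  rw [← Real.norm_eq_abs, ← Complex.norm_real, h, norm_mul, Complex.norm_real,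
    Real.norm_of_nonneg (by positivity)]
  refine mul_le_mul_of_nonneg_left ?_ (by positivity)
  refine norm_integral_le_of_norm_le (integrable_inv_one_add_div_sq hA0) (ae_of_all _ fun t => ?_)
  rw [norm_mul, mul_comm Complex.I, Complex.norm_exp_ofReal_mul_I, one_mul, norm_inv]
  exact inv_anti₀ (by positivity) (one_add_sq_le_norm_prod (by simpa using hn)
    (fun j _ => sub_pos.mpr (hw j)) (fun j _ => hA j) t)

theorem aestronglyMeasurable_of_inv {g : ℝ → ℝ}
    (hg : AEStronglyMeasurable (fun t => 1 / (w₀ - g t)) (volume.restrict (Set.Ioc (0 : ℝ) 1))) :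
    AEStronglyMeasurable g (volume.restrict (Set.Ioc (0 : ℝ) 1)) := by
  have h1 : g = fun t => w₀ - (1 / (w₀ - g t))⁻¹ := by ext t; simp
  rw [h1]
  exact (measurable_const.sub (measurable_id.inv)).comp_aemeasurable hg.aemeasurable
    |>.aestronglyMeasurable

theorem tendsto_inv_nat_mul_log_sqrt (hn : Tendsto n l atTop) :
    Tendsto (fun i => (n i : ℝ)⁻¹ * Real.log √(n i)) l (𝓝 0) := by
  have h1 : Tendsto (fun x : ℝ => Real.log x / x) atTop (𝓝 0) := by
    simpa using Real.tendsto_pow_log_div_mul_add_atTop 1 0 1 one_ne_zero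
  have h2 := (h1.comp (tendsto_natCast_atTop_atTop.comp hn)).div_const 2
  rw [zero_div] at h2
  refine h2.congr fun i => ?_
  simp only [Function.comp_apply]
  rw [Real.log_sqrt (Nat.cast_nonneg _)]
  ring

theorem tendsto_inv_nat_mul_const (hn : Tendsto n l atTop) (c : ℝ) :
    Tendsto (fun i => (n i : ℝ)⁻¹ * c) l (𝓝 0) := by
  have := (tendsto_inv_atTop_zero.comp (tendsto_natCast_atTop_atTop (R := ℝ).comp hn)).mul_const c
  rw [zero_mul] at this
  exact this

theorem tendsto_log_ddExp [l.IsCountablyGenerated] (hn : Tendsto n l atTop)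
    (hp : ∀ᶠ i in l, Function.Injective (p i)) (hB : ∀ᶠ i in l, ∀ j, |p i j| ≤ B)
    (hhB : ∀ᵐ t, t ∈ Set.Ioc (0 : ℝ) 1 → |h t| ≤ B)
    (hd : Tendsto (fun i => stepDist (p i) h) l (𝓝 0))
    (hlt : ∀ᶠ i in l, ∀ j, p i j < w₀) (hh : ∀ᵐ t, t ∈ Set.Ioc (0 : ℝ) 1 → h t < w₀)
    (hI : IntervalIntegrable (fun t => 1 / (w₀ - h t)) volume 0 1) :
    Tendsto (fun i => (n i : ℝ)⁻¹ * Real.log (ddExp Finset.univ (p i)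
        (n i * ∫ t in (0 : ℝ)..1, 1 / (w₀ - h t)))) l
      (𝓝 ((∫ t in (0 : ℝ)..1, 1 / (w₀ - h t)) * w₀ - ∫ t in (0 : ℝ)..1, Real.log (w₀ - h t))) := by
  set y := ∫ t in (0 : ℝ)..1, 1 / (w₀ - h t) with hy
  have hm := aestronglyMeasurable_of_inv hI.1.aestronglyMeasurable
  have hint : IntervalIntegrable h volume 0 1 := intervalIntegrable_of_bound hm hhB
  have hy0 : 0 < y := intervalIntegral_pos_of_ae_pos hI
    (hh.mono fun t ht hI => one_div_pos.mpr (sub_pos.mpr (ht hI)))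
  -- integrals at points to the right of `w₀`
  have hmeas : ∀ φ : ℝ → ℝ, Measurable φ → AEStronglyMeasurable (fun t => φ (h t))
      (volume.restrict (Set.Ioc (0 : ℝ) 1)) := fun φ hφ =>
    (hφ.comp_aemeasurable hm.aemeasurable).aestronglyMeasurable
  have i1 : ∀ w, w₀ < w → IntervalIntegrable (fun t => (w - h t)⁻¹) volume 0 1 := by
    intro w hw
    refine intervalIntegrable_of_bound (hmeas (fun x => (w - x)⁻¹) (by fun_prop)) (B := (w - w₀)⁻¹) ?_
    filter_upwards [hh] with t ht htI
    have := ht htI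
    rw [Real.norm_of_nonneg (inv_nonneg.mpr (by linarith))]
    exact inv_anti₀ (by linarith) (by linarith)
  have i2 : ∀ w, w₀ < w → IntervalIntegrable (fun t => (w - h t)⁻¹ ^ 2) volume 0 1 := by
    intro w hw
    refine intervalIntegrable_of_bound (hmeas (fun x => (w - x)⁻¹ ^ 2) (by fun_prop))
      (B := (w - w₀)⁻¹ ^ 2) ?_
    filter_upwards [hh] with t ht htI
    have := ht htI
    rw [norm_pow, Real.norm_of_nonneg (inv_nonneg.mpr (by linarith))]
    exact pow_le_pow_left₀ (inv_nonneg.mpr (by linarith)) (inv_anti₀ (by linarith) (by linarith)) 2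
  have i3 : ∀ w, w₀ < w → IntervalIntegrable (fun t => Real.log (w - h t)) volume 0 1 := by
    intro w hw
    refine intervalIntegrable_of_bound (hmeas (fun x => Real.log (w - x))
      (by fun_prop)) (B := (w + B) + (w - w₀)⁻¹) ?_
    filter_upwards [hh, hhB] with t ht hb htI
    have h1 := ht htI
    have h2 := (abs_le.mp (hb htI)).1
    have h3 := Real.log_le_sub_one_of_pos (x := w - h t) (by linarith)
    have h4 := Real.one_sub_inv_le_log_of_pos (x := w - h t) (by linarith)
    have h5 : (w - h t)⁻¹ ≤ (w - w₀)⁻¹ := inv_anti₀ (by linarith) (by linarith)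
    have h6 : 0 < (w - w₀)⁻¹ := inv_pos.mpr (by linarith)
    rw [Real.norm_eq_abs]
    exact abs_le.mpr ⟨by linarith, by linarith⟩
  set D1 : ℝ → ℝ := fun w => ∫ t in (0 : ℝ)..1, (w - h t)⁻¹ with hD1
  set D2 : ℝ → ℝ := fun w => ∫ t in (0 : ℝ)..1, (w - h t)⁻¹ ^ 2 with hD2
  set D3 : ℝ → ℝ := fun w => ∫ t in (0 : ℝ)..1, Real.log (w - h t) with hD3
  have hS : ∀ᵐ t, t ∈ Set.Ioc (0 : ℝ) 1 → h t ∈ Set.Iic w₀ := hh.mono fun t ht hI => (ht hI).le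
  have hpS : ∀ᶠ i in l, ∀ j, p i j ∈ Set.Iic w₀ := hlt.mono fun i hi j => (hi j).le
  have t1 : ∀ w, w₀ < w → Tendsto (fun i => (n i : ℝ)⁻¹ * ∑ j, (w - p i j)⁻¹) l (𝓝 (D1 w)) := by
    intro w hw
    refine tendsto_mean hn hint hd (S := Set.Iic w₀) (φ := fun x => (w - x)⁻¹)
      (K := 1 / (w - w₀) ^ 2) (fun x hx z hz => ?_) hpS hS (i1 w hw)
    have hx' : x ≤ w₀ := hx
    have hz' : z ≤ w₀ := hz
    have := abs_inv_sub_inv_le (a := w - x) (b := w - z) (sub_pos.mpr hw) (by linarith) (by linarith)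
    rw [sub_sub_sub_cancel_left, abs_sub_comm z] at this
    rw [Real.norm_eq_abs]
    exact this.trans_eq (by ring)
  have t2 : ∀ w, w₀ < w → Tendsto (fun i => (n i : ℝ)⁻¹ * ∑ j, (w - p i j)⁻¹ ^ 2) l
      (𝓝 (D2 w)) := by
    intro w hw
    refine tendsto_mean hn hint hd (S := Set.Iic w₀) (φ := fun x => (w - x)⁻¹ ^ 2)
      (K := 2 * (w - w₀)⁻¹ * (1 / (w - w₀) ^ 2)) (fun x hx z hz => ?_) hpS hS (i2 w hw)
    have hx' : x ≤ w₀ := hx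
    have hz' : z ≤ w₀ := hz
    have h1 := abs_inv_sub_inv_le (a := w - x) (b := w - z) (sub_pos.mpr hw) (by linarith)
      (by linarith)
    rw [sub_sub_sub_cancel_left, abs_sub_comm z] at h1
    have h2 : (w - x)⁻¹ ≤ (w - w₀)⁻¹ := inv_anti₀ (by linarith) (by linarith)
    have h3 : (w - z)⁻¹ ≤ (w - w₀)⁻¹ := inv_anti₀ (by linarith) (by linarith)
    have h4 : 0 ≤ (w - x)⁻¹ := inv_nonneg.mpr (by linarith)
    have h5 : 0 ≤ (w - z)⁻¹ := inv_nonneg.mpr (by linarith)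
    simp only [Real.norm_eq_abs]
    rw [sq_sub_sq, abs_mul, abs_of_nonneg (add_nonneg h4 h5), mul_assoc]
    refine mul_le_mul (by linarith) (h1.trans_eq (by ring)) (abs_nonneg _) ?_
    have := sub_pos.mpr hw
    positivity
  have t3 : ∀ w, w₀ < w → Tendsto (fun i => (n i : ℝ)⁻¹ * ∑ j, Real.log (w - p i j)) l
      (𝓝 (D3 w)) := by
    intro w hw
    refine tendsto_mean hn hint hd (S := Set.Iic w₀) (φ := fun x => Real.log (w - x))
      (K := 1 / (w - w₀)) (fun x hx z hz => ?_) hpS hS (i3 w hw)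
    have hx' : x ≤ w₀ := hx
    have hz' : z ≤ w₀ := hz
    have := abs_log_sub_log_le (a := w - x) (b := w - z) (sub_pos.mpr hw) (by linarith) (by linarith)
    rw [sub_sub_sub_cancel_left, abs_sub_comm z] at this
    rw [Real.norm_eq_abs]
    exact this.trans_eq (by ring)
  -- upper bound
  have upper : ∀ w, w₀ < w → ∃ u : α → ℝ, Tendsto u l (𝓝 (y * w - D3 w)) ∧
      ∀ᶠ i in l, (n i : ℝ)⁻¹ * Real.log (ddExp Finset.univ (p i) (n i * y)) ≤ u i := by
    intro w hw
    set C := 1 / (2 * Real.pi) * ∫ t : ℝ, (1 + t ^ 2 / (w + B) ^ 2)⁻¹ with hC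
    refine ⟨fun i => (n i : ℝ)⁻¹ * Real.log C +
      (y * w - (n i : ℝ)⁻¹ * ∑ j, Real.log (w - p i j)), ?_, ?_⟩
    · simpa using (tendsto_inv_nat_mul_const hn (Real.log C)).add ((t3 w hw).const_sub (y * w))
    · filter_upwards [hn.eventually_gt_atTop 1, hp, hB, hlt] with i hi hpi hBi hlti
      have hn0 : (0 : ℝ) < n i := by exact_mod_cast (zero_lt_one.trans hi)
      have hpos : ∀ j, 0 < w - p i j := fun j => by linarith [hlti j]
      have h1 := ddExp_le_of_bound hi hpi (w := w) (A := w + B) (fun j => by linarith [hlti j])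
        (fun j => by linarith [(abs_le.mp (hBi j)).1]) (mul_pos hn0 hy0)
      have hdd := ddExp_pos (s := Finset.univ) ⟨⟨0, by omega⟩, by simp⟩ hpi.injOn (n i * y)
        (mul_pos hn0 hy0)
      have hprod : 0 < ∏ j, (w - p i j) := Finset.prod_pos fun j _ => hpos j
      have h2 := Real.log_le_log (by positivity) h1
      rw [Real.log_mul (by positivity) (by positivity), Real.log_mul hdd.ne' hprod.ne',
        Real.log_prod fun j _ => (hpos j).ne', Real.log_exp] at h2
      have h3 : Real.log (ddExp Finset.univ (p i) (n i * y)) ≤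
          Real.log C + (n i * y * w - ∑ j, Real.log (w - p i j)) := by linarith
      refine (mul_le_mul_of_nonneg_left h3 (inv_nonneg.mpr hn0.le)).trans_eq ?_
      field_simp
  have hD1pos : ∀ w, w₀ < w → 0 < D1 w := fun w hw => intervalIntegral_pos_of_ae_pos (i1 w hw)
    (hh.mono fun t ht hI => inv_pos.mpr (by linarith [ht hI]))
  have hD2pos : ∀ w, w₀ < w → 0 < D2 w := fun w hw => intervalIntegral_pos_of_ae_pos (i2 w hw)
    (hh.mono fun t ht hI => by have := ht hI; have : 0 < w - h t := by linarith
                               positivity)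
  have hD1lt : ∀ w, w₀ < w → D1 w < y := by
    intro w hw
    rw [← sub_pos, hy, hD1, ← intervalIntegral.integral_sub hI (i1 w hw)]
    refine intervalIntegral_pos_of_ae_pos (hI.sub (i1 w hw)) (hh.mono fun t ht hI => ?_)
    have := ht hI
    rw [one_div, sub_pos]
    exact (inv_lt_inv₀ (by linarith) (by linarith)).mpr (by linarith)
  -- lower bound
  have lower : ∀ w, w₀ < w → ∃ u : α → ℝ,
      Tendsto u l (𝓝 (Real.log (y / D1 w) - (y - D1 w) * B + (D1 w * w - D3 w))) ∧
      ∀ᶠ i in l, u i ≤ (n i : ℝ)⁻¹ * Real.log (ddExp Finset.univ (p i) (n i * y)) := by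
    intro w hw
    set y' : α → ℝ := fun i => (n i : ℝ)⁻¹ * ∑ j, (w - p i j)⁻¹ with hy'
    have hy'lim : Tendsto y' l (𝓝 (D1 w)) := t1 w hw
    have hy'pos : ∀ᶠ i in l, 0 < y' i := hy'lim.eventually_const_lt (hD1pos w hw)
    have hy'lt : ∀ᶠ i in l, y' i < y := hy'lim.eventually_lt_const (hD1lt w hw)
    have hlclt := tendsto_ddExp (w := fun _ => w) (y := y') hn (sub_pos.mpr hw) (hD2pos w hw) hp
      hy'pos (hlt.mono fun i hi j => by linarith [hi j])
      (tendsto_const_nhds.congr fun i => by rw [hy']; ring)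
      ((t2 w hw).congr fun i => by rw [div_eq_inv_mul])
    set Q : α → ℝ := fun i => √(n i) * (ddExp Finset.univ (p i) (n i * y' i) *
      (∏ j, (w - p i j)) * Real.exp (-(n i * y' i * w))) with hQ
    have hc0 : (1 / √(2 * Real.pi * D2 w)) ≠ 0 := by
      have := hD2pos w hw
      positivity
    have hQlog : Tendsto (fun i => (n i : ℝ)⁻¹ * Real.log (Q i)) l (𝓝 0) := by
      have h1 := hlclt.log hc0
      have h2 := (tendsto_inv_atTop_zero.comp
        (tendsto_natCast_atTop_atTop (R := ℝ).comp hn)).mul h1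
      rw [zero_mul] at h2
      exact h2
    have hratio : Tendsto (fun i => (1 - (n i : ℝ)⁻¹) * Real.log (y / y' i)) l
        (𝓝 (Real.log (y / D1 w))) := by
      have h1 := (tendsto_const_nhds (x := y)).div hy'lim (hD1pos w hw).ne'
      have h2 := h1.log (div_pos hy0 (hD1pos w hw)).ne'
      have h3 := ((tendsto_inv_atTop_zero.comp
        (tendsto_natCast_atTop_atTop (R := ℝ).comp hn)).const_sub 1).mul h2
      simpa using h3
    refine ⟨fun i => (1 - (n i : ℝ)⁻¹) * Real.log (y / y' i) - (y - y' i) * B +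
      (y' i * w - (n i : ℝ)⁻¹ * ∑ j, Real.log (w - p i j)) +
      ((n i : ℝ)⁻¹ * Real.log (Q i) - (n i : ℝ)⁻¹ * Real.log √(n i)), ?_, ?_⟩
    · have := ((hratio.sub ((hy'lim.const_sub y).mul_const B)).add
        ((hy'lim.mul_const w).sub (t3 w hw))).add (hQlog.sub (tendsto_inv_nat_mul_log_sqrt hn))
      simpa using this
    · filter_upwards [hn.eventually_gt_atTop 1, hp, hB, hlt, hy'pos, hy'lt] with
        i hi hpi hBi hlti hy1 hy2
      have hn0 : (0 : ℝ) < n i := by exact_mod_cast (zero_lt_one.trans hi)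
      have hpos : ∀ j, 0 < w - p i j := fun j => by linarith [hlti j]
      have hne : (Finset.univ : Finset (Fin (n i))).Nonempty := ⟨⟨0, by omega⟩, by simp⟩
      have hdd := ddExp_pos hne hpi.injOn (n i * y' i) (mul_pos hn0 hy1)
      have hdd2 := ddExp_pos hne hpi.injOn (n i * y) (mul_pos hn0 hy0)
      have hprod : 0 < ∏ j, (w - p i j) := Finset.prod_pos fun j _ => hpos j
      have hsq : 0 < √(n i : ℝ) := Real.sqrt_pos.mpr hn0
      have hlogQ : Real.log (Q i) = Real.log √(n i) +
          (Real.log (ddExp Finset.univ (p i) (n i * y' i)) + ∑ j, Real.log (w - p i j) +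
            -(n i * y' i * w)) := by
        rw [hQ]
        simp only []
        rw [Real.log_mul hsq.ne' (by positivity), Real.log_mul (by positivity) (by positivity),
          Real.log_mul hdd.ne' hprod.ne', Real.log_prod fun j _ => (hpos j).ne', Real.log_exp]
      have hc : 1 ≤ y / y' i := by rw [one_le_div hy1]; exact hy2.le
      have h1 := ddExp_mul_ge hne hpi.injOn (m := -B) (fun j _ => (abs_le.mp (hBi j)).1) hc
        (n i * y' i) (mul_pos hn0 hy1)
      rw [show y / y' i * (n i * y' i) = n i * y by field_simp,
        show (y / y' i - 1) * (n i * y' i) * -B = -(n i * ((y - y' i) * B)) by field_simp,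
        Finset.card_univ, Fintype.card_fin] at h1
      have hc0 : 0 < y / y' i := by linarith
      have h2 := Real.log_le_log (by positivity) h1
      rw [Real.log_mul (by positivity) hdd.ne', Real.log_mul (by positivity) (by positivity),
        Real.log_pow, Real.log_exp, Nat.cast_sub hi.le, Nat.cast_one] at h2
      refine le_trans (le_of_eq ?_) (mul_le_mul_of_nonneg_left h2 (inv_nonneg.mpr hn0.le))
      rw [hlogQ]
      field_simp
      ring
  -- the limit `w → w₀` from the right
  have l1 : Tendsto D1 (𝓝[>] w₀) (𝓝 y) := by
    refine intervalIntegral.tendsto_integral_filter_of_dominated_convergence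
      (fun t => 1 / (w₀ - h t)) ?_ ?_ hI ?_
    · filter_upwards [self_mem_nhdsWithin] with w hw
      exact (i1 w hw).def'.aestronglyMeasurable
    · filter_upwards [self_mem_nhdsWithin] with w hw
      filter_upwards [hh] with t ht htI
      rw [Set.uIoc_of_le zero_le_one] at htI
      have h1 := ht htI
      have h2 : w₀ < w := hw
      rw [Real.norm_of_nonneg (inv_nonneg.mpr (by linarith)), one_div]
      exact inv_anti₀ (by linarith) (by linarith)
    · filter_upwards [hh] with t ht htI
      rw [Set.uIoc_of_le zero_le_one] at htI
      have h1 := ht htI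
      rw [one_div]
      have : ContinuousAt (fun w => (w - h t)⁻¹) w₀ :=
        ContinuousAt.inv₀ (by fun_prop) (by linarith)
      exact this.tendsto.mono_left nhdsWithin_le_nhds
  have l3 : Tendsto D3 (𝓝[>] w₀) (𝓝 (∫ t in (0 : ℝ)..1, Real.log (w₀ - h t))) := by
    refine intervalIntegral.tendsto_integral_filter_of_dominated_convergence
      (fun t => (w₀ + 1 + B) + 1 / (w₀ - h t)) ?_ ?_ (intervalIntegrable_const.add hI) ?_
    · filter_upwards [self_mem_nhdsWithin] with w hw
      exact (i3 w hw).def'.aestronglyMeasurable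
    · filter_upwards [Ioo_mem_nhdsGT (lt_add_one w₀)] with w hw
      filter_upwards [hh, hhB] with t ht hb htI
      rw [Set.uIoc_of_le zero_le_one] at htI
      have h1 := ht htI
      have h2 := (abs_le.mp (hb htI)).1
      have h3 := Real.log_le_sub_one_of_pos (x := w - h t) (by linarith [hw.1])
      have h4 := Real.one_sub_inv_le_log_of_pos (x := w - h t) (by linarith [hw.1])
      have h5 : (w - h t)⁻¹ ≤ (w₀ - h t)⁻¹ := inv_anti₀ (by linarith) (by linarith [hw.1])
      have h6 : 0 < (w₀ - h t)⁻¹ := inv_pos.mpr (by linarith)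
      rw [Real.norm_eq_abs, one_div]
      have := hw.1
      have := hw.2
      exact abs_le.mpr ⟨by linarith, by linarith⟩
    · filter_upwards [hh] with t ht htI
      rw [Set.uIoc_of_le zero_le_one] at htI
      have h1 := ht htI
      have : ContinuousAt (fun w => Real.log (w - h t)) w₀ :=
        ContinuousAt.log (by fun_prop) (by linarith)
      exact this.tendsto.mono_left nhdsWithin_le_nhds
  have lid : Tendsto (fun w : ℝ => w) (𝓝[>] w₀) (𝓝 w₀) := tendsto_id.mono_left nhdsWithin_le_nhds
  have lU := (lid.const_mul y).sub l3
  have lL := ((((tendsto_const_nhds (x := y)).div l1 hy0.ne').log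
    (div_pos hy0 hy0).ne').sub ((l1.const_sub y).mul_const B)).add ((l1.mul lid).sub l3)
  rw [div_self hy0.ne', Real.log_one, sub_self, zero_mul, sub_zero, zero_add] at lL
  refine tendsto_order.mpr ⟨fun b hb => ?_, fun b hb => ?_⟩
  · obtain ⟨w, hw1, hw2⟩ := ((lL.eventually_const_lt hb).and self_mem_nhdsWithin).exists
    obtain ⟨u, hu, hle⟩ := lower w hw2
    filter_upwards [hu.eventually_const_lt hw1, hle] with i h1 h2 using h1.trans_le h2
  · obtain ⟨w, hw1, hw2⟩ := ((lU.eventually_lt_const hb).and self_mem_nhdsWithin).exists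
    obtain ⟨u, hu, hle⟩ := upper w hw2
    filter_upwards [hu.eventually_lt_const hw1, hle] with i h1 h2 using h2.trans_lt h1

end LogAsymptotics

end SchurAsymp

namespace SchurAsymp

open MeasureTheory

theorem pole_eq {N : ℕ} (lam : Fin N → ℤ) (i : Fin N) :
    pole lam i = (shiftedPart lam i : ℝ) / N := by
  unfold pole shiftedPart
  push_cast
  ring

theorem pole_strictAnti {N : ℕ} {lam : Fin N → ℤ} (h : Antitone lam) : StrictAnti (pole lam) := by
  intro i j hij
  have hN : (0 : ℝ) < N := by exact_mod_cast (Nat.zero_le _).trans_lt i.2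
  rw [pole_eq, pole_eq]
  have := shiftedPart_strictAnti h hij
  gcongr

theorem prod_erase_eq_prod_succAbove {M : Type*} [CommMonoid M] {n : ℕ} (j : Fin (n + 1))
    (g : Fin (n + 1) → M) : ∏ i ∈ Finset.univ.erase j, g i = ∏ k, g (j.succAbove k) := by
  rw [Fin.univ_succAbove n j]
  simp

/-- The constant `(N - 1)! / N ^ (N - 1)`. -/
noncomputable def factorialRatio (N : ℕ) : ℝ := (N - 1).factorial / (N : ℝ) ^ (N - 1)

theorem normSchur_exp {N : ℕ} (hN : 0 < N) {lam : Fin N → ℤ} (hlam : Antitone lam) {y : ℂ}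
    (hy : Complex.exp y ≠ 1) :
    normSchur lam (Complex.exp y) = factorialRatio N / (Complex.exp y - 1) ^ (N - 1) *
      ddExpC Finset.univ (pole lam) (N * y) := by
  obtain ⟨n, rfl⟩ : ∃ n, N = n + 1 := ⟨N - 1, by omega⟩
  rw [normSchur_eq_sum hlam (Complex.exp_ne_zero y) hy, factorialRatio, Nat.add_sub_cancel, ddExpC,
    Finset.mul_sum, Finset.mul_sum]
  refine Finset.sum_congr rfl fun j _ => ?_
  have hn : ((n + 1 : ℕ) : ℂ) ≠ 0 := by exact_mod_cast Nat.succ_ne_zero n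
  have h1 : Complex.exp (((n + 1 : ℕ) : ℂ) * y * (pole lam j : ℂ)) =
      Complex.exp y ^ shiftedPart lam j := by
    rw [← Complex.exp_int_mul, pole_eq]
    congr 1
    push_cast at hn ⊢
    field_simp
  have h2 : ((Lagrange.nodalWeight Finset.univ (pole lam) j : ℝ) : ℂ) = ((n + 1 : ℕ) : ℂ) ^ n /
      ∏ k, ((shiftedPart lam j : ℂ) - shiftedPart lam (j.succAbove k)) := by
    rw [ofReal_nodalWeight, Lagrange.nodalWeight, prod_erase_eq_prod_succAbove,
      show ((n + 1 : ℕ) : ℂ) ^ n = ∏ _k : Fin n, ((n + 1 : ℕ) : ℂ) by simp,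
      ← Finset.prod_div_distrib]
    refine Finset.prod_congr rfl fun k _ => ?_
    rw [pole_eq, pole_eq]
    push_cast
    rw [← sub_div, inv_div]
  rw [h1, h2]
  push_cast at hn ⊢
  field_simp

theorem ddExpC_eq_zero {N : ℕ} (hN : 1 < N) {lam : Fin N → ℤ} (hlam : Antitone lam) {y : ℂ}
    (hy : Complex.exp y = 1) : ddExpC Finset.univ (pole lam) (N * y) = 0 := by
  have hn : (N : ℂ) ≠ 0 := by exact_mod_cast (zero_lt_one.trans hN).ne'
  have h1 : ∀ j, Complex.exp ((N : ℂ) * y * (pole lam j : ℂ)) = 1 := by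
    intro j
    have : (N : ℂ) * y * (pole lam j : ℂ) = shiftedPart lam j * y := by
      rw [pole_eq]; push_cast; field_simp
    rw [this, Complex.exp_int_mul, hy, one_zpow]
  simp only [ddExpC, h1, mul_one]
  rw [← Complex.ofReal_sum, sum_nodalWeight_eq_zero (by simpa using hN)
    (pole_strictAnti hlam).injective.injOn, Complex.ofReal_zero]

theorem normSchur_exp_real {N : ℕ} (hN : 0 < N) {lam : Fin N → ℤ} (hlam : Antitone lam) {y : ℝ}
    (hy : y ≠ 0) :
    normSchur lam (Real.exp y) = factorialRatio N / (Real.exp y - 1) ^ (N - 1) *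
      ddExp Finset.univ (pole lam) (N * y) := by
  have h := normSchur_exp hN hlam (y := (y : ℂ)) (by
    rw [← Complex.ofReal_exp]
    exact_mod_cast fun h => hy (Real.exp_eq_one_iff y |>.mp h))
  rw [← Complex.ofReal_exp, normSchur_ofReal, show (N : ℂ) * (y : ℂ) = ((N * y : ℝ) : ℂ) by
    push_cast; ring, ddExpC_ofReal] at h
  exact_mod_cast h

theorem factorialRatio_pos {N : ℕ} (hN : 0 < N) : 0 < factorialRatio N := by
  unfold factorialRatio; positivity

theorem tendsto_factorialRatio :
    Tendsto (fun N : ℕ => factorialRatio N * Real.exp N / √N) atTop (𝓝 √(2 * Real.pi)) := by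
  have h := Stirling.tendsto_stirlingSeq_sqrt_pi.mul_const √2
  rw [← Real.sqrt_mul Real.pi_nonneg, mul_comm Real.pi] at h
  refine h.congr' ?_
  filter_upwards [eventually_gt_atTop 0] with N hN
  have hN' : (0 : ℝ) < N := by exact_mod_cast hN
  obtain ⟨n, rfl⟩ : ∃ n, N = n + 1 := ⟨N - 1, by omega⟩
  unfold Stirling.stirlingSeq factorialRatio
  rw [Nat.add_sub_cancel, Nat.factorial_succ, div_pow, ← Real.exp_nat_mul, mul_one,
    Real.sqrt_mul (by norm_num)]
  have h2 : √(2 : ℝ) ≠ 0 := by positivity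
  have h3 : √((n + 1 : ℕ) : ℝ) ≠ 0 := by positivity
  push_cast at *
  field_simp
  rw [pow_succ]; ring

theorem tendsto_log_factorialRatio :
    Tendsto (fun N : ℕ => (N : ℝ)⁻¹ * Real.log (factorialRatio N)) atTop (𝓝 (-1)) := by
  have h0 : √(2 * Real.pi) ≠ 0 := by positivity
  have h1 := (tendsto_inv_atTop_zero.comp (tendsto_natCast_atTop_atTop (R := ℝ))).mul
    (tendsto_factorialRatio.log h0)
  rw [zero_mul] at h1
  have h2 := (h1.add (tendsto_inv_nat_mul_log_sqrt (n := fun N => N) tendsto_id)).sub_const 1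
  rw [zero_add, zero_sub] at h2
  refine h2.congr' ?_
  filter_upwards [eventually_gt_atTop 0] with N hN
  have hN' : (0 : ℝ) < N := by exact_mod_cast hN
  have := factorialRatio_pos hN
  simp only [Function.comp_apply]
  rw [Real.log_div (by positivity) (by positivity), Real.log_mul (by positivity) (by positivity),
    Real.log_exp]
  field_simp
  ring

theorem ae_eq_zero_of_frequently {l : Filter ℕ} {n : ℕ → ℕ} {p : ∀ i, Fin (n i) → ℝ} {h : ℝ → ℝ}
    (hn : Tendsto n l atTop) (hint : IntervalIntegrable h volume 0 1)
    (hd : Tendsto (fun i => stepDist (p i) h) l (𝓝 0)) {φ : ℝ → ℝ} (h0 : ∀ x, 0 ≤ φ x)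
    (hφ : ∀ x y, |φ x - φ y| ≤ |x - y|) (hp : ∃ᶠ i in l, ∀ j, φ (p i j) = 0) :
    ∀ᵐ t, t ∈ Set.Ioc (0 : ℝ) 1 → φ (h t) = 0 := by
  have hcont : Continuous φ := by
    refine (LipschitzWith.of_dist_le_mul (K := 1) fun x y => ?_).continuous
    simpa [Real.dist_eq] using hφ x y
  have hφint : IntervalIntegrable (fun t => φ (h t)) volume 0 1 := by
    have h1 : IntervalIntegrable (fun t => |h t - 0| + φ 0) volume 0 1 :=
      (hint.sub intervalIntegrable_const).abs.add intervalIntegrable_const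
    refine h1.mono_fun (hcont.comp_aestronglyMeasurable hint.def'.aestronglyMeasurable)
      (ae_of_all _ fun t => ?_)
    have := (abs_le.mp (hφ (h t) 0)).2
    simp only []
    rw [Real.norm_of_nonneg (h0 _), Real.norm_of_nonneg (add_nonneg (abs_nonneg _) (h0 _))]
    linarith
  have hle : ∫ t in (0 : ℝ)..1, φ (h t) ≤ 0 := by
    by_contra! hpos
    obtain ⟨i, hi, hlt, hpos'⟩ := (hp.and_eventually ((hd.eventually_lt_const hpos).and
      (hn.eventually_gt_atTop 0))).exists
    have := norm_mean_sub_integral_le hpos' (p := p i) hint (S := Set.univ) (φ := φ) (K := 1)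
      (fun x _ y _ => by simpa using hφ x y) (fun _ => trivial) (ae_of_all _ fun _ _ => trivial) hφint
    simp only [hi, Finset.sum_const_zero, smul_zero, zero_sub, norm_neg, one_mul] at this
    exact lt_irrefl _ (lt_of_le_of_lt ((le_abs_self _).trans this) hlt)
  have heq : ∫ t in (0 : ℝ)..1, φ (h t) = 0 :=
    le_antisymm hle (intervalIntegral.integral_nonneg zero_le_one fun t _ => h0 _)
  rw [intervalIntegral.integral_eq_zero_iff_of_le_of_nonneg_ae zero_le_one
    (ae_of_all _ fun t => h0 _) hφint] at heq
  rw [Filter.EventuallyEq, ae_restrict_iff' measurableSet_Ioc] at heq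
  exact heq

theorem ae_le_of_frequently {l : Filter ℕ} {n : ℕ → ℕ} {p : ∀ i, Fin (n i) → ℝ} {h : ℝ → ℝ}
    (hn : Tendsto n l atTop) (hint : IntervalIntegrable h volume 0 1)
    (hd : Tendsto (fun i => stepDist (p i) h) l (𝓝 0)) {c : ℝ}
    (hp : ∃ᶠ i in l, ∀ j, p i j ≤ c) : ∀ᵐ t, t ∈ Set.Ioc (0 : ℝ) 1 → h t ≤ c := by
  have := ae_eq_zero_of_frequently hn hint hd (φ := fun x => max (x - c) 0)
    (fun x => le_max_right _ _) (fun x y => by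
      refine (abs_max_sub_max_le_abs _ _ _).trans_eq ?_
      congr 1; ring) (hp.mono fun i hi j => max_eq_right (by linarith [hi j]))
  filter_upwards [this] with t ht htI
  have := max_eq_right_iff.mp (ht htI)
  linarith

theorem ae_ge_of_frequently {l : Filter ℕ} {n : ℕ → ℕ} {p : ∀ i, Fin (n i) → ℝ} {h : ℝ → ℝ}
    (hn : Tendsto n l atTop) (hint : IntervalIntegrable h volume 0 1)
    (hd : Tendsto (fun i => stepDist (p i) h) l (𝓝 0)) {c : ℝ}
    (hp : ∃ᶠ i in l, ∀ j, c ≤ p i j) : ∀ᵐ t, t ∈ Set.Ioc (0 : ℝ) 1 → c ≤ h t := by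
  have := ae_eq_zero_of_frequently hn hint hd (φ := fun x => max (c - x) 0)
    (fun x => le_max_right _ _) (fun x y => by
      refine (abs_max_sub_max_le_abs _ _ _).trans_eq ?_
      rw [sub_sub_sub_cancel_left, abs_sub_comm])
    (hp.mono fun i hi j => max_eq_right (by linarith [hi j]))
  filter_upwards [this] with t ht htI
  have := max_eq_right_iff.mp (ht htI)
  linarith

theorem not_mem_sigInterval_iff {N : ℕ} {lam : Fin N → ℤ} {w : ℝ} :
    w ∉ sigInterval lam ↔ (∀ i, w < (lam i : ℝ) / N) ∨ ∀ i, (lam i : ℝ) / N + 1 < w := by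
  simp only [sigInterval, Set.mem_ofPred_eq, not_and_or, not_exists, not_le]

theorem pole_lt_of_parts_lt {N : ℕ} {lam : Fin N → ℤ} {w : ℝ}
    (h : ∀ i, (lam i : ℝ) / N + 1 < w) (i : Fin N) : pole lam i < w := by
  have hN : (0 : ℝ) < N := by exact_mod_cast (Nat.zero_le _).trans_lt i.2
  refine lt_of_le_of_lt ?_ (h i)
  unfold pole
  rw [div_add_one hN.ne']
  gcongr
  linarith [(Nat.cast_nonneg (i : ℕ) : (0 : ℝ) ≤ _)]

theorem lt_pole_of_lt_parts {N : ℕ} {lam : Fin N → ℤ} {w : ℝ}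
    (h : ∀ i, w < (lam i : ℝ) / N) (i : Fin N) : w < pole lam i := by
  have hN : (0 : ℝ) < N := by exact_mod_cast (Nat.zero_le _).trans_lt i.2
  refine lt_of_lt_of_le (h i) ?_
  unfold pole
  gcongr
  have : ((i : ℕ) : ℝ) + 1 ≤ N := by exact_mod_cast i.2
  linarith

theorem abs_pole_le {N : ℕ} {lam : Fin N → ℤ} {f : ℝ → ℝ} {B C : ℝ}
    (hB : ∀ t ∈ Set.Icc (0 : ℝ) 1, |f t| ≤ B) (hC : Rinf lam f ≤ C) (i : Fin N) :
    |pole lam i| ≤ B + C + 1 := by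
  have hN : (0 : ℝ) < N := by exact_mod_cast (Nat.zero_le _).trans_lt i.2
  have h1 : |(lam i : ℝ) / N - f (((i : ℕ) + 1 : ℝ) / N)| ≤ C :=
    (le_ciSup (f := fun i : Fin N => |(lam i : ℝ) / N - f (((i : ℕ) + 1 : ℝ) / N)|)
      (Set.finite_range _).bddAbove i).trans hC
  have hi : ((i : ℕ) : ℝ) + 1 ≤ N := by exact_mod_cast i.2
  have h2 := hB (((i : ℕ) + 1 : ℝ) / N) ⟨by positivity, (div_le_one hN).mpr hi⟩
  have h3 : pole lam i = ((lam i : ℝ) / N - f (((i : ℕ) + 1 : ℝ) / N)) +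
      (f (((i : ℕ) + 1 : ℝ) / N) + (1 - ((i : ℕ) + 1 : ℝ) / N)) := by
    unfold pole; field_simp; ring
  have h4 : |1 - ((i : ℕ) + 1 : ℝ) / N| ≤ 1 := by
    have h5 : ((i : ℕ) + 1 : ℝ) / N ≤ 1 := (div_le_one hN).mpr hi
    have h6 : 0 ≤ ((i : ℕ) + 1 : ℝ) / N := by positivity
    rw [abs_of_nonneg (by linarith)]; linarith
  rw [h3]
  have h7 := abs_add_le (f (((i : ℕ) + 1 : ℝ) / N)) (1 - ((i : ℕ) + 1 : ℝ) / N)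
  exact (abs_add_le _ _).trans (by linarith)

theorem isCriticalPoint_ofReal {f : ℝ → ℝ} {y w₀ : ℝ} (h : IsCriticalPoint f y w₀) :
    IntervalIntegrable (fun t => 1 / (w₀ - (f t + 1 - t))) volume 0 1 ∧
      ∫ t in (0 : ℝ)..1, 1 / (w₀ - (f t + 1 - t)) = y := by
  have e : (fun t : ℝ => 1 / ((w₀ : ℂ) - f t - 1 + t)) =
      fun t : ℝ => ((1 / (w₀ - (f t + 1 - t)) : ℝ) : ℂ) := by
    ext t; push_cast; congr 1; ring
  obtain ⟨h1, h2⟩ := h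
  rw [dF] at h2
  rw [e] at h1
  rw [e, intervalIntegral.integral_ofReal] at h2
  refine ⟨?_, by exact_mod_cast h2⟩
  have := h1.def'.re
  simp only [RCLike.re_to_complex, Complex.ofReal_re] at this
  rwa [intervalIntegrable_iff]

end SchurAsymp

namespace SchurAsymp

open MeasureTheory

theorem intervalIntegrable_log_of_inv {g : ℝ → ℝ} {A : ℝ}
    (hg : IntervalIntegrable (fun t => 1 / g t) volume 0 1)
    (hpos : ∀ᵐ t, t ∈ Set.Ioc (0 : ℝ) 1 → 0 < g t)
    (hA : ∀ᵐ t, t ∈ Set.Ioc (0 : ℝ) 1 → g t ≤ A) :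
    IntervalIntegrable (fun t => Real.log (g t)) volume 0 1 := by
  have h1 : IntervalIntegrable (fun t => A + 1 / g t) volume 0 1 := intervalIntegrable_const.add hg
  have hm : AEStronglyMeasurable g (volume.restrict (Set.uIoc (0 : ℝ) 1)) := by
    have := hg.def'.aestronglyMeasurable
    have h2 : g = fun t => (1 / g t)⁻¹ := by ext t; simp
    rw [h2]
    exact (measurable_id.inv.comp_aemeasurable this.aemeasurable).aestronglyMeasurable
  refine h1.mono_fun (Real.measurable_log.comp_aemeasurable hm.aemeasurable).aestronglyMeasurable ?_
  rw [Filter.EventuallyLE, ae_restrict_iff' measurableSet_uIoc, Set.uIoc_of_le zero_le_one]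
  filter_upwards [hpos, hA] with t h0 hA htI
  have h0 := h0 htI
  have hA := hA htI
  have h3 := Real.log_le_sub_one_of_pos h0
  have h4 := Real.one_sub_inv_le_log_of_pos h0
  have h6 : 0 < (g t)⁻¹ := inv_pos.mpr h0
  rw [one_div, Real.norm_eq_abs, Real.norm_of_nonneg (by linarith)]
  exact abs_le.mpr ⟨by linarith, by linarith⟩

theorem F_re_eq_of_lt {f : ℝ → ℝ} {w₀ : ℝ}
    (hh : ∀ᵐ t, t ∈ Set.Ioc (0 : ℝ) 1 → f t + 1 - t < w₀) :
    (F f w₀).re = ∫ t in (0 : ℝ)..1, Real.log (w₀ - (f t + 1 - t)) := by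
  have : F f w₀ = ∫ t in (0 : ℝ)..1, ((Real.log (w₀ - (f t + 1 - t)) : ℝ) : ℂ) := by
    refine intervalIntegral.integral_congr_ae ?_
    filter_upwards [hh] with t ht htI
    rw [Set.uIoc_of_le zero_le_one] at htI
    have := ht htI
    rw [Complex.ofReal_log (by linarith)]
    congr 1; push_cast; ring
  rw [this, intervalIntegral.integral_ofReal, Complex.ofReal_re]

theorem F_re_eq_of_gt {f : ℝ → ℝ} {w₀ : ℝ}
    (hh : ∀ᵐ t, t ∈ Set.Ioc (0 : ℝ) 1 → w₀ < f t + 1 - t)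
    (hint : IntervalIntegrable (fun t => Real.log ((f t + 1 - t) - w₀)) volume 0 1) :
    (F f w₀).re = ∫ t in (0 : ℝ)..1, Real.log ((f t + 1 - t) - w₀) := by
  have : F f w₀ = ∫ t in (0 : ℝ)..1,
      (((Real.log ((f t + 1 - t) - w₀) : ℝ) : ℂ) + Real.pi * Complex.I) := by
    refine intervalIntegral.integral_congr_ae ?_
    filter_upwards [hh] with t ht htI
    rw [Set.uIoc_of_le zero_le_one] at htI
    have := ht htI
    have e : (w₀ - f t - 1 + t : ℂ) = ((-((f t + 1 - t) - w₀) : ℝ) : ℂ) := by push_cast; ring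
    rw [e, ← mul_neg_one, Complex.ofReal_mul, Complex.ofReal_neg, Complex.ofReal_one,
      Complex.log_ofReal_mul (by linarith) (by norm_num), Complex.log_neg_one]
  have hc : IntervalIntegrable (fun t => ((Real.log ((f t + 1 - t) - w₀) : ℝ) : ℂ)) volume 0 1 := by
    rw [intervalIntegrable_iff] at hint ⊢
    exact hint.ofReal
  rw [this, intervalIntegral.integral_add hc intervalIntegrable_const,
    intervalIntegral.integral_ofReal]
  simp

/-- From the asymptotics of the divided difference to those of the Schur function. -/
theorem tendsto_log_normSchur {ν : ℕ → ℕ} (hν : Tendsto ν atTop atTop)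
    {S : ℕ → ℝ} {DD : ℕ → ℝ} {x L : ℝ} (hx : x ≠ 0)
    (hDD : ∀ᶠ k in atTop, 0 < DD k)
    (hS : ∀ᶠ k in atTop, S k = factorialRatio (ν k) / |x| ^ (ν k - 1) * DD k)
    (hlim : Tendsto (fun k => (ν k : ℝ)⁻¹ * Real.log (DD k)) atTop (𝓝 L)) :
    (∀ᶠ k in atTop, 0 < S k) ∧
      Tendsto (fun k => Real.log (S k) / ν k) atTop (𝓝 (L - 1 - Real.log |x|)) := by
  have hx0 : 0 < |x| := abs_pos.mpr hx
  constructor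
  · filter_upwards [hDD, hS, hν.eventually_gt_atTop 0] with k h1 h2 h3
    have := factorialRatio_pos h3
    rw [h2]; positivity
  · have h1 := (tendsto_log_factorialRatio.comp hν).add hlim
    have h2 := ((tendsto_inv_nat_mul_const hν (Real.log |x|)).sub_const (Real.log |x|)).add h1
    rw [zero_sub] at h2
    refine (h2.congr' ?_).trans_eq (by congr 1; ring)
    filter_upwards [hDD, hS, hν.eventually_gt_atTop 0] with k h1 h2 h3
    have h4 := factorialRatio_pos h3
    have h5 : (0 : ℝ) < ν k := by exact_mod_cast h3
    rw [h2, Real.log_mul (by positivity) (by positivity), Real.log_div (by positivity)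
      (by positivity), Real.log_pow, Nat.cast_sub h3]
    simp only [Function.comp_apply]
    field_simp
    push_cast; ring

theorem log_asymptotics_real {ν : ℕ → ℕ} (hν : StrictMono ν) {lam : ∀ k, Fin (ν k) → ℤ}
    (hlam : ∀ k, Antitone (lam k)) {f : ℝ → ℝ} (hf : PiecewiseContinuous f)
    (hRinf : BddAbove (Set.range fun k => Rinf (lam k) f))
    (hR : Tendsto (fun k => R1 (lam k) f / (ν k : ℝ)) atTop (𝓝 0)) {y w₀ : ℝ} (hy : y ≠ 0)
    (hcrit : IsCriticalPoint f y w₀) (hadm : ∀ᶠ k in atTop, w₀ ∉ sigInterval (lam k)) :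
    (∀ᶠ k in atTop, 0 < normSchur (lam k) (Real.exp y)) ∧
      Tendsto (fun k => Real.log (normSchur (lam k) (Real.exp y)) / (ν k : ℝ)) atTop
        (𝓝 (y * w₀ - (F f w₀).re - 1 - Real.log |Real.exp y - 1|)) := by
  have hνt : Tendsto ν atTop atTop := hν.tendsto_atTop
  obtain ⟨C, hC⟩ := hRinf
  obtain ⟨B, hB⟩ := hf.exists_bound
  obtain ⟨hI, hIy⟩ := isCriticalPoint_ofReal hcrit
  have hfint := hf.intervalIntegrable
  have hhint : IntervalIntegrable (fun t : ℝ => f t + 1 - t) volume 0 1 :=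
    (hfint.add intervalIntegrable_const).sub (continuous_id.intervalIntegrable _ _)
  have hd1 := tendsto_stepDist_parts hf hνt hR
  have hd2 := tendsto_stepDist_pole hf hνt hR
  have hC' : ∀ k, Rinf (lam k) f ≤ |C| := fun k => (hC ⟨k, rfl⟩).trans (le_abs_self C)
  have hpB : ∀ k j, |pole (lam k) j| ≤ B + |C| + 1 := fun k j => abs_pole_le hB (hC' k) j
  have hhB : ∀ t ∈ Set.Ioc (0 : ℝ) 1, |f t + 1 - t| ≤ B + |C| + 1 := by
    intro t ht
    have h1 := hB t ⟨ht.1.le, ht.2⟩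
    have h2 : |1 - t| ≤ 1 := by rw [abs_of_nonneg (by linarith [ht.2])]; linarith [ht.1]
    have h3 := abs_add_le (f t) (1 - t)
    rw [add_sub_assoc]
    linarith [abs_nonneg C]
  have hx : Real.exp y - 1 ≠ 0 := sub_ne_zero.mpr fun h => hy ((Real.exp_eq_one_iff y).mp h)
  have hright : (∃ᶠ k in atTop, ∀ i, (lam k i : ℝ) / ν k + 1 < w₀) →
      ∀ᵐ t, t ∈ Set.Ioc (0 : ℝ) 1 → f t + 1 - t < w₀ := by
    intro hfr
    have := ae_le_of_frequently hνt hfint hd1 (c := w₀ - 1)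
      (hfr.mono fun k hk j => by linarith [hk j])
    filter_upwards [this] with t ht htI
    linarith [ht htI, htI.1]
  have hleft : (∃ᶠ k in atTop, ∀ i, w₀ < (lam k i : ℝ) / ν k) →
      ∀ᵐ t, t ∈ Set.Ioc (0 : ℝ) 1 → w₀ < f t + 1 - t := by
    intro hfr
    have := ae_ge_of_frequently hνt hfint hd1 (c := w₀) (hfr.mono fun k hk j => (hk j).le)
    filter_upwards [this, (Set.countable_singleton (1 : ℝ)).ae_notMem volume] with t ht ht1 htI
    have h2 : t < 1 := lt_of_le_of_ne htI.2 ht1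
    linarith [ht htI]
  have hrpos : (∀ᵐ t, t ∈ Set.Ioc (0 : ℝ) 1 → f t + 1 - t < w₀) → 0 < y := fun h =>
    hIy ▸ intervalIntegral_pos_of_ae_pos hI
      (h.mono fun t ht htI => one_div_pos.mpr (sub_pos.mpr (ht htI)))
  have hI' : IntervalIntegrable (fun t => 1 / (-w₀ - -(f t + 1 - t))) volume 0 1 := by
    refine hI.neg.congr fun t _ => ?_
    rw [Pi.neg_apply, ← div_neg]
    congr 1; ring
  have hIy' : ∫ t in (0 : ℝ)..1, 1 / (-w₀ - -(f t + 1 - t)) = -y := by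
    rw [← hIy, ← intervalIntegral.integral_neg]
    congr 1; ext t
    rw [← div_neg]; congr 1; ring
  have hlneg : (∀ᵐ t, t ∈ Set.Ioc (0 : ℝ) 1 → w₀ < f t + 1 - t) → y < 0 := fun h => by
    have := intervalIntegral_pos_of_ae_pos hI'
      (h.mono fun t ht htI => one_div_pos.mpr (by linarith [ht htI]))
    rw [hIy'] at this
    linarith
  rcases hy.lt_or_gt with hneg | hpos
  · have hev : ∀ᶠ k in atTop, ∀ i, w₀ < (lam k i : ℝ) / ν k := by
      have : ∀ᶠ k in atTop, ¬ ∀ i, (lam k i : ℝ) / ν k + 1 < w₀ := by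
        rw [← not_frequently]
        exact fun h => absurd (hrpos (hright h)) (not_lt.mpr hneg.le)
      filter_upwards [hadm, this] with k h1 h2
      exact (not_mem_sigInterval_iff.mp h1).resolve_right h2
    have hae := hleft hev.frequently
    have hFre := F_re_eq_of_gt hae (intervalIntegrable_log_of_inv (A := B + |C| + 1 + |w₀|)
      (by simpa [sub_eq_add_neg, add_comm] using hI')
      (hae.mono fun t ht htI => sub_pos.mpr (ht htI))
      (ae_of_all _ fun t ht => by
        have := le_abs_self (f t + 1 - t)
        have := hhB t ht
        have := neg_abs_le w₀
        linarith))
    have h := tendsto_log_ddExp (n := ν) (p := fun k j => -pole (lam k) j)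
      (h := fun t => -(f t + 1 - t)) (w₀ := -w₀) (B := B + |C| + 1) hνt
      (Eventually.of_forall fun k => neg_injective.comp (pole_strictAnti (hlam k)).injective)
      (Eventually.of_forall fun k j => by rw [abs_neg]; exact hpB k j)
      (ae_of_all _ fun t ht => by rw [abs_neg]; exact hhB t ht) ?_
      (hev.mono fun k hk j => neg_lt_neg (lt_pole_of_lt_parts hk j))
      (hae.mono fun t ht htI => neg_lt_neg (ht htI)) hI'
    · rw [hIy'] at h
      have e1 : (fun t : ℝ => Real.log (-w₀ - -(f t + 1 - t))) =
          fun t : ℝ => Real.log ((f t + 1 - t) - w₀) := by ext t; congr 1; ring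
      rw [e1, ← hFre, neg_mul_neg] at h
      refine tendsto_log_normSchur hνt hx ?_ ?_ h
      · filter_upwards [hνt.eventually_gt_atTop 0] with k hk
        have hk' : (0 : ℝ) < ν k := by exact_mod_cast hk
        exact ddExp_pos ⟨⟨0, hk⟩, by simp⟩
          (neg_injective.comp (pole_strictAnti (hlam k)).injective).injOn _
          (mul_pos hk' (by linarith))
      · filter_upwards [hνt.eventually_gt_atTop 0] with k hk
        rw [normSchur_exp_real hk (hlam k) hy, mul_neg, ddExp_neg, Finset.card_univ,
          Fintype.card_fin, abs_of_neg (by linarith [Real.exp_lt_exp.mpr hneg, Real.exp_zero])]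
        rw [show Real.exp y - 1 = -1 * -(Real.exp y - 1) by ring, mul_pow]
        have hs : ((-1 : ℝ)) ^ (ν k - 1) * (-1) ^ (ν k - 1) = 1 := by rw [← mul_pow]; simp
        have hs2 : ((-1 : ℝ)) ^ (ν k - 1) ≠ 0 := pow_ne_zero _ (by norm_num)
        have hz : (-(Real.exp y - 1)) ^ (ν k - 1) ≠ 0 := pow_ne_zero _ (neg_ne_zero.mpr hx)
        rw [show -(-1 * -(Real.exp y - 1)) = -(Real.exp y - 1) by ring]
        field_simp
        linear_combination (-factorialRatio (ν k) * ddExp Finset.univ (pole (lam k)) (ν k * y)) * hs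
    · refine hd2.congr' ?_
      filter_upwards [hνt.eventually_gt_atTop 0] with k hk
      rw [stepDist, stepDist]
      refine intervalIntegral.integral_congr_ae (ae_of_all _ fun t ht => ?_)
      rw [Set.uIoc_of_le zero_le_one] at ht
      rw [stepFn_comp hk (pole (lam k)) (fun x => -x) ht, ← neg_sub', abs_neg]
  · have hev : ∀ᶠ k in atTop, ∀ i, (lam k i : ℝ) / ν k + 1 < w₀ := by
      have : ∀ᶠ k in atTop, ¬ ∀ i, w₀ < (lam k i : ℝ) / ν k := by
        rw [← not_frequently]
        exact fun h => absurd (hlneg (hleft h)) (not_lt.mpr hpos.le)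
      filter_upwards [hadm, this] with k h1 h2
      exact (not_mem_sigInterval_iff.mp h1).resolve_left h2
    have hae := hright hev.frequently
    have h := tendsto_log_ddExp (n := ν) (p := fun k => pole (lam k))
      (h := fun t => f t + 1 - t) (w₀ := w₀) (B := B + |C| + 1) hνt
      (Eventually.of_forall fun k => (pole_strictAnti (hlam k)).injective)
      (Eventually.of_forall fun k j => hpB k j)
      (ae_of_all _ fun t ht => hhB t ht) hd2
      (hev.mono fun k hk j => pole_lt_of_parts_lt hk j) hae hI
    rw [hIy, ← F_re_eq_of_lt hae] at h
    refine tendsto_log_normSchur hνt hx ?_ ?_ h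
    · filter_upwards [hνt.eventually_gt_atTop 0] with k hk
      have hk' : (0 : ℝ) < ν k := by exact_mod_cast hk
      exact ddExp_pos ⟨⟨0, hk⟩, by simp⟩ (pole_strictAnti (hlam k)).injective.injOn _
        (mul_pos hk' hpos)
    · filter_upwards [hνt.eventually_gt_atTop 0] with k hk
      rw [normSchur_exp_real hk (hlam k) hy, abs_of_pos (by linarith [Real.one_lt_exp_iff.mpr hpos])]

end SchurAsymp

namespace SchurAsymp

open MeasureTheory

theorem not_intervalIntegrable_of_zero_left {G : ℝ → ℂ} {K : ℝ}
    (hG : ∀ s ∈ Set.Icc (0 : ℝ) 1, ∀ t ∈ Set.Icc (0 : ℝ) 1, ‖G s - G t‖ ≤ K * |s - t|)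
    {t₀ t₁ : ℝ} (h0 : 0 ≤ t₀) (h01 : t₀ < t₁) (h1 : t₁ ≤ 1) (hz : G t₀ = 0) (hnz : G t₁ ≠ 0) :
    ¬ IntervalIntegrable (fun t => 1 / G t) volume 0 1 := by
  intro hint
  have hcont : ContinuousOn G (Set.Icc 0 1) := by
    refine LipschitzOnWith.continuousOn (K := K.toNNReal) (LipschitzOnWith.of_dist_le_mul
      fun s hs t ht => ?_)
    rw [dist_eq_norm, Real.dist_eq]
    exact (hG s hs t ht).trans (mul_le_mul_of_nonneg_right (Real.le_coe_toNNReal K) (abs_nonneg _))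
  set Z := Set.Icc t₀ t₁ ∩ G ⁻¹' {0} with hZ
  have hZc : IsClosed Z := (hcont.mono (Set.Icc_subset_Icc h0 h1)).preimage_isClosed_of_isClosed
    isClosed_Icc isClosed_singleton
  have hZne : Z.Nonempty := ⟨t₀, ⟨le_rfl, h01.le⟩, hz⟩
  have hZb : BddAbove Z := ⟨t₁, fun x hx => hx.1.2⟩
  have hs := hZc.csSup_mem hZne hZb
  set s := sSup Z with hsdef
  have hsz : G s = 0 := hs.2
  have hst : s < t₁ := lt_of_le_of_ne hs.1.2 fun h => hnz (h ▸ hsz)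
  have hs0 : 0 ≤ s := h0.trans hs.1.1
  have hsub : IntervalIntegrable (fun t => (t - s)⁻¹) volume s t₁ := by
    have h2 : IntervalIntegrable (fun t => K * ‖1 / G t‖) volume s t₁ :=
      (hint.mono_set (by
        rw [Set.uIcc_of_le hst.le, Set.uIcc_of_le zero_le_one]
        exact Set.Icc_subset_Icc hs0 h1)).norm.const_mul K
    refine h2.mono_fun (by fun_prop) ?_
    rw [Filter.EventuallyLE, ae_restrict_iff' measurableSet_uIoc, Set.uIoc_of_le hst.le]
    refine ae_of_all _ fun t ht => ?_
    have htG : G t ≠ 0 := fun h => by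
      have : t ≤ s := le_csSup hZb ⟨⟨hs.1.1.trans ht.1.le, ht.2⟩, h⟩
      linarith [ht.1]
    have hle := hG t ⟨hs0.trans ht.1.le, ht.2.trans h1⟩ s ⟨hs0, hst.le.trans h1⟩
    have htpos : 0 < t - s := sub_pos.mpr ht.1
    rw [hsz, sub_zero, abs_of_pos htpos] at hle
    have hGpos : 0 < ‖G t‖ := norm_pos_iff.mpr htG
    have hK : 0 ≤ K := by
      by_contra hK
      have := mul_neg_of_neg_of_pos (not_le.mp hK) htpos
      linarith
    rw [Real.norm_of_nonneg (by positivity), Real.norm_of_nonneg (by positivity), norm_div,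
      norm_one, inv_eq_one_div, mul_one_div, div_le_div_iff₀ htpos hGpos]
    linarith
  rw [intervalIntegrable_sub_inv_iff] at hsub
  rcases hsub with h | h
  · exact hst.ne h
  · exact h Set.left_mem_uIcc

/-- A Lipschitz function with integrable reciprocal has no isolated zero. -/
theorem eq_zero_of_intervalIntegrable_inv {G : ℝ → ℂ} {K : ℝ}
    (hG : ∀ s ∈ Set.Icc (0 : ℝ) 1, ∀ t ∈ Set.Icc (0 : ℝ) 1, ‖G s - G t‖ ≤ K * |s - t|)
    (hint : IntervalIntegrable (fun t => 1 / G t) volume 0 1) {t₀ : ℝ}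
    (ht₀ : t₀ ∈ Set.Icc (0 : ℝ) 1) (hz : G t₀ = 0) {t₁ : ℝ} (ht₁ : t₁ ∈ Set.Icc (0 : ℝ) 1) :
    G t₁ = 0 := by
  by_contra hnz
  rcases lt_trichotomy t₀ t₁ with h | h | h
  · exact not_intervalIntegrable_of_zero_left hG ht₀.1 h ht₁.2 hz hnz hint
  · exact hnz (h ▸ hz)
  · have hflip := hint.comp_sub_left 1
    refine not_intervalIntegrable_of_zero_left (G := fun t => G (1 - t)) (K := K)
      (fun s hs t ht => ?_) (t₀ := 1 - t₀) (t₁ := 1 - t₁) (by linarith [ht₀.2]) (by linarith)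
      (by linarith [ht₁.1]) (by simpa using hz) (by simpa using hnz) ?_
    · refine (hG (1 - s) ⟨by linarith [hs.2], by linarith [hs.1]⟩ (1 - t)
        ⟨by linarith [ht.2], by linarith [ht.1]⟩).trans_eq ?_
      rw [sub_sub_sub_cancel_left, abs_sub_comm]
    · simpa using hflip.symm

section Trapezoid

theorem norm_trapezoid_le {n : ℕ} (hn : 0 < n) {φ φ' : ℝ → ℂ} {ω : ℝ}
    (hφ : ∀ t ∈ Set.Icc (0 : ℝ) 1, HasDerivWithinAt φ (φ' t) (Set.Icc 0 1) t)
    (hω : ∀ s ∈ Set.Icc (0 : ℝ) 1, ∀ t ∈ Set.Icc (0 : ℝ) 1, |s - t| ≤ 1 / n →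
      ‖φ' s - φ' t‖ ≤ ω) :
    ‖∑ j : Fin n, φ (((j : ℕ) + 1 : ℝ) / n) - n * (∫ t in (0 : ℝ)..1, φ t) -
      (φ 1 - φ 0) / 2‖ ≤ 2 * ω := by
  have hn' : (0 : ℝ) < n := by exact_mod_cast hn
  have hcont : ContinuousOn φ (Set.Icc 0 1) := fun t ht => (hφ t ht).continuousWithinAt
  have hω0 : 0 ≤ ω := by
    have := hω 0 ⟨le_rfl, zero_le_one⟩ 0 ⟨le_rfl, zero_le_one⟩ (by simp)
    simpa using this
  set a : ℕ → ℝ := fun k => k / n with ha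
  have ha0 : a 0 = 0 := by simp [ha]
  have han : a n = 1 := by simp [ha, hn'.ne']
  have hle : ∀ k, a k ≤ a (k + 1) := fun k => by simp only [ha]; gcongr; simp
  have hstep : ∀ k, a (k + 1) - a k = 1 / n := fun k => by
    simp only [ha]; push_cast; ring
  have hIcc : ∀ k < n, Set.Icc (a k) (a (k + 1)) ⊆ Set.Icc 0 1 := by
    intro k hk
    refine Set.Icc_subset_Icc (by positivity) ?_
    simp only [ha]
    rw [div_le_one hn']
    exact_mod_cast hk
  have hint : ∀ k < n, IntervalIntegrable φ volume (a k) (a (k + 1)) := fun k hk =>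
    ContinuousOn.intervalIntegrable (by
      rw [Set.uIcc_of_le (hle k)]; exact hcont.mono (hIcc k hk))
  have hsum := intervalIntegral.sum_integral_adjacent_intervals hint
  rw [ha0, han] at hsum
  have htel := Finset.sum_range_sub (fun k => φ (a k)) n
  rw [ha0, han] at htel
  rw [← hsum, ← htel, Fin.sum_univ_eq_sum_range (fun k => φ (((k : ℝ) + 1) / n)) n,
    Finset.mul_sum, ← Finset.sum_sub_distrib, Finset.sum_div, ← Finset.sum_sub_distrib]
  have hpiece : ∀ k ∈ Finset.range n, ‖φ (((k : ℝ) + 1) / n) -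
      n * (∫ t in a k..a (k + 1), φ t) - (φ (a (k + 1)) - φ (a k)) / 2‖ ≤ 2 * ω / n := by
    intro k hk
    rw [Finset.mem_range] at hk
    have hsub := hIcc k hk
    have e0 : ((k : ℝ) + 1) / n = a (k + 1) := by simp [ha]
    rw [e0]
    have hak : a k ∈ Set.Icc (a k) (a (k + 1)) := ⟨le_rfl, hle k⟩
    have hak1 : a (k + 1) ∈ Set.Icc (a k) (a (k + 1)) := ⟨hle k, le_rfl⟩
    set e : ℝ → ℂ := fun t => φ t - φ (a k) - (t - a k : ℝ) * φ' (a k) with he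
    have hebound : ∀ t ∈ Set.Icc (a k) (a (k + 1)), ‖e t‖ ≤ ω / n := by
      intro t ht
      have hder : ∀ x ∈ Set.Icc (a k) (a (k + 1)), HasDerivWithinAt
          (fun t => φ t - (t - a k : ℝ) * φ' (a k)) (φ' x - φ' (a k)) (Set.Icc (a k) (a (k + 1))) x := by
        intro x hx
        have h1 := (hφ x (hsub hx)).mono hsub
        have h2 : HasDerivWithinAt (fun t : ℝ => ((t - a k : ℝ) : ℂ) * φ' (a k)) (1 * φ' (a k))
            (Set.Icc (a k) (a (k + 1))) x := by
          have h3 := (((hasDerivAt_id x).sub_const (a k)).ofReal_comp.mul_const (φ' (a k)))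
          simpa using h3.hasDerivWithinAt
        simpa using h1.fun_sub h2
      have hb : ∀ x ∈ Set.Icc (a k) (a (k + 1)), ‖φ' x - φ' (a k)‖ ≤ ω := by
        intro x hx
        refine hω x (hsub hx) _ (hsub hak) ?_
        rw [abs_of_nonneg (by linarith [hx.1]), ← hstep k]
        linarith [hx.2]
      have := (convex_Icc (a k) (a (k + 1))).norm_image_sub_le_of_norm_hasDerivWithin_le hder hb hak ht
      simp only [sub_self, Complex.ofReal_zero, zero_mul, sub_zero] at this
      have h4 : ‖t - a k‖ ≤ 1 / n := by
        rw [Real.norm_of_nonneg (by linarith [ht.1]), ← hstep k]; linarith [ht.2]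
      rw [he]
      simp only []
      rw [sub_right_comm]
      exact this.trans ((mul_le_mul_of_nonneg_left h4 hω0).trans_eq (by ring))
    have hie : IntervalIntegrable e volume (a k) (a (k + 1)) := by
      refine ((hint k hk).sub intervalIntegrable_const).sub (Continuous.intervalIntegrable ?_ _ _)
      fun_prop
    have hlin : ∫ t in a k..a (k + 1), ((t - a k : ℝ) : ℂ) * φ' (a k) =
        (1 / (2 * n ^ 2) : ℝ) * φ' (a k) := by
      rw [intervalIntegral.integral_mul_const, intervalIntegral.integral_ofReal]
      congr 2
      rw [intervalIntegral.integral_comp_sub_right (fun t => t), integral_id, hstep]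
      simp; ring
    have hI : ∫ t in a k..a (k + 1), φ t =
        (1 / n : ℝ) * φ (a k) + (1 / (2 * n ^ 2) : ℝ) * φ' (a k) + ∫ t in a k..a (k + 1), e t := by
      have h1 : ∀ t, φ t = φ (a k) + ((t - a k : ℝ) : ℂ) * φ' (a k) + e t := fun t => by
        rw [he]; ring
      rw [intervalIntegral.integral_congr fun t _ => h1 t, intervalIntegral.integral_add
        (intervalIntegrable_const.add (Continuous.intervalIntegrable (by fun_prop) _ _)) hie,
        intervalIntegral.integral_add intervalIntegrable_const
        (Continuous.intervalIntegrable (by fun_prop) _ _), hlin, intervalIntegral.integral_const,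
        hstep, Complex.real_smul]
    have hb : φ (a (k + 1)) = φ (a k) + (1 / n : ℝ) * φ' (a k) + e (a (k + 1)) := by
      rw [he]; simp only []; rw [hstep]; ring
    have hnc : (n : ℂ) ≠ 0 := by exact_mod_cast hn'.ne'
    have hfin : φ (a (k + 1)) - n * (∫ t in a k..a (k + 1), φ t) -
        (φ (a (k + 1)) - φ (a k)) / 2 = e (a (k + 1)) / 2 - n * ∫ t in a k..a (k + 1), e t := by
      rw [hI, hb]
      push_cast
      field_simp
      ring
    rw [hfin]
    have hie2 : ‖∫ t in a k..a (k + 1), e t‖ ≤ ω / n * |a (k + 1) - a k| := by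
      refine intervalIntegral.norm_integral_le_of_norm_le_const fun t ht => hebound t ?_
      rw [Set.uIoc_of_le (hle k)] at ht
      exact ⟨ht.1.le, ht.2⟩
    rw [hstep, abs_of_pos (by positivity)] at hie2
    refine (norm_sub_le _ _).trans ?_
    rw [norm_div, norm_mul, Complex.norm_natCast, Complex.norm_ofNat]
    have h5 := hebound _ hak1
    have h6 : (n : ℝ) * ‖∫ t in a k..a (k + 1), e t‖ ≤ ω / n := by
      refine (mul_le_mul_of_nonneg_left hie2 hn'.le).trans_eq ?_
      field_simp
    have h7 : 2 * ω / n = ω / n + ω / n := by ring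
    have h8 : 0 ≤ ω / n := by positivity
    linarith
  refine (norm_sum_le _ _).trans ((Finset.sum_le_sum hpiece).trans_eq ?_)
  rw [Finset.sum_const, Finset.card_range, nsmul_eq_mul]
  field_simp

theorem norm_riemann_sum_sub_integral_le {n : ℕ} (hn : 0 < n) {φ : ℝ → ℂ} {K : ℝ}
    (hφ : ∀ s ∈ Set.Icc (0 : ℝ) 1, ∀ t ∈ Set.Icc (0 : ℝ) 1, ‖φ s - φ t‖ ≤ K * |s - t|) (hK : 0 ≤ K) :
    ‖(∑ j : Fin n, φ (((j : ℕ) + 1 : ℝ) / n)) / n - ∫ t in (0 : ℝ)..1, φ t‖ ≤ K / n := by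
  have hn' : (0 : ℝ) < n := by exact_mod_cast hn
  have hcont : ContinuousOn φ (Set.Icc 0 1) := by
    refine LipschitzOnWith.continuousOn (K := K.toNNReal) (LipschitzOnWith.of_dist_le_mul
      fun s hs t ht => ?_)
    rw [dist_eq_norm, Real.dist_eq]
    exact (hφ s hs t ht).trans (mul_le_mul_of_nonneg_right (Real.le_coe_toNNReal K) (abs_nonneg _))
  have hmem : ∀ j : Fin n, ((j : ℕ) + 1 : ℝ) / n ∈ Set.Icc (0 : ℝ) 1 := fun j =>
    ⟨by positivity, (div_le_one hn').mpr (by exact_mod_cast j.2)⟩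
  have h := norm_mean_sub_integral_le hn (p := fun j : Fin n => ((j : ℕ) + 1 : ℝ) / n)
    (h := fun t => t) (continuous_id.intervalIntegrable _ _) (S := Set.Icc 0 1) hφ hmem
    (ae_of_all _ fun t ht => ⟨ht.1.le, ht.2⟩)
    (hcont.intervalIntegrable_of_Icc zero_le_one)
  have hdist : stepDist (fun j : Fin n => ((j : ℕ) + 1 : ℝ) / n) (fun t => t) ≤ 1 / n := by
    have e : (1 / n : ℝ) = ∫ _t in (0 : ℝ)..1, (1 / n : ℝ) := by simp
    rw [e, stepDist]
    refine intervalIntegral.integral_mono_on_of_le_Ioo zero_le_one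
      ((intervalIntegrable_stepFn hn _).sub (continuous_id.intervalIntegrable _ _)).abs
      intervalIntegrable_const fun t ht => ?_
    obtain ⟨i, hi⟩ := exists_cell hn ⟨ht.1, ht.2.le⟩
    rw [stepFn_eq _ i hi, abs_of_nonneg (by linarith [hi.2])]
    have := hi.1
    rw [add_div]
    linarith
  have h2 := h.trans (mul_le_mul_of_nonneg_left hdist hK)
  rw [mul_one_div] at h2
  refine le_trans (le_of_eq ?_) h2
  congr 2
  rw [Complex.real_smul, div_eq_inv_mul]
  push_cast
  rfl

end Trapezoid

end SchurAsymp

namespace SchurAsymp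

open MeasureTheory

/-- The limiting density of the poles, `h(t) = f(t) + 1 - t`. -/
def limitPole (f : ℝ → ℝ) (t : ℝ) : ℝ := f t + 1 - t

theorem TwiceDifferentiable.hasDerivWithinAt {f : ℝ → ℝ} (hf : TwiceDifferentiable f) {t : ℝ}
    (ht : t ∈ Set.Icc (0 : ℝ) 1) : HasDerivWithinAt (limitPole f)
      (derivWithin f (Set.Icc 0 1) t - 1) (Set.Icc 0 1) t :=
  ((hf.1 t ht).hasDerivWithinAt.add_const 1).sub (hasDerivWithinAt_id t _)

theorem TwiceDifferentiable.continuousOn_deriv {f : ℝ → ℝ} (hf : TwiceDifferentiable f) :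
    ContinuousOn (fun t => derivWithin f (Set.Icc 0 1) t - 1) (Set.Icc 0 1) :=
  hf.2.continuousOn.sub continuousOn_const

theorem TwiceDifferentiable.continuousOn {f : ℝ → ℝ} (hf : TwiceDifferentiable f) :
    ContinuousOn (limitPole f) (Set.Icc 0 1) := fun _ ht =>
  (hf.hasDerivWithinAt ht).continuousWithinAt

theorem TwiceDifferentiable.exists_deriv_bound {f : ℝ → ℝ} (hf : TwiceDifferentiable f) :
    ∃ K : ℝ, 0 ≤ K ∧ ∀ t ∈ Set.Icc (0 : ℝ) 1, |derivWithin f (Set.Icc 0 1) t - 1| ≤ K := by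
  obtain ⟨K, hK⟩ := isCompact_Icc.exists_bound_of_continuousOn hf.continuousOn_deriv
  exact ⟨K, (norm_nonneg _).trans (hK 0 ⟨le_rfl, zero_le_one⟩), hK⟩

theorem TwiceDifferentiable.lipschitz {f : ℝ → ℝ} (hf : TwiceDifferentiable f) :
    ∃ K : ℝ, 0 ≤ K ∧ ∀ s ∈ Set.Icc (0 : ℝ) 1, ∀ t ∈ Set.Icc (0 : ℝ) 1,
      |limitPole f s - limitPole f t| ≤ K * |s - t| := by
  obtain ⟨K, hK0, hK⟩ := hf.exists_deriv_bound
  refine ⟨K, hK0, fun s hs t ht => ?_⟩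
  exact (convex_Icc (0 : ℝ) 1).norm_image_sub_le_of_norm_hasDerivWithin_le
    (fun x hx => hf.hasDerivWithinAt hx) hK ht hs

theorem TwiceDifferentiable.intervalIntegrable {f : ℝ → ℝ} (hf : TwiceDifferentiable f) :
    IntervalIntegrable f volume 0 1 :=
  hf.1.continuousOn.intervalIntegrable_of_Icc zero_le_one

theorem TwiceDifferentiable.exists_dist_le {f : ℝ → ℝ} (hf : TwiceDifferentiable f) {w : ℂ}
    (hw : ∀ t ∈ Set.Icc (0 : ℝ) 1, w ≠ limitPole f t) :
    ∃ ρ > 0, ∀ t ∈ Set.Icc (0 : ℝ) 1, ρ ≤ ‖w - limitPole f t‖ := by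
  have hc : ContinuousOn (fun t => ‖w - limitPole f t‖) (Set.Icc (0 : ℝ) 1) :=
    (continuousOn_const.sub (Complex.continuous_ofReal.comp_continuousOn hf.continuousOn)).norm
  obtain ⟨t, ht, hmin⟩ := isCompact_Icc.exists_isMinOn ⟨0, by simp⟩ hc
  exact ⟨_, norm_pos_iff.mpr (sub_ne_zero.mpr (hw t ht)), fun s hs => hmin hs⟩

theorem TwiceDifferentiable.ne_limitPole {f : ℝ → ℝ} (hf : TwiceDifferentiable f) {y w : ℂ}
    (hcrit : IsCriticalPoint f y w) {t₁ : ℝ} (ht₁ : t₁ ∈ Set.Icc (0 : ℝ) 1)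
    (hne : w ≠ limitPole f t₁) {t : ℝ} (ht : t ∈ Set.Icc (0 : ℝ) 1) : w ≠ limitPole f t := by
  intro h
  obtain ⟨K, hK0, hK⟩ := hf.lipschitz
  refine hne (sub_eq_zero.mp (eq_zero_of_intervalIntegrable_inv
    (G := fun t => w - limitPole f t) (K := K) (fun s hs t ht => ?_) ?_ ht (sub_eq_zero.mpr h) ht₁))
  · rw [sub_sub_sub_cancel_left, ← Complex.ofReal_sub, Complex.norm_real, Real.norm_eq_abs,
      abs_sub_comm s t]
    exact hK t ht s hs
  · convert hcrit.1 using 2 with t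
    rw [limitPole]; push_cast; ring

theorem TwiceDifferentiable.lt_or_gt {f : ℝ → ℝ} (hf : TwiceDifferentiable f) {w : ℝ}
    (hw : ∀ t ∈ Set.Icc (0 : ℝ) 1, w ≠ limitPole f t) :
    (∀ t ∈ Set.Icc (0 : ℝ) 1, limitPole f t < w) ∨ ∀ t ∈ Set.Icc (0 : ℝ) 1, w < limitPole f t := by
  by_contra! hcon
  obtain ⟨⟨s, hs, hsw⟩, t, ht, htw⟩ := hcon
  have hconn := isPreconnected_Icc.image _ hf.continuousOn
  obtain ⟨x, hx, hxw⟩ := hconn.ordConnected.out ⟨t, ht, rfl⟩ ⟨s, hs, rfl⟩ ⟨htw, hsw⟩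
  exact hw x hx hxw.symm

theorem tendsto_trapezoid_log {α : Type*} {l : Filter α} {n : α → ℕ} (hn : Tendsto n l atTop)
    {f : ℝ → ℝ} (hf : TwiceDifferentiable f) {w : α → ℂ} {w₀ : ℂ} (hw : Tendsto w l (𝓝 w₀)) {s : ℂ}
    (hs : s ≠ 0) {ρ : ℝ} (hρ : 0 < ρ)
    (hdist : ∀ᶠ i in l, ∀ t ∈ Set.Icc (0 : ℝ) 1, ρ ≤ ‖w i - limitPole f t‖)
    (hslit : ∀ᶠ i in l, ∀ t ∈ Set.Icc (0 : ℝ) 1, s * (w i - limitPole f t) ∈ Complex.slitPlane)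
    (hslit0 : ∀ t ∈ Set.Icc (0 : ℝ) 1, s * (w₀ - limitPole f t) ∈ Complex.slitPlane) :
    Tendsto (fun i => ∑ j : Fin (n i),
        Complex.log (s * (w i - limitPole f (((j : ℕ) + 1 : ℝ) / n i))) -
      n i * ∫ t in (0 : ℝ)..1, Complex.log (s * (w i - limitPole f t))) l
      (𝓝 ((Complex.log (s * (w₀ - limitPole f 1)) - Complex.log (s * (w₀ - limitPole f 0))) / 2)) := by
  obtain ⟨B, hB0, hB⟩ := hf.exists_deriv_bound
  obtain ⟨K, hK0, hK⟩ := hf.lipschitz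
  set h' := fun t => derivWithin f (Set.Icc 0 1) t - 1 with hh'
  have huc := isCompact_Icc.uniformContinuousOn_of_continuous hf.continuousOn_deriv
  rw [Metric.uniformContinuousOn_iff] at huc
  have hbd : ∀ t ∈ Set.Icc (0 : ℝ) 1, Tendsto (fun i => Complex.log (s * (w i - limitPole f t))) l
      (𝓝 (Complex.log (s * (w₀ - limitPole f t)))) := fun t ht =>
    (continuousAt_clog (hslit0 t ht)).tendsto.comp ((hw.sub_const _).const_mul s)
  have hkey : Tendsto (fun i => ∑ j : Fin (n i),
        Complex.log (s * (w i - limitPole f (((j : ℕ) + 1 : ℝ) / n i))) -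
      n i * (∫ t in (0 : ℝ)..1, Complex.log (s * (w i - limitPole f t))) -
      (Complex.log (s * (w i - limitPole f 1)) - Complex.log (s * (w i - limitPole f 0))) / 2) l
      (𝓝 0) := by
    rw [Metric.tendsto_nhds]
    intro ε hε
    obtain ⟨δ, hδ, hδ'⟩ := huc (ε * ρ / 8) (by positivity)
    have hinv : Tendsto (fun i => 1 / (n i : ℝ)) l (𝓝 0) :=
      (tendsto_one_div_atTop_nhds_zero_nat (𝕜 := ℝ)).comp hn
    have e1 : ∀ᶠ i in l, 1 / (n i : ℝ) < δ := hinv.eventually_lt_const hδ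
    have hinv2 : Tendsto (fun i => B * K / ρ ^ 2 * (1 / (n i : ℝ))) l (𝓝 0) := by
      simpa using hinv.const_mul (B * K / ρ ^ 2)
    have e2 : ∀ᶠ i in l, B * K / ρ ^ 2 * (1 / (n i : ℝ)) < ε / 8 :=
      hinv2.eventually_lt_const (by positivity)
    filter_upwards [hdist, hslit, e1, e2, hn.eventually_gt_atTop 0] with i hd hsl h1 h2 h0
    have hder : ∀ t ∈ Set.Icc (0 : ℝ) 1, HasDerivWithinAt
        (fun t => Complex.log (s * (w i - limitPole f t)))
        (-(h' t : ℂ) / (w i - limitPole f t)) (Set.Icc 0 1) t := by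
      intro t ht
      have h3 : HasDerivWithinAt (fun t => s * (w i - (limitPole f t : ℂ)))
          (s * -(h' t : ℂ)) (Set.Icc 0 1) t :=
        (((hf.hasDerivWithinAt ht).ofReal_comp).const_sub (w i)).const_mul s
      have h4 := h3.clog_real (hsl t ht)
      convert h4 using 1
      rw [mul_div_mul_left _ _ hs]
    have hmod : ∀ x ∈ Set.Icc (0 : ℝ) 1, ∀ t ∈ Set.Icc (0 : ℝ) 1, |x - t| ≤ 1 / n i →
        ‖-(h' x : ℂ) / (w i - limitPole f x) - -(h' t : ℂ) / (w i - limitPole f t)‖ ≤ ε / 4 := by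
      intro x hx t ht hxt
      have hx0 : w i - limitPole f x ≠ 0 := norm_pos_iff.mp (hρ.trans_le (hd x hx))
      have ht0 : w i - limitPole f t ≠ 0 := norm_pos_iff.mp (hρ.trans_le (hd t ht))
      have e : -(h' x : ℂ) / (w i - limitPole f x) - -(h' t : ℂ) / (w i - limitPole f t) =
          ((h' t - h' x : ℝ) : ℂ) / (w i - limitPole f x) +
          (h' t : ℂ) * ((limitPole f t - limitPole f x : ℝ) : ℂ) * 1 /
            ((w i - limitPole f x) * (w i - limitPole f t)) := by
        push_cast
        field_simp
        ring
      rw [e]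
      refine (norm_add_le _ _).trans ?_
      have hh := hδ' t ht x hx (by rw [Real.dist_eq, abs_sub_comm]; linarith)
      rw [Real.dist_eq] at hh
      have b1 : ‖((h' t - h' x : ℝ) : ℂ) / (w i - limitPole f x)‖ ≤ ε / 8 := by
        rw [norm_div, Complex.norm_real, Real.norm_eq_abs, div_le_iff₀ (hρ.trans_le (hd x hx))]
        have := mul_le_mul_of_nonneg_left (hd x hx) (show 0 ≤ ε / 8 by positivity)
        exact hh.le.trans (by linarith)
      have b2 : ‖(h' t : ℂ) * ((limitPole f t - limitPole f x : ℝ) : ℂ) * 1 /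
            ((w i - limitPole f x) * (w i - limitPole f t))‖ ≤ ε / 8 := by
        rw [norm_div, norm_mul, norm_mul, norm_mul, Complex.norm_real, Complex.norm_real,
          norm_one, mul_one, Real.norm_eq_abs, Real.norm_eq_abs]
        have b3 := (hK t ht x hx).trans (mul_le_mul_of_nonneg_left
          ((abs_sub_comm t x).trans_le hxt) hK0)
        have b4 : |h' t| * |limitPole f t - limitPole f x| ≤ B * (K * (1 / n i)) :=
          mul_le_mul (hB t ht) b3 (abs_nonneg _) hB0
        have b5 : ρ * ρ ≤ ‖w i - limitPole f x‖ * ‖w i - limitPole f t‖ :=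
          mul_le_mul (hd x hx) (hd t ht) hρ.le (norm_nonneg _)
        refine (div_le_div₀ (by positivity) b4 (by positivity) b5).trans (le_trans (le_of_eq ?_) h2.le)
        field_simp
      linarith
    have := norm_trapezoid_le h0 hder hmod
    rw [dist_zero_right]
    refine this.trans_lt ?_
    linarith
  have h01 := ((hbd 1 ⟨zero_le_one, le_rfl⟩).sub (hbd 0 ⟨le_rfl, zero_le_one⟩)).div_const 2
  have := hkey.add h01
  rw [zero_add] at this
  refine this.congr fun i => ?_
  ring

/-- Differentiation of `dF` under the integral sign. -/
theorem hasDerivAt_dF {f : ℝ → ℝ} (hm : AEStronglyMeasurable f (volume.restrict (Set.Ioc 0 1)))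
    {w : ℂ} {ρ : ℝ} (hρ : 0 < ρ)
    (hd : ∀ᵐ t, t ∈ Set.Ioc (0 : ℝ) 1 → ρ ≤ ‖w - limitPole f t‖) :
    HasDerivAt (dF f) (-∫ t in (0 : ℝ)..1, ((w - limitPole f t)⁻¹) ^ 2) w := by
  have hm' : AEStronglyMeasurable (fun t => (limitPole f t : ℂ))
      (volume.restrict (Set.Ioc (0 : ℝ) 1)) :=
    Complex.continuous_ofReal.comp_aestronglyMeasurable
      ((hm.add aestronglyMeasurable_const).sub continuous_id.aestronglyMeasurable)
  have hinvm : ∀ z : ℂ, AEStronglyMeasurable (fun t => (z - limitPole f t)⁻¹)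
      (volume.restrict (Set.Ioc (0 : ℝ) 1)) := fun z =>
    (measurable_inv.comp_aemeasurable
      (aestronglyMeasurable_const.sub hm').aemeasurable).aestronglyMeasurable
  have hball : ∀ t, ρ ≤ ‖w - limitPole f t‖ → ∀ z ∈ Metric.ball w (ρ / 2),
      ρ / 2 ≤ ‖z - limitPole f t‖ := by
    intro t ht z hz
    rw [mem_ball_iff_norm] at hz
    have := norm_sub_le (z - limitPole f t) (z - w)
    rw [sub_sub_sub_cancel_left, norm_sub_rev] at this
    rw [norm_sub_rev] at this
    linarith [norm_sub_rev (w : ℂ) (limitPole f t)]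
  have key := intervalIntegral.hasDerivAt_integral_of_dominated_loc_of_deriv_le (μ := volume)
    (a := 0) (b := 1) (F := fun (z : ℂ) (t : ℝ) => (z - limitPole f t)⁻¹)
    (F' := fun (z : ℂ) (t : ℝ) => -((z - limitPole f t)⁻¹) ^ 2) (x₀ := w)
    (bound := fun _ => ((ρ / 2)⁻¹) ^ 2) (s := Metric.ball w (ρ / 2))
    (Metric.ball_mem_nhds w (by positivity)) (Eventually.of_forall fun z => by
      rw [Set.uIoc_of_le zero_le_one]; exact hinvm z) ?_
    (by rw [Set.uIoc_of_le zero_le_one]; exact ((hinvm w).pow 2).neg) ?_ intervalIntegrable_const ?_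
  · have e : dF f = fun z : ℂ => ∫ t in (0 : ℝ)..1, (z - (limitPole f t : ℂ))⁻¹ := by
      ext z
      rw [dF]
      congr 1; ext t
      rw [limitPole, one_div]; congr 1; push_cast; ring
    rw [e, ← intervalIntegral.integral_neg]
    exact key.2
  · refine intervalIntegrable_of_bound (B := ρ⁻¹) (hinvm w) ?_
    filter_upwards [hd] with t ht htI
    rw [norm_inv]
    exact inv_anti₀ hρ (ht htI)
  · filter_upwards [hd] with t ht htI z hz
    rw [Set.uIoc_of_le zero_le_one] at htI
    rw [norm_neg, norm_pow, norm_inv]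
    have := hball t (ht htI) z hz
    gcongr
  · filter_upwards [hd] with t ht htI z hz
    rw [Set.uIoc_of_le zero_le_one] at htI
    have h1 := hball t (ht htI) z hz
    have h2 : z - limitPole f t ≠ 0 := norm_pos_iff.mp (by linarith)
    have h3 : HasDerivAt (fun z => (z - (limitPole f t : ℂ))⁻¹) (-1 / (z - limitPole f t) ^ 2) z :=
      ((hasDerivAt_id z).sub_const (limitPole f t : ℂ)).inv h2
    have e : -1 / (z - (limitPole f t : ℂ)) ^ 2 = -((z - limitPole f t)⁻¹) ^ 2 := by
      rw [inv_pow, neg_div, one_div]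
    rw [e] at h3
    exact h3

end SchurAsymp

namespace SchurAsymp

open MeasureTheory

/-- The ratio `∏ (w - p_j) / (w - q_j)`. -/
noncomputable def poleRatio {n : ℕ} (p q : Fin n → ℝ) (w : ℂ) : ℂ :=
  ∏ j, (w - p j) / (w - q j)

/-- The logarithmic derivative of `poleRatio`. -/
noncomputable def poleDiff {n : ℕ} (p q : Fin n → ℝ) (w : ℂ) : ℂ :=
  ∑ j, (w - p j)⁻¹ - ∑ j, (w - q j)⁻¹

theorem differentiableAt_poleRatio {n : ℕ} (p : Fin n → ℝ) {q : Fin n → ℝ} {w : ℂ}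
    (hw : ∀ j, w ≠ q j) : DifferentiableAt ℂ (poleRatio p q) w := by
  unfold poleRatio
  refine DifferentiableAt.fun_finsetProd fun j _ => ?_
  exact (differentiableAt_id.sub_const _).div (differentiableAt_id.sub_const _)
    (sub_ne_zero.mpr (hw j))

theorem logDeriv_poleRatio {n : ℕ} {p q : Fin n → ℝ} {w : ℂ} (hp : ∀ j, w ≠ p j)
    (hq : ∀ j, w ≠ q j) : logDeriv (poleRatio p q) w = poleDiff p q w := by
  have hd : ∀ c : ℝ, DifferentiableAt ℂ (fun z : ℂ => z - c) w := fun c =>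
    differentiableAt_id.sub_const _
  have h1 : ∀ c : ℝ, logDeriv (fun z : ℂ => z - c) w = (w - c)⁻¹ := fun c => by
    rw [logDeriv_apply, deriv_sub_const, deriv_id'', one_div]
  unfold poleRatio poleDiff
  rw [logDeriv_prod (f := fun j (z : ℂ) => (z - p j) / (z - q j))
    (fun j _ => div_ne_zero (sub_ne_zero.mpr (hp j)) (sub_ne_zero.mpr (hq j)))
    (fun j _ => (hd _).div (hd _) (sub_ne_zero.mpr (hq j))), ← Finset.sum_sub_distrib]
  refine Finset.sum_congr rfl fun j _ => ?_
  rw [logDeriv_div (f := fun z : ℂ => z - p j) (g := fun z : ℂ => z - q j) w (sub_ne_zero.mpr (hp j)) (sub_ne_zero.mpr (hq j)) (hd _) (hd _), h1, h1]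

theorem poleRatio_ne_zero {n : ℕ} {p q : Fin n → ℝ} {w : ℂ} (hq : ∀ j, w ≠ q j) :
    poleRatio p q w ≠ 0 ↔ ∀ j, w ≠ p j := by
  unfold poleRatio
  rw [Finset.prod_ne_zero_iff]
  simp only [Finset.mem_univ, true_imp_iff]
  refine forall_congr' fun j => ?_
  rw [div_ne_zero_iff, sub_ne_zero, sub_ne_zero]
  exact and_iff_left (hq j)

theorem hasDerivAt_poleDiff {n : ℕ} {p q : Fin n → ℝ} {w : ℂ} (hp : ∀ j, w ≠ p j)
    (hq : ∀ j, w ≠ q j) : HasDerivAt (poleDiff p q)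
      (-(∑ j, ((w - p j)⁻¹) ^ 2 - ∑ j, ((w - q j)⁻¹) ^ 2)) w := by
  have h1 : ∀ c : ℝ, w ≠ c → HasDerivAt (fun z : ℂ => (z - c)⁻¹) (-((w - c)⁻¹) ^ 2) w := by
    intro c hc
    have h3 : HasDerivAt (fun z => (z - (c : ℂ))⁻¹) (-1 / (w - c) ^ 2) w :=
      ((hasDerivAt_id w).sub_const (c : ℂ)).inv (sub_ne_zero.mpr hc)
    have e : -1 / (w - (c : ℂ)) ^ 2 = -((w - c)⁻¹) ^ 2 := by
      rw [inv_pow, neg_div, one_div]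
    rwa [e] at h3
  have h2 := (HasDerivAt.fun_sum fun (j : Fin n) (_ : j ∈ Finset.univ) => h1 _ (hp j)).fun_sub
    (HasDerivAt.fun_sum fun (j : Fin n) (_ : j ∈ Finset.univ) => h1 _ (hq j))
  unfold poleDiff
  rw [Finset.sum_neg_distrib, Finset.sum_neg_distrib, ← neg_sub'] at h2
  exact h2

theorem exp_Q_eq {N : ℕ} (hN : 0 < N) {lam : Fin N → ℤ} {f : ℝ → ℝ} {w : ℂ}
    (hp : ∀ j, w ≠ pole lam j) (hq : ∀ j : Fin N, w ≠ limitPole f (((j : ℕ) + 1 : ℝ) / N)) :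
    Complex.exp (Q lam f w) =
      poleRatio (pole lam) (fun j => limitPole f (((j : ℕ) + 1 : ℝ) / N)) w := by
  have hN' : (N : ℂ) ≠ 0 := by exact_mod_cast hN.ne'
  rw [Q, Complex.exp_sum, poleRatio]
  refine Finset.prod_congr rfl fun j _ => ?_
  have h1 := sub_ne_zero.mpr (hp j)
  have h2 := sub_ne_zero.mpr (hq j)
  have e2 : w - (limitPole f (((j : ℕ) + 1 : ℝ) / N) : ℂ) =
      w - (f (((j : ℕ) + 1 : ℝ) / N) : ℂ) - 1 + ((j : ℕ) + 1 : ℂ) / N := by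
    rw [limitPole]; push_cast; ring
  have e : 1 + ((f (((j : ℕ) + 1 : ℝ) / N) : ℂ) - (lam j : ℂ) / N) /
      (w - (f (((j : ℕ) + 1 : ℝ) / N) : ℂ) - 1 + ((j : ℕ) + 1 : ℂ) / N) =
      (w - pole lam j) / (w - limitPole f (((j : ℕ) + 1 : ℝ) / N)) := by
    rw [← e2]
    rw [eq_div_iff h2, add_mul, div_mul_cancel₀ _ h2, one_mul, e2, pole]
    push_cast
    field_simp
    ring
  rw [e, Complex.exp_log (div_ne_zero h1 h2)]

theorem norm_sub_le_of_finite {U : Set ℂ} (hU : IsOpen U) {A B : ℂ → ℂ}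
    (hA : ContinuousOn A U) (hB : ContinuousOn B U) {S : Set ℂ} (hS : S.Finite) {ε : ℝ}
    (h : ∀ w ∈ U, w ∉ S → ‖A w - B w‖ ≤ ε) {w : ℂ} (hw : w ∈ U) : ‖A w - B w‖ ≤ ε := by
  have hc : Tendsto (fun z => ‖A z - B z‖) (𝓝[≠] w) (𝓝 ‖A w - B w‖) :=
    ((hA.continuousAt (hU.mem_nhds hw)).sub
      (hB.continuousAt (hU.mem_nhds hw))).norm.tendsto.mono_left nhdsWithin_le_nhds
  refine le_of_tendsto hc ?_
  have h1 : ∀ᶠ z in 𝓝[≠] w, z ∈ U := nhdsWithin_le_nhds (hU.mem_nhds hw)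
  have h2 : ∀ᶠ z in 𝓝[≠] w, z ∉ S \ {w} :=
    nhdsWithin_le_nhds ((hS.subset Set.sdiff_subset).isClosed.isOpen_compl.mem_nhds (by simp))
  filter_upwards [h1, h2, self_mem_nhdsWithin] with z hz1 hz2 hz3
  exact h z hz1 fun hz => hz2 ⟨hz, hz3⟩

/-- If functions that agree with the ratios `∏ (w - p_j) / (w - q_j)` off the zeros converge
uniformly near a point where the limit does not vanish, then the zeros stay away from it. -/
theorem exists_ball_of_tendstoUniformlyOn {n : ℕ → ℕ} {p q : ∀ k, Fin (n k) → ℝ}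
    {E : ℕ → ℂ → ℂ} {g : ℂ → ℂ} {w₀ : ℂ} {r : ℝ} (hr : 0 < r)
    (hE : TendstoUniformlyOn E g atTop (Metric.ball w₀ r))
    (hq : ∀ k, ∀ w ∈ Metric.ball w₀ r, ∀ j, w ≠ q k j)
    (hEP : ∀ᶠ k in atTop, ∀ w ∈ Metric.ball w₀ r, (∀ j, w ≠ p k j) → E k w = poleRatio (p k) (q k) w)
    (hp : ∀ᶠ k in atTop, ∀ j, w₀ ≠ p k j) (hg : g w₀ ≠ 0) :
    ∃ ρ > 0, ρ ≤ r ∧ (∀ᶠ k in atTop, ∀ w ∈ Metric.ball w₀ ρ, ∀ j, w ≠ p k j) ∧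
      TendstoUniformlyOn (fun k => poleRatio (p k) (q k)) g atTop (Metric.ball w₀ ρ) ∧
      ∀ w ∈ Metric.ball w₀ ρ, g w ≠ 0 := by
  have hPc : ∀ k, ContinuousOn (poleRatio (p k) (q k)) (Metric.ball w₀ r) := fun k w hw =>
    (differentiableAt_poleRatio (p k) (hq k w hw)).continuousAt.continuousWithinAt
  have hw₀ : w₀ ∈ Metric.ball w₀ r := Metric.mem_ball_self hr
  set ε := ‖g w₀‖ / 8 with hε
  have hε0 : 0 < ε := by have := norm_pos_iff.mpr hg; positivity
  obtain ⟨k₁, hk₁⟩ := (eventually_atTop.mp (hEP.and hp))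
  obtain ⟨k₂, hk₂⟩ := Metric.uniformCauchySeqOn_iff.mp hE.uniformCauchySeqOn ε hε0
  obtain ⟨k₃, hk₃⟩ := eventually_atTop.mp (Metric.tendstoUniformlyOn_iff.mp hE ε hε0)
  set m := max k₁ (max k₂ k₃) with hm
  have hm1 : k₁ ≤ m := le_max_left _ _
  have hm2 : k₂ ≤ m := (le_max_left _ _).trans (le_max_right _ _)
  have hm3 : k₃ ≤ m := (le_max_right _ _).trans (le_max_right _ _)
  have hPP : ∀ k ≥ m, ∀ w ∈ Metric.ball w₀ r,
      ‖poleRatio (p k) (q k) w - poleRatio (p m) (q m) w‖ ≤ ε := by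
    intro k hk w hw
    refine norm_sub_le_of_finite Metric.isOpen_ball (hPc k) (hPc m)
      ((Set.finite_range fun j => (p k j : ℂ)).union (Set.finite_range fun j => (p m j : ℂ)))
      (fun z hz hzS => ?_) hw
    have z1 : ∀ j, z ≠ p k j := fun j h => hzS (Or.inl ⟨j, h.symm⟩)
    have z2 : ∀ j, z ≠ p m j := fun j h => hzS (Or.inr ⟨j, h.symm⟩)
    rw [← (hk₁ k (hm1.trans hk)).1 z hz z1, ← (hk₁ m hm1).1 z hz z2, ← dist_eq_norm]
    exact (hk₂ k (hm2.trans hk) m hm2 z hz).le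
  have hPg : ‖poleRatio (p m) (q m) w₀ - g w₀‖ ≤ ε := by
    rw [← (hk₁ m hm1).1 w₀ hw₀ (hk₁ m hm1).2, ← dist_eq_norm, dist_comm]
    exact (hk₃ m hm3 w₀ hw₀).le
  obtain ⟨ρ, hρ, hρc⟩ := Metric.continuousAt_iff.mp
    ((hPc m).continuousAt (Metric.ball_mem_nhds w₀ hr)) ε hε0
  have hnear : ∀ k ≥ m, ∀ w ∈ Metric.ball w₀ (min ρ r),
      ‖poleRatio (p k) (q k) w - g w₀‖ ≤ 3 * ε := by
    intro k hk w hw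
    rw [Metric.mem_ball, lt_min_iff] at hw
    have a1 := hPP k hk w hw.2
    have a2 := (hρc hw.1).le
    rw [dist_eq_norm] at a2
    have := norm_sub_le_norm_sub_add_norm_sub (poleRatio (p k) (q k) w) (poleRatio (p m) (q m) w) (g w₀)
    have := norm_sub_le_norm_sub_add_norm_sub (poleRatio (p m) (q m) w) (poleRatio (p m) (q m) w₀) (g w₀)
    linarith
  have hsub : Metric.ball w₀ (min ρ r) ⊆ Metric.ball w₀ r :=
    Metric.ball_subset_ball (min_le_right _ _)
  have hnz : ∀ k ≥ m, ∀ w ∈ Metric.ball w₀ (min ρ r), ∀ j, w ≠ p k j := by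
    intro k hk w hw
    rw [← poleRatio_ne_zero (hq k w (hsub hw))]
    intro h0
    have := hnear k hk w hw
    rw [h0, zero_sub, norm_neg] at this
    linarith
  have hPE : ∀ k ≥ m, ∀ w ∈ Metric.ball w₀ (min ρ r), E k w = poleRatio (p k) (q k) w :=
    fun k hk w hw => (hk₁ k (hm1.trans hk)).1 w (hsub hw) (hnz k hk w hw)
  have hunif : TendstoUniformlyOn (fun k => poleRatio (p k) (q k)) g atTop
      (Metric.ball w₀ (min ρ r)) :=
    (hE.mono hsub).congr ((eventually_ge_atTop m).mono fun k hk w hw => hPE k hk w hw)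
  refine ⟨min ρ r, lt_min hρ hr, min_le_right _ _, (eventually_ge_atTop m).mono hnz, hunif,
    fun w hw h0 => ?_⟩
  have h1 := hunif.tendsto_at hw
  rw [h0] at h1
  have h2 : ‖(0 : ℂ) - g w₀‖ ≤ 3 * ε :=
    le_of_tendsto (h1.sub_const _).norm ((eventually_ge_atTop m).mono fun k hk => hnear k hk w hw)
  rw [zero_sub, norm_neg] at h2
  linarith

/-- The logarithmic derivatives of the ratios converge locally uniformly. -/
theorem tendstoLocallyUniformlyOn_poleDiff {n : ℕ → ℕ} {p q : ∀ k, Fin (n k) → ℝ} {g : ℂ → ℂ}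
    {U : Set ℂ} (hU : IsOpen U)
    (hP : TendstoUniformlyOn (fun k => poleRatio (p k) (q k)) g atTop U)
    (hq : ∀ k, ∀ w ∈ U, ∀ j, w ≠ q k j) (hp : ∀ᶠ k in atTop, ∀ w ∈ U, ∀ j, w ≠ p k j)
    (hg : ∀ w ∈ U, g w ≠ 0) :
    DifferentiableOn ℂ g U ∧ DifferentiableOn ℂ (logDeriv g) U ∧
      TendstoLocallyUniformlyOn (fun k => poleDiff (p k) (q k)) (logDeriv g) atTop U := by
  have hPd : ∀ k, DifferentiableOn ℂ (poleRatio (p k) (q k)) U := fun k w hw =>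
    (differentiableAt_poleRatio (p k) (hq k w hw)).differentiableWithinAt
  have hP' := hP.tendstoLocallyUniformlyOn
  have hgd := hP'.differentiableOn (Eventually.of_forall hPd) hU
  have hgd' : DifferentiableOn ℂ (logDeriv g) U := (hgd.deriv hU).div hgd hg
  refine ⟨hgd, hgd', ?_⟩
  have h1 := (hP'.deriv (Eventually.of_forall hPd) hU).div₀ hP' (hgd.deriv hU).continuousOn
    hgd.continuousOn hg
  have h1 : TendstoLocallyUniformlyOn (fun k => logDeriv (poleRatio (p k) (q k))) (logDeriv g)
    atTop U := h1
  intro u hu x hx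
  obtain ⟨t, ht, h⟩ := h1 u hu x hx
  refine ⟨t ∩ U, inter_mem ht self_mem_nhdsWithin, ?_⟩
  filter_upwards [h, hp] with k hk hpk z hz
  rw [← logDeriv_poleRatio (hpk z hz.2) (hq k z hz.2)]
  exact hk z hz.1

end SchurAsymp

namespace SchurAsymp

open MeasureTheory

theorem norm_inv_sub_inv_le {a b : ℂ} {ρ : ℝ} (hρ : 0 < ρ) (ha : ρ ≤ ‖a‖) (hb : ρ ≤ ‖b‖) :
    ‖a⁻¹ - b⁻¹‖ ≤ (ρ ^ 2)⁻¹ * ‖a - b‖ := by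
  have ha0 : a ≠ 0 := norm_pos_iff.mp (hρ.trans_le ha)
  have hb0 : b ≠ 0 := norm_pos_iff.mp (hρ.trans_le hb)
  rw [inv_sub_inv ha0 hb0, norm_div, norm_mul, norm_sub_rev, div_eq_inv_mul, pow_two]
  gcongr

theorem norm_inv_sq_sub_inv_sq_le {a b : ℂ} {ρ : ℝ} (hρ : 0 < ρ) (ha : ρ ≤ ‖a‖) (hb : ρ ≤ ‖b‖) :
    ‖(a⁻¹) ^ 2 - (b⁻¹) ^ 2‖ ≤ 2 * ρ⁻¹ * (ρ ^ 2)⁻¹ * ‖a - b‖ := by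
  rw [sq_sub_sq, norm_mul, mul_assoc]
  refine mul_le_mul ?_ (norm_inv_sub_inv_le hρ ha hb) (norm_nonneg _) (by positivity)
  refine (norm_add_le _ _).trans ?_
  rw [norm_inv, norm_inv, two_mul]
  exact add_le_add (inv_anti₀ hρ ha) (inv_anti₀ hρ hb)

theorem grid_mem {n : ℕ} (j : Fin n) : ((j : ℕ) + 1 : ℝ) / n ∈ Set.Icc (0 : ℝ) 1 := by
  have hn' : (0 : ℝ) < n := by exact_mod_cast (Nat.zero_le _).trans_lt j.2
  exact ⟨by positivity, (div_le_one hn').mpr (by exact_mod_cast j.2)⟩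

theorem dF_eq (f : ℝ → ℝ) (w : ℂ) : dF f w = ∫ t in (0 : ℝ)..1, (w - (limitPole f t : ℂ))⁻¹ := by
  rw [dF]
  congr 1; ext t
  rw [limitPole, one_div]; congr 1; push_cast; ring

/-- The disc with centre `w₀` and radius `ρ` stays away from the poles, and the local behaviour of
`exp Q` on it is under control. -/
structure RefinedBall {ν : ℕ → ℕ} (lam : ∀ k, Fin (ν k) → ℤ) (f : ℝ → ℝ) (g : ℂ → ℂ) (w₀ : ℂ)
    (ρ : ℝ) : Prop where
  pos : 0 < ρ
  far : ∀ t ∈ Set.Icc (0 : ℝ) 1, 2 * ρ ≤ ‖w₀ - limitPole f t‖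
  ne_pole : ∀ᶠ k in atTop, ∀ w ∈ Metric.ball w₀ ρ, ∀ j, w ≠ pole (lam k) j
  tendsto : TendstoUniformlyOn (fun k => poleRatio (pole (lam k))
    (fun j => limitPole f (((j : ℕ) + 1 : ℝ) / ν k))) g atTop (Metric.ball w₀ ρ)
  ne_zero : ∀ w ∈ Metric.ball w₀ ρ, g w ≠ 0
  differentiableOn : DifferentiableOn ℂ g (Metric.ball w₀ ρ)
  differentiableOn_logDeriv : DifferentiableOn ℂ (logDeriv g) (Metric.ball w₀ ρ)
  tendsto_poleDiff : TendstoLocallyUniformlyOn (fun k => poleDiff (pole (lam k))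
    (fun j => limitPole f (((j : ℕ) + 1 : ℝ) / ν k))) (logDeriv g) atTop (Metric.ball w₀ ρ)

theorem RefinedBall.mem {ν : ℕ → ℕ} {lam : ∀ k, Fin (ν k) → ℤ} {f : ℝ → ℝ} {g : ℂ → ℂ} {w₀ : ℂ}
    {ρ : ℝ} (h : RefinedBall lam f g w₀ ρ) : w₀ ∈ Metric.ball w₀ ρ := Metric.mem_ball_self h.pos

theorem RefinedBall.le_norm {ν : ℕ → ℕ} {lam : ∀ k, Fin (ν k) → ℤ} {f : ℝ → ℝ} {g : ℂ → ℂ} {w₀ : ℂ}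
    {ρ : ℝ} (h : RefinedBall lam f g w₀ ρ) {w : ℂ} (hw : w ∈ Metric.ball w₀ ρ) {t : ℝ}
    (ht : t ∈ Set.Icc (0 : ℝ) 1) : ρ ≤ ‖w - limitPole f t‖ := by
  have h1 := h.far t ht
  rw [mem_ball_iff_norm] at hw
  have := norm_sub_le_norm_sub_add_norm_sub w₀ w (limitPole f t : ℂ)
  rw [norm_sub_rev w₀ w] at this
  linarith

theorem exists_refinedBall {ν : ℕ → ℕ} (hν : Tendsto ν atTop atTop) {lam : ∀ k, Fin (ν k) → ℤ}
    {f : ℝ → ℝ} (hf : TwiceDifferentiable f) {M : Set ℂ} {g : ℂ → ℂ} (hM : IsOpen M)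
    (hQ : TendstoUniformlyOn (fun k w => Complex.exp (Q (lam k) f w)) g atTop M) {w₀ : ℂ}
    (hw₀ : w₀ ∈ M) (hg : g w₀ ≠ 0) (hh : ∀ t ∈ Set.Icc (0 : ℝ) 1, w₀ ≠ limitPole f t)
    (hp : ∀ᶠ k in atTop, ∀ j, w₀ ≠ pole (lam k) j) : ∃ ρ, RefinedBall lam f g w₀ ρ := by
  obtain ⟨d, hd0, hd⟩ := hf.exists_dist_le hh
  obtain ⟨r, hr, hrM⟩ := Metric.isOpen_iff.mp hM w₀ hw₀
  set r' := min r (d / 2) with hr'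
  have hr'0 : 0 < r' := lt_min hr (by positivity)
  have hne : ∀ w ∈ Metric.ball w₀ r', ∀ t ∈ Set.Icc (0 : ℝ) 1, w ≠ limitPole f t := by
    intro w hw t ht h
    have h1 := hd t ht
    rw [Metric.mem_ball, lt_min_iff, dist_eq_norm, norm_sub_rev, h] at hw
    linarith [hw.2]
  obtain ⟨ρ, hρ, hρr, h1, h2, h3⟩ := exists_ball_of_tendstoUniformlyOn
    (p := fun k => pole (lam k)) (q := fun k j => limitPole f (((j : ℕ) + 1 : ℝ) / ν k)) hr'0
    (hQ.mono ((Metric.ball_subset_ball (min_le_left _ _)).trans hrM))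
    (fun k w hw j => hne w hw _ (grid_mem j)) ((hν.eventually_gt_atTop 0).mono fun k hk w hw hwp =>
      exp_Q_eq hk hwp fun j => hne w hw _ (grid_mem j)) hp hg
  · have hsub := Metric.ball_subset_ball (x := w₀) hρr
    obtain ⟨h4, h5, h6⟩ := tendstoLocallyUniformlyOn_poleDiff Metric.isOpen_ball h2
      (fun k w hw j => hne w (hsub hw) _ (grid_mem j)) h1 h3
    refine ⟨ρ, hρ, fun t ht => ?_, h1, h2, h3, h4, h5, h6⟩
    have := hd t ht
    have := hρr.trans (min_le_right _ _)
    linarith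

section

variable {ν : ℕ → ℕ} {lam : ∀ k, Fin (ν k) → ℤ} {f : ℝ → ℝ} {g : ℂ → ℂ} {w₀ : ℂ} {ρ : ℝ}
  {α : Type*} {l : Filter α} {κ : α → ℕ} {w : α → ℂ}

theorem RefinedBall.eventually_mem (h : RefinedBall lam f g w₀ ρ) (hw : Tendsto w l (𝓝 w₀)) :
    ∀ᶠ i in l, w i ∈ Metric.ball w₀ (ρ / 2) :=
  hw.eventually_mem (Metric.ball_mem_nhds _ (half_pos h.pos))

theorem RefinedBall.tendsto_poleRatio (h : RefinedBall lam f g w₀ ρ)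
    (hκ : Tendsto κ l atTop) (hw : Tendsto w l (𝓝 w₀)) :
    Tendsto (fun i => poleRatio (pole (lam (κ i)))
      (fun j => limitPole f (((j : ℕ) + 1 : ℝ) / ν (κ i))) (w i)) l (𝓝 (g w₀)) := by
  have h1 : TendstoLocallyUniformlyOn (fun i => poleRatio (pole (lam (κ i)))
      (fun j => limitPole f (((j : ℕ) + 1 : ℝ) / ν (κ i)))) g l (Metric.ball w₀ ρ) :=
    TendstoUniformlyOn.tendstoLocallyUniformlyOn fun u hu => hκ.eventually (h.tendsto u hu)
  exact h1.tendsto_comp (h.differentiableOn.continuousOn w₀ h.mem) h.mem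
    (tendsto_nhdsWithin_iff.mpr ⟨hw, hw.eventually_mem (Metric.ball_mem_nhds _ h.pos)⟩)

theorem RefinedBall.tendsto_poleDiff_comp (h : RefinedBall lam f g w₀ ρ)
    (hκ : Tendsto κ l atTop) (hw : Tendsto w l (𝓝 w₀)) :
    Tendsto (fun i => poleDiff (pole (lam (κ i)))
      (fun j => limitPole f (((j : ℕ) + 1 : ℝ) / ν (κ i))) (w i)) l (𝓝 (logDeriv g w₀)) := by
  have h1 : TendstoLocallyUniformlyOn (fun i => poleDiff (pole (lam (κ i)))
      (fun j => limitPole f (((j : ℕ) + 1 : ℝ) / ν (κ i)))) (logDeriv g) l (Metric.ball w₀ ρ) := by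
    intro u hu x hx
    obtain ⟨t, ht, h⟩ := h.tendsto_poleDiff u hu x hx
    exact ⟨t, ht, hκ.eventually h⟩
  exact h1.tendsto_comp (h.differentiableOn_logDeriv.continuousOn w₀ h.mem) h.mem
    (tendsto_nhdsWithin_iff.mpr ⟨hw, hw.eventually_mem (Metric.ball_mem_nhds _ h.pos)⟩)

theorem RefinedBall.tendsto_deriv_poleDiff_comp (h : RefinedBall lam f g w₀ ρ)
    (hκ : Tendsto κ l atTop) (hw : Tendsto w l (𝓝 w₀)) :
    Tendsto (fun i => ∑ j, ((w i - pole (lam (κ i)) j)⁻¹) ^ 2 -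
      ∑ j : Fin (ν (κ i)), ((w i - limitPole f (((j : ℕ) + 1 : ℝ) / ν (κ i)))⁻¹) ^ 2) l
      (𝓝 (-deriv (logDeriv g) w₀)) := by
  have hq : ∀ k, ∀ z ∈ Metric.ball w₀ ρ, ∀ j : Fin (ν k),
      z ≠ limitPole f (((j : ℕ) + 1 : ℝ) / ν k) := fun k z hz j =>
    sub_ne_zero.mp (norm_pos_iff.mp (h.pos.trans_le (h.le_norm hz (grid_mem j))))
  have h0 : TendstoLocallyUniformlyOn (deriv ∘ fun k => poleDiff (pole (lam k))
    (fun j => limitPole f (((j : ℕ) + 1 : ℝ) / ν k))) (deriv (logDeriv g)) atTop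
      (Metric.ball w₀ ρ) := by
    refine h.tendsto_poleDiff.deriv ?_ Metric.isOpen_ball
    filter_upwards [h.ne_pole] with k hk z hz
    exact (hasDerivAt_poleDiff (hk z hz) (hq k z hz)).differentiableAt.differentiableWithinAt
  have h1 : TendstoLocallyUniformlyOn (fun i => deriv (poleDiff (pole (lam (κ i)))
      (fun j => limitPole f (((j : ℕ) + 1 : ℝ) / ν (κ i))))) (deriv (logDeriv g)) l
      (Metric.ball w₀ ρ) := by
    intro u hu x hx
    obtain ⟨t, ht, h⟩ := h0 u hu x hx
    exact ⟨t, ht, hκ.eventually h⟩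
  have h2 := (h1.tendsto_comp
    ((h.differentiableOn_logDeriv.deriv Metric.isOpen_ball).continuousOn w₀ h.mem) h.mem
    (tendsto_nhdsWithin_iff.mpr ⟨hw, hw.eventually_mem (Metric.ball_mem_nhds _ h.pos)⟩)).neg
  refine h2.congr' ?_
  filter_upwards [hκ.eventually h.ne_pole, hw.eventually_mem (Metric.ball_mem_nhds _ h.pos)]
    with i hi hwi
  rw [(hasDerivAt_poleDiff (hi _ hwi) (hq _ _ hwi)).deriv, neg_neg]

theorem tendsto_sqrt_inv {n : α → ℕ} (hn : Tendsto n l atTop) :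
    Tendsto (fun i => (√(n i : ℝ))⁻¹) l (𝓝 0) :=
  tendsto_inv_atTop_zero.comp (Real.tendsto_sqrt_atTop.comp (tendsto_natCast_atTop_atTop.comp hn))

theorem RefinedBall.tendsto_mean_inv (h : RefinedBall lam f g w₀ ρ) (hf : TwiceDifferentiable f)
    (hν : Tendsto ν atTop atTop) (hκ : Tendsto κ l atTop) (hw : Tendsto w l (𝓝 w₀)) :
    Tendsto (fun i => ((√(ν (κ i) : ℝ) : ℝ) : ℂ) *
      (dF f (w i) - (∑ j, (w i - pole (lam (κ i)) j)⁻¹) / ν (κ i))) l (𝓝 0) := by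
  obtain ⟨K, hK0, hK⟩ := hf.lipschitz
  have hn := hν.comp hκ
  have hs : Tendsto (fun i => (√(ν (κ i) : ℝ))⁻¹) l (𝓝 0) := tendsto_sqrt_inv hn
  have hs' : Tendsto (fun i => (((√(ν (κ i) : ℝ))⁻¹ : ℝ) : ℂ)) l (𝓝 0) := by
    have := (Complex.continuous_ofReal.tendsto 0).comp hs
    rwa [Complex.ofReal_zero] at this
  have h1 := (h.tendsto_poleDiff_comp hκ hw).mul hs'
  rw [mul_zero] at h1
  have h2 : Tendsto (fun i => ((√(ν (κ i) : ℝ) : ℝ) : ℂ) *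
      ((∑ j : Fin (ν (κ i)), (w i - limitPole f (((j : ℕ) + 1 : ℝ) / ν (κ i)))⁻¹) / ν (κ i) -
        dF f (w i))) l (𝓝 0) := by
    have h3 := hs.const_mul ((ρ ^ 2)⁻¹ * K)
    rw [mul_zero] at h3
    refine squeeze_zero_norm' ?_ h3
    filter_upwards [h.eventually_mem hw, hn.eventually_gt_atTop 0] with i hi h0
    have hpos : (0 : ℝ) < ν (κ i) := by exact_mod_cast h0
    have hmem := Metric.ball_subset_ball (by linarith [h.pos] : ρ / 2 ≤ ρ) hi
    have hri := norm_riemann_sum_sub_integral_le (n := ν (κ i)) h0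
      (φ := fun t => (w i - limitPole f t)⁻¹) (K := (ρ ^ 2)⁻¹ * K) (fun s hs t ht => ?_)
      (by have := h.pos; positivity)
    · rw [norm_mul, Complex.norm_real, Real.norm_of_nonneg (Real.sqrt_nonneg _), dF_eq]
      refine (mul_le_mul_of_nonneg_left hri (Real.sqrt_nonneg _)).trans_eq ?_
      have : √(ν (κ i) : ℝ) * √(ν (κ i) : ℝ) = ν (κ i) := Real.mul_self_sqrt hpos.le
      have hne : √(ν (κ i) : ℝ) ≠ 0 := (Real.sqrt_pos.mpr hpos).ne'
      nth_rewrite 2 [← this]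
      field_simp
    · refine (norm_inv_sub_inv_le h.pos (h.le_norm hmem hs) (h.le_norm hmem ht)).trans ?_
      rw [mul_assoc]
      refine mul_le_mul_of_nonneg_left ?_ (by positivity)
      rw [sub_sub_sub_cancel_left, ← Complex.ofReal_sub, Complex.norm_real, Real.norm_eq_abs,
        abs_sub_comm s t]
      exact hK t ht s hs
  have h4 := (h1.add h2).neg
  rw [add_zero, neg_zero] at h4
  refine h4.congr' ?_
  filter_upwards [hn.eventually_gt_atTop 0] with i h0
  have hpos : (0 : ℝ) < ν (κ i) := by exact_mod_cast h0
  have hc : (ν (κ i) : ℂ) = ((√(ν (κ i) : ℝ) : ℝ) : ℂ) * ((√(ν (κ i) : ℝ) : ℝ) : ℂ) := by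
    rw [← Complex.ofReal_mul, Real.mul_self_sqrt hpos.le, Complex.ofReal_natCast]
  have hne : ((√(ν (κ i) : ℝ) : ℝ) : ℂ) ≠ 0 :=
    Complex.ofReal_ne_zero.mpr (Real.sqrt_pos.mpr hpos).ne'
  rw [poleDiff, hc, Complex.ofReal_inv]
  generalize ((√(ν (κ i) : ℝ) : ℝ) : ℂ) = r at *
  field_simp
  ring

theorem RefinedBall.tendsto_mean_inv_sq (h : RefinedBall lam f g w₀ ρ)
    (hf : TwiceDifferentiable f)
    (hν : Tendsto ν atTop atTop) (hκ : Tendsto κ l atTop) (hw : Tendsto w l (𝓝 w₀)) :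
    Tendsto (fun i => (∑ j, ((w i - pole (lam (κ i)) j)⁻¹) ^ 2) / ν (κ i)) l
      (𝓝 (-d2F f w₀)) := by
  obtain ⟨K, hK0, hK⟩ := hf.lipschitz
  have hn := hν.comp hκ
  have hρ := h.pos
  have hinv : Tendsto (fun i => 1 / (ν (κ i) : ℝ)) l (𝓝 (0 : ℝ)) :=
    (tendsto_one_div_atTop_nhds_zero_nat (𝕜 := ℝ)).comp hn
  have hinv' : Tendsto (fun i => 1 / (ν (κ i) : ℂ)) l (𝓝 0) := by
    have := (Complex.continuous_ofReal.tendsto 0).comp hinv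
    simpa [Function.comp_def] using this
  have h1 := (h.tendsto_deriv_poleDiff_comp hκ hw).mul hinv'
  rw [mul_zero] at h1
  set C := 2 * ρ⁻¹ * (ρ ^ 2)⁻¹ with hC
  have hC0 : 0 ≤ C := by positivity
  have h2 : Tendsto (fun i =>
      (∑ j : Fin (ν (κ i)), ((w i - limitPole f (((j : ℕ) + 1 : ℝ) / ν (κ i)))⁻¹) ^ 2) / ν (κ i) -
      ∫ t in (0 : ℝ)..1, ((w₀ - limitPole f t)⁻¹) ^ 2) l (𝓝 0) := by
    have hw1 : Tendsto (fun i => ‖w i - w₀‖) l (𝓝 0) := by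
      simpa using (hw.sub_const w₀).norm
    have h3 := (hw1.const_mul C).add (hinv.const_mul (C * K))
    rw [mul_zero, mul_zero, add_zero] at h3
    refine squeeze_zero_norm' ?_ h3
    filter_upwards [h.eventually_mem hw, hn.eventually_gt_atTop 0] with i hi h0
    have hpos : (0 : ℝ) < ν (κ i) := by exact_mod_cast h0
    have hmem := Metric.ball_subset_ball (by linarith [h.pos] : ρ / 2 ≤ ρ) hi
    have hri := norm_riemann_sum_sub_integral_le (n := ν (κ i)) h0
      (φ := fun t => ((w₀ - limitPole f t)⁻¹) ^ 2) (K := C * K) (fun s hs t ht => ?_)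
      (by positivity)
    · have h5 : ‖(∑ j : Fin (ν (κ i)), ((w i - limitPole f (((j : ℕ) + 1 : ℝ) / ν (κ i)))⁻¹) ^ 2) /
          ν (κ i) - (∑ j : Fin (ν (κ i)),
            ((w₀ - limitPole f (((j : ℕ) + 1 : ℝ) / ν (κ i)))⁻¹) ^ 2) / ν (κ i)‖ ≤
          C * ‖w i - w₀‖ := by
        rw [← sub_div, ← Finset.sum_sub_distrib, norm_div, Complex.norm_natCast, div_le_iff₀ hpos]
        refine (norm_sum_le_of_le (f := fun j : Fin (ν (κ i)) =>
          ((w i - limitPole f (((j : ℕ) + 1 : ℝ) / ν (κ i)))⁻¹) ^ 2 -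
          ((w₀ - limitPole f (((j : ℕ) + 1 : ℝ) / ν (κ i)))⁻¹) ^ 2)
          (n := fun _ => C * ‖w i - w₀‖) Finset.univ fun j _ => ?_).trans_eq ?_
        · have := norm_inv_sq_sub_inv_sq_le hρ (h.le_norm hmem (grid_mem j))
            (h.le_norm h.mem (grid_mem j))
          rwa [sub_sub_sub_cancel_right] at this
        · rw [Finset.sum_const, Finset.card_univ, Fintype.card_fin, nsmul_eq_mul, mul_comm]
      refine (norm_sub_le_norm_sub_add_norm_sub _ _ _).trans (add_le_add h5
        (hri.trans_eq (mul_one_div (C * K) (ν (κ i) : ℝ)).symm))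
    · refine (norm_inv_sq_sub_inv_sq_le hρ (h.le_norm h.mem hs) (h.le_norm h.mem ht)).trans
        ((mul_le_mul_of_nonneg_left (b := ‖_‖) (c := K * |s - t|) ?_ hC0).trans_eq
          (mul_assoc C K _).symm)
      rw [sub_sub_sub_cancel_left, ← Complex.ofReal_sub, Complex.norm_real, Real.norm_eq_abs,
        abs_sub_comm s t]
      exact hK t ht s hs
  have hd : d2F f w₀ = -∫ t in (0 : ℝ)..1, ((w₀ - limitPole f t)⁻¹) ^ 2 := by
    have hm := hf.intervalIntegrable.1.aestronglyMeasurable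
    exact (hasDerivAt_dF hm hρ (ae_of_all _ fun t ht => h.le_norm h.mem ⟨ht.1.le, ht.2⟩)).deriv
  have h4 := (h1.add h2).add_const (∫ t in (0 : ℝ)..1, ((w₀ - limitPole f t)⁻¹) ^ 2)
  rw [add_zero, zero_add] at h4
  rw [hd, neg_neg]
  refine h4.congr fun i => ?_
  ring

end

end SchurAsymp

namespace SchurAsymp

open MeasureTheory

theorem integral_inv_strictAnti {h : ℝ → ℝ} (hc : ContinuousOn h (Set.Icc 0 1)) {a b : ℝ}
    (ha : ∀ t ∈ Set.Icc (0 : ℝ) 1, h t < a) (hab : a < b) :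
    ∫ t in (0 : ℝ)..1, (b - h t)⁻¹ < ∫ t in (0 : ℝ)..1, (a - h t)⁻¹ := by
  have hlt : ∀ t ∈ Set.Icc (0 : ℝ) 1, (b - h t)⁻¹ < (a - h t)⁻¹ := fun t ht =>
    inv_strictAnti₀ (sub_pos.mpr (ha t ht)) (by linarith)
  refine intervalIntegral.integral_lt_integral_of_continuousOn_of_le_of_exists_lt zero_lt_one
    ((continuousOn_const.sub hc).inv₀ fun t ht => ?_)
    ((continuousOn_const.sub hc).inv₀ fun t ht => ?_)
    (fun t ht => (hlt t ⟨ht.1.le, ht.2⟩).le) ⟨0, by simp, hlt 0 (by simp)⟩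
  · have := ha t ht; exact (by linarith : (0 : ℝ) < b - h t).ne'
  · exact (sub_pos.mpr (ha t ht)).ne'

theorem tendsto_of_tendsto_integral_inv {α : Type*} {l : Filter α} {h : ℝ → ℝ}
    (hc : ContinuousOn h (Set.Icc 0 1)) {w : α → ℝ} {w₀ : ℝ}
    (hw : ∀ᶠ i in l, ∀ t ∈ Set.Icc (0 : ℝ) 1, h t < w i)
    (hw₀ : ∀ t ∈ Set.Icc (0 : ℝ) 1, h t < w₀)
    (hlim : Tendsto (fun i => ∫ t in (0 : ℝ)..1, (w i - h t)⁻¹) l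
      (𝓝 (∫ t in (0 : ℝ)..1, (w₀ - h t)⁻¹))) : Tendsto w l (𝓝 w₀) := by
  obtain ⟨t₀, ht₀, hmax⟩ := isCompact_Icc.exists_isMaxOn ⟨0, by simp⟩ hc
  rw [tendsto_order]
  constructor
  · intro a ha
    set a' := max a ((h t₀ + w₀) / 2) with ha'
    have h1 : a' < w₀ := max_lt ha (by linarith [hw₀ t₀ ht₀])
    have h2 : ∀ t ∈ Set.Icc (0 : ℝ) 1, h t < a' := fun t ht =>
      lt_of_lt_of_le (by have := hmax ht; simp only [Set.mem_ofPred_eq] at this; linarith [hw₀ t₀ ht₀])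
        (le_max_right _ _)
    filter_upwards [hw, hlim.eventually_lt_const (integral_inv_strictAnti hc h2 h1)] with i h3 h4
    refine lt_of_le_of_lt (le_max_left a ((h t₀ + w₀) / 2)) ?_
    by_contra! hle
    rcases hle.eq_or_lt with h5 | h5
    · rw [h5] at h4; exact lt_irrefl _ h4
    · exact lt_asymm h4 (integral_inv_strictAnti hc h3 h5)
  · intro b hb
    filter_upwards [hlim.eventually_const_lt (integral_inv_strictAnti hc hw₀ hb)] with i h4
    by_contra! hle
    have h2 : ∀ t ∈ Set.Icc (0 : ℝ) 1, h t < b := fun t ht => (hw₀ t ht).trans hb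
    rcases hle.eq_or_lt with h5 | h5
    · rw [h5] at h4; exact lt_irrefl _ h4
    · exact lt_asymm h4 (integral_inv_strictAnti hc h2 h5)

theorem dF_ofReal (f : ℝ → ℝ) (w : ℝ) :
    dF f w = ((∫ t in (0 : ℝ)..1, (w - limitPole f t)⁻¹ : ℝ) : ℂ) := by
  rw [dF_eq, ← intervalIntegral.integral_ofReal]
  congr 1; ext t; push_cast; rfl

theorem TwiceDifferentiable.ne_limitPole_of_ne_zero {f : ℝ → ℝ} (hf : TwiceDifferentiable f)
    {y w : ℂ} (hcrit : IsCriticalPoint f y w) (hy : y ≠ 0) {t : ℝ} (ht : t ∈ Set.Icc (0 : ℝ) 1) :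
    w ≠ limitPole f t := by
  have : ∃ t₁ ∈ Set.Icc (0 : ℝ) 1, w ≠ limitPole f t₁ := by
    by_contra! hall
    refine hy ?_
    rw [← hcrit.2, dF_eq]
    refine (intervalIntegral.integral_congr (g := fun _ => (0 : ℂ)) fun t ht => ?_).trans (by simp)
    rw [Set.uIcc_of_le zero_le_one] at ht
    simp only []
    rw [← hall t ht, sub_self, inv_zero]
  obtain ⟨t₁, ht₁, h1⟩ := this
  exact hf.ne_limitPole hcrit ht₁ h1 ht

theorem integral_inv_pos {h : ℝ → ℝ} {w : ℝ} (hc : ContinuousOn h (Set.Icc 0 1))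
    (hw : ∀ t ∈ Set.Icc (0 : ℝ) 1, h t < w) : 0 < ∫ t in (0 : ℝ)..1, (w - h t)⁻¹ := by
  refine intervalIntegral_pos_of_ae_pos (ContinuousOn.intervalIntegrable_of_Icc zero_le_one
    ((continuousOn_const.sub hc).inv₀ fun t ht => (sub_pos.mpr (hw t ht)).ne')) ?_
  exact ae_of_all _ fun t ht => inv_pos.mpr (sub_pos.mpr (hw t ⟨ht.1.le, ht.2⟩))

/-- A real critical point for `y ≠ 0` lies on the side of the limiting poles given by the sign of
`y`. -/
theorem TwiceDifferentiable.side {f : ℝ → ℝ} (hf : TwiceDifferentiable f) {y w s : ℝ}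
    (hcrit : IsCriticalPoint f y w) (hs : s = 1 ∨ s = -1) (hy : 0 < s * y) {t : ℝ}
    (ht : t ∈ Set.Icc (0 : ℝ) 1) : 0 < s * (w - limitPole f t) := by
  have hy0 : y ≠ 0 := fun h => by simp [h] at hy
  have hne : ∀ t ∈ Set.Icc (0 : ℝ) 1, w ≠ limitPole f t := fun t ht h =>
    hf.ne_limitPole_of_ne_zero hcrit (by exact_mod_cast hy0) ht (by exact_mod_cast h)
  have hint : ∫ t in (0 : ℝ)..1, (w - limitPole f t)⁻¹ = y := by
    have := hcrit.2
    rw [dF_ofReal] at this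
    exact_mod_cast this
  rcases hf.lt_or_gt hne with h | h
  · have := integral_inv_pos hf.continuousOn h
    rw [hint] at this
    rcases hs with rfl | rfl
    · linarith [h t ht]
    · linarith
  · have := integral_inv_pos (h := fun t => -limitPole f t) (w := -w) hf.continuousOn.neg
      fun t ht => neg_lt_neg (h t ht)
    have e : ∫ t in (0 : ℝ)..1, (-w - -limitPole f t)⁻¹ = -y := by
      rw [← hint, ← intervalIntegral.integral_neg]
      congr 1; ext t
      rw [← inv_neg]; congr 1; ring
    rw [e] at this
    rcases hs with rfl | rfl
    · linarith
    · linarith [h t ht]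

theorem F_re_eq_of_sign {f : ℝ → ℝ} (hf : TwiceDifferentiable f) {w s : ℝ} (hs : s = 1 ∨ s = -1)
    (h : ∀ t ∈ Set.Icc (0 : ℝ) 1, 0 < s * (w - limitPole f t)) :
    (F f w).re = ∫ t in (0 : ℝ)..1, Real.log (s * (w - limitPole f t)) := by
  rcases hs with rfl | rfl
  · rw [F_re_eq_of_lt (ae_of_all _ fun t ht => by
      have := h t ⟨ht.1.le, ht.2⟩; rw [limitPole] at this; linarith)]
    simp [limitPole]
  · have e : ∀ t, f t + 1 - t - w = -1 * (w - limitPole f t) := fun t => by rw [limitPole]; ring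
    rw [F_re_eq_of_gt (ae_of_all _ fun t ht => by
      have := h t ⟨ht.1.le, ht.2⟩; rw [limitPole] at this; linarith)]
    · simp only [e]
    · simp only [e]
      exact ContinuousOn.intervalIntegrable_of_Icc zero_le_one
        ((continuousOn_const.mul (continuousOn_const.sub hf.continuousOn)).log
          fun t ht => (h t ht).ne')

theorem tendsto_prod_mul_exp_F {α : Type*} {l : Filter α} {n : α → ℕ} (hn : Tendsto n l atTop)
    {f : ℝ → ℝ} (hf : TwiceDifferentiable f) {w : α → ℝ} {w₀ s : ℝ} (hw : Tendsto w l (𝓝 w₀))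
    (hs : s = 1 ∨ s = -1) {ρ : ℝ} (hρ : 0 < ρ)
    (hdist : ∀ᶠ i in l, ∀ t ∈ Set.Icc (0 : ℝ) 1, ρ ≤ s * (w i - limitPole f t))
    (hdist0 : ∀ t ∈ Set.Icc (0 : ℝ) 1, ρ ≤ s * (w₀ - limitPole f t)) :
    Tendsto (fun i => (∏ j : Fin (n i), s * (w i - limitPole f (((j : ℕ) + 1 : ℝ) / n i))) *
      Real.exp (-(n i * (F f (w i)).re))) l
      (𝓝 √((w₀ - limitPole f 1) / (w₀ - limitPole f 0))) := by
  have hs0 : s ≠ 0 := by rcases hs with rfl | rfl <;> norm_num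
  have hsabs : |s| = 1 := by rcases hs with rfl | rfl <;> norm_num
  have hcast : ∀ x t : ℝ, (s : ℂ) * ((x : ℂ) - limitPole f t) =
      ((s * (x - limitPole f t) : ℝ) : ℂ) := fun x t => by push_cast; rfl
  have key := tendsto_trapezoid_log hn hf (w := fun i => (w i : ℂ)) (w₀ := (w₀ : ℂ))
    ((Complex.continuous_ofReal.tendsto _).comp hw) (s := (s : ℂ)) (by exact_mod_cast hs0) hρ
    (hdist.mono fun i hi t ht => by
      rw [← Complex.ofReal_sub, Complex.norm_real, Real.norm_eq_abs]
      refine (hi t ht).trans ((le_abs_self _).trans_eq ?_)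
      rw [abs_mul, hsabs, one_mul])
    (hdist.mono fun i hi t ht => by
      rw [hcast]; exact Complex.ofReal_mem_slitPlane.mpr (hρ.trans_le (hi t ht)))
    (fun t ht => by
      rw [hcast]; exact Complex.ofReal_mem_slitPlane.mpr (hρ.trans_le (hdist0 t ht)))
  have key2 := Real.continuous_exp.tendsto _ |>.comp ((Complex.continuous_re.tendsto _).comp key)
  have h1 := hρ.trans_le (hdist0 1 (by simp))
  have h0 := hρ.trans_le (hdist0 0 (by simp))
  refine (key2.congr' ?_).trans_eq ?_
  · filter_upwards [hdist] with i hi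
    have hpos : ∀ t ∈ Set.Icc (0 : ℝ) 1, 0 < s * (w i - limitPole f t) := fun t ht =>
      hρ.trans_le (hi t ht)
    simp only [Function.comp_apply]
    have e1 : ∑ j : Fin (n i), Complex.log (s * (w i - limitPole f (((j : ℕ) + 1 : ℝ) / n i))) =
        ((∑ j : Fin (n i), Real.log (s * (w i - limitPole f (((j : ℕ) + 1 : ℝ) / n i))) : ℝ) : ℂ) := by
      push_cast
      refine Finset.sum_congr rfl fun j _ => ?_
      rw [hcast, Complex.ofReal_log (hpos _ (grid_mem j)).le]
    have e2 : ∫ t in (0 : ℝ)..1, Complex.log (s * (w i - limitPole f t)) =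
        ((∫ t in (0 : ℝ)..1, Real.log (s * (w i - limitPole f t)) : ℝ) : ℂ) := by
      rw [← intervalIntegral.integral_ofReal]
      refine intervalIntegral.integral_congr fun t ht => ?_
      rw [Set.uIcc_of_le zero_le_one] at ht
      rw [hcast, Complex.ofReal_log (hpos _ ht).le]
    rw [e1, e2, F_re_eq_of_sign hf hs hpos, ← Complex.ofReal_natCast, ← Complex.ofReal_mul,
      ← Complex.ofReal_sub, Complex.ofReal_re, sub_eq_add_neg, Real.exp_add,
      ← Real.log_prod fun j _ => (hpos _ (grid_mem j)).ne',
      Real.exp_log (Finset.prod_pos fun j _ => hpos _ (grid_mem j))]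
  · congr 1
    rw [hcast, hcast, ← Complex.ofReal_log h1.le, ← Complex.ofReal_log h0.le, ← Complex.ofReal_sub,
      ← Complex.ofReal_ofNat, ← Complex.ofReal_div, Complex.ofReal_re, ← Real.log_div h1.ne' h0.ne',
      mul_div_mul_left _ _ hs0, Real.sqrt_eq_rpow, Real.rpow_def_of_pos]
    · congr 1; ring
    · rw [← mul_div_mul_left _ _ hs0]; positivity

end SchurAsymp

namespace SchurAsymp

open MeasureTheory

theorem RefinedBall.continuousAt_d2F {ν : ℕ → ℕ} {lam : ∀ k, Fin (ν k) → ℤ} {f : ℝ → ℝ} {g : ℂ → ℂ}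
    {w₀ : ℂ} {ρ : ℝ} (h : RefinedBall lam f g w₀ ρ) (hf : TwiceDifferentiable f) :
    ContinuousAt (d2F f) w₀ := by
  have hm := hf.intervalIntegrable.1.aestronglyMeasurable
  have hd : DifferentiableOn ℂ (dF f) (Metric.ball w₀ ρ) := fun w hw =>
    (hasDerivAt_dF hm h.pos (ae_of_all _ fun t ht =>
      h.le_norm hw ⟨ht.1.le, ht.2⟩)).differentiableAt.differentiableWithinAt
  exact (hd.deriv Metric.isOpen_ball).continuousOn.continuousAt
    (Metric.ball_mem_nhds _ h.pos)

/-- The poles lie on the same side of an admissible real critical point as the limiting poles. -/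
theorem RefinedBall.eventually_side {ν : ℕ → ℕ} {lam : ∀ k, Fin (ν k) → ℤ} {f : ℝ → ℝ} {g : ℂ → ℂ}
    {w₀ ρ y s : ℝ} (h : RefinedBall lam f g w₀ ρ) (hf : TwiceDifferentiable f)
    (hν : Tendsto ν atTop atTop) (hcrit : IsCriticalPoint f y w₀) (hs : s = 1 ∨ s = -1)
    (hy : 0 < s * y) (hadm : ∀ᶠ k in atTop, w₀ ∉ sigInterval (lam k)) :
    ∀ᶠ k in atTop, ∀ j, ρ ≤ s * (w₀ - pole (lam k) j) := by
  have h1 := h.tendsto_mean_inv hf hν (κ := id) tendsto_id (w := fun _ => (w₀ : ℂ))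
    tendsto_const_nhds
  have hs' : Tendsto (fun k => (((√(ν k : ℝ))⁻¹ : ℝ) : ℂ)) atTop (𝓝 0) := by
    have := (Complex.continuous_ofReal.tendsto 0).comp (tendsto_sqrt_inv hν)
    rwa [Complex.ofReal_zero] at this
  have h2 := (hs'.mul h1).const_sub (dF f w₀)
  rw [mul_zero, sub_zero] at h2
  have h3 := ((Complex.continuous_re.tendsto _).comp h2).const_mul s
  rw [hcrit.2, Complex.ofReal_re, ← hcrit.2] at h3
  filter_upwards [h3.eventually_const_lt hy, hadm, h.ne_pole, hν.eventually_gt_atTop 0]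
    with k hk hak hpk h0 j
  have hpos : (0 : ℝ) < ν k := by exact_mod_cast h0
  have hr : ((√(ν k : ℝ) : ℝ) : ℂ) ≠ 0 := Complex.ofReal_ne_zero.mpr (Real.sqrt_pos.mpr hpos).ne'
  have e : dF f w₀ - (((√(ν k : ℝ))⁻¹ : ℝ) : ℂ) * (((√(ν (id k) : ℝ) : ℝ) : ℂ) *
      (dF f w₀ - (∑ j, ((w₀ : ℂ) - pole (lam (id k)) j)⁻¹) / ν (id k))) =
      (((∑ j, (w₀ - pole (lam k) j)⁻¹) / ν k : ℝ) : ℂ) := by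
    rw [Complex.ofReal_inv]
    simp only [id]
    rw [inv_mul_cancel_left₀ hr]
    push_cast; ring
  simp only [Function.comp_apply] at hk
  rw [e, Complex.ofReal_re] at hk
  have hside : 0 < s * (w₀ - pole (lam k) j) := by
    have hne : (Finset.univ : Finset (Fin (ν k))).Nonempty := ⟨j, Finset.mem_univ j⟩
    rcases not_mem_sigInterval_iff.mp hak with hl | hr
    · have hneg : (∑ j, (w₀ - pole (lam k) j)⁻¹) / ν k < 0 := by
        refine div_neg_of_neg_of_pos (Finset.sum_neg (fun j _ => ?_) hne) hpos
        exact inv_neg''.mpr (sub_neg.mpr (lt_pole_of_lt_parts hl j))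
      have := lt_pole_of_lt_parts hl j
      rcases hs with rfl | rfl <;> linarith
    · have hneg : 0 < (∑ j, (w₀ - pole (lam k) j)⁻¹) / ν k := by
        refine div_pos (Finset.sum_pos (fun j _ => ?_) hne) hpos
        exact inv_pos.mpr (sub_pos.mpr (pole_lt_of_parts_lt hr j))
      have := pole_lt_of_parts_lt hr j
      rcases hs with rfl | rfl <;> linarith
  by_contra! hlt
  refine hpk (pole (lam k) j) ?_ j rfl
  rw [mem_ball_iff_norm, ← Complex.ofReal_sub, Complex.norm_real, Real.norm_eq_abs, abs_lt]
  rcases hs with rfl | rfl <;> constructor <;> linarith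

theorem real_main_term_algebra {s σ φ E r D A B e₁ e₂ x R : ℝ} {z : ℂ} (hs : s * s = 1)
    (hσ : σ * σ = 1) (hx : x ≠ 0) (hr : r ≠ 0) (hA : A ≠ 0) (hB : B ≠ 0) (hE : E ≠ 0) (h₁ : e₁ ≠ 0)
    (h₂ : e₂ ≠ 0) :
    ((φ * E / r * (s * (r * (D * A * e₁))) * (σ * s * B * e₂)⁻¹ * R⁻¹ : ℝ) : ℂ) *
      (z / ((A / B : ℝ) : ℂ)) =
    ((φ / x * D : ℝ) : ℂ) / (((R * (e₁⁻¹ * e₂ / (E * (σ * x))) : ℝ) : ℂ) / z) := by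
  have hreal : φ * E / r * (s * (r * (D * A * e₁))) * (σ * s * B * e₂)⁻¹ * R⁻¹ / (A / B) =
      φ / x * D / (R * (e₁⁻¹ * e₂ / (E * (σ * x)))) := by
    have h1 : s = 1 ∨ s = -1 := mul_self_eq_one_iff.mp hs
    have h2 : σ = 1 ∨ σ = -1 := mul_self_eq_one_iff.mp hσ
    rw [← div_div (φ / x * D) R, div_eq_mul_inv (φ / x * D) R]
    generalize R⁻¹ = R'
    rcases h1 with rfl | rfl <;> rcases h2 with rfl | rfl <;> field_simp
  have key : ∀ a b c d : ℂ, a / b = c / d → a * (z / b) = c / (d / z) := fun a b c d h => by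
    rw [mul_div_left_comm, div_div_eq_mul_div, mul_comm c z, mul_div_assoc, h]
  refine key _ _ _ _ ?_
  rw [← Complex.ofReal_div, ← Complex.ofReal_div, hreal]

theorem sqrt_constants {a c m : ℝ} (ha : 0 < a) (hc : 0 < c) (hm : 0 < m) :
    √a * (1 / √(a * m)) * (√c⁻¹)⁻¹ * (√(c / m))⁻¹ = 1 := by
  rw [Real.sqrt_inv, inv_inv, Real.sqrt_div hc.le, Real.sqrt_mul ha.le]
  have := (Real.sqrt_pos.mpr hc).ne'
  have := (Real.sqrt_pos.mpr hm).ne'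
  have := (Real.sqrt_pos.mpr ha).ne'
  field_simp

theorem tendsto_normSchur_div_realMainTerm {ν : ℕ → ℕ} (hν : Tendsto ν atTop atTop)
    {lam : ∀ k, Fin (ν k) → ℤ} (hlam : ∀ k, Antitone (lam k)) {f : ℝ → ℝ}
    (hf : TwiceDifferentiable f) {g : ℂ → ℂ} {α : Type*} {l : Filter α} [l.IsCountablyGenerated]
    {κ : α → ℕ} (hκ : Tendsto κ l atTop) {y w : α → ℝ} {y₀ w₀ ρ s : ℝ}
    (h : RefinedBall lam f g w₀ ρ) (hs : s = 1 ∨ s = -1) (hy₀ : 0 < s * y₀)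
    (hcrit₀ : IsCriticalPoint f y₀ w₀) (hadm : ∀ᶠ k in atTop, w₀ ∉ sigInterval (lam k))
    (hd2 : d2F f w₀ ≠ 0) (hy : Tendsto y l (𝓝 y₀))
    (hcrit : ∀ᶠ i in l, IsCriticalPoint f (y i) (w i)) :
    Tendsto (fun i => ((normSchur (lam (κ i)) (Real.exp (y i)) : ℝ) : ℂ) /
      realMainTerm (ν (κ i)) f g (y i) (w i)) l (𝓝 1) := by
  have hn := hν.comp hκ
  have hρ := h.pos
  have hs2 : s * s = 1 := by rcases hs with rfl | rfl <;> norm_num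
  have hs0 : s ≠ 0 := by rcases hs with rfl | rfl <;> norm_num
  have hsabs : |s| = 1 := by rcases hs with rfl | rfl <;> norm_num
  have hyev : ∀ᶠ i in l, 0 < s * y i := (hy.const_mul s).eventually_const_lt hy₀
  have hside0 := fun t (ht : t ∈ Set.Icc (0 : ℝ) 1) => hf.side hcrit₀ hs hy₀ ht
  have hside : ∀ᶠ i in l, ∀ t ∈ Set.Icc (0 : ℝ) 1, 0 < s * (w i - limitPole f t) := by
    filter_upwards [hyev, hcrit] with i h1 h2 t ht using hf.side h2 hs h1 ht
  have hint : ∀ {y w : ℝ}, IsCriticalPoint f y w → ∫ t in (0 : ℝ)..1, (w - limitPole f t)⁻¹ = y := by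
    intro y w hc
    have := hc.2
    rw [dF_ofReal] at this
    exact_mod_cast this
  have hsint : ∀ w : ℝ, ∫ t in (0 : ℝ)..1, (s * w - s * limitPole f t)⁻¹ =
      s * ∫ t in (0 : ℝ)..1, (w - limitPole f t)⁻¹ := by
    intro w
    rw [← intervalIntegral.integral_const_mul]
    congr 1; ext t
    rw [← mul_sub, mul_inv, show s⁻¹ = s from inv_eq_of_mul_eq_one_left hs2]
  have hw : Tendsto w l (𝓝 w₀) := by
    have h1 : Tendsto (fun i => s * w i) l (𝓝 (s * w₀)) := by
      refine tendsto_of_tendsto_integral_inv (h := fun t => s * limitPole f t)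
        (continuousOn_const.mul hf.continuousOn) ?_ ?_ ?_
      · filter_upwards [hside] with i hi t ht
        linarith [hi t ht]
      · intro t ht
        linarith [hside0 t ht]
      · rw [hsint, hint hcrit₀]
        refine (hy.const_mul s).congr' ?_
        filter_upwards [hcrit] with i hi
        rw [hsint, hint hi]
    have h2 := h1.const_mul s
    simpa only [← mul_assoc, hs2, one_mul] using h2
  have hwC : Tendsto (fun i => (w i : ℂ)) l (𝓝 (w₀ : ℂ)) :=
    (Complex.continuous_ofReal.tendsto _).comp hw
  have habs : ∀ x t : ℝ, 0 < s * (x - limitPole f t) →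
      ‖(x : ℂ) - limitPole f t‖ = s * (x - limitPole f t) := by
    intro x t hx
    rw [← Complex.ofReal_sub, Complex.norm_real, Real.norm_eq_abs, ← abs_of_pos hx, abs_mul, hsabs,
      one_mul]
  set m := -(d2F f w₀).re with hm
  have hmean := h.tendsto_mean_inv_sq hf hν hκ hwC
  have hcastsq : ∀ i, (∑ j, (((w i : ℂ) - pole (lam (κ i)) j)⁻¹) ^ 2) / ν (κ i) =
      (((∑ j, ((w i - pole (lam (κ i)) j)⁻¹) ^ 2) / ν (κ i) : ℝ) : ℂ) := fun i => by push_cast; rfl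
  have hmeanR : Tendsto (fun i => (∑ j, ((w i - pole (lam (κ i)) j)⁻¹) ^ 2) / (ν (κ i) : ℝ)) l
      (𝓝 m) := by
    have := (Complex.continuous_re.tendsto _).comp hmean
    rw [Complex.neg_re, ← hm] at this
    refine this.congr fun i => ?_
    rw [Function.comp_apply, hcastsq, Complex.ofReal_re]
  by_cases hbot : l = ⊥
  · rw [hbot]; exact tendsto_bot
  have : l.NeBot := ⟨hbot⟩
  have him : (d2F f w₀).im = 0 := by
    have := (Complex.continuous_im.tendsto _).comp hmean
    have h0 : Tendsto (fun _ : α => (0 : ℝ)) l (𝓝 (-d2F f w₀).im) := by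
      refine this.congr fun i => ?_
      rw [Function.comp_apply, hcastsq, Complex.ofReal_im]
    have := tendsto_nhds_unique h0 tendsto_const_nhds
    rwa [Complex.neg_im, neg_eq_zero] at this
  have hm0 : 0 < m := by
    refine lt_of_le_of_ne (ge_of_tendsto' hmeanR fun i => by positivity) fun h0 => hd2 ?_
    exact Complex.ext (by rw [Complex.zero_re]; linarith) (by rw [him, Complex.zero_im])
  have hpole : ∀ᶠ i in l, ∀ j, ρ / 2 ≤ s * (w i - pole (lam (κ i)) j) := by
    have h1 := hκ.eventually (h.eventually_side hf hν hcrit₀ hs hy₀ hadm)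
    have h2 : ∀ᶠ i in l, |w i - w₀| < ρ / 2 := by
      have := Metric.tendsto_nhds.mp hw (ρ / 2) (by positivity)
      simpa only [Real.dist_eq] using this
    filter_upwards [h1, h2] with i hi hi2 j
    have := hi j
    rw [abs_lt] at hi2
    rcases hs with rfl | rfl <;> linarith
  have hsaddle : Tendsto (fun i => √(ν (κ i) : ℝ) *
      (y i - (∑ j, (w i - pole (lam (κ i)) j)⁻¹) / ν (κ i))) l (𝓝 0) := by
    have := (Complex.continuous_re.tendsto _).comp (h.tendsto_mean_inv hf hν hκ hwC)
    rw [Complex.zero_re] at this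
    refine this.congr' ?_
    filter_upwards [hcrit] with i hi
    rw [Function.comp_apply, hi.2]
    have : ((√(ν (κ i) : ℝ) : ℝ) : ℂ) * ((y i : ℂ) - (∑ j, ((w i : ℂ) - pole (lam (κ i)) j)⁻¹) /
      ν (κ i)) = ((√(ν (κ i) : ℝ) * (y i - (∑ j, (w i - pole (lam (κ i)) j)⁻¹) / ν (κ i)) : ℝ) : ℂ) := by
      push_cast; rfl
    rw [this, Complex.ofReal_re]
  have hDD : Tendsto (fun i => s * (√(ν (κ i) : ℝ) *
      (ddExp Finset.univ (pole (lam (κ i))) (ν (κ i) * y i) * (∏ j, (w i - pole (lam (κ i)) j)) *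
      Real.exp (-(ν (κ i) * y i * w i))))) l (𝓝 (1 / √(2 * Real.pi * m))) := by
    have hinj : ∀ᶠ i in l, Function.Injective (pole (lam (κ i))) :=
      Eventually.of_forall fun i => (pole_strictAnti (hlam (κ i))).injective
    rcases hs with rfl | rfl
    · simp only [one_mul] at hyev hpole ⊢
      exact tendsto_ddExp (n := fun i => ν (κ i)) (p := fun i => pole (lam (κ i))) hn
        (half_pos hρ) hm0 hinj hyev hpole hsaddle hmeanR
    · simp only [neg_mul, one_mul, neg_sub] at hyev hpole ⊢
      exact tendsto_ddExp_of_neg (n := fun i => ν (κ i)) (p := fun i => pole (lam (κ i))) hn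
        (half_pos hρ) hm0 hinj (hyev.mono fun i hi => by linarith) hpole hsaddle hmeanR
  have hfac := tendsto_factorialRatio.comp hn
  have hfar : ∀ᶠ i in l, ∀ t ∈ Set.Icc (0 : ℝ) 1, ρ ≤ s * (w i - limitPole f t) := by
    filter_upwards [hside, hwC.eventually_mem (Metric.ball_mem_nhds _ hρ)] with i h1 h2 t ht
    rw [← habs _ _ (h1 t ht)]
    exact h.le_norm h2 ht
  have hfar0 : ∀ t ∈ Set.Icc (0 : ℝ) 1, ρ ≤ s * (w₀ - limitPole f t) := by
    intro t ht
    rw [← habs _ _ (hside0 t ht)]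
    exact h.le_norm h.mem ht
  have hprod := tendsto_prod_mul_exp_F hn hf hw hs hρ hfar hfar0
  have hpr := h.tendsto_poleRatio hκ hwC
  have hg0 : g w₀ ≠ 0 := h.ne_zero _ h.mem
  have hgw : Tendsto (fun i => g (w i)) l (𝓝 (g w₀)) :=
    ((h.differentiableOn.continuousOn.continuousAt (Metric.ball_mem_nhds _ hρ)).tendsto).comp hwC
  have hd2w : Tendsto (fun i => (d2F f (w i)).re) l (𝓝 (-m)) := by
    have := (Complex.continuous_re.tendsto _).comp ((h.continuousAt_d2F hf).tendsto.comp hwC)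
    rw [hm, neg_neg]; exact this
  have e0 : ∀ x : ℝ, x - limitPole f 0 = x - f 0 - 1 := fun x => by rw [limitPole]; ring
  have e1 : ∀ x : ℝ, x - limitPole f 1 = x - f 1 := fun x => by rw [limitPole]; ring
  have hx0 : 0 < s * (w₀ - f 0 - 1) := by rw [← e0]; exact hside0 0 (by simp)
  have hx1 : 0 < s * (w₀ - f 1) := by rw [← e1]; exact hside0 1 (by simp)
  have hx0' : w₀ - f 0 - 1 ≠ 0 := right_ne_zero_of_mul hx0.ne'
  have hx1' : w₀ - f 1 ≠ 0 := right_ne_zero_of_mul hx1.ne'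
  have hquot : 0 < (w₀ - f 0 - 1) / (w₀ - f 1) := by
    rw [← mul_div_mul_left _ _ hs0]; positivity
  have hroot : Tendsto (fun i => √(-((w i - f 0 - 1) / ((d2F f (w i)).re * (w i - f 1))))) l
      (𝓝 √((w₀ - f 0 - 1) / (w₀ - f 1) / m)) := by
    refine (Real.continuous_sqrt.tendsto _).comp ?_
    have := ((hw.sub_const (f 0)).sub_const 1 |>.div (hd2w.mul (hw.sub_const (f 1)))
      (mul_ne_zero (neg_ne_zero.mpr hm0.ne') hx1')).neg
    refine this.trans_eq ?_
    congr 1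
    field_simp
  have hroot0 : √((w₀ - f 0 - 1) / (w₀ - f 1) / m) ≠ 0 := (Real.sqrt_pos.mpr (by positivity)).ne'
  have hprod0 : √((w₀ - limitPole f 1) / (w₀ - limitPole f 0)) ≠ 0 := by
    rw [e0, e1]
    refine (Real.sqrt_pos.mpr ?_).ne'
    rw [← inv_div]; positivity
  have hreal := ((hfac.mul hDD).mul (hprod.inv₀ hprod0)).mul (hroot.inv₀ hroot0)
  have hrealC := (Complex.continuous_ofReal.tendsto _).comp hreal
  have hall := hrealC.mul (hgw.div hpr hg0)
  rw [div_self hg0, mul_one] at hall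
  have hlimit : √(2 * Real.pi) * (1 / √(2 * Real.pi * m)) *
      (√((w₀ - limitPole f 1) / (w₀ - limitPole f 0)))⁻¹ *
      (√((w₀ - f 0 - 1) / (w₀ - f 1) / m))⁻¹ = 1 := by
    rw [e0, e1, ← inv_div (w₀ - f 0 - 1)]
    exact sqrt_constants (by positivity) hquot hm0
  rw [hlimit, Complex.ofReal_one] at hall
  refine hall.congr' ?_
  filter_upwards [hyev, hfar, hpole, hn.eventually_gt_atTop 0] with i hyi hfi hpi h0
  have h0 : 0 < ν (κ i) := h0
  have hpos : (0 : ℝ) < ν (κ i) := by exact_mod_cast h0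
  have hyi0 : y i ≠ 0 := right_ne_zero_of_mul hyi.ne'
  have hexp : Real.exp (y i) - 1 ≠ 0 := sub_ne_zero.mpr fun h => hyi0 ((Real.exp_eq_one_iff _).mp h)
  have hsexp : |Real.exp (y i) - 1| = s * (Real.exp (y i) - 1) := by
    rcases hs with rfl | rfl
    · rw [one_mul, abs_of_pos]
      linarith [Real.one_lt_exp_iff.mpr (by linarith : 0 < y i)]
    · rw [abs_of_neg, neg_one_mul]
      linarith [Real.exp_lt_one_iff.mpr (by linarith : y i < 0)]
  simp only [Function.comp_apply]
  rw [normSchur_exp_real h0 (hlam _) hyi0, realMainTerm, hsexp]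
  rw [show ((ν (κ i) : ℕ) : ℤ) - 1 = ((ν (κ i) - 1 : ℕ) : ℤ) by omega, zpow_natCast, mul_pow]
  have hqne : ∀ j : Fin (ν (κ i)), w i - limitPole f (((j : ℕ) + 1 : ℝ) / ν (κ i)) ≠ 0 := fun j =>
    right_ne_zero_of_mul (hρ.trans_le (hfi _ (grid_mem j))).ne'
  have hpne : ∀ j : Fin (ν (κ i)), w i - pole (lam (κ i)) j ≠ 0 := fun j =>
    right_ne_zero_of_mul ((half_pos hρ).trans_le (hpi j)).ne'
  have hratio : poleRatio (pole (lam (κ i))) (fun j => limitPole f (((j : ℕ) + 1 : ℝ) / ν (κ i))) (w i) =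
      (((∏ j, (w i - pole (lam (κ i)) j)) /
        ∏ j : Fin (ν (κ i)), (w i - limitPole f (((j : ℕ) + 1 : ℝ) / ν (κ i))) : ℝ) : ℂ) := by
    rw [poleRatio, Finset.prod_div_distrib]; push_cast; rfl
  have hA0 : ∏ j, (w i - pole (lam (κ i)) j) ≠ 0 := Finset.prod_ne_zero_iff.mpr fun j _ => hpne j
  have hB0 : ∏ j : Fin (ν (κ i)), (w i - limitPole f (((j : ℕ) + 1 : ℝ) / ν (κ i))) ≠ 0 :=
    Finset.prod_ne_zero_iff.mpr fun j _ => hqne j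
  have hexps : Real.exp (ν (κ i) * (y i * w i - (F f (w i)).re)) =
      (Real.exp (-(ν (κ i) * y i * w i)))⁻¹ * Real.exp (-(ν (κ i) * (F f (w i)).re)) := by
    rw [← Real.exp_neg, ← Real.exp_add]; congr 1; ring
  have hsn : s ^ ν (κ i) = s ^ (ν (κ i) - 1) * s := by
    rw [← pow_succ]; congr 1; omega
  rw [Pi.div_apply, hratio, Finset.prod_mul_distrib, Finset.prod_const, Finset.card_univ,
    Fintype.card_fin, hexps, hsn]
  exact real_main_term_algebra hs2 (by rw [← mul_pow, hs2, one_pow]) (pow_ne_zero _ hexp)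
    (Real.sqrt_pos.mpr hpos).ne' hA0 hB0 (Real.exp_ne_zero _) (Real.exp_ne_zero _)
    (Real.exp_ne_zero _)

theorem refined_asymptotics_real {ν : ℕ → ℕ} (hν : Tendsto ν atTop atTop)
    {lam : ∀ k, Fin (ν k) → ℤ} (hlam : ∀ k, Antitone (lam k)) {f : ℝ → ℝ}
    (hf : TwiceDifferentiable f) {M : Set ℂ} {g : ℂ → ℂ} (hM : IsOpen M)
    (hQ : TendstoUniformlyOn (fun k w => Complex.exp (Q (lam k) f w)) g atTop M)
    {K : Set ℝ} {w₀ : ℝ → ℝ} (hK : IsCompact K)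
    (h : ∀ y ∈ K, y ≠ 0 ∧ IsCriticalPoint f y (w₀ y) ∧
      (∀ᶠ k in atTop, w₀ y ∉ sigInterval (lam k)) ∧
      (w₀ y : ℂ) ∈ M ∧ g (w₀ y) ≠ 0 ∧ d2F f (w₀ y) ≠ 0) :
    TendstoUniformlyOn (fun k y => ((normSchur (lam k) (Real.exp y) : ℝ) : ℂ) /
      realMainTerm (ν k) f g y (w₀ y)) (fun _ => 1) atTop K := by
  rw [← tendstoLocallyUniformlyOn_iff_tendstoUniformlyOn_of_compact hK,
    tendstoLocallyUniformlyOn_iff_forall_tendsto]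
  intro y hy
  obtain ⟨hy0, hcrit, hadm, hwM, hg, hd2⟩ := h y hy
  rw [← Uniform.tendsto_nhds_right]
  obtain ⟨s, hs, hsy⟩ : ∃ s : ℝ, (s = 1 ∨ s = -1) ∧ 0 < s * y := by
    rcases hy0.lt_or_gt with h | h
    · exact ⟨-1, Or.inr rfl, by linarith⟩
    · exact ⟨1, Or.inl rfl, by linarith⟩
  obtain ⟨ρ, hρ⟩ := exists_refinedBall hν hf hM hQ hwM hg (fun t ht =>
    hf.ne_limitPole_of_ne_zero hcrit (by exact_mod_cast hy0) ht) (by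
      filter_upwards [hadm] with k hk j heq
      have heq : w₀ y = pole (lam k) j := by exact_mod_cast heq
      rcases not_mem_sigInterval_iff.mp hk with h | h
      · exact (lt_pole_of_lt_parts h j).ne heq
      · exact (pole_lt_of_parts_lt h j).ne' heq)
  have hsnd : Tendsto (fun i : ℕ × ℝ => i.2) (atTop ×ˢ 𝓝[K] y) (𝓝[K] y) := tendsto_snd
  exact tendsto_normSchur_div_realMainTerm hν hlam hf (κ := fun i : ℕ × ℝ => i.1)
    (y := fun i => i.2) (w := fun i => w₀ i.2) tendsto_fst hρ hs hsy hcrit hadm hd2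
    (hsnd.mono_right nhdsWithin_le_nhds)
    ((hsnd.eventually self_mem_nhdsWithin).mono fun i hi => (h i.2 hi).2.1)

end SchurAsymp

namespace SchurAsymp

open MeasureTheory

section LocalContour

variable {α : Type*} {l : Filter α} {n : α → ℕ} {a : ∀ i, Fin (n i) → ℂ} {y : α → ℂ} {v : ℂ}
  {ρ κ : ℝ}

/-- The function `e^{n y z} / ∏ (1 + z / a_j)`. -/
noncomputable def localFn {n : ℕ} (a : Fin n → ℂ) (y z : ℂ) : ℂ :=
  Complex.exp (n * y * z) * (∏ j, (1 + z / a j))⁻¹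

theorem differentiableOn_localFn {n : ℕ} {a : Fin n → ℂ} {ρ : ℝ} (ha : ∀ j, ρ ≤ ‖a j‖)
    (y : ℂ) : DifferentiableOn ℂ (localFn a y) (Metric.ball 0 ρ) := by
  unfold localFn
  refine DifferentiableOn.mul (by fun_prop) (DifferentiableOn.inv (by fun_prop) fun z hz => ?_)
  refine Finset.prod_ne_zero_iff.mpr fun j _ h => ?_
  have h1 : z / a j = -1 := by linear_combination h
  have h2 := congrArg norm h1
  rw [mem_ball_zero_iff] at hz
  have h4 := ha j
  rw [norm_div, norm_neg, norm_one, div_eq_one_iff_eq (by linarith [norm_nonneg z])] at h2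
  linarith

theorem norm_cexp_le_of_norm_sub_le {X T E u : ℂ} {N κ η τ β : ℝ} (hN : 0 ≤ N) (hκ : 0 < κ)
    (hη : η ^ 2 = τ) (hX : ‖X - (-κ : ℝ)‖ ≤ κ / 16) (hu : ‖u - 1‖ ≤ 1 / 4)
    (hT : ‖T‖ ≤ N * (κ * τ / 32)) (hE : ‖E‖ ≤ N * (κ * τ * (β / 16))) (hβ : β ≤ 1) :
    ‖Complex.exp (T + N * (X * τ * u ^ 2 / 2) + E)‖ ≤ Real.exp (-(N * (κ * τ / 100))) := by
  rw [Complex.norm_exp, Real.exp_le_exp, Complex.add_re, Complex.add_re]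
  have h1 := (Complex.re_le_norm T).trans hT
  have h2 := (Complex.re_le_norm E).trans hE
  have hτ : 0 ≤ τ := hη ▸ sq_nonneg η
  have hu2 : ‖u ^ 2 - 1‖ ≤ 9 / 16 := by
    have e : u ^ 2 - 1 = (u - 1) * (u - 1 + 2) := by ring
    rw [e, norm_mul]
    have := norm_add_le (u - 1) 2
    rw [Complex.norm_ofNat] at this
    nlinarith [norm_nonneg (u - 1), norm_nonneg (u - 1 + 2)]
  have hun : ‖u ^ 2‖ ≤ 25 / 16 := by
    have := norm_add_le (u ^ 2 - 1) 1
    rw [sub_add_cancel, norm_one] at this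
    linarith
  have hure : 7 / 16 ≤ (u ^ 2).re := by
    have := Complex.abs_re_le_norm (u ^ 2 - 1)
    rw [Complex.sub_re, Complex.one_re] at this
    have := (abs_le.mp (this.trans hu2)).1
    linarith
  have h3 : (N * (X * τ * u ^ 2 / 2) : ℂ).re ≤ N * τ * (κ * (-87 / 512)) := by
    have e : (N * (X * τ * u ^ 2 / 2) : ℂ) =
        ((N * τ / 2 : ℝ) : ℂ) * ((X - (-κ : ℝ)) * u ^ 2 + ((-κ : ℝ) : ℂ) * u ^ 2) := by
      push_cast; ring
    rw [e, Complex.re_ofReal_mul, Complex.add_re, Complex.re_ofReal_mul]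
    have h4 := Complex.re_le_norm ((X - (-κ : ℝ)) * u ^ 2)
    rw [norm_mul] at h4
    have h5 : ‖X - (-κ : ℝ)‖ * ‖u ^ 2‖ ≤ κ / 16 * (25 / 16) :=
      mul_le_mul hX hun (norm_nonneg _) (by positivity)
    have h6 : ((X - (-κ : ℝ)) * u ^ 2).re + -κ * (u ^ 2).re ≤ κ * (-87 / 256) := by nlinarith
    have h7 := mul_le_mul_of_nonneg_left h6 (show 0 ≤ N * τ / 2 by positivity)
    linarith
  have h8 : N * (κ * τ * (β / 16)) ≤ N * (κ * τ * (1 / 16)) := by gcongr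
  nlinarith [mul_nonneg hN (mul_nonneg hκ.le hτ)]

theorem eventually_norm_localFn_le (hn : Tendsto n l atTop) (hρ : 0 < ρ)
    (hκ : 0 < κ) (hv : v ≠ 0) (ha : ∀ᶠ i in l, ∀ j, ρ ≤ ‖a i j‖)
    (h1 : Tendsto (fun i => (√(n i) : ℂ) * (y i - (∑ j, (a i j)⁻¹) / n i)) l (𝓝 0))
    (h2 : Tendsto (fun i => v ^ 2 * ((∑ j, (a i j)⁻¹ ^ 2) / n i)) l (𝓝 (-κ : ℝ)))
    {η : ℝ} (hη : 0 < η) (hη1 : 2 * (‖v‖ * η) ≤ ρ / 2) (hη2 : (‖v‖ / ρ) ^ 3 * η ≤ κ / 32) :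
    ∀ᶠ i in l, ∀ σ : ℝ, |σ| = η → ∀ z : ℂ, ‖z - v * σ‖ ≤ ‖v‖ * η / 4 →
      ‖localFn (a i) (y i) z‖ ≤ Real.exp (-(n i * (κ * η ^ 2 / 100))) := by
  have hv0 : 0 < ‖v‖ := norm_pos_iff.mpr hv
  have hsq : Tendsto (fun i => √(n i : ℝ)) l atTop :=
    Real.tendsto_sqrt_atTop.comp (tendsto_natCast_atTop_atTop.comp hn)
  have e1 : ∀ᶠ i in l, ‖(√(n i) : ℂ) * (y i - (∑ j, (a i j)⁻¹) / n i)‖ ≤ 1 :=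
    (h1.norm.eventually_le_const (by simp))
  have e2 : ∀ᶠ i in l, ‖v ^ 2 * ((∑ j, (a i j)⁻¹ ^ 2) / n i) - (-κ : ℝ)‖ ≤ κ / 16 := by
    have := (h2.sub_const ((-κ : ℝ) : ℂ)).norm
    rw [sub_self, norm_zero] at this
    exact this.eventually_le_const (by positivity)
  have e3 : ∀ᶠ i in l, 2 * (‖v‖ * η) / (κ * η ^ 2 / 32) ≤ √(n i : ℝ) := hsq.eventually_ge_atTop _
  filter_upwards [ha, e1, e2, e3, hn.eventually_gt_atTop 0] with i hai hT hX hbig h0 σ hσ z hz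
  have hpos : (0 : ℝ) < n i := by exact_mod_cast h0
  have hs : 0 < √(n i : ℝ) := Real.sqrt_pos.mpr hpos
  have hσ0 : σ ≠ 0 := fun h => by rw [h, abs_zero] at hσ; exact hη.ne hσ
  have hvσ : v * σ ≠ 0 := mul_ne_zero hv (Complex.ofReal_ne_zero.mpr hσ0)
  have hvn : ‖v * σ‖ = ‖v‖ * η := by rw [norm_mul, Complex.norm_real, Real.norm_eq_abs, hσ]
  have hzn : ‖z‖ ≤ 5 / 4 * (‖v‖ * η) := by
    have := norm_add_le (z - v * σ) (v * σ)
    rw [sub_add_cancel, hvn] at this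
    linarith
  have hvη : 0 < ‖v‖ * η := by positivity
  obtain ⟨E, hE, hform⟩ := exists_exponent (a i) hρ hai (y i) z (by linarith)
  set u := z / (v * σ) with hu
  have hzu : z = v * σ * u := by rw [hu, mul_div_cancel₀ _ hvσ]
  have hu1 : ‖u - 1‖ ≤ 1 / 4 := by
    rw [hu, div_sub_one hvσ, norm_div, hvn, div_le_iff₀ hvη]
    linarith
  have hσ2 : σ ^ 2 = η ^ 2 := by rw [← sq_abs, hσ]
  rw [localFn, hform]
  have hncs : (n i : ℂ) = (√(n i : ℝ) : ℂ) * (√(n i : ℝ) : ℂ) := by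
    exact_mod_cast (Real.mul_self_sqrt hpos.le).symm
  have hnc : (n i : ℂ) ≠ 0 := by exact_mod_cast h0.ne'
  have hexp : (n i * y i - ∑ j, (a i j)⁻¹) * z + (∑ j, (a i j)⁻¹ ^ 2) * z ^ 2 / 2 + E =
      (√(n i : ℝ) : ℂ) * ((√(n i) : ℂ) * (y i - (∑ j, (a i j)⁻¹) / n i)) * z +
      ((n i : ℝ) : ℂ) * ((v ^ 2 * ((∑ j, (a i j)⁻¹ ^ 2) / n i)) * ((η ^ 2 : ℝ) : ℂ) * u ^ 2 / 2) +
        E := by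
    rw [← mul_assoc (√(n i : ℝ) : ℂ), ← hncs, ← hσ2]
    nth_rewrite 2 [hzu]
    push_cast
    field_simp
  rw [hexp]
  refine norm_cexp_le_of_norm_sub_le (τ := η ^ 2) (η := η) (β := 125 / 128) hpos.le hκ rfl hX hu1 ?_ ?_
    (by norm_num)
  · rw [norm_mul, norm_mul, Complex.norm_real, Real.norm_of_nonneg hs.le]
    rw [div_le_iff₀ (by positivity)] at hbig
    have e : (n i : ℝ) * (κ * η ^ 2 / 32) = √(n i : ℝ) * (√(n i : ℝ) * (κ * η ^ 2 / 32)) := by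
      rw [← mul_assoc, Real.mul_self_sqrt hpos.le]
    rw [e, mul_assoc]
    refine mul_le_mul_of_nonneg_left ?_ hs.le
    have := mul_le_mul hT hzn (norm_nonneg _) zero_le_one
    linarith
  · refine hE.trans (mul_le_mul_of_nonneg_left ?_ hpos.le)
    have h5 : (‖z‖ / ρ) ^ 3 ≤ (5 / 4 * (‖v‖ * η) / ρ) ^ 3 := by gcongr
    have h6 : (5 / 4 * (‖v‖ * η) / ρ) ^ 3 = 125 / 64 * ((‖v‖ / ρ) ^ 3 * η) * η ^ 2 := by ring
    have h7 : (‖v‖ / ρ) ^ 3 * η * η ^ 2 ≤ κ / 32 * η ^ 2 := by gcongr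
    rw [h6] at h5
    linarith

theorem tendsto_curve_integral [l.IsCountablyGenerated] (hn : Tendsto n l atTop) (hρ : 0 < ρ)
    (hκ : 0 < κ) (hv : v ≠ 0) (ha : ∀ᶠ i in l, ∀ j, ρ ≤ ‖a i j‖)
    (h1 : Tendsto (fun i => (√(n i) : ℂ) * (y i - (∑ j, (a i j)⁻¹) / n i)) l (𝓝 0))
    (h2 : Tendsto (fun i => v ^ 2 * ((∑ j, (a i j)⁻¹ ^ 2) / n i)) l (𝓝 (-κ : ℝ)))
    {η : ℝ} (hη : 0 < η) (hη1 : 2 * (‖v‖ * η) ≤ ρ / 2) (hη2 : (‖v‖ / ρ) ^ 3 * η ≤ κ / 32)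
    {c : α → ℝ → ℂ} {c' : ℝ → ℂ} {D : Set ℝ} (hD : D.Countable) (hc : ∀ i, Continuous (c i))
    (hc' : ∀ i, ∀ s ∈ Set.Ioo (-η) η, s ∉ D → HasDerivAt (c i) (c' s) s)
    (hball : ∀ᶠ i in l, ∀ s ∈ Set.Icc (-η) η, c i s ∈ Metric.ball 0 ρ)
    (hint : ∀ᶠ i in l, IntervalIntegrable (fun s => localFn (a i) (y i) (c i s) * c' s) volume (-η) η)
    (hend : ∀ᶠ i in l, ∀ σ : ℝ, |σ| = η → ‖c i σ - v * σ‖ ≤ ‖v‖ * η / 4) :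
    Tendsto (fun i => (√(n i) : ℂ) * ∫ s in (-η)..η, localFn (a i) (y i) (c i s) * c' s) l
      (𝓝 (v * (√(2 * Real.pi / κ) : ℝ))) := by
  have hv0 : 0 < ‖v‖ := norm_pos_iff.mpr hv
  have hsq : Tendsto (fun i => √(n i : ℝ)) l atTop :=
    Real.tendsto_sqrt_atTop.comp (tendsto_natCast_atTop_atTop.comp hn)
  have hmain := (tendsto_integral_scaled (v := v) hn hρ hκ ha h1 h2 hη
    (by nlinarith [mul_pos hv0 hη]) (hη2.trans (by linarith))).const_mul v
  have hbound := eventually_norm_localFn_le hn hρ hκ hv ha h1 h2 hη hη1 hη2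
  have hdecay : Tendsto (fun i => √(n i : ℝ) *
      (‖v‖ * η / 2 * Real.exp (-(n i * (κ * η ^ 2 / 100))))) l (𝓝 0) := by
    have hA : 0 < κ * η ^ 2 / 100 := by positivity
    have h3 := (Real.tendsto_pow_mul_exp_neg_atTop_nhds_zero 1).comp
      ((tendsto_natCast_atTop_atTop (R := ℝ)).comp hn |>.const_mul_atTop hA)
    have h4 := h3.const_mul (‖v‖ * η / 2 / (κ * η ^ 2 / 100))
    rw [mul_zero] at h4
    refine squeeze_zero_norm' ?_ h4
    filter_upwards [hn.eventually_gt_atTop 0] with i h0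
    have hpos : (1 : ℝ) ≤ n i := by exact_mod_cast h0
    rw [Real.norm_of_nonneg (by positivity)]
    simp only [Function.comp_apply, pow_one]
    have h5 : √(n i : ℝ) ≤ n i := by
      rw [Real.sqrt_le_left (by linarith)]; nlinarith
    have h6 : Real.exp (-(κ * η ^ 2 / 100 * n i)) = Real.exp (-(n i * (κ * η ^ 2 / 100))) := by
      rw [mul_comm]
    rw [h6]
    refine (mul_le_mul_of_nonneg_right h5 (by positivity)).trans_eq ?_
    field_simp
  have hdiff : Tendsto (fun i => (√(n i) : ℂ) * (∫ s in (-η)..η, localFn (a i) (y i) (c i s) * c' s) -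
      v * ∫ τ in Set.Icc (-(η * √(n i))) (η * √(n i)), scaled (a i) (y i) v τ) l (𝓝 0) := by
    refine squeeze_zero_norm' ?_ hdecay
    filter_upwards [hbound, hend, hint, hball, ha, hn.eventually_gt_atTop 0] with
      i hb he hi hbl hai h0
    have hpos : (0 : ℝ) < n i := by exact_mod_cast h0
    have hs : 0 < √(n i : ℝ) := Real.sqrt_pos.mpr hpos
    obtain ⟨Φ, hΦ⟩ := (differentiableOn_localFn hai (y i)).isExactOn_ball
    have hle : -η ≤ η := by linarith
    have I1 : ∫ s in (-η)..η, localFn (a i) (y i) (c i s) * c' s = Φ (c i η) - Φ (c i (-η)) := by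
      refine integral_eq_of_hasDerivAt_off_countable (fun s => Φ (c i s))
        (fun s => localFn (a i) (y i) (c i s) * c' s) hD ?_ ?_ hi
      · intro s hs'
        rw [Set.uIcc_of_le hle] at hs'
        exact ((hΦ _ (hbl s hs')).continuousAt.comp (hc i).continuousAt).continuousWithinAt
      · intro s hs'
        rw [min_eq_left hle, max_eq_right hle] at hs'
        have := HasDerivAt.scomp s (hΦ _ (hbl s ⟨hs'.1.1.le, hs'.1.2.le⟩)) (hc' i s hs'.1 hs'.2)
        rw [smul_eq_mul, mul_comm] at this
        exact this
    have hvball : ∀ τ ∈ Set.Icc (-η) η, v * (τ : ℂ) ∈ Metric.ball (0 : ℂ) ρ := by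
      intro τ hτ
      rw [mem_ball_zero_iff, norm_mul, Complex.norm_real, Real.norm_eq_abs]
      have := mul_le_mul_of_nonneg_left (abs_le.mpr hτ) hv0.le
      nlinarith [mul_pos hv0 hη]
    have I2 : ∫ τ in (-η)..η, localFn (a i) (y i) (v * τ) * v = Φ (v * η) - Φ (v * (-η : ℝ)) := by
      refine intervalIntegral.integral_eq_sub_of_hasDerivAt (f := fun τ : ℝ => Φ (v * τ))
        (fun τ hτ => ?_) ?_
      · rw [Set.uIcc_of_le hle] at hτ
        have h3 : HasDerivAt (fun τ : ℝ => v * (τ : ℂ)) v τ := by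
          simpa using (Complex.ofRealCLM.hasDerivAt (x := τ)).const_mul v
        have := HasDerivAt.scomp τ (hΦ _ (hvball τ hτ)) h3
        rw [smul_eq_mul, mul_comm] at this
        exact this
      · refine ContinuousOn.intervalIntegrable ?_
        rw [Set.uIcc_of_le hle]
        exact ((differentiableOn_localFn hai (y i)).continuousOn.comp (by fun_prop) hvball).mul
          continuousOn_const
    have I3 : v * ∫ τ in Set.Icc (-(η * √(n i))) (η * √(n i)), scaled (a i) (y i) v τ =
        √(n i) * (Φ (v * η) - Φ (v * (-η : ℝ))) := by
      rw [← I2, intervalIntegral.integral_mul_const, integral_Icc_eq_integral_Ioc,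
        ← intervalIntegral.integral_of_le (by nlinarith)]
      have := intervalIntegral.integral_comp_div (a := -(η * √(n i))) (b := η * √(n i))
        (fun τ : ℝ => localFn (a i) (y i) (v * τ)) hs.ne'
      rw [neg_div, mul_div_cancel_right₀ _ hs.ne', Complex.real_smul] at this
      rw [show (∫ τ in -(η * √(n i))..η * √(n i), scaled (a i) (y i) v τ) =
        ∫ τ in -(η * √(n i))..η * √(n i), localFn (a i) (y i) (v * ((τ / √(n i) : ℝ) : ℂ)) from rfl,
        this]
      ring
    have hseg : ∀ σ : ℝ, |σ| = η → ‖Φ (c i σ) - Φ (v * σ)‖ ≤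
        Real.exp (-(n i * (κ * η ^ 2 / 100))) * (‖v‖ * η / 4) := by
      intro σ hσ
      have hsub : Metric.closedBall (v * σ : ℂ) (‖v‖ * η / 4) ⊆ Metric.ball 0 ρ := by
        intro z hz
        rw [mem_closedBall_iff_norm] at hz
        rw [mem_ball_zero_iff]
        have := norm_add_le (z - v * σ) (v * σ)
        rw [sub_add_cancel, norm_mul v, Complex.norm_real, Real.norm_eq_abs, hσ] at this
        nlinarith [mul_pos hv0 hη]
      have h3 := (convex_closedBall (v * σ : ℂ) (‖v‖ * η / 4)).norm_image_sub_le_of_norm_hasDerivWithin_le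
        (f := Φ) (f' := localFn (a i) (y i)) (C := Real.exp (-(n i * (κ * η ^ 2 / 100))))
        (fun z hz => (hΦ z (hsub hz)).hasDerivWithinAt)
        (fun z hz => hb σ hσ z (mem_closedBall_iff_norm.mp hz))
        (Metric.mem_closedBall_self (by positivity)) (mem_closedBall_iff_norm.mpr (he σ hσ))
      exact h3.trans (mul_le_mul_of_nonneg_left (he σ hσ) (Real.exp_nonneg _))
    rw [I1, I3, ← mul_sub, norm_mul, Complex.norm_real, Real.norm_of_nonneg hs.le]
    refine mul_le_mul_of_nonneg_left ?_ hs.le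
    have hp := hseg η (abs_of_pos hη)
    have hm := hseg (-η) (by rw [abs_neg, abs_of_pos hη])
    have e : Φ (c i η) - Φ (c i (-η)) - (Φ (v * η) - Φ (v * (-η : ℝ))) =
        (Φ (c i η) - Φ (v * η)) - (Φ (c i (-η)) - Φ (v * (-η : ℝ))) := by ring
    rw [e]
    refine (norm_sub_le _ _).trans ?_
    linarith
  have := hdiff.add hmain
  rw [zero_add] at this
  refine this.congr fun i => ?_
  ring

end LocalContour

end SchurAsymp

namespace SchurAsymp

open MeasureTheory

theorem norm_integrand {N : ℕ} (hN : 0 < N) {lam : Fin N → ℤ} {y z : ℂ} (hz : ∀ i, z ≠ pole lam i) :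
    ‖integrand lam y z‖ =
      Real.exp (N * ((y * z).re - (∑ i, Real.log ‖z - pole lam i‖) / N)) := by
  have hN' : (N : ℝ) ≠ 0 := by exact_mod_cast hN.ne'
  have hpos : ∀ i, 0 < ‖z - pole lam i‖ := fun i => norm_pos_iff.mpr (sub_ne_zero.mpr (hz i))
  rw [integrand, norm_div, norm_prod, Complex.norm_exp, mul_sub, mul_div_cancel₀ _ hN', Real.exp_sub,
    Real.exp_sum]
  congr 1
  · rw [mul_assoc, ← Complex.ofReal_natCast, Complex.re_ofReal_mul]
  · exact Finset.prod_congr rfl fun i _ => (Real.exp_log (hpos i)).symm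

theorem integrand_div_integrand {N : ℕ} {lam : Fin N → ℤ} {y z w : ℂ} (hw : ∀ i, w ≠ pole lam i) :
    integrand lam y z / integrand lam y w = localFn (fun i => w - pole lam i) y (z - w) := by
  have h1 : ∏ i, (z - pole lam i) = (∏ i, (w - pole lam i)) * ∏ i, (1 + (z - w) / (w - pole lam i)) := by
    rw [← Finset.prod_mul_distrib]
    refine Finset.prod_congr rfl fun i _ => ?_
    rw [mul_add, mul_div_cancel₀ _ (sub_ne_zero.mpr (hw i))]
    ring
  have h2 : ∏ i, (w - pole lam i) ≠ 0 :=
    Finset.prod_ne_zero_iff.mpr fun i _ => sub_ne_zero.mpr (hw i)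
  rw [integrand, integrand, localFn, h1, mul_sub, Complex.exp_sub, div_div_div_eq]
  have := Complex.exp_ne_zero (N * y * w)
  field_simp

theorem IsSteepestDescentContour.exists_tangent {f : ℝ → ℝ} {y w₀ : ℂ} {γ : ℝ → ℂ}
    (hγ : IsSteepestDescentContour f y w₀ γ) :
    ∃ c : ℝ, c ≠ 0 ∧ deriv γ 0 ^ 2 * d2F f w₀ = ((c ^ 2 : ℝ) : ℂ) ∧ HasDerivAt γ (deriv γ 0) 0 ∧
      deriv γ 0 ≠ 0 := by
  obtain ⟨c, hc, hd⟩ := hγ.tangent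
  have hF := hγ.d2F_ne_zero
  rw [hd.deriv]
  refine ⟨c, hc, ?_, hd, mul_ne_zero (Complex.ofReal_ne_zero.mpr hc) ?_⟩
  · rw [mul_pow, ← Complex.cpow_nat_mul, show ((2 : ℕ) : ℂ) * -(1 / 2) = -1 by push_cast; ring,
      Complex.cpow_neg_one, mul_assoc, inv_mul_cancel₀ hF]
    push_cast; ring
  · rw [Ne, Complex.cpow_eq_zero_iff]
    exact fun h => hF h.1

theorem tendsto_sqrt_mul_exp_neg {ν : ℕ → ℕ} (hν : Tendsto ν atTop atTop) {δ : ℝ} (hδ : 0 < δ)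
    (C : ℝ) : Tendsto (fun k => √(ν k : ℝ) * (C * Real.exp (-(ν k * δ)))) atTop (𝓝 0) := by
  have h3 := (Real.tendsto_pow_mul_exp_neg_atTop_nhds_zero 1).comp
    ((tendsto_natCast_atTop_atTop (R := ℝ)).comp hν |>.atTop_mul_const hδ)
  have h4 := h3.const_mul (|C| / δ)
  rw [mul_zero] at h4
  refine squeeze_zero_norm' ?_ h4
  filter_upwards [hν.eventually_gt_atTop 0] with k h0
  have hpos : (1 : ℝ) ≤ ν k := by exact_mod_cast h0
  simp only [Function.comp_apply, pow_one]
  rw [norm_mul, norm_mul, Real.norm_of_nonneg (Real.sqrt_nonneg _),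
    Real.norm_of_nonneg (Real.exp_nonneg _), Real.norm_eq_abs]
  have h5 : √(ν k : ℝ) ≤ ν k := by
    rw [Real.sqrt_le_left (by linarith)]; nlinarith
  refine (mul_le_mul_of_nonneg_right h5 (by positivity)).trans_eq ?_
  field_simp

theorem tendsto_tail {ν : ℕ → ℕ} (hν : Tendsto ν atTop atTop) {lam : ∀ k, Fin (ν k) → ℤ}
    {f : ℝ → ℝ} {y w₀ : ℂ} {γ : ℝ → ℂ} (hγ : IsSteepestDescentContour f y w₀ γ) {d : ℝ} (hd : 0 < d)
    (hdist : ∀ᶠ k in atTop, ∀ (s : ℝ) (i : Fin (ν k)), d ≤ ‖γ s - pole (lam k) i‖)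
    (hT : ∀ η > 0, ∀ᶠ k in atTop, ∀ s : ℝ,
      (F f (γ s)).re - η ≤ (∑ i, Real.log ‖γ s - pole (lam k) i‖) / ν k)
    {w : ℕ → ℂ} (hw : Tendsto w atTop (𝓝 w₀)) (hwp : ∀ᶠ k in atTop, ∀ i, w k ≠ pole (lam k) i)
    (hU : Tendsto (fun k => (∑ i, Real.log ‖w k - pole (lam k) i‖) / ν k) atTop (𝓝 (F f w₀).re))
    {η : ℝ} (hη : 0 < η) :
    Tendsto (fun k => (√(ν k) : ℂ) * ((∫ s in (Set.Ioc (-η) η)ᶜ,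
      integrand (lam k) y (γ s) * deriv γ s) / integrand (lam k) y (w k))) atTop (𝓝 0) := by
  obtain ⟨δ, hδ, hmax⟩ := hγ.max η hη
  set Φ := fun s => (y * γ s - F f (γ s)).re with hΦ
  set Φ₀ := (y * w₀ - F f w₀).re with hΦ₀
  set A := ∫ s, Real.exp (Φ s) * ‖deriv γ s‖ with hA
  have hdecay := tendsto_sqrt_mul_exp_neg hν (half_pos hδ) (A * Real.exp (-(Φ₀ - δ)))
  have hsad : Tendsto (fun k => (y * w k).re - (∑ i, Real.log ‖w k - pole (lam k) i‖) / ν k) atTop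
      (𝓝 Φ₀) := by
    rw [hΦ₀, Complex.sub_re]
    exact ((Complex.continuous_re.tendsto _).comp (hw.const_mul y)).sub hU
  refine squeeze_zero_norm' ?_ hdecay
  filter_upwards [hdist, hT (δ / 4) (by positivity), hwp,
    hsad.eventually_const_lt (show Φ₀ - δ / 4 < Φ₀ by linarith), hν.eventually_gt_atTop 0]
    with k hdk hTk hwk hs h0
  have hpos : (1 : ℝ) ≤ ν k := by exact_mod_cast h0
  have hne : ∀ s i, γ s ≠ pole (lam k) i := fun s i =>
    sub_ne_zero.mp (norm_pos_iff.mp (hd.trans_le (hdk s i)))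
  have hlow : Real.exp (ν k * (Φ₀ - δ / 4)) ≤ ‖integrand (lam k) y (w k)‖ := by
    rw [norm_integrand h0 hwk, Real.exp_le_exp]
    exact mul_le_mul_of_nonneg_left hs.le (by linarith)
  have hup : ∀ s ∈ (Set.Ioc (-η) η)ᶜ, ‖integrand (lam k) y (γ s) * deriv γ s‖ ≤
      Real.exp ((ν k - 1) * (Φ₀ - δ) + ν k * (δ / 4)) * (Real.exp (Φ s) * ‖deriv γ s‖) := by
    intro s hs
    have hse : η ≤ |s| := by
      rw [Set.mem_compl_iff, Set.mem_Ioc, not_and_or, not_lt, not_le] at hs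
      rcases hs with h | h
      · rw [abs_of_neg (by linarith)]; linarith
      · exact h.le.trans (le_abs_self s)
    rw [norm_mul, ← mul_assoc, ← Real.exp_add]
    refine mul_le_mul_of_nonneg_right ?_ (norm_nonneg _)
    rw [norm_integrand h0 (hne s), Real.exp_le_exp]
    have h1 := hmax s hse
    have h2 := hTk s
    have h3 : (y * γ s).re - (∑ i, Real.log ‖γ s - pole (lam k) i‖) / ν k ≤ Φ s + δ / 4 := by
      rw [hΦ]; simp only [Complex.sub_re]; linarith
    have h4 : Φ s ≤ Φ₀ - δ := h1
    have h5 := mul_le_mul_of_nonneg_left h3 (show (0 : ℝ) ≤ ν k by linarith)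
    have h6 := mul_le_mul_of_nonneg_left h4 (show (0 : ℝ) ≤ ν k - 1 by linarith)
    linarith
  have hint : IntegrableOn (fun s => Real.exp ((ν k - 1) * (Φ₀ - δ) + ν k * (δ / 4)) *
      (Real.exp (Φ s) * ‖deriv γ s‖)) (Set.Ioc (-η) η)ᶜ :=
    (hγ.integrable.const_mul _).integrableOn
  have hI : ‖∫ s in (Set.Ioc (-η) η)ᶜ, integrand (lam k) y (γ s) * deriv γ s‖ ≤
      Real.exp ((ν k - 1) * (Φ₀ - δ) + ν k * (δ / 4)) * A := by
    refine (norm_integral_le_of_norm_le hint ?_).trans ?_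
    · rw [ae_restrict_iff' measurableSet_Ioc.compl]
      exact ae_of_all _ hup
    · rw [integral_const_mul]
      refine mul_le_mul_of_nonneg_left ?_ (Real.exp_nonneg _)
      exact setIntegral_le_integral hγ.integrable (ae_of_all _ fun s => by positivity)
  have hA0 : 0 ≤ A := integral_nonneg fun s => by positivity
  rw [norm_mul, Complex.norm_real, Real.norm_of_nonneg (Real.sqrt_nonneg _), norm_div]
  refine mul_le_mul_of_nonneg_left ?_ (Real.sqrt_nonneg _)
  refine (div_le_div₀ (by positivity) hI (Real.exp_pos _) hlow).trans_eq ?_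
  rw [mul_comm _ A, mul_div_assoc, ← Real.exp_sub, mul_assoc, ← Real.exp_add]
  congr 2
  ring

theorem tendsto_contour_integral {ν : ℕ → ℕ} (hν : Tendsto ν atTop atTop) {lam : ∀ k, Fin (ν k) → ℤ}
    {f : ℝ → ℝ} {y w₀ : ℂ} {γ : ℝ → ℂ} (hγ : IsSteepestDescentContour f y w₀ γ) {d : ℝ} (hd : 0 < d)
    (hdist : ∀ᶠ k in atTop, ∀ (s : ℝ) (i : Fin (ν k)), d ≤ ‖γ s - pole (lam k) i‖)
    (hint : ∀ᶠ k in atTop, Integrable (fun s : ℝ => integrand (lam k) y (γ s) * deriv γ s))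
    (hT : ∀ η > 0, ∀ᶠ k in atTop, ∀ s : ℝ,
      (F f (γ s)).re - η ≤ (∑ i, Real.log ‖γ s - pole (lam k) i‖) / ν k)
    {w : ℕ → ℂ} (hw : Tendsto w atTop (𝓝 w₀))
    (hU : Tendsto (fun k => (∑ i, Real.log ‖w k - pole (lam k) i‖) / ν k) atTop (𝓝 (F f w₀).re))
    (h1 : Tendsto (fun k => (√(ν k) : ℂ) * (y - (∑ i, (w k - pole (lam k) i)⁻¹) / ν k)) atTop (𝓝 0))
    (h2 : Tendsto (fun k => (∑ i, ((w k - pole (lam k) i)⁻¹) ^ 2) / (ν k : ℂ)) atTop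
      (𝓝 (-d2F f w₀))) :
    ∃ c : ℝ, c ≠ 0 ∧ deriv γ 0 ^ 2 * d2F f w₀ = ((c ^ 2 : ℝ) : ℂ) ∧ deriv γ 0 ≠ 0 ∧
      Tendsto (fun k => (√(ν k) : ℂ) * ((∫ s, integrand (lam k) y (γ s) * deriv γ s) /
        integrand (lam k) y (w k))) atTop (𝓝 (deriv γ 0 * (√(2 * Real.pi / c ^ 2) : ℝ))) := by
  obtain ⟨c, hc, hvc, hder, hv⟩ := hγ.exists_tangent
  refine ⟨c, hc, hvc, hv, ?_⟩
  set v := deriv γ 0 with hvdef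
  set κ := c ^ 2 with hκ
  have hκ0 : 0 < κ := by positivity
  have hv0 : 0 < ‖v‖ := norm_pos_iff.mpr hv
  obtain ⟨hγc, D, hDfin, hDs, -⟩ := hγ.piecewise_smooth
  have hbase := hγ.base
  set ρ := d / 2 with hρ
  have hρ0 : 0 < ρ := by positivity
  have hlin : ∀ᶠ s : ℝ in 𝓝 0, ‖γ s - w₀ - v * s‖ ≤ ‖v‖ / 8 * |s| := by
    have := (hasDerivAt_iff_isLittleO.mp hder).def (show 0 < ‖v‖ / 8 by positivity)
    filter_upwards [this] with s hs
    rw [hbase, sub_zero, Complex.real_smul, mul_comm] at hs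
    exact hs
  have hnear : ∀ᶠ s : ℝ in 𝓝 0, ‖γ s - w₀‖ < d / 4 := by
    have := Metric.continuousAt_iff.mp (hγc.continuousAt (x := 0)) (d / 4) (by positivity)
    rw [hbase] at this
    obtain ⟨ε, hε, h⟩ := this
    filter_upwards [Metric.ball_mem_nhds (0 : ℝ) hε] with s hs
    rw [← dist_eq_norm]; exact h hs
  obtain ⟨ε, hε, hεP⟩ := Metric.eventually_nhds_iff.mp (hlin.and hnear)
  set η := min (ε / 2) (min (ρ / (4 * ‖v‖)) (κ / 32 / (‖v‖ / ρ) ^ 3)) with hη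
  have hη0 : 0 < η := lt_min (by positivity) (lt_min (by positivity) (by positivity))
  have hη1 : 2 * (‖v‖ * η) ≤ ρ / 2 := by
    have : η ≤ ρ / (4 * ‖v‖) := (min_le_right _ _).trans (min_le_left _ _)
    rw [le_div_iff₀ (by positivity)] at this
    linarith
  have hη2 : (‖v‖ / ρ) ^ 3 * η ≤ κ / 32 := by
    have : η ≤ κ / 32 / (‖v‖ / ρ) ^ 3 := (min_le_right _ _).trans (min_le_right _ _)
    rw [le_div_iff₀ (by positivity)] at this
    linarith
  have hηε : ∀ s : ℝ, |s| ≤ η → ‖γ s - w₀ - v * s‖ ≤ ‖v‖ / 8 * |s| ∧ ‖γ s - w₀‖ < d / 4 := by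
    intro s hs
    refine hεP ?_
    rw [Real.dist_eq, sub_zero]
    have : η ≤ ε / 2 := min_le_left _ _
    linarith
  have hwclose : ∀ r > 0, ∀ᶠ k in atTop, ‖w k - w₀‖ < r := fun r hr => by
    have := Metric.tendsto_nhds.mp hw r hr
    simpa only [dist_eq_norm] using this
  have ha : ∀ᶠ k in atTop, ∀ i, ρ ≤ ‖w k - pole (lam k) i‖ := by
    filter_upwards [hdist, hwclose (d / 4) (by positivity)] with k h3 h4 i
    have h5 := h3 0 i
    rw [hbase] at h5
    have := norm_sub_le_norm_sub_add_norm_sub w₀ (w k) (pole (lam k) i : ℂ)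
    rw [norm_sub_rev w₀ (w k)] at this
    linarith
  have hwp : ∀ᶠ k in atTop, ∀ i, w k ≠ pole (lam k) i := ha.mono fun k hk i =>
    sub_ne_zero.mp (norm_pos_iff.mp (hρ0.trans_le (hk i)))
  have h2' : Tendsto (fun k => v ^ 2 * ((∑ i, ((w k - pole (lam k) i)⁻¹) ^ 2) / (ν k : ℂ))) atTop
      (𝓝 (-κ : ℝ)) := by
    have := h2.const_mul (v ^ 2)
    rw [mul_neg, hvc] at this
    rwa [Complex.ofReal_neg]
  have hloc := tendsto_curve_integral (n := ν) (a := fun k i => w k - pole (lam k) i)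
    (y := fun _ => y) hν hρ0 hκ0 hv ha h1 h2' hη0 hη1 hη2 (c := fun k s => γ s - w k)
    (c' := deriv γ) (D := D ∩ Set.Icc (-η) η) (hDfin _ _).countable
    (fun k => hγc.sub continuous_const) ?_ ?_ ?_ ?_
  · have htail := tendsto_tail hν hγ hd hdist hT hw hwp hU hη0
    have := hloc.add htail
    rw [add_zero] at this
    refine this.congr' ?_
    filter_upwards [hint, hwp] with k hk hwk
    rw [← mul_add]
    congr 1
    rw [← integral_add_compl measurableSet_Ioc hk, add_div,
      intervalIntegral.integral_of_le (by linarith)]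
    congr 1
    rw [← integral_div]
    refine integral_congr_ae (ae_of_all _ fun s => ?_)
    simp only []
    rw [← integrand_div_integrand hwk]
    ring
  · intro k s hs hsD
    have hs' : s ∉ D := fun h => hsD ⟨h, hs.1.le, hs.2.le⟩
    exact (((hDs s hs').differentiableAt (by norm_num)).hasDerivAt).sub_const _
  · filter_upwards [hwclose (d / 4) (by positivity)] with k hk s hs
    rw [mem_ball_zero_iff]
    have h3 := (hηε s (abs_le.mpr hs)).2
    have := norm_sub_le_norm_sub_add_norm_sub (γ s) w₀ (w k)
    rw [norm_sub_rev w₀] at this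
    linarith
  · filter_upwards [hint, hwp] with k hk hwk
    have h3 := (hk.div_const (integrand (lam k) y (w k))).intervalIntegrable (a := -η) (b := η)
    refine h3.congr fun s _ => ?_
    rw [← integrand_div_integrand hwk]
    ring
  · filter_upwards [hwclose (‖v‖ * η / 8) (by positivity)] with k hk σ hσ
    have h3 := (hηε σ hσ.le).1
    rw [hσ] at h3
    have e : γ σ - w k - v * σ = (γ σ - w₀ - v * σ) - (w k - w₀) := by ring
    rw [e]
    have := norm_sub_le (γ σ - w₀ - v * σ) (w k - w₀)
    linarith

end SchurAsymp

namespace SchurAsymp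

open MeasureTheory

/-- The logarithm of the distance to `w`, truncated from below at `ln d`. -/
noncomputable def truncLog (d : ℝ) (w : ℂ) (x : ℝ) : ℝ := Real.log (max ‖w - x‖ d)

theorem truncLog_eq {d : ℝ} {w : ℂ} {x : ℝ} (h : d ≤ ‖w - x‖) : truncLog d w x = Real.log ‖w - x‖ := by
  rw [truncLog, max_eq_left h]

theorem abs_truncLog_sub_le {d : ℝ} (hd : 0 < d) (w w' : ℂ) (x x' : ℝ) :
    |truncLog d w x - truncLog d w' x'| ≤ d⁻¹ * (‖w - w'‖ + |x - x'|) := by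
  refine (abs_log_sub_log_le hd (le_max_right _ _) (le_max_right _ _)).trans ?_
  rw [div_eq_inv_mul]
  refine mul_le_mul_of_nonneg_left ?_ (by positivity)
  refine (abs_max_sub_max_le_abs _ _ _).trans ((abs_norm_sub_norm_le _ _).trans ?_)
  have e : w - x - (w' - x') = (w - w') - ((x - x' : ℝ) : ℂ) := by push_cast; ring
  rw [e]
  refine (norm_sub_le _ _).trans ?_
  rw [Complex.norm_real, Real.norm_eq_abs]

theorem continuous_truncLog {d : ℝ} (hd : 0 < d) (w : ℂ) : Continuous (truncLog d w) := by
  refine Continuous.log ?_ fun x => (hd.trans_le (le_max_right _ _)).ne'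
  fun_prop

theorem intervalIntegrable_truncLog {d : ℝ} (hd : 0 < d) (w : ℂ) {h : ℝ → ℝ}
    (hint : IntervalIntegrable h volume 0 1) :
    IntervalIntegrable (fun t => truncLog d w (h t)) volume 0 1 := by
  have h1 : IntervalIntegrable (fun t => d⁻¹ * |h t - 0| + |truncLog d w 0|) volume 0 1 :=
    ((hint.sub intervalIntegrable_const).abs.const_mul _).add intervalIntegrable_const
  refine h1.mono_fun ((continuous_truncLog hd w).comp_aestronglyMeasurable
    hint.def'.aestronglyMeasurable) (ae_of_all _ fun t => ?_)
  have h2 := abs_truncLog_sub_le hd w w (h t) 0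
  rw [sub_self, norm_zero, zero_add] at h2
  have h3 := abs_sub_abs_le_abs_sub (truncLog d w (h t)) (truncLog d w 0)
  simp only []
  rw [Real.norm_eq_abs, Real.norm_of_nonneg (by positivity)]
  linarith

theorem abs_mean_truncLog_sub_le {n : ℕ} (hn : 0 < n) {d : ℝ} (hd : 0 < d) (w : ℂ) (p : Fin n → ℝ)
    {h : ℝ → ℝ} (hint : IntervalIntegrable h volume 0 1) :
    |(∑ j, truncLog d w (p j)) / n - ∫ t in (0 : ℝ)..1, truncLog d w (h t)| ≤
      d⁻¹ * stepDist p h := by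
  have := norm_mean_sub_integral_le hn (p := p) hint (S := Set.univ) (φ := truncLog d w) (K := d⁻¹)
    (fun x _ y _ => by simpa using abs_truncLog_sub_le hd w w x y) (fun _ => trivial)
    (ae_of_all _ fun _ _ => trivial) (intervalIntegrable_truncLog hd w hint)
  rwa [Real.norm_eq_abs, smul_eq_mul, ← div_eq_inv_mul] at this

theorem F_eq (f : ℝ → ℝ) (w : ℂ) :
    F f w = ∫ t in (0 : ℝ)..1, Complex.log (w - (limitPole f t : ℂ)) := by
  rw [F]
  congr 1; ext t
  rw [limitPole]; congr 1; push_cast; ring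

theorem intervalIntegrable_log_sub {d : ℝ} (hd : 0 < d) {w : ℂ} {h : ℝ → ℝ}
    (hint : IntervalIntegrable h volume 0 1)
    (hfar : ∀ᵐ t, t ∈ Set.Ioc (0 : ℝ) 1 → d ≤ ‖w - h t‖) :
    IntervalIntegrable (fun t => Complex.log (w - h t)) volume 0 1 := by
  have h1 : IntervalIntegrable (fun t => |truncLog d w (h t)| + Real.pi) volume 0 1 :=
    (intervalIntegrable_truncLog hd w hint).abs.add intervalIntegrable_const
  refine h1.mono_fun ?_ ?_
  · have hm : AEMeasurable (fun t => (h t : ℂ)) (volume.restrict (Set.uIoc (0 : ℝ) 1)) :=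
      Complex.measurable_ofReal.comp_aemeasurable hint.def'.aestronglyMeasurable.aemeasurable
    exact (Complex.measurable_log.comp_aemeasurable (hm.const_sub w)).aestronglyMeasurable
  · rw [Filter.EventuallyLE, Set.uIoc_of_le zero_le_one, ae_restrict_iff' measurableSet_Ioc]
    filter_upwards [hfar] with t ht htI
    rw [Real.norm_of_nonneg (by positivity), truncLog_eq (ht htI)]
    refine (Complex.norm_le_abs_re_add_abs_im _).trans ?_
    rw [Complex.log_re, Complex.log_im]
    exact add_le_add_right (Complex.abs_arg_le_pi _) _

theorem F_re_eq_truncLog {d : ℝ} (hd : 0 < d) {w : ℂ} {f : ℝ → ℝ}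
    (hint : IntervalIntegrable (limitPole f) volume 0 1)
    (hfar : ∀ᵐ t, t ∈ Set.Ioc (0 : ℝ) 1 → d ≤ ‖w - limitPole f t‖) :
    (F f w).re = ∫ t in (0 : ℝ)..1, truncLog d w (limitPole f t) := by
  have h1 := intervalIntegrable_log_sub hd hint hfar
  have h2 := Complex.reCLM.intervalIntegral_comp_comm h1
  rw [F_eq, ← Complex.reCLM_apply, ← h2]
  refine intervalIntegral.integral_congr_ae ?_
  rw [Set.uIoc_of_le zero_le_one]
  filter_upwards [hfar] with t ht htI
  rw [truncLog_eq (ht htI), Complex.reCLM_apply, Complex.log_re]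

theorem le_mean_log_of_stepDist {α : Type*} {l : Filter α} {n : α → ℕ} (hn : Tendsto n l atTop)
    {p : ∀ i, Fin (n i) → ℝ} {f : ℝ → ℝ} (hint : IntervalIntegrable (limitPole f) volume 0 1)
    (hd : Tendsto (fun i => stepDist (p i) (limitPole f)) l (𝓝 0)) {d : ℝ} (hd0 : 0 < d) {γ : ℝ → ℂ}
    (hdist : ∀ᶠ i in l, ∀ (s : ℝ) j, d ≤ ‖γ s - p i j‖)
    (hfar : ∀ s : ℝ, ∀ᵐ t, t ∈ Set.Ioc (0 : ℝ) 1 → d ≤ ‖γ s - limitPole f t‖) {η : ℝ} (hη : 0 < η) :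
    ∀ᶠ i in l, ∀ s : ℝ, (F f (γ s)).re - η ≤ (∑ j, Real.log ‖γ s - p i j‖) / n i := by
  have h1 := hd.const_mul d⁻¹
  rw [mul_zero] at h1
  filter_upwards [h1.eventually_lt_const hη, hn.eventually_gt_atTop 0, hdist] with i h2 h3 h4 s
  have h5 := (abs_le.mp (abs_mean_truncLog_sub_le h3 hd0 (γ s) (p i) hint)).1
  rw [← F_re_eq_truncLog hd0 hint (hfar s),
    Finset.sum_congr rfl fun j _ => truncLog_eq (h4 s j)] at h5
  linarith

theorem tendsto_mean_log_of_stepDist {α : Type*} {l : Filter α} {n : α → ℕ}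
    (hn : Tendsto n l atTop) {p : ∀ i, Fin (n i) → ℝ} {f : ℝ → ℝ}
    (hint : IntervalIntegrable (limitPole f) volume 0 1)
    (hd : Tendsto (fun i => stepDist (p i) (limitPole f)) l (𝓝 0)) {d : ℝ} (hd0 : 0 < d) {w : α → ℂ}
    {w₀ : ℂ} (hw : Tendsto w l (𝓝 w₀)) (hdist : ∀ᶠ i in l, ∀ j, d ≤ ‖w i - p i j‖)
    (hfar : ∀ᵐ t, t ∈ Set.Ioc (0 : ℝ) 1 → d ≤ ‖w₀ - limitPole f t‖) :
    Tendsto (fun i => (∑ j, Real.log ‖w i - p i j‖) / n i) l (𝓝 (F f w₀).re) := by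
  rw [tendsto_iff_norm_sub_tendsto_zero]
  have h1 := ((tendsto_iff_norm_sub_tendsto_zero.mp hw).add hd).const_mul d⁻¹
  rw [zero_add, mul_zero] at h1
  refine squeeze_zero' (Eventually.of_forall fun _ => norm_nonneg _) ?_ h1
  filter_upwards [hn.eventually_gt_atTop 0, hdist] with i h3 h4
  have h5 := abs_mean_truncLog_sub_le h3 hd0 (w i) (p i) hint
  have h6 : |(∫ t in (0 : ℝ)..1, truncLog d (w i) (limitPole f t)) -
      ∫ t in (0 : ℝ)..1, truncLog d w₀ (limitPole f t)| ≤ d⁻¹ * ‖w i - w₀‖ := by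
    rw [← intervalIntegral.integral_sub (intervalIntegrable_truncLog hd0 _ hint)
      (intervalIntegrable_truncLog hd0 _ hint), ← Real.norm_eq_abs]
    refine (intervalIntegral.norm_integral_le_of_norm_le_const (C := d⁻¹ * ‖w i - w₀‖)
      fun t _ => ?_).trans_eq (by simp)
    have := abs_truncLog_sub_le hd0 (w i) w₀ (limitPole f t) (limitPole f t)
    rwa [sub_self, abs_zero, add_zero] at this
  rw [Finset.sum_congr rfl fun j _ => truncLog_eq (h4 j)] at h5
  rw [F_re_eq_truncLog hd0 hint hfar, Real.norm_eq_abs, mul_add]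
  have := abs_sub_le ((∑ j, Real.log ‖w i - p i j‖) / n i)
    (∫ t in (0 : ℝ)..1, truncLog d (w i) (limitPole f t))
    (∫ t in (0 : ℝ)..1, truncLog d w₀ (limitPole f t))
  linarith

theorem ae_dist_le_of_stepDist {l : Filter ℕ} [l.NeBot] {n : ℕ → ℕ} (hn : Tendsto n l atTop)
    {p : ∀ i, Fin (n i) → ℝ} {h : ℝ → ℝ} (hint : IntervalIntegrable h volume 0 1)
    (hd : Tendsto (fun i => stepDist (p i) h) l (𝓝 0)) {d : ℝ} {w : ℂ}
    (hdist : ∀ᶠ i in l, ∀ j, d ≤ ‖w - p i j‖) :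
    ∀ᵐ t, t ∈ Set.Ioc (0 : ℝ) 1 → d ≤ ‖w - h t‖ := by
  have := ae_eq_zero_of_frequently hn hint hd (φ := fun x => max (d - ‖w - x‖) 0)
    (fun x => le_max_right _ _) (fun x y => ?_)
    (hdist.frequently.mono fun i hi j => max_eq_right (by linarith [hi j]))
  · filter_upwards [this] with t ht htI
    have := max_eq_right_iff.mp (ht htI)
    linarith
  · refine (abs_max_sub_max_le_abs _ _ _).trans ?_
    rw [sub_sub_sub_cancel_left]
    refine (abs_norm_sub_norm_le _ _).trans_eq ?_
    rw [sub_sub_sub_cancel_left, ← Complex.ofReal_sub, Complex.norm_real, Real.norm_eq_abs]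

/-- Nearby holomorphic functions take the same value, if the derivative does not vanish. -/
theorem eventually_exists_eq_of_tendstoLocallyUniformlyOn {α : Type*} {l : Filter α} [l.NeBot]
    {u : α → ℂ → ℂ} {v : ℂ → ℂ} {w₀ : ℂ} {ρ : ℝ} (hρ : 0 < ρ)
    (hu : ∀ᶠ i in l, DifferentiableOn ℂ (u i) (Metric.ball w₀ ρ))
    (huv : TendstoLocallyUniformlyOn u v l (Metric.ball w₀ ρ)) (hv : deriv v w₀ ≠ 0) {ε : ℝ}
    (hε : 0 < ε) : ∀ᶠ i in l, ∃ z ∈ Metric.closedBall w₀ ε, u i z = v w₀ := by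
  have hmem := Metric.mem_ball_self (x := w₀) hρ
  have hdv : DifferentiableAt ℂ v w₀ := by
    by_contra h; exact hv (deriv_zero_of_not_differentiableAt h)
  have hev := (hasDerivAt_iff_isLittleO.mp hdv.hasDerivAt).def
    (show 0 < ‖deriv v w₀‖ / 2 by positivity)
  obtain ⟨r₀, hr₀, hr₀P⟩ := Metric.eventually_nhds_iff.mp hev
  set r := min (r₀ / 2) (min (ρ / 2) ε) with hr
  have hr0 : 0 < r := by positivity
  have hrρ : r < ρ := by
    have : r ≤ ρ / 2 := (min_le_right _ _).trans (min_le_left _ _)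
    linarith
  have hsub : Metric.closedBall w₀ r ⊆ Metric.ball w₀ ρ := Metric.closedBall_subset_ball hrρ
  set δ := ‖deriv v w₀‖ / 2 * r with hδ
  have hδ0 : 0 < δ := by positivity
  have hsph : ∀ z ∈ Metric.sphere w₀ r, δ ≤ ‖v z - v w₀‖ := by
    intro z hz
    rw [mem_sphere_iff_norm] at hz
    have h1 := hr₀P (y := z) (by
      rw [dist_eq_norm, hz]
      have : r ≤ r₀ / 2 := min_le_left _ _
      linarith)
    rw [smul_eq_mul, hz] at h1
    have h2 := norm_sub_norm_le ((z - w₀) * deriv v w₀) (v z - v w₀)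
    rw [norm_mul, hz, norm_sub_rev _ (v z - v w₀)] at h2
    rw [hδ]; linarith
  have hunif := (tendstoLocallyUniformlyOn_iff_forall_isCompact Metric.isOpen_ball).mp huv _ hsub
    (isCompact_closedBall w₀ r)
  rw [Metric.tendstoUniformlyOn_iff] at hunif
  have hderiv : ∀ᶠ i in l, deriv (u i) w₀ ≠ 0 :=
    ((huv.deriv hu Metric.isOpen_ball).tendsto_at hmem).eventually_ne hv
  filter_upwards [hu, hderiv, hunif (δ / 8) (by positivity)] with i h1 h2 h3
  have h4 : ∀ z ∈ Metric.closedBall w₀ r, ‖u i z - v z‖ < δ / 8 := fun z hz => by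
    rw [← dist_eq_norm, dist_comm]; exact h3 z hz
  have h0 := h4 w₀ (Metric.mem_closedBall_self hr0.le)
  have h5 := DiffContOnCl.ball_subset_image_closedBall (f := u i) (z₀ := w₀) (r := r) (ε := δ / 2)
    (by
      refine DifferentiableOn.diffContOnCl ?_
      rw [closure_ball w₀ hr0.ne']
      exact h1.mono hsub) hr0 (fun z hz => ?_) ?_
  · obtain ⟨z, hz, hzv⟩ := h5 (show v w₀ ∈ Metric.ball (u i w₀) (δ / 2 / 2) by
      rw [mem_ball_iff_norm, norm_sub_rev]; linarith)
    exact ⟨z, Metric.closedBall_subset_closedBall ((min_le_right _ _).trans (min_le_right _ _)) hz,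
      hzv⟩
  · have h6 := hsph z hz
    have h7 := h4 z (Metric.sphere_subset_closedBall hz)
    have e : v z - v w₀ = (u i z - u i w₀) - (u i z - v z) + (u i w₀ - v w₀) := by ring
    have h8 := norm_add_le ((u i z - u i w₀) - (u i z - v z)) (u i w₀ - v w₀)
    have h9 := norm_sub_le (u i z - u i w₀) (u i z - v z)
    rw [← e] at h8
    linarith
  · intro h
    refine h2 ?_
    have : u i =ᶠ[𝓝 w₀] fun _ => u i w₀ := h.mono fun z hz => not_not.mp hz
    rw [this.deriv_eq, deriv_const]

theorem exists_tendsto_of_eventually_exists {X : Type*} [PseudoMetricSpace X] {x₀ : X}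
    {P : ℕ → X → Prop} (h : ∀ ε > 0, ∀ᶠ k in atTop, ∃ x ∈ Metric.closedBall x₀ ε, P k x) :
    ∃ x : ℕ → X, Tendsto x atTop (𝓝 x₀) ∧ ∀ᶠ k in atTop, P k (x k) := by
  classical
  have h1 : ∀ k, ∃ x, (∃ z, P k z) → P k x ∧ ∀ z, P k z → dist x x₀ ≤ dist z x₀ + 1 / ((k : ℝ) + 1) := by
    intro k
    by_cases hk : ∃ z, P k z
    · set A := (fun z => dist z x₀) '' {z | P k z} with hA
      obtain ⟨z, hz⟩ := hk
      have hne : A.Nonempty := ⟨_, z, hz, rfl⟩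
      have hb : BddBelow A := ⟨0, by rintro _ ⟨z, -, rfl⟩; exact dist_nonneg⟩
      obtain ⟨_, ⟨x, hx, rfl⟩, hlt⟩ := exists_lt_of_csInf_lt hne
        (show sInf A < sInf A + 1 / ((k : ℝ) + 1) by linarith [Nat.one_div_pos_of_nat (α := ℝ) (n := k)])
      refine ⟨x, fun _ => ⟨hx, fun z hz => hlt.le.trans ?_⟩⟩
      have : sInf A ≤ dist z x₀ := csInf_le hb ⟨z, hz, rfl⟩
      linarith
    · exact ⟨x₀, fun h => absurd h hk⟩
  choose x hx using h1
  refine ⟨x, ?_, ?_⟩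
  · rw [Metric.tendsto_nhds]
    intro ε hε
    filter_upwards [h (ε / 4) (by positivity),
      tendsto_one_div_add_atTop_nhds_zero_nat.eventually_lt_const (show 0 < ε / 4 by positivity)]
      with k ⟨z, hz, hzP⟩ hk
    have := (hx k ⟨z, hzP⟩).2 z hzP
    rw [Metric.mem_closedBall] at hz
    linarith
  · filter_upwards [h 1 one_pos] with k ⟨z, _, hzP⟩
    exact (hx k ⟨z, hzP⟩).1

end SchurAsymp

namespace SchurAsymp

open MeasureTheory

theorem le_norm_sub_of_mem_ball {w₀ z x : ℂ} {d : ℝ} (h : d ≤ ‖w₀ - x‖)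
    (hz : z ∈ Metric.ball w₀ (d / 2)) : d / 2 ≤ ‖z - x‖ := by
  rw [mem_ball_iff_norm] at hz
  have := norm_sub_le_norm_sub_add_norm_sub w₀ z x
  rw [norm_sub_rev w₀ z] at this
  linarith

theorem tendstoUniformlyOn_mean_inv {α : Type*} {l : Filter α} {n : α → ℕ} (hn : Tendsto n l atTop)
    {p : ∀ i, Fin (n i) → ℝ} {f : ℝ → ℝ} (hint : IntervalIntegrable (limitPole f) volume 0 1)
    (hd : Tendsto (fun i => stepDist (p i) (limitPole f)) l (𝓝 0)) {d : ℝ} (hd0 : 0 < d) {w₀ : ℂ}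
    (hdist : ∀ᶠ i in l, ∀ j, d ≤ ‖w₀ - p i j‖)
    (hfar : ∀ᵐ t, t ∈ Set.Ioc (0 : ℝ) 1 → d ≤ ‖w₀ - limitPole f t‖) :
    TendstoUniformlyOn (fun i (z : ℂ) => (∑ j, (z - p i j)⁻¹) / (n i : ℂ)) (dF f) l
      (Metric.ball w₀ (d / 2)) := by
  rw [Metric.tendstoUniformlyOn_iff]
  intro ε hε
  have h1 := hd.const_mul ((d / 2) ^ 2)⁻¹
  rw [mul_zero] at h1
  filter_upwards [h1.eventually_lt_const hε, hdist, hn.eventually_gt_atTop 0] with i h2 h3 h4 z hz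
  have hm : AEStronglyMeasurable (fun t => (z - limitPole f t : ℂ)⁻¹)
      (volume.restrict (Set.Ioc (0 : ℝ) 1)) := by
    have hm : AEMeasurable (fun t => (limitPole f t : ℂ)) (volume.restrict (Set.Ioc (0 : ℝ) 1)) := by
      rw [← Set.uIoc_of_le zero_le_one]
      exact Complex.measurable_ofReal.comp_aemeasurable hint.def'.aestronglyMeasurable.aemeasurable
    exact (hm.const_sub z).inv.aestronglyMeasurable
  have h5 := norm_mean_sub_integral_le h4 (p := p i) hint (S := {x | d / 2 ≤ ‖z - x‖})
    (φ := fun x : ℝ => (z - x : ℂ)⁻¹) (K := ((d / 2) ^ 2)⁻¹) (fun x hx y hy => ?_)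
    (fun j => show d / 2 ≤ ‖z - (p i j : ℂ)‖ from le_norm_sub_of_mem_ball (h3 j) hz)
    (by filter_upwards [hfar] with t ht htI using le_norm_sub_of_mem_ball (ht htI) hz) ?_
  · rw [dist_comm, dist_eq_norm, dF_eq]
    refine lt_of_eq_of_lt ?_ (h5.trans_lt h2)
    congr 2
    rw [Complex.real_smul, Complex.ofReal_inv, Complex.ofReal_natCast, div_eq_inv_mul]
  · refine (norm_inv_sub_inv_le (half_pos hd0) hx hy).trans_eq ?_
    rw [sub_sub_sub_cancel_left, ← Complex.ofReal_sub, Complex.norm_real, Real.norm_eq_abs,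
      abs_sub_comm]
  · refine intervalIntegrable_of_bound (B := (d / 2)⁻¹) hm ?_
    filter_upwards [hfar] with t ht htI
    rw [norm_inv]
    exact inv_anti₀ (half_pos hd0) (le_norm_sub_of_mem_ball (ht htI) hz)

theorem hasDerivAt_mean_inv {n : ℕ} {p : Fin n → ℝ} {z : ℂ} (hz : ∀ j, z ≠ p j) :
    HasDerivAt (fun z : ℂ => (∑ j, (z - p j)⁻¹) / (n : ℂ)) (-((∑ j, ((z - p j)⁻¹) ^ 2) / (n : ℂ))) z := by
  rw [← neg_div, ← Finset.sum_neg_distrib]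
  refine HasDerivAt.div_const (HasDerivAt.fun_sum fun j _ => ?_) _
  have h := ((hasDerivAt_id z).sub_const (p j : ℂ)).inv (sub_ne_zero.mpr (hz j))
  simp only [id] at h
  rwa [neg_div, one_div, ← inv_pow] at h

/-- Approximate poles that converge in `L¹` have a critical point near `w₀`. -/
theorem exists_saddle {ν : ℕ → ℕ} (hν : Tendsto ν atTop atTop)
    {p : ∀ k, Fin (ν k) → ℝ} {f : ℝ → ℝ} (hint : IntervalIntegrable (limitPole f) volume 0 1)
    (hd : Tendsto (fun k => stepDist (p k) (limitPole f)) atTop (𝓝 0)) {d : ℝ} (hd0 : 0 < d) {w₀ : ℂ}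
    (hdist : ∀ᶠ k in atTop, ∀ j, d ≤ ‖w₀ - p k j‖)
    (hfar : ∀ᵐ t, t ∈ Set.Ioc (0 : ℝ) 1 → d ≤ ‖w₀ - limitPole f t‖) (hF : d2F f w₀ ≠ 0) :
    ∃ w : ℕ → ℂ, Tendsto w atTop (𝓝 w₀) ∧
      (∀ᶠ k in atTop, (∑ j, (w k - p k j)⁻¹) / (ν k : ℂ) = dF f w₀) ∧
      Tendsto (fun k => (∑ j, ((w k - p k j)⁻¹) ^ 2) / (ν k : ℂ)) atTop (𝓝 (-d2F f w₀)) := by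
  have hd2 := half_pos hd0
  have hU := (tendstoUniformlyOn_mean_inv hν hint hd hd0 hdist hfar).tendstoLocallyUniformlyOn
  have hne : ∀ᶠ k in atTop, ∀ z ∈ Metric.ball w₀ (d / 2), ∀ j, z ≠ p k j := by
    filter_upwards [hdist] with k hk z hz j
    exact sub_ne_zero.mp (norm_pos_iff.mp (hd2.trans_le (le_norm_sub_of_mem_ball (hk j) hz)))
  have hdiff : ∀ᶠ k in atTop, DifferentiableOn ℂ (fun z : ℂ => (∑ j, (z - p k j)⁻¹) / (ν k : ℂ))
      (Metric.ball w₀ (d / 2)) := by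
    filter_upwards [hne] with k hk z hz
    exact (hasDerivAt_mean_inv (hk z hz)).differentiableAt.differentiableWithinAt
  have hmem := Metric.mem_ball_self (x := w₀) hd2
  obtain ⟨w, hw, hwP⟩ := exists_tendsto_of_eventually_exists fun ε hε =>
    eventually_exists_eq_of_tendstoLocallyUniformlyOn hd2 hdiff hU hF hε
  refine ⟨w, hw, hwP, ?_⟩
  have hdF := hU.differentiableOn hdiff Metric.isOpen_ball
  have hD := hU.deriv hdiff Metric.isOpen_ball
  have hc : ContinuousAt (deriv (dF f)) w₀ :=
    ((hdF.deriv Metric.isOpen_ball).differentiableAt (Metric.ball_mem_nhds _ hd2)).continuousAt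
  have h1 := (hD.tendsto_comp hc.continuousWithinAt hmem (tendsto_nhdsWithin_iff.mpr
    ⟨hw, hw.eventually_mem (Metric.ball_mem_nhds _ hd2)⟩)).neg
  refine h1.congr' ?_
  filter_upwards [hne, hw.eventually_mem (Metric.ball_mem_nhds _ hd2)] with k hk hwk
  simp only [Function.comp_apply]
  rw [(hasDerivAt_mean_inv (hk _ hwk)).deriv, neg_neg]

theorem SameContourIntegral.integral_eq {N : ℕ} (hN : 0 < N) {lam : Fin N → ℤ} (hlam : Antitone lam)
    {y : ℂ} {γ : ℝ → ℂ} (h : SameContourIntegral lam y γ) :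
    ∫ s : ℝ, integrand lam y (γ s) * deriv γ s =
      2 * Real.pi * Complex.I * ddExpC Finset.univ (pole lam) (N * y) := by
  have hpos : 0 < ∑ i, |pole lam i| + 1 := by positivity
  have hR : ∀ i, |pole lam i| < ∑ i, |pole lam i| + 1 := fun i =>
    (Finset.single_le_sum (f := fun i => |pole lam i|) (fun _ _ => abs_nonneg _)
      (Finset.mem_univ i)).trans_lt (lt_add_one _)
  rw [h.2 _ hpos hR, ← circleIntegral_exp_div_prod (R := ∑ i, |pole lam i| + 1)
    ⟨⟨0, hN⟩, Finset.mem_univ _⟩ (pole_strictAnti hlam).injective.injOn fun j _ => hR j]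
  rfl

theorem normSchur_eq_contour_integral {ν : ℕ → ℕ} (hν : Tendsto ν atTop atTop)
    {lam : ∀ k, Fin (ν k) → ℤ} (hlam : ∀ k, Antitone (lam k)) {y : ℂ} {γ : ℝ → ℂ}
    (hsame : ∀ᶠ k in atTop, SameContourIntegral (lam k) y γ)
    (h0 : ∀ᶠ k in atTop, ∫ s, integrand (lam k) y (γ s) * deriv γ s ≠ 0) :
    Complex.exp y ≠ 1 ∧ ∀ᶠ k in atTop, normSchur (lam k) (Complex.exp y) =
      factorialRatio (ν k) / (Complex.exp y - 1) ^ (ν k - 1) *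
        ((∫ s, integrand (lam k) y (γ s) * deriv γ s) / (2 * Real.pi * Complex.I)) := by
  have hJe : ∀ᶠ k in atTop, (∫ s, integrand (lam k) y (γ s) * deriv γ s) =
      2 * Real.pi * Complex.I * ddExpC Finset.univ (pole (lam k)) (ν k * y) := by
    filter_upwards [hsame, hν.eventually_gt_atTop 0] with k hk h0
    exact hk.integral_eq h0 (hlam k)
  have hy : Complex.exp y ≠ 1 := by
    intro hy
    obtain ⟨k, h1, h2, h3⟩ := (hJe.and (h0.and (hν.eventually_gt_atTop 1))).exists
    rw [ddExpC_eq_zero h3 (hlam k) hy, mul_zero] at h1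
    exact h2 h1
  refine ⟨hy, ?_⟩
  filter_upwards [hJe, hν.eventually_gt_atTop 0] with k h1 h0
  rw [normSchur_exp h0 (hlam k) hy, h1, mul_div_cancel_left₀ _ Complex.two_pi_I_ne_zero]

/-- The argument of a logarithm can be prescribed up to a bounded error. -/
theorem exists_log_tendsto {ν : ℕ → ℕ} (hν : Tendsto ν atTop atTop) {S : ℕ → ℂ} {L : ℂ}
    (hS : ∀ᶠ k in atTop, S k ≠ 0)
    (hlim : Tendsto (fun k => Real.log ‖S k‖ / ν k) atTop (𝓝 L.re)) :
    ∃ ℓ : ℕ → ℂ, (∀ᶠ k in atTop, Complex.exp (ℓ k) = S k) ∧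
      Tendsto (fun k => ℓ k / (ν k : ℂ)) atTop (𝓝 L) := by
  set m : ℕ → ℤ := fun k => round ((ν k * L.im - (Complex.log (S k)).im) / (2 * Real.pi)) with hm
  set ℓ : ℕ → ℂ := fun k => Complex.log (S k) + m k * (2 * Real.pi * Complex.I) with hℓ
  have hre : ∀ k, (ℓ k).re = Real.log ‖S k‖ := fun k => by
    simp [hℓ, Complex.log_re]
  have him : ∀ k, |(ℓ k).im - ν k * L.im| ≤ Real.pi := by
    intro k
    have h1 := abs_sub_round ((ν k * L.im - (Complex.log (S k)).im) / (2 * Real.pi))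
    have h2 : (ℓ k).im - ν k * L.im = -(2 * Real.pi) *
        ((ν k * L.im - (Complex.log (S k)).im) / (2 * Real.pi) - m k) := by
      have : (ℓ k).im = (Complex.log (S k)).im + m k * (2 * Real.pi) := by simp [hℓ]
      rw [this]
      have := Real.pi_pos
      field_simp
      ring
    rw [h2, abs_mul, abs_neg, abs_of_pos Real.two_pi_pos]
    have := mul_le_mul_of_nonneg_left h1 Real.two_pi_pos.le
    linarith
  refine ⟨ℓ, hS.mono fun k hk => ?_, ?_⟩
  · rw [hℓ]
    simp only []
    rw [Complex.exp_add, Complex.exp_log hk, Complex.exp_int_mul_two_pi_mul_I, mul_one]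
  · rw [tendsto_iff_norm_sub_tendsto_zero]
    have h1 := (tendsto_iff_norm_sub_tendsto_zero.mp hlim).add (tendsto_inv_nat_mul_const hν Real.pi)
    rw [zero_add] at h1
    refine squeeze_zero' (Eventually.of_forall fun _ => norm_nonneg _) ?_ h1
    filter_upwards [hν.eventually_gt_atTop 0] with k hk
    have hk' : (0 : ℝ) < ν k := by exact_mod_cast hk
    refine (Complex.norm_le_abs_re_add_abs_im _).trans (add_le_add ?_ ?_)
    · rw [Real.norm_eq_abs, Complex.sub_re, ← Complex.ofReal_natCast, Complex.div_ofReal_re, hre]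
    · rw [Complex.sub_im, ← Complex.ofReal_natCast, Complex.div_ofReal_im]
      have e : (ℓ k).im / ν k - L.im = (ν k : ℝ)⁻¹ * ((ℓ k).im - ν k * L.im) := by field_simp
      rw [e, abs_mul, abs_of_pos (inv_pos.mpr hk')]
      exact mul_le_mul_of_nonneg_left (him k) (by positivity)

theorem log_asymptotics_complex {ν : ℕ → ℕ} (hν : Tendsto ν atTop atTop)
    {lam : ∀ k, Fin (ν k) → ℤ} (hlam : ∀ k, Antitone (lam k)) {f : ℝ → ℝ}
    (hf : PiecewiseContinuous f) (hR : Tendsto (fun k => R1 (lam k) f / (ν k : ℝ)) atTop (𝓝 0))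
    {y w₀ : ℂ} {γ : ℝ → ℂ} (hcrit : IsCriticalPoint f y w₀) (hγ : IsSteepestDescentContour f y w₀ γ)
    (hdef : DeformableTo lam y γ) :
    ∃ ℓ : ℕ → ℂ, (∀ᶠ k in atTop, Complex.exp (ℓ k) = normSchur (lam k) (Complex.exp y)) ∧
      Tendsto (fun k => ℓ k / (ν k : ℂ)) atTop
        (𝓝 (y * w₀ - F f w₀ - 1 - Complex.log (Complex.exp y - 1))) := by
  obtain ⟨⟨d, hd, hdist⟩, hsame⟩ := hdef
  have hint : IntervalIntegrable (limitPole f) volume 0 1 :=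
    (hf.intervalIntegrable.add intervalIntegrable_const).sub
      (continuous_id.intervalIntegrable _ _)
  have hst : Tendsto (fun k => stepDist (pole (lam k)) (limitPole f)) atTop (𝓝 0) :=
    tendsto_stepDist_pole hf hν hR
  have hfar : ∀ s : ℝ, ∀ᵐ t, t ∈ Set.Ioc (0 : ℝ) 1 → d ≤ ‖γ s - limitPole f t‖ := fun s =>
    ae_dist_le_of_stepDist hν hint hst (hdist.mono fun k hk j => hk s j)
  have hd₀ : ∀ᶠ k in atTop, ∀ j, d ≤ ‖w₀ - pole (lam k) j‖ := hdist.mono fun k hk j => by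
    rw [← hγ.base]; exact hk 0 j
  have hfar₀ := hfar 0
  rw [hγ.base] at hfar₀
  obtain ⟨w, hw, hw1, hw2⟩ := exists_saddle hν hint hst hd hd₀ hfar₀ hγ.d2F_ne_zero
  rw [hcrit.2] at hw1
  have hwd : ∀ᶠ k in atTop, ∀ j, d / 2 ≤ ‖w k - pole (lam k) j‖ := by
    filter_upwards [hd₀, hw.eventually_mem (Metric.ball_mem_nhds _ (half_pos hd))] with k h1 h2 j
    exact le_norm_sub_of_mem_ball (h1 j) h2
  have hwp : ∀ᶠ k in atTop, ∀ i, w k ≠ pole (lam k) i := hwd.mono fun k hk i =>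
    sub_ne_zero.mp (norm_pos_iff.mp ((half_pos hd).trans_le (hk i)))
  have hU := tendsto_mean_log_of_stepDist hν hint hst (half_pos hd) hw hwd
    (hfar₀.mono fun t ht htI => (half_le_self hd.le).trans (ht htI))
  obtain ⟨c, hc, -, hv, hlim⟩ := tendsto_contour_integral hν hγ hd hdist (hsame.mono fun k hk => hk.1)
    (fun η hη => le_mean_log_of_stepDist hν hint hst hd hdist hfar hη) hw hU
    (tendsto_const_nhds.congr' (hw1.mono fun k hk => by simp only []; rw [hk, sub_self, mul_zero])) hw2
  have hlim0 : deriv γ 0 * ((√(2 * Real.pi / c ^ 2) : ℝ) : ℂ) ≠ 0 := by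
    refine mul_ne_zero hv (Complex.ofReal_ne_zero.mpr (Real.sqrt_ne_zero'.mpr ?_))
    have := Real.pi_pos
    positivity
  set J := fun k => ∫ s, integrand (lam k) y (γ s) * deriv γ s with hJ
  set X := fun k => (√(ν k) : ℂ) * (J k / integrand (lam k) y (w k)) with hX
  have hJ0 : ∀ᶠ k in atTop, J k ≠ 0 := by
    filter_upwards [hlim.eventually_ne hlim0] with k hk h
    exact hk (by simp only [hX]; rw [h, zero_div, mul_zero])
  obtain ⟨hy, hSe⟩ := normSchur_eq_contour_integral hν hlam hsame hJ0
  have hy' : Complex.exp y - 1 ≠ 0 := sub_ne_zero.mpr hy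
  have hS : ∀ᶠ k in atTop, ‖normSchur (lam k) (Complex.exp y)‖ =
      factorialRatio (ν k) / ‖Complex.exp y - 1‖ ^ (ν k - 1) * (‖J k‖ / (2 * Real.pi)) := by
    filter_upwards [hSe, hν.eventually_gt_atTop 0] with k h1 h0
    rw [h1, norm_mul, norm_div, norm_div, norm_pow, Complex.norm_real,
      Real.norm_of_nonneg (factorialRatio_pos h0).le]
    congr 2
    simp [abs_of_pos Real.pi_pos]
  refine exists_log_tendsto hν ?_ ?_
  · filter_upwards [hS, hJ0, hν.eventually_gt_atTop 0] with k h1 h2 h0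
    rw [← norm_pos_iff, h1]
    have := factorialRatio_pos h0
    have := norm_pos_iff.mpr hy'
    have := norm_pos_iff.mpr h2
    have := Real.pi_pos
    positivity
  · have hXlog : Tendsto (fun k => (ν k : ℝ)⁻¹ * Real.log ‖X k‖) atTop (𝓝 0) := by
      have h1 := (Real.continuousAt_log (norm_pos_iff.mpr hlim0).ne').tendsto.comp hlim.norm
      have h2 := ((tendsto_natCast_atTop_atTop (R := ℝ)).comp hν).inv_tendsto_atTop.mul h1
      rwa [zero_mul] at h2
    have hJlog : Tendsto (fun k => (ν k : ℝ)⁻¹ * Real.log ‖J k‖) atTop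
        (𝓝 ((y * w₀ - F f w₀).re)) := by
      have h1 : Tendsto (fun k => (y * w k).re - (∑ i, Real.log ‖w k - pole (lam k) i‖) / ν k) atTop
          (𝓝 ((y * w₀ - F f w₀).re)) := by
        rw [Complex.sub_re]
        exact ((Complex.continuous_re.tendsto _).comp (hw.const_mul y)).sub hU
      have h2 := (hXlog.add h1).sub (tendsto_inv_nat_mul_log_sqrt hν)
      rw [zero_add, sub_zero] at h2
      refine h2.congr' ?_
      filter_upwards [hwp, hJ0, hν.eventually_gt_atTop 0] with k h3 h4 h0
      have hk' : (0 : ℝ) < ν k := by exact_mod_cast h0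
      have h5 := norm_pos_iff.mpr h4
      have h6 := norm_integrand h0 (y := y) h3
      have h7 := Real.sqrt_pos.mpr hk'
      have h8 : Real.log ‖X k‖ = Real.log (√(ν k)) + (Real.log ‖J k‖ -
          ν k * ((y * w k).re - (∑ i, Real.log ‖w k - pole (lam k) i‖) / ν k)) := by
        rw [hX]
        simp only []
        rw [norm_mul, norm_div, Complex.norm_real, Real.norm_of_nonneg h7.le, h6,
          Real.log_mul h7.ne' (div_pos h5 (Real.exp_pos _)).ne', Real.log_div h5.ne'
          (Real.exp_ne_zero _), Real.log_exp]
      rw [h8]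
      field_simp
      ring
    have hDD : Tendsto (fun k => (ν k : ℝ)⁻¹ * Real.log (‖J k‖ / (2 * Real.pi))) atTop
        (𝓝 ((y * w₀ - F f w₀).re)) := by
      have := hJlog.sub (tendsto_inv_nat_mul_const hν (Real.log (2 * Real.pi)))
      rw [sub_zero] at this
      refine this.congr' (hJ0.mono fun k hk => ?_)
      simp only []
      rw [Real.log_div (norm_ne_zero_iff.mpr hk) Real.two_pi_pos.ne', mul_sub]
    have := (tendsto_log_normSchur hν (x := ‖Complex.exp y - 1‖) (norm_ne_zero_iff.mpr hy')
      (hJ0.mono fun k hk => div_pos (norm_pos_iff.mpr hk) Real.two_pi_pos)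
      (by simpa only [abs_norm] using hS) hDD).2
    refine this.trans_eq ?_
    rw [abs_norm]
    congr 1
    simp [Complex.log_re]

end SchurAsymp

namespace SchurAsymp

open MeasureTheory

/-- The difference of the means of `φ` over the points `p` and over the points `q`. -/
noncomputable def meanDiff {n : ℕ} (p q : Fin n → ℝ) (φ : ℝ → ℂ) : ℂ :=
  (∑ j, (φ (p j) - φ (q j))) / n

theorem meanDiff_add {n : ℕ} (p q : Fin n → ℝ) (φ ψ : ℝ → ℂ) :
    meanDiff p q (fun x => φ x + ψ x) = meanDiff p q φ + meanDiff p q ψ := by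
  rw [meanDiff, meanDiff, meanDiff, ← add_div, ← Finset.sum_add_distrib]
  congr 1
  exact Finset.sum_congr rfl fun j _ => by ring

theorem meanDiff_mul {n : ℕ} (p q : Fin n → ℝ) (c : ℂ) (φ : ℝ → ℂ) :
    meanDiff p q (fun x => c * φ x) = c * meanDiff p q φ := by
  rw [meanDiff, meanDiff, ← mul_div_assoc, Finset.mul_sum]
  congr 1
  exact Finset.sum_congr rfl fun j _ => by ring

theorem meanDiff_star {n : ℕ} (p q : Fin n → ℝ) (φ : ℝ → ℂ) :
    meanDiff p q (fun x => star (φ x)) = star (meanDiff p q φ) := by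
  simp [meanDiff]

theorem norm_meanDiff_le {n : ℕ} (p q : Fin n → ℝ) {φ : ℝ → ℂ} {C : ℝ} (hφ : ∀ x, ‖φ x‖ ≤ C) :
    ‖meanDiff p q φ‖ ≤ 2 * C := by
  have hC : 0 ≤ C := (norm_nonneg _).trans (hφ 0)
  rw [meanDiff, norm_div, Complex.norm_natCast]
  refine div_le_of_le_mul₀ (by positivity) (by positivity) ?_
  refine (norm_sum_le_of_le (f := fun j => φ (p j) - φ (q j)) _ (n := fun _ => 2 * C) fun j _ =>
    (norm_sub_le _ _).trans (by linarith [hφ (p j), hφ (q j)])).trans_eq ?_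
  rw [Finset.sum_const, Finset.card_univ, Fintype.card_fin, nsmul_eq_mul]
  ring

variable {α : Type*} {l : Filter α}

theorem tendsto_meanDiff_poly {n : α → ℕ} {p q : ∀ i, Fin (n i) → ℝ} {s : ℝ → ℂ}
    (hm : ∀ m : ℕ, Tendsto (fun i => meanDiff (p i) (q i) fun x => s x ^ m) l (𝓝 0))
    (P : Polynomial ℂ) : Tendsto (fun i => meanDiff (p i) (q i) fun x => P.eval (s x)) l (𝓝 0) := by
  induction P using Polynomial.induction_on' with
  | add P Q hP hQ =>
    have := hP.add hQ
    rw [add_zero] at this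
    refine this.congr fun i => ?_
    simp only [Polynomial.eval_add]
    rw [meanDiff_add]
  | monomial m c =>
    have := (hm m).const_mul c
    rw [mul_zero] at this
    refine this.congr fun i => ?_
    simp only [Polynomial.eval_monomial]
    rw [meanDiff_mul]

/-- The Cayley transform that maps `z₀` to infinity, as a function on the compactified line. -/
noncomputable def cayley (z₀ : ℂ) (hz : z₀.im ≠ 0) : C(OnePoint ℝ, ℂ) :=
  OnePoint.continuousMapMk ⟨fun x : ℝ => 1 - (z₀ - star z₀) * (z₀ - x)⁻¹, by
    refine continuous_const.sub (continuous_const.mul (Continuous.inv₀ (by fun_prop) fun x hx => ?_))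
    refine hz ?_
    rw [sub_eq_zero.mp hx, Complex.ofReal_im]⟩ 1 (by
    have h1 : Tendsto (fun x : ℝ => (z₀ - x : ℂ)) (cocompact ℝ) (cocompact ℂ) := by
      have h2 : Topology.IsClosedEmbedding (fun x : ℝ => (z₀ - x : ℂ)) :=
        (Homeomorph.subLeft z₀).isClosedEmbedding.comp Complex.isometry_ofReal.isClosedEmbedding
      exact h2.tendsto_cocompact
    have h3 := ((tendsto_inv₀_cobounded' (α := ℂ)).mono_left
      (Metric.cobounded_eq_cocompact (α := ℂ)).ge).comp h1
    have h4 := ((tendsto_nhdsWithin_iff.mp h3).1.const_mul (z₀ - star z₀)).const_sub 1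
    rw [mul_zero, sub_zero] at h4
    rwa [coclosedCompact_eq_cocompact])

theorem cayley_coe {z₀ : ℂ} (hz : z₀.im ≠ 0) (x : ℝ) :
    cayley z₀ hz x = 1 - (z₀ - star z₀) * (z₀ - x)⁻¹ := rfl

theorem cayley_infty {z₀ : ℂ} (hz : z₀.im ≠ 0) : cayley z₀ hz OnePoint.infty = 1 := rfl

theorem star_cayley_mul_self {z₀ : ℂ} (hz : z₀.im ≠ 0) : star (cayley z₀ hz) * cayley z₀ hz = 1 := by
  ext x
  rw [ContinuousMap.mul_apply, ContinuousMap.star_apply, ContinuousMap.one_apply]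
  cases x using OnePoint.rec with
  | infty => rw [cayley_infty]; simp
  | coe x =>
    have h1 : z₀ - x ≠ 0 := fun h => hz (by rw [sub_eq_zero.mp h, Complex.ofReal_im])
    have h2 : star z₀ - x ≠ 0 := fun h => h1 (by
      have := congrArg star h
      simpa using this)
    rw [cayley_coe, show (1 : ℂ) - (z₀ - star z₀) * (z₀ - x)⁻¹ = (star z₀ - x) / (z₀ - x) by
      field_simp; ring]
    simp only [star_div₀, star_sub, star_star]
    have : star (x : ℂ) = x := Complex.conj_ofReal x
    rw [this]
    field_simp

theorem separatesPoints_cayley {z₀ : ℂ} (hz : z₀.im ≠ 0) :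
    (StarAlgebra.adjoin ℂ {cayley z₀ hz}).SeparatesPoints := by
  intro x y hxy
  refine ⟨cayley z₀ hz, ⟨cayley z₀ hz, StarAlgebra.subset_adjoin _ _ rfl, rfl⟩, ?_⟩
  have h1 : ∀ x : ℝ, z₀ - x ≠ 0 := fun x h => hz (by rw [sub_eq_zero.mp h, Complex.ofReal_im])
  have h0 : z₀ - star z₀ ≠ 0 := fun h => hz (by
    have := congrArg Complex.im h
    simp at this
    linarith)
  have hne : ∀ x : ℝ, cayley z₀ hz x ≠ 1 := fun x h => by
    rw [cayley_coe, sub_eq_self] at h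
    exact mul_ne_zero h0 (inv_ne_zero (h1 x)) h
  cases x using OnePoint.rec with
  | infty => cases y using OnePoint.rec with
    | infty => exact absurd rfl hxy
    | coe y => rw [cayley_infty]; exact (hne y).symm
  | coe x => cases y using OnePoint.rec with
    | infty => rw [cayley_infty]; exact hne x
    | coe y =>
      intro h
      refine hxy ?_
      rw [cayley_coe, cayley_coe, sub_right_inj] at h
      have h2 := inv_injective (mul_left_cancel₀ h0 h)
      rw [sub_right_inj] at h2
      rw [Complex.ofReal_injective h2]

theorem mem_closure_cayley {z₀ : ℂ} (hz : z₀.im ≠ 0) {a : C(OnePoint ℝ, ℂ)}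
    (ha : a ∈ Submonoid.closure ({cayley z₀ hz} ∪ star {cayley z₀ hz})) :
    ∃ m : ℕ, a = cayley z₀ hz ^ m ∨ a = star (cayley z₀ hz) ^ m := by
  have hu := star_cayley_mul_self hz
  set u := cayley z₀ hz
  have key : ∀ m k : ℕ, ∃ r, u ^ m * star u ^ k = u ^ r ∨ u ^ m * star u ^ k = star u ^ r := by
    intro m k
    have h1 : ∀ r, star u ^ r * u ^ r = 1 := fun r => by rw [← mul_pow, hu, one_pow]
    rcases le_total m k with h | h
    · refine ⟨k - m, Or.inr ?_⟩
      obtain ⟨r, rfl⟩ := Nat.exists_eq_add_of_le h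
      rw [Nat.add_sub_cancel_left, pow_add, ← mul_assoc, mul_comm (u ^ m), h1, one_mul]
    · refine ⟨m - k, Or.inl ?_⟩
      obtain ⟨r, rfl⟩ := Nat.exists_eq_add_of_le h
      rw [Nat.add_sub_cancel_left, pow_add, mul_comm, ← mul_assoc, h1, one_mul]
  induction ha using Submonoid.closure_induction with
  | mem a ha =>
    rcases ha with h | h
    · exact ⟨1, Or.inl (by rw [pow_one]; exact h)⟩
    · refine ⟨1, Or.inr ?_⟩
      rw [pow_one, ← star_star a]
      exact congrArg star (Set.mem_star.mp h)
  | one => exact ⟨0, Or.inl (pow_zero _).symm⟩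
  | mul a b _ _ ha hb =>
    obtain ⟨m, rfl | rfl⟩ := ha <;> obtain ⟨k, rfl | rfl⟩ := hb
    · exact ⟨m + k, Or.inl (pow_add _ _ _).symm⟩
    · exact key m k
    · rw [mul_comm]; exact key k m
    · exact ⟨m + k, Or.inr (pow_add _ _ _).symm⟩

/-- Weak convergence is implied by the convergence of the derivatives of the Stieltjes transform at
one non-real point. -/
theorem tendsto_meanDiff_of_moments {n : α → ℕ} {p q : ∀ i, Fin (n i) → ℝ} {z₀ : ℂ}
    (hz : z₀.im ≠ 0)
    (hm : ∀ m : ℕ, Tendsto (fun i => meanDiff (p i) (q i) fun x => ((z₀ - x)⁻¹) ^ m) l (𝓝 0))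
    (Φ : C(OnePoint ℝ, ℂ)) : Tendsto (fun i => meanDiff (p i) (q i) fun x => Φ x) l (𝓝 0) := by
  set u := cayley z₀ hz with hu
  have hpow : ∀ m : ℕ, Tendsto (fun i => meanDiff (p i) (q i) fun x => (u ^ m) x) l (𝓝 0) := by
    intro m
    refine (tendsto_meanDiff_poly hm ((1 - Polynomial.C (z₀ - star z₀) * Polynomial.X) ^ m)).congr
      fun i => ?_
    congr 1
    ext x
    rw [ContinuousMap.pow_apply, hu, cayley_coe]
    simp
  have hspan : ∀ a ∈ StarAlgebra.adjoin ℂ {u},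
      Tendsto (fun i => meanDiff (p i) (q i) fun x => a x) l (𝓝 0) := by
    intro a ha
    have ha' : a ∈ Submodule.span ℂ
        (Submonoid.closure ({u} ∪ star {u}) : Set C(OnePoint ℝ, ℂ)) := by
      rw [← Algebra.adjoin_eq_span, ← StarAlgebra.adjoin_toSubalgebra]
      exact ha
    clear ha
    induction ha' using Submodule.span_induction with
    | mem a h =>
      obtain ⟨m, rfl | rfl⟩ := mem_closure_cayley hz h
      · exact hpow m
      · have := (hpow m).star
        rw [star_zero] at this
        refine this.congr fun i => ?_
        rw [← meanDiff_star]
        congr 1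
        ext x
        rw [← star_pow]
        rfl
    | zero =>
      simp only [meanDiff, ContinuousMap.zero_apply, sub_zero, Finset.sum_const_zero, zero_div]
      exact tendsto_const_nhds
    | add a b _ _ h1 h2 =>
      have := h1.add h2
      rw [add_zero] at this
      refine this.congr fun i => ?_
      rw [← meanDiff_add]; rfl
    | smul c a _ h =>
      have := h.const_mul c
      rw [mul_zero] at this
      refine this.congr fun i => ?_
      rw [← meanDiff_mul]; rfl
  have hdense := ContinuousMap.starSubalgebra_topologicalClosure_eq_top_of_separatesPoints _
    (separatesPoints_cayley hz)
  have hΦ : Φ ∈ (StarAlgebra.adjoin ℂ {u}).topologicalClosure := by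
    rw [hdense]; trivial
  have hΦ' : Φ ∈ closure ((StarAlgebra.adjoin ℂ {u} : StarSubalgebra ℂ C(OnePoint ℝ, ℂ)) :
    Set C(OnePoint ℝ, ℂ)) := hΦ
  rw [Metric.tendsto_nhds]
  intro ε hε
  obtain ⟨a, ha, hda⟩ := Metric.mem_closure_iff.mp hΦ' (ε / 4) (by positivity)
  filter_upwards [Metric.tendsto_nhds.mp (hspan a ha) (ε / 2) (by positivity)] with i hi
  rw [dist_zero_right] at hi ⊢
  have h1 := norm_meanDiff_le (p i) (q i) (φ := fun x => (Φ - a) x) (C := ε / 4) fun x =>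
    ((Φ - a).norm_coe_le_norm x).trans (by rw [← dist_eq_norm]; exact hda.le)
  have h2 : meanDiff (p i) (q i) (fun x => Φ x) =
      meanDiff (p i) (q i) (fun x => a x) + meanDiff (p i) (q i) fun x => (Φ - a) x := by
    rw [← meanDiff_add]
    congr 1; ext x
    simp
  rw [h2]
  refine (norm_add_le _ _).trans_lt ?_
  linarith

theorem hasDerivAt_meanDiff_inv_pow {n : ℕ} {p q : Fin n → ℝ} {z : ℂ} (hp : ∀ j, z ≠ p j)
    (hq : ∀ j, z ≠ q j) (m : ℕ) :
    HasDerivAt (fun z : ℂ => meanDiff p q fun x => ((z - x)⁻¹) ^ m)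
      (-m * meanDiff p q fun x => ((z - x)⁻¹) ^ (m + 1)) z := by
  have h1 : ∀ x : ℝ, z ≠ x → HasDerivAt (fun z : ℂ => ((z - x)⁻¹) ^ m)
      (-m * ((z - x)⁻¹) ^ (m + 1)) z := by
    intro x hx
    have h := (((hasDerivAt_id z).sub_const (x : ℂ)).inv (sub_ne_zero.mpr hx)).pow m
    simp only [id] at h
    refine h.congr_deriv ?_
    rcases m with _ | m
    · simp
    · have := sub_ne_zero.mpr hx
      rw [Nat.add_sub_cancel, Pi.inv_apply, pow_succ _ (m + 1), pow_succ _ m, neg_div, one_div,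
        ← inv_pow]
      ring
  rw [← meanDiff_mul]
  exact (HasDerivAt.fun_sum fun j _ => (h1 _ (hp j)).sub (h1 _ (hq j))).div_const _

theorem tendstoLocallyUniformlyOn_meanDiff_inv_pow [l.NeBot] {n : α → ℕ} {p q : ∀ i, Fin (n i) → ℝ}
    {U : Set ℂ} (hU : IsOpen U) (hp : ∀ᶠ i in l, ∀ z ∈ U, ∀ j, z ≠ p i j)
    (hq : ∀ᶠ i in l, ∀ z ∈ U, ∀ j, z ≠ q i j)
    (h : TendstoLocallyUniformlyOn (fun i z => meanDiff (p i) (q i) fun x => (z - x)⁻¹)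
      (fun _ => 0) l U) (m : ℕ) :
    TendstoLocallyUniformlyOn (fun i (z : ℂ) => meanDiff (p i) (q i) fun x => ((z - x)⁻¹) ^ (m + 1))
      (fun _ => 0) l U := by
  induction m with
  | zero => simpa only [zero_add, pow_one] using h
  | succ m ih =>
    have hd := ih.deriv (by
      filter_upwards [hp, hq] with i h1 h2 z hz
      exact (hasDerivAt_meanDiff_inv_pow (h1 z hz) (h2 z hz)
        (m + 1)).differentiableAt.differentiableWithinAt) hU
    have hm : (-((m + 1 : ℕ) : ℂ)) ≠ 0 := neg_ne_zero.mpr (Nat.cast_ne_zero.mpr (Nat.succ_ne_zero m))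
    rw [Metric.tendstoLocallyUniformlyOn_iff] at hd ⊢
    intro ε hε z hz
    obtain ⟨t, ht, h1⟩ := hd (‖(-((m + 1 : ℕ) : ℂ))‖ * ε) (by positivity) z hz
    refine ⟨t ∩ U, Filter.inter_mem ht self_mem_nhdsWithin, ?_⟩
    filter_upwards [h1, hp, hq] with i h2 h3 h4 w hw
    have h5 := h2 w hw.1
    simp only [Function.comp_apply] at h5
    rw [(hasDerivAt_meanDiff_inv_pow (h3 w hw.2) (h4 w hw.2) (m + 1)).deriv, deriv_const,
      dist_zero_left, norm_mul] at h5
    rw [dist_zero_left]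
    exact lt_of_mul_lt_mul_left h5 (norm_nonneg _)

end SchurAsymp

namespace SchurAsymp

open MeasureTheory

/-- If the points `q` stay in a bounded set, then the convergence of means holds for all continuous
functions with values in `[0, 1]`, since no mass escapes to infinity. -/
theorem tendsto_mean_sub_mean_of_weak {α : Type*} {l : Filter α} {n : α → ℕ}
    {p q : ∀ i, Fin (n i) → ℝ} (hn : Tendsto n l atTop)
    (hw : ∀ Φ : C(OnePoint ℝ, ℂ), Tendsto (fun i => meanDiff (p i) (q i) fun x => Φ x) l (𝓝 0))
    {H : ℝ} (hq : ∀ i j, |q i j| ≤ H) {ψ : ℝ → ℝ} (hψ : Continuous ψ)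
    (h01 : ∀ x, 0 ≤ ψ x ∧ ψ x ≤ 1) :
    Tendsto (fun i => (∑ j, ψ (p i j)) / n i - (∑ j, ψ (q i j)) / n i) l (𝓝 0) := by
  have hcs : ∀ φ : ℝ → ℝ, Continuous φ → (∀ x, H + 1 < |x| → φ x = 0) →
      Tendsto (fun i => (∑ j, φ (p i j)) / n i - (∑ j, φ (q i j)) / n i) l (𝓝 0) := by
    intro φ hφ h0
    have hlim : Tendsto (fun x : ℝ => (φ x : ℂ)) (coclosedCompact ℝ) (𝓝 0) := by
      rw [coclosedCompact_eq_cocompact]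
      refine tendsto_const_nhds.congr' ?_
      have h1 : (Metric.closedBall (0 : ℝ) (H + 1))ᶜ ∈ cocompact ℝ :=
        (isCompact_closedBall _ _).compl_mem_cocompact
      filter_upwards [h1] with x hx
      rw [Set.mem_compl_iff, mem_closedBall_zero_iff, not_le, Real.norm_eq_abs] at hx
      rw [h0 x hx, Complex.ofReal_zero]
    have h2 := hw (OnePoint.continuousMapMk ⟨fun x : ℝ => (φ x : ℂ), by fun_prop⟩ 0 hlim)
    have h3 := (Complex.continuous_re.tendsto _).comp h2
    rw [Complex.zero_re] at h3
    refine h3.congr fun i => ?_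
    have h4 : meanDiff (p i) (q i) (fun x : ℝ => (φ x : ℂ)) =
        (((∑ j, φ (p i j)) / n i - (∑ j, φ (q i j)) / n i : ℝ) : ℂ) := by
      rw [meanDiff, Finset.sum_sub_distrib]
      push_cast
      rw [sub_div]
    exact (congrArg Complex.re h4).trans (Complex.ofReal_re _)
  set χ : ℝ → ℝ := fun x => max 0 (min 1 (H + 1 - |x|)) with hχ
  have hχc : Continuous χ := by fun_prop
  have hχ0 : ∀ x, 0 ≤ χ x := fun x => le_max_left _ _
  have hχ1 : ∀ x, χ x ≤ 1 := fun x => max_le zero_le_one (min_le_left _ _)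
  have hχs : ∀ x, H + 1 < |x| → χ x = 0 := fun x hx =>
    max_eq_left ((min_le_right _ _).trans (by linarith))
  have hχq : ∀ i j, χ (q i j) = 1 := fun i j => by
    have := hq i j
    rw [hχ]
    simp only []
    rw [min_eq_left (by linarith), max_eq_right zero_le_one]
  have t1 := hcs χ hχc hχs
  have t2 := hcs (fun x => ψ x * χ x) (hψ.mul hχc) fun x hx => by rw [hχs x hx, mul_zero]
  have t3 := t2.norm.sub t1
  rw [norm_zero, sub_zero] at t3
  refine squeeze_zero_norm' ?_ t3
  filter_upwards [hn.eventually_gt_atTop 0] with i hi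
  have hi' : (0 : ℝ) < n i := by exact_mod_cast hi
  simp only [hχq, mul_one, Finset.sum_const, Finset.card_univ, Fintype.card_fin, nsmul_eq_mul]
  rw [div_self hi'.ne']
  have h5 : 0 ≤ (∑ j, ψ (p i j)) / n i - (∑ j, ψ (p i j) * χ (p i j)) / n i := by
    rw [sub_nonneg]
    gcongr with j
    exact mul_le_of_le_one_right (h01 _).1 (hχ1 _)
  have h6 : (∑ j, ψ (p i j)) / n i - (∑ j, ψ (p i j) * χ (p i j)) / n i ≤
      1 - (∑ j, χ (p i j)) / n i := by
    rw [← sub_div, ← Finset.sum_sub_distrib, ← div_self hi'.ne', ← sub_div]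
    have : (n i : ℝ) - ∑ j, χ (p i j) = ∑ j, (1 - χ (p i j)) := by
      rw [Finset.sum_sub_distrib]; simp
    rw [this]
    refine div_le_div_of_nonneg_right (Finset.sum_le_sum fun j _ => ?_) hi'.le
    nlinarith [h01 (p i j), hχ1 (p i j)]
  have h7 := norm_add_le ((∑ j, ψ (p i j)) / n i - (∑ j, ψ (p i j) * χ (p i j)) / n i)
    ((∑ j, ψ (p i j) * χ (p i j)) / n i - (∑ j, ψ (q i j)) / n i)
  rw [sub_add_sub_cancel, Real.norm_of_nonneg h5] at h7
  linarith

theorem tendsto_mean_grid {α : Type*} {l : Filter α} [l.IsCountablyGenerated] {n : α → ℕ}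
    (hn : Tendsto n l atTop) {φ : ℝ → ℝ} (hφ : ContinuousOn φ (Set.Icc 0 1)) :
    Tendsto (fun i => (∑ j : Fin (n i), φ (((j : ℕ) + 1 : ℝ) / n i)) / n i) l
      (𝓝 (∫ t in (0 : ℝ)..1, φ t)) := by
  have hpc : PiecewiseContinuous φ := by
    refine ⟨∅, Set.finite_empty, fun t ht _ => hφ t ht, fun t ht => ⟨⟨φ t, ?_⟩, ⟨φ t, ?_⟩⟩⟩ <;>
    exact (hφ t ht).tendsto.mono_left (nhdsWithin_mono _ Set.inter_subset_left)
  have h := tendsto_mean hn hpc.intervalIntegrable (hpc.tendsto_stepDist hn) (S := Set.univ)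
    (φ := fun x => x) (K := 1) (fun x _ y _ => by simp) (Eventually.of_forall fun _ _ => trivial)
    (ae_of_all _ fun _ _ => trivial) hpc.intervalIntegrable
  refine h.congr fun i => ?_
  rw [smul_eq_mul, ← div_eq_inv_mul]

/-- Weak convergence of decreasing sequences gives a pointwise upper bound. -/
theorem eventually_le_of_weak {α : Type*} {l : Filter α} {n : α → ℕ} {p : ∀ i, Fin (n i) → ℝ}
    {h : ℝ → ℝ} (hn : Tendsto n l atTop) (hp : ∀ i, Antitone (p i))
    (hanti : AntitoneOn h (Set.Icc 0 1)) (hc : ContinuousOn h (Set.Icc 0 1))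
    (hw : ∀ ψ : ℝ → ℝ, Continuous ψ → (∀ x, 0 ≤ ψ x ∧ ψ x ≤ 1) →
      Tendsto (fun i => (∑ j, ψ (p i j)) / n i) l (𝓝 (∫ t in (0 : ℝ)..1, ψ (h t))))
    {t : ℝ} (ht : t ∈ Set.Ioo (0 : ℝ) 1) {ε : ℝ} (hε : 0 < ε) :
    ∀ᶠ i in l, ∀ j : Fin (n i), t ≤ ((j : ℕ) + 1 : ℝ) / n i → p i j ≤ h t + ε := by
  obtain ⟨δ, hδ, hδP⟩ := Metric.continuousWithinAt_iff.mp (hc t ⟨ht.1.le, ht.2.le⟩) (ε / 2)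
    (by positivity)
  set t' := max (t - δ / 2) (t / 2) with ht'
  have h1 : t' < t := max_lt (by linarith) (by linarith [ht.1])
  have h2 : 0 < t' := lt_max_of_lt_right (by linarith [ht.1])
  have h3 : h t' ≤ h t + ε / 2 := by
    have := hδP (x := t') ⟨h2.le, (h1.trans ht.2).le⟩ (by
      rw [Real.dist_eq, abs_sub_comm, abs_of_pos (by linarith)]
      have := le_max_left (t - δ / 2) (t / 2)
      linarith)
    rw [Real.dist_eq] at this
    linarith [(abs_lt.mp this).2]
  set ψ : ℝ → ℝ := fun x => max 0 (min 1 ((x - (h t + ε / 2)) / (ε / 2))) with hψ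
  have hψ0 : ∀ x, 0 ≤ ψ x := fun x => le_max_left _ _
  have hψ1 : ∀ x, ψ x ≤ 1 := fun x => max_le zero_le_one (min_le_left _ _)
  have hψc : Continuous ψ := by
    refine continuous_const.max (continuous_const.min ?_)
    exact (continuous_id.sub continuous_const).div_const _
  have hψh : ContinuousOn (fun s => ψ (h s)) (Set.Icc 0 1) := hψc.comp_continuousOn hc
  have hint : ∀ a ∈ Set.Icc (0 : ℝ) 1, ∀ b ∈ Set.Icc (0 : ℝ) 1,
      IntervalIntegrable (fun s => ψ (h s)) volume a b := fun a ha b hb =>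
    (hψh.mono ((Set.uIcc_subset_uIcc (by rwa [Set.uIcc_of_le zero_le_one])
      (by rwa [Set.uIcc_of_le zero_le_one])).trans_eq
        (Set.uIcc_of_le (zero_le_one (α := ℝ))))).intervalIntegrable
  have m0 : (0 : ℝ) ∈ Set.Icc (0 : ℝ) 1 := ⟨le_rfl, zero_le_one⟩
  have m1 : (1 : ℝ) ∈ Set.Icc (0 : ℝ) 1 := ⟨zero_le_one, le_rfl⟩
  have mt : t' ∈ Set.Icc (0 : ℝ) 1 := ⟨h2.le, (h1.trans ht.2).le⟩
  have hI : ∫ s in (0 : ℝ)..1, ψ (h s) ≤ t' := by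
    rw [← intervalIntegral.integral_add_adjacent_intervals (hint 0 m0 t' mt) (hint t' mt 1 m1)]
    have e1 : ∫ s in (0 : ℝ)..t', ψ (h s) ≤ ∫ _s in (0 : ℝ)..t', (1 : ℝ) :=
      intervalIntegral.integral_mono_on h2.le (hint 0 m0 t' mt) intervalIntegrable_const
        fun s _ => hψ1 _
    have e2 : ∫ s in t'..(1 : ℝ), ψ (h s) ≤ ∫ _s in t'..(1 : ℝ), (0 : ℝ) :=
      intervalIntegral.integral_mono_on mt.2 (hint t' mt 1 m1) intervalIntegrable_const
        fun s hs => by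
          have h4 := hanti mt ⟨h2.le.trans hs.1, hs.2⟩ hs.1
          refine (max_eq_left ((min_le_right _ _).trans ?_)).le
          exact div_nonpos_of_nonpos_of_nonneg (by linarith) (by positivity)
    simp only [intervalIntegral.integral_const, sub_zero, smul_eq_mul, mul_one, mul_zero] at e1 e2
    linarith
  filter_upwards [(hw ψ hψc fun x => ⟨hψ0 x, hψ1 x⟩).eventually_lt_const (hI.trans_lt h1),
    hn.eventually_gt_atTop 0] with i h4 hi j hj
  by_contra! hlt
  have hi' : (0 : ℝ) < n i := by exact_mod_cast hi
  have h5 : ∀ k ∈ Finset.Iic j, ψ (p i k) = 1 := by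
    intro k hk
    have := hp i (Finset.mem_Iic.mp hk)
    have h6 : 1 ≤ (p i k - (h t + ε / 2)) / (ε / 2) := by
      rw [le_div_iff₀ (by positivity)]; linarith
    rw [hψ]
    simp only []
    rw [min_eq_left h6, max_eq_right zero_le_one]
  have h6 : ((j : ℕ) + 1 : ℝ) ≤ ∑ k, ψ (p i k) := by
    refine le_trans ?_ (Finset.sum_le_sum_of_subset_of_nonneg (Finset.subset_univ (Finset.Iic j))
      fun k _ _ => hψ0 _)
    rw [Finset.sum_congr rfl h5, Finset.sum_const, Fin.card_Iic]
    simp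
  have h7 : ((j : ℕ) + 1 : ℝ) / n i ≤ (∑ k, ψ (p i k)) / n i := by gcongr
  linarith

/-- Weak convergence of decreasing sequences implies pointwise convergence of the step functions. -/
theorem tendsto_stepFn_of_weak {α : Type*} {l : Filter α} {n : α → ℕ} {p : ∀ i, Fin (n i) → ℝ}
    {h : ℝ → ℝ} (hn : Tendsto n l atTop) (hp : ∀ i, Antitone (p i))
    (hanti : AntitoneOn h (Set.Icc 0 1)) (hc : ContinuousOn h (Set.Icc 0 1))
    (hw : ∀ ψ : ℝ → ℝ, Continuous ψ → (∀ x, 0 ≤ ψ x ∧ ψ x ≤ 1) →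
      Tendsto (fun i => (∑ j, ψ (p i j)) / n i) l (𝓝 (∫ t in (0 : ℝ)..1, ψ (h t))))
    {t : ℝ} (ht : t ∈ Set.Ioo (0 : ℝ) 1) : Tendsto (fun i => stepFn (p i) t) l (𝓝 (h t)) := by
  have hmem : ∀ s ∈ Set.Icc (0 : ℝ) 1, 1 - s ∈ Set.Icc (0 : ℝ) 1 := fun s hs =>
    ⟨by linarith [hs.2], by linarith [hs.1]⟩
  have hlow : ∀ ε > 0, ∀ᶠ i in l, ∀ j : Fin (n i), (j : ℕ) / (n i : ℝ) ≤ t → h t - ε ≤ p i j := by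
    intro ε hε
    have key := eventually_le_of_weak (p := fun i j => -p i (Fin.rev j)) (h := fun s => -h (1 - s)) hn
      (fun i a b hab => neg_le_neg (hp i (Fin.rev_le_rev.mpr hab)))
      (fun a ha b hb hab => neg_le_neg (hanti (hmem b hb) (hmem a ha) (by linarith)))
      (hc.comp (continuous_const.sub continuous_id).continuousOn hmem).neg ?_
      (t := 1 - t) ⟨by linarith [ht.2], by linarith [ht.1]⟩ hε
    · filter_upwards [key, hn.eventually_gt_atTop 0] with i h1 hi j hj
      have hi' : (0 : ℝ) < n i := by exact_mod_cast hi
      have h2 := h1 (Fin.rev j) (by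
        rw [Fin.val_rev, Nat.cast_sub j.2, le_div_iff₀ hi']
        rw [div_le_iff₀ hi'] at hj
        push_cast
        linarith)
      rw [Fin.rev_rev, sub_sub_cancel] at h2
      linarith
    · intro ψ hψ h01
      have h1 := hw (fun x => ψ (-x)) (hψ.comp continuous_neg) fun x => h01 _
      have h2 := intervalIntegral.integral_comp_sub_left (fun s => ψ (-h s)) (a := 0) (b := 1) 1
      rw [sub_self, sub_zero] at h2
      rw [h2]
      refine h1.congr fun i => ?_
      congr 1
      exact (Equiv.sum_comp Fin.revPerm fun j => ψ (-p i j)).symm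
  rw [Metric.tendsto_nhds]
  intro ε hε
  filter_upwards [eventually_le_of_weak hn hp hanti hc hw ht (half_pos hε), hlow _ (half_pos hε),
    hn.eventually_gt_atTop 0] with i h1 h2 hi
  obtain ⟨j, hj⟩ := exists_cell hi ⟨ht.1, ht.2.le⟩
  rw [stepFn_eq _ j hj, Real.dist_eq, abs_lt]
  constructor
  · linarith [h2 j hj.1.le]
  · linarith [h1 j hj.2]

/-- The projection to `[-B, B]`. -/
noncomputable def clip (B x : ℝ) : ℝ := max (-B) (min B x)

theorem continuous_clip (B : ℝ) : Continuous (clip B) := by unfold clip; fun_prop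

theorem clip_of_abs_le {B x : ℝ} (h : |x| ≤ B) : clip B x = x := by
  rw [clip, min_eq_right (abs_le.mp h).2, max_eq_right (abs_le.mp h).1]

theorem abs_clip_le {B : ℝ} (hB : 0 ≤ B) (x : ℝ) : |clip B x| ≤ B :=
  abs_le.mpr ⟨le_max_left _ _, max_le (by linarith) (min_le_left _ _)⟩

theorem tendsto_stepDist_clip {α : Type*} {l : Filter α} [l.IsCountablyGenerated] {n : α → ℕ}
    (hn : Tendsto n l atTop) {p : ∀ i, Fin (n i) → ℝ} {h : ℝ → ℝ}
    (hint : IntervalIntegrable h volume 0 1)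
    (hpt : ∀ t ∈ Set.Ioo (0 : ℝ) 1, Tendsto (fun i => stepFn (p i) t) l (𝓝 (h t))) {B : ℝ}
    (hB : ∀ t ∈ Set.Icc (0 : ℝ) 1, |h t| ≤ B) :
    Tendsto (fun i => stepDist (fun j => clip B (p i j)) h) l (𝓝 0) := by
  have hB0 : 0 ≤ B := (abs_nonneg _).trans (hB 0 ⟨le_rfl, zero_le_one⟩)
  have h1 := intervalIntegral.tendsto_integral_filter_of_dominated_convergence
    (μ := volume) (a := 0) (b := 1) (l := l) (f := fun _ => (0 : ℝ))
    (F := fun i t => |stepFn (fun j => clip B (p i j)) t - h t|)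
    (fun _ => 2 * B) ?_ ?_ intervalIntegrable_const ?_
  · simpa [stepDist] using h1
  · filter_upwards [hn.eventually_gt_atTop 0] with i hi
    exact ((intervalIntegrable_stepFn hi _).sub hint).abs.def'.aestronglyMeasurable
  · filter_upwards [hn.eventually_gt_atTop 0] with i hi
    refine ae_of_all _ fun t ht => ?_
    rw [Set.uIoc_of_le zero_le_one] at ht
    obtain ⟨j, hj⟩ := exists_cell hi ht
    rw [stepFn_eq _ j hj, Real.norm_eq_abs, abs_abs]
    have h2 := abs_clip_le hB0 (p i j)
    have h3 := hB t ⟨ht.1.le, ht.2⟩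
    exact (abs_sub _ _).trans (by linarith)
  · filter_upwards [(Set.countable_singleton (1 : ℝ)).ae_notMem volume] with t ht1 ht
    rw [Set.uIoc_of_le zero_le_one] at ht
    have ht' : t ∈ Set.Ioo (0 : ℝ) 1 := ⟨ht.1, lt_of_le_of_ne ht.2 ht1⟩
    have h2 := ((continuous_clip B).tendsto _).comp (hpt t ht')
    rw [clip_of_abs_le (hB t ⟨ht.1.le, ht.2⟩)] at h2
    have h3 := (h2.sub_const (h t)).abs
    rw [sub_self, abs_zero] at h3
    refine h3.congr' ?_
    filter_upwards [hn.eventually_gt_atTop 0] with i hi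
    rw [stepFn_comp hi (p i) (clip B) ht]
    rfl

theorem dist_le_of_tendsto_stepFn {α : Type*} {l : Filter α} [l.NeBot] {n : α → ℕ}
    (hn : Tendsto n l atTop) {p : ∀ i, Fin (n i) → ℝ} {h : ℝ → ℝ}
    (hpt : ∀ t ∈ Set.Ioo (0 : ℝ) 1, Tendsto (fun i => stepFn (p i) t) l (𝓝 (h t))) {d : ℝ} {w : ℂ}
    (hd : ∀ᶠ i in l, ∀ j, d ≤ ‖w - p i j‖) :
    ∀ᵐ t, t ∈ Set.Ioc (0 : ℝ) 1 → d ≤ ‖w - h t‖ := by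
  filter_upwards [(Set.countable_singleton (1 : ℝ)).ae_notMem volume] with t ht1 ht
  have h1 := ((Complex.continuous_ofReal.tendsto _).comp
    (hpt t ⟨ht.1, lt_of_le_of_ne ht.2 ht1⟩)).const_sub w |>.norm
  refine ge_of_tendsto h1 ?_
  filter_upwards [hd, hn.eventually_gt_atTop 0] with i hi h0
  obtain ⟨j, hj⟩ := exists_cell h0 ht
  rw [Function.comp_apply, stepFn_eq _ j hj]
  exact hi j

end SchurAsymp

namespace SchurAsymp

open MeasureTheory

theorem abs_sub_clip_le {B : ℝ} (hB : 0 ≤ B) (x : ℝ) : |x - clip B x| ≤ |x| := by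
  unfold clip
  rcases le_total B x with h | h
  · rw [min_eq_left h, max_eq_right (by linarith), abs_of_nonneg (by linarith),
      abs_of_nonneg (hB.trans h)]
    linarith
  · rw [min_eq_right h]
    rcases le_total (-B) x with h' | h'
    · rw [max_eq_right h', sub_self, abs_zero]
      exact abs_nonneg x
    · rw [max_eq_left h', abs_of_nonpos (by linarith), abs_of_nonpos (by linarith)]
      linarith

theorem norm_sub_clip_le {B : ℝ} {w : ℂ} (hB : ‖w‖ ≤ B) (x : ℝ) : ‖w - clip B x‖ ≤ ‖w - x‖ := by
  have hre := abs_le.mp ((Complex.abs_re_le_norm w).trans hB)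
  have hB0 := (norm_nonneg w).trans hB
  rw [← sq_le_sq₀ (norm_nonneg _) (norm_nonneg _), Complex.sq_norm, Complex.sq_norm,
    Complex.normSq_apply, Complex.normSq_apply]
  simp only [Complex.sub_re, Complex.ofReal_re, Complex.sub_im, Complex.ofReal_im, sub_zero]
  have key : (w.re - clip B x) * (w.re - clip B x) ≤ (w.re - x) * (w.re - x) := by
    unfold clip
    rcases le_total B x with h | h
    · rw [min_eq_left h, max_eq_right (by linarith)]
      nlinarith
    · rw [min_eq_right h]
      rcases le_total (-B) x with h' | h'
      · rw [max_eq_right h']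
      · rw [max_eq_left h']
        nlinarith
  linarith

/-- The error of clipping is controlled, uniformly in `w`, by the error at a single point. -/
theorem exists_truncLog_clip_le {d d₀ B : ℝ} (hd : 0 < d) (hd₀ : 0 < d₀) {w₀ : ℂ} (hB : d₀ ≤ B)
    (hB' : 4 * ‖w₀‖ ≤ B) :
    ∃ C : ℝ, 0 ≤ C ∧ ∀ (w : ℂ) (x : ℝ), d₀ ≤ ‖w₀ - x‖ →
      truncLog d w (clip (2 * B) x) - C * (truncLog d₀ w₀ x - truncLog d₀ w₀ (clip B x)) ≤
        truncLog d w x := by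
  have hB0 : 0 < B := hd₀.trans_le hB
  have hlog : 0 < Real.log (7 / 5) := Real.log_pos (by norm_num)
  set A := Real.log (1 + 2 * B / d) with hA
  have hA0 : 0 ≤ A := Real.log_nonneg (le_add_of_nonneg_right (by positivity))
  refine ⟨max 1 (A / Real.log (7 / 5)), by positivity, fun w x hx => ?_⟩
  set C := max 1 (A / Real.log (7 / 5)) with hC
  have hC0 : 0 ≤ C := zero_le_one.trans (le_max_left _ _)
  have hw₀ : ‖w₀‖ ≤ B := by linarith [norm_nonneg w₀]
  rcases le_or_gt |x| (2 * B) with h | h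
  · rw [clip_of_abs_le h]
    have : truncLog d₀ w₀ (clip B x) ≤ truncLog d₀ w₀ x := by
      refine Real.log_le_log (hd₀.trans_le (le_max_right _ _)) ?_
      exact max_le_max (norm_sub_clip_le hw₀ x) le_rfl
    nlinarith
  · set τ := |x| / (2 * B) with hτ
    have hτ1 : 1 ≤ τ := by rw [hτ, le_div_iff₀ (by positivity)]; linarith
    have hxτ : |x| = 2 * B * τ := by rw [hτ]; field_simp
    have hτl : 0 ≤ Real.log τ := Real.log_nonneg hτ1
    have h1 : truncLog d w (clip (2 * B) x) ≤ truncLog d w x + (Real.log τ + A) := by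
      set M := max ‖w - x‖ d with hM
      have hMd : d ≤ M := le_max_right _ _
      have hM0 : 0 < M := hd.trans_le hMd
      have e : w - (clip (2 * B) x : ℂ) = (w - x) + ((x - clip (2 * B) x : ℝ) : ℂ) := by
        push_cast; ring
      have h2 : max ‖w - (clip (2 * B) x : ℂ)‖ d ≤ M + |x| := by
        refine max_le ?_ (by linarith [abs_nonneg x])
        rw [e]
        refine (norm_add_le _ _).trans (add_le_add (le_max_left _ _) ?_)
        rw [Complex.norm_real, Real.norm_eq_abs]
        exact abs_sub_clip_le (by positivity) x
      have h3 : M + |x| ≤ M * (τ * (1 + 2 * B / d)) := by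
        have h4 : |x| ≤ M * (2 * B / d * τ) := by
          rw [hxτ]
          have : d * (2 * B / d * τ) ≤ M * (2 * B / d * τ) := by gcongr
          refine le_trans (le_of_eq ?_) this
          field_simp
        nlinarith
      rw [truncLog, truncLog, ← hM, hA, ← Real.log_mul (by positivity) (by positivity),
        ← Real.log_mul (by positivity) (by positivity)]
      exact Real.log_le_log (hd.trans_le (le_max_right _ _)) (h2.trans h3)
    have h2 : Real.log τ + Real.log (7 / 5) ≤ truncLog d₀ w₀ x - truncLog d₀ w₀ (clip B x) := by
      have h3 : 7 / 8 * |x| ≤ ‖w₀ - x‖ := by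
        have := norm_sub_norm_le (x : ℂ) w₀
        rw [Complex.norm_real, Real.norm_eq_abs, norm_sub_rev] at this
        linarith
      have h4 : max ‖w₀ - (clip B x : ℂ)‖ d₀ ≤ 5 / 4 * B := by
        refine max_le ((norm_sub_le _ _).trans ?_) (by linarith)
        rw [Complex.norm_real, Real.norm_eq_abs]
        linarith [abs_clip_le hB0.le x]
      have h5 : truncLog d₀ w₀ (clip B x) ≤ Real.log (5 / 4 * B) :=
        Real.log_le_log (hd₀.trans_le (le_max_right _ _)) h4
      have h6 : Real.log (7 / 8 * |x|) ≤ truncLog d₀ w₀ x := by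
        rw [truncLog_eq hx]
        exact Real.log_le_log (by rw [hxτ]; positivity) h3
      have h7 : 7 / 8 * |x| = 5 / 4 * B * (τ * (7 / 5)) := by rw [hxτ]; ring
      rw [h7, Real.log_mul (by positivity) (by positivity),
        Real.log_mul (show τ ≠ 0 by positivity) (by positivity)] at h6
      linarith
    have h3 : Real.log τ + A ≤ C * (Real.log τ + Real.log (7 / 5)) := by
      have h4 : A ≤ C * Real.log (7 / 5) := by
        have : A / Real.log (7 / 5) ≤ C := le_max_right _ _
        rwa [div_le_iff₀ hlog] at this
      have h5 : Real.log τ ≤ C * Real.log τ := le_mul_of_one_le_left hτl (le_max_left _ _)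
      linarith
    have := mul_le_mul_of_nonneg_left h2 hC0
    linarith

theorem le_mean_log_of_tendsto_stepFn {α : Type*} {l : Filter α} [l.IsCountablyGenerated] [l.NeBot]
    {n : α → ℕ} (hn : Tendsto n l atTop) {p : ∀ i, Fin (n i) → ℝ} {f : ℝ → ℝ}
    (hint : IntervalIntegrable (limitPole f) volume 0 1)
    (hpt : ∀ t ∈ Set.Ioo (0 : ℝ) 1, Tendsto (fun i => stepFn (p i) t) l (𝓝 (limitPole f t))) {H : ℝ}
    (hH : ∀ t ∈ Set.Icc (0 : ℝ) 1, |limitPole f t| ≤ H) {w₀ : ℂ} {d₀ : ℝ} (hd₀ : 0 < d₀)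
    (hdist₀ : ∀ᶠ i in l, ∀ j, d₀ ≤ ‖w₀ - p i j‖)
    (hU : Tendsto (fun i => (∑ j, Real.log ‖w₀ - p i j‖) / n i) l (𝓝 (F f w₀).re)) {d : ℝ}
    (hd : 0 < d) {γ : ℝ → ℂ} (hdist : ∀ᶠ i in l, ∀ (s : ℝ) j, d ≤ ‖γ s - p i j‖) {η : ℝ}
    (hη : 0 < η) :
    ∀ᶠ i in l, ∀ s : ℝ, (F f (γ s)).re - η ≤ (∑ j, Real.log ‖γ s - p i j‖) / n i := by
  set B := max H (max d₀ (4 * ‖w₀‖)) with hB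
  have hB1 : H ≤ B := le_max_left _ _
  have hB2 : d₀ ≤ B := (le_max_left _ _).trans (le_max_right _ _)
  have hB3 : 4 * ‖w₀‖ ≤ B := (le_max_right _ _).trans (le_max_right _ _)
  obtain ⟨C, hC, hCP⟩ := exists_truncLog_clip_le hd hd₀ hB2 hB3
  have hc1 := tendsto_stepDist_clip hn hint hpt fun t ht => (hH t ht).trans hB1
  have hc2 := tendsto_stepDist_clip hn hint hpt (B := 2 * B) fun t ht => (hH t ht).trans (by linarith)
  have hfar₀ := dist_le_of_tendsto_stepFn hn hpt hdist₀
  have hfar : ∀ s : ℝ, ∀ᵐ t, t ∈ Set.Ioc (0 : ℝ) 1 → d ≤ ‖γ s - limitPole f t‖ := fun s =>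
    dist_le_of_tendsto_stepFn hn hpt (hdist.mono fun k hk j => hk s j)
  have hδ : Tendsto (fun i => (∑ j, truncLog d₀ w₀ (p i j)) / n i -
      (∑ j, truncLog d₀ w₀ (clip B (p i j))) / n i) l (𝓝 0) := by
    have h1 : Tendsto (fun i => (∑ j, truncLog d₀ w₀ (clip B (p i j))) / n i) l
        (𝓝 (F f w₀).re) := by
      rw [F_re_eq_truncLog hd₀ hint hfar₀, tendsto_iff_norm_sub_tendsto_zero]
      have h2 := hc1.const_mul d₀⁻¹
      rw [mul_zero] at h2
      refine squeeze_zero' (Eventually.of_forall fun _ => norm_nonneg _) ?_ h2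
      filter_upwards [hn.eventually_gt_atTop 0] with i hi
      exact abs_mean_truncLog_sub_le hi hd₀ w₀ _ hint
    have h2 := hU.sub h1
    rw [sub_self] at h2
    refine h2.congr' ?_
    filter_upwards [hdist₀] with i hi
    rw [Finset.sum_congr rfl fun j _ => truncLog_eq (hi j)]
  have hsmall := (hc2.const_mul d⁻¹).add (hδ.const_mul C)
  rw [mul_zero, mul_zero, zero_add] at hsmall
  filter_upwards [hsmall.eventually_lt_const hη, hn.eventually_gt_atTop 0, hdist, hdist₀]
    with i h1 hi h3 h4 s
  have hi' : (0 : ℝ) < n i := by exact_mod_cast hi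
  have h5 := (abs_le.mp (abs_mean_truncLog_sub_le hi hd (γ s) (fun j => clip (2 * B) (p i j)) hint)).1
  rw [← F_re_eq_truncLog hd hint (hfar s)] at h5
  have h6 : (∑ j, truncLog d (γ s) (clip (2 * B) (p i j))) / n i -
      C * ((∑ j, truncLog d₀ w₀ (p i j)) / n i - (∑ j, truncLog d₀ w₀ (clip B (p i j))) / n i) ≤
      (∑ j, Real.log ‖γ s - p i j‖) / n i := by
    rw [← sub_div, ← mul_div_assoc, ← sub_div, ← Finset.sum_sub_distrib, Finset.mul_sum,
      ← Finset.sum_sub_distrib]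
    refine div_le_div_of_nonneg_right (Finset.sum_le_sum fun j _ => ?_) hi'.le
    rw [← truncLog_eq (h3 s j)]
    exact hCP (γ s) (p i j) (h4 j)
  linarith

end SchurAsymp

namespace SchurAsymp

open MeasureTheory

theorem TwiceDifferentiable.exists_abs_limitPole_le {f : ℝ → ℝ} (hf : TwiceDifferentiable f) :
    ∃ H : ℝ, ∀ t ∈ Set.Icc (0 : ℝ) 1, |limitPole f t| ≤ H := by
  obtain ⟨H, hH⟩ := isCompact_Icc.exists_bound_of_continuousOn hf.continuousOn
  exact ⟨H, hH⟩

theorem antitoneOn_limitPole {f : ℝ → ℝ} (hf : AntitoneOn f (Set.Icc 0 1)) :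
    AntitoneOn (limitPole f) (Set.Icc 0 1) := fun a ha b hb hab => by
  have := hf ha hb hab
  rw [limitPole, limitPole]
  linarith

theorem TwiceDifferentiable.ne_limitPole_of_antitoneOn {f : ℝ → ℝ} (hf : TwiceDifferentiable f)
    (hanti : AntitoneOn f (Set.Icc 0 1)) {y w : ℂ} (hcrit : IsCriticalPoint f y w) {t : ℝ}
    (ht : t ∈ Set.Icc (0 : ℝ) 1) : w ≠ limitPole f t := by
  have m0 : (0 : ℝ) ∈ Set.Icc (0 : ℝ) 1 := ⟨le_rfl, zero_le_one⟩
  have m1 : (1 : ℝ) ∈ Set.Icc (0 : ℝ) 1 := ⟨zero_le_one, le_rfl⟩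
  by_cases h : w = limitPole f 0
  · refine hf.ne_limitPole hcrit m1 (fun h' => ?_) ht
    have h1 : limitPole f 0 = limitPole f 1 := Complex.ofReal_injective (h.symm.trans h')
    have h2 := hanti m0 m1 zero_le_one
    rw [limitPole, limitPole] at h1
    linarith
  · exact hf.ne_limitPole hcrit m0 h ht

theorem TwiceDifferentiable.exists_slit {f : ℝ → ℝ} (hf : TwiceDifferentiable f) {w : ℂ}
    (hw : ∀ t ∈ Set.Icc (0 : ℝ) 1, w ≠ limitPole f t) :
    ∃ s c : ℂ, s ≠ 0 ∧ ∀ t ∈ Set.Icc (0 : ℝ) 1, s * (w - limitPole f t) ∈ Complex.slitPlane ∧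
      Complex.log (w - limitPole f t) = Complex.log (s * (w - limitPole f t)) + c := by
  by_cases him : w.im = 0
  · obtain ⟨x, rfl⟩ : ∃ x : ℝ, w = x := ⟨w.re, Complex.ext rfl (by simpa using him)⟩
    rcases hf.lt_or_gt (w := x) fun t ht h => hw t ht (by rw [h]) with h | h
    · refine ⟨1, 0, one_ne_zero, fun t ht => ?_⟩
      rw [one_mul, add_zero, ← Complex.ofReal_sub]
      exact ⟨Complex.ofReal_mem_slitPlane.mpr (sub_pos.mpr (h t ht)), rfl⟩
    · refine ⟨-1, Real.pi * Complex.I, neg_ne_zero.mpr one_ne_zero, fun t ht => ?_⟩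
      have hpos := sub_pos.mpr (h t ht)
      have e : -1 * ((x : ℂ) - limitPole f t) = ((limitPole f t - x : ℝ) : ℂ) := by push_cast; ring
      rw [e]
      refine ⟨Complex.ofReal_mem_slitPlane.mpr hpos, ?_⟩
      have e' : (x : ℂ) - limitPole f t = ((-(limitPole f t - x) : ℝ) : ℂ) := by push_cast; ring
      rw [e', Complex.log, Complex.log, Complex.norm_real, Complex.norm_real, norm_neg,
        Complex.arg_ofReal_of_neg (neg_neg_of_pos hpos), Complex.arg_ofReal_of_nonneg hpos.le]
      simp
  · refine ⟨1, 0, one_ne_zero, fun t ht => ?_⟩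
    rw [one_mul, add_zero]
    exact ⟨Or.inr (by simpa using him), rfl⟩

theorem tendsto_prod_mul_exp_F_complex {α : Type*} {l : Filter α} {n : α → ℕ}
    (hn : Tendsto n l atTop) {f : ℝ → ℝ} (hf : TwiceDifferentiable f) {w : ℂ}
    (hw : ∀ t ∈ Set.Icc (0 : ℝ) 1, w ≠ limitPole f t) :
    Tendsto (fun i => (∏ j : Fin (n i), (w - limitPole f (((j : ℕ) + 1 : ℝ) / n i))) *
      Complex.exp (-(n i * F f w))) l
      (𝓝 (Complex.exp ((Complex.log (w - limitPole f 1) - Complex.log (w - limitPole f 0)) / 2))) := by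
  obtain ⟨ρ, hρ, hd⟩ := hf.exists_dist_le hw
  obtain ⟨s, c, hs, hsc⟩ := hf.exists_slit hw
  have key := tendsto_trapezoid_log hn hf (w := fun _ => w) tendsto_const_nhds hs hρ
    (Eventually.of_forall fun _ => hd) (Eventually.of_forall fun _ t ht => (hsc t ht).1)
    fun t ht => (hsc t ht).1
  have hcont : ContinuousOn (fun t => Complex.log (s * (w - limitPole f t))) (Set.Icc (0 : ℝ) 1) :=
    (continuousOn_const.mul (continuousOn_const.sub
      (Complex.continuous_ofReal.comp_continuousOn hf.continuousOn))).clog fun t ht => (hsc t ht).1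
  have hF : F f w = (∫ t in (0 : ℝ)..1, Complex.log (s * (w - limitPole f t))) + c := by
    rw [F_eq, intervalIntegral.integral_congr (g := fun t =>
      Complex.log (s * (w - limitPole f t)) + c) fun t ht => (hsc t (by
        rwa [Set.uIcc_of_le zero_le_one] at ht)).2, intervalIntegral.integral_add
      (hcont.intervalIntegrable_of_Icc zero_le_one) intervalIntegrable_const]
    simp
  have key2 := (Complex.continuous_exp.tendsto _).comp key
  rw [(hsc 1 (by simp)).2, (hsc 0 (by simp)).2, add_sub_add_right_eq_sub]
  refine key2.congr fun i => ?_
  have hq : ∀ j : Fin (n i), w - limitPole f (((j : ℕ) + 1 : ℝ) / n i) ≠ 0 := fun j =>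
    sub_ne_zero.mpr (hw _ (grid_mem j))
  have hprod : ∏ j : Fin (n i), (w - limitPole f (((j : ℕ) + 1 : ℝ) / n i)) = Complex.exp
      ((∑ j : Fin (n i), Complex.log (s * (w - limitPole f (((j : ℕ) + 1 : ℝ) / n i)))) + n i * c) := by
    have : (n i : ℂ) * c = ∑ _j : Fin (n i), c := by simp
    rw [this, ← Finset.sum_add_distrib, Complex.exp_sum]
    refine Finset.prod_congr rfl fun j _ => ?_
    rw [← (hsc _ (grid_mem j)).2, Complex.exp_log (hq j)]
  rw [Function.comp_apply, hprod, ← Complex.exp_add, hF]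
  congr 1
  ring

theorem RefinedBall.tendsto_mean_log {ν : ℕ → ℕ} {lam : ∀ k, Fin (ν k) → ℤ} {f : ℝ → ℝ} {g : ℂ → ℂ}
    {w₀ : ℂ} {ρ : ℝ} (h : RefinedBall lam f g w₀ ρ) (hf : TwiceDifferentiable f)
    (hν : Tendsto ν atTop atTop) :
    Tendsto (fun k => (∑ j, Real.log ‖w₀ - pole (lam k) j‖) / ν k) atTop (𝓝 (F f w₀).re) := by
  have hρ := h.pos
  have hne : ∀ t ∈ Set.Icc (0 : ℝ) 1, ‖w₀ - limitPole f t‖ ≠ 0 := fun t ht =>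
    (hρ.trans_le (h.le_norm h.mem ht)).ne'
  have hcont : ContinuousOn (fun t => Real.log ‖w₀ - limitPole f t‖) (Set.Icc (0 : ℝ) 1) :=
    ((continuousOn_const.sub
      (Complex.continuous_ofReal.comp_continuousOn hf.continuousOn)).norm).log hne
  have h1 := tendsto_mean_grid hν hcont
  have hF : (F f w₀).re = ∫ t in (0 : ℝ)..1, Real.log ‖w₀ - limitPole f t‖ := by
    rw [F_re_eq_truncLog hρ
      (hf.continuousOn.intervalIntegrable_of_Icc zero_le_one)
      (ae_of_all _ fun t ht => h.le_norm h.mem ⟨ht.1.le, ht.2⟩)]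
    refine intervalIntegral.integral_congr fun t ht => ?_
    rw [Set.uIcc_of_le zero_le_one] at ht
    exact truncLog_eq (h.le_norm h.mem ht)
  rw [← hF] at h1
  have h2 := (h.tendsto_poleRatio tendsto_id (tendsto_const_nhds (x := w₀))).norm
  have hg0 : ‖g w₀‖ ≠ 0 := norm_ne_zero_iff.mpr (h.ne_zero _ h.mem)
  have h3 := (Real.continuousAt_log hg0).tendsto.comp h2
  have h4 := (((tendsto_natCast_atTop_atTop (R := ℝ)).comp hν).inv_tendsto_atTop.mul h3).add h1
  rw [zero_mul, zero_add] at h4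
  refine h4.congr' ?_
  filter_upwards [h.ne_pole] with k hk
  simp only [Function.comp_apply, id, Pi.inv_apply]
  rw [poleRatio, norm_prod, Real.log_prod fun j _ => norm_ne_zero_iff.mpr (div_ne_zero
    (sub_ne_zero.mpr (hk _ h.mem j)) (norm_ne_zero_iff.mp (hne _ (grid_mem j)))),
    ← div_eq_inv_mul, ← add_div, ← Finset.sum_add_distrib]
  congr 1
  refine Finset.sum_congr rfl fun j _ => ?_
  rw [norm_div, Real.log_div (norm_ne_zero_iff.mpr (sub_ne_zero.mpr (hk _ h.mem j)))
    (hne _ (grid_mem j)), sub_add_cancel]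

theorem RefinedBall.tendsto_meanDiff {ν : ℕ → ℕ} {lam : ∀ k, Fin (ν k) → ℤ} {f : ℝ → ℝ} {g : ℂ → ℂ}
    {w₀ : ℂ} {ρ : ℝ} (h : RefinedBall lam f g w₀ ρ) (hν : Tendsto ν atTop atTop)
    (Φ : C(OnePoint ℝ, ℂ)) :
    Tendsto (fun k => meanDiff (pole (lam k)) (fun j => limitPole f (((j : ℕ) + 1 : ℝ) / ν k))
      fun x => Φ x) atTop (𝓝 0) := by
  have hρ := h.pos
  have hbase : TendstoLocallyUniformlyOn (fun k (z : ℂ) => meanDiff (pole (lam k))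
      (fun j => limitPole f (((j : ℕ) + 1 : ℝ) / ν k)) fun x => (z - x)⁻¹) (fun _ => 0) atTop
      (Metric.ball w₀ ρ) := by
    rw [Metric.tendstoLocallyUniformlyOn_iff]
    intro ε hε z hz
    obtain ⟨t, ht, h1⟩ := Metric.tendstoLocallyUniformlyOn_iff.mp h.tendsto_poleDiff 1 one_pos z hz
    have hc := (h.differentiableOn_logDeriv.continuousOn z hz).norm
    have ht' : {w | ‖logDeriv g w‖ < ‖logDeriv g z‖ + 1} ∈ 𝓝[Metric.ball w₀ ρ] z :=
      hc.eventually_lt_const (by linarith)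
    refine ⟨_, Filter.inter_mem ht ht', ?_⟩
    have hsm := tendsto_inv_nat_mul_const hν (‖logDeriv g z‖ + 2)
    filter_upwards [h1, hsm.eventually_lt_const hε, hν.eventually_gt_atTop 0] with k h2 h3 h0 w hw
    have h0' : (0 : ℝ) < ν k := by exact_mod_cast h0
    refine lt_of_le_of_lt ?_ h3
    have h4 := h2 w hw.1
    have h5 : ‖logDeriv g w‖ < ‖logDeriv g z‖ + 1 := hw.2
    rw [dist_eq_norm] at h4
    have h6 := norm_sub_norm_le (poleDiff (pole (lam k))
      (fun j => limitPole f (((j : ℕ) + 1 : ℝ) / ν k)) w) (logDeriv g w)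
    rw [norm_sub_rev] at h6
    rw [dist_zero_left, meanDiff, Finset.sum_sub_distrib, norm_div, Complex.norm_natCast,
      ← div_eq_inv_mul]
    refine div_le_div_of_nonneg_right ?_ h0'.le
    rw [poleDiff] at h6
    rw [poleDiff] at h4
    linarith
  have hq : ∀ᶠ k in atTop, ∀ z ∈ Metric.ball w₀ ρ, ∀ j : Fin (ν k),
      z ≠ limitPole f (((j : ℕ) + 1 : ℝ) / ν k) := Eventually.of_forall fun k z hz j =>
    sub_ne_zero.mp (norm_pos_iff.mp (hρ.trans_le (h.le_norm hz (grid_mem j))))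
  obtain ⟨z₀, hz₀, him⟩ : ∃ z₀ ∈ Metric.ball w₀ ρ, z₀.im ≠ 0 := by
    have hmem : ∀ τ : ℝ, |τ| < ρ → w₀ + τ * Complex.I ∈ Metric.ball w₀ ρ := fun τ hτ => by
      rw [mem_ball_iff_norm, add_sub_cancel_left, norm_mul, Complex.norm_I, mul_one,
        Complex.norm_real]
      exact hτ
    by_cases h0 : w₀.im = 0
    · refine ⟨_, hmem (ρ / 2) (by rw [abs_of_pos (by positivity)]; linarith), ?_⟩
      simp [h0, hρ.ne']
    · exact ⟨w₀, h.mem, h0⟩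
  refine tendsto_meanDiff_of_moments him (fun m => ?_) Φ
  rcases m with _ | m
  · simp [meanDiff]
  · exact (tendstoLocallyUniformlyOn_meanDiff_inv_pow Metric.isOpen_ball h.ne_pole hq hbase
      m).tendsto_at hz₀

theorem RefinedBall.tendsto_stepFn_pole {ν : ℕ → ℕ} {lam : ∀ k, Fin (ν k) → ℤ} {f : ℝ → ℝ}
    {g : ℂ → ℂ} {w₀ : ℂ} {ρ : ℝ} (h : RefinedBall lam f g w₀ ρ) (hf : TwiceDifferentiable f)
    (hanti : AntitoneOn f (Set.Icc 0 1)) (hν : Tendsto ν atTop atTop)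
    (hlam : ∀ k, Antitone (lam k)) {t : ℝ} (ht : t ∈ Set.Ioo (0 : ℝ) 1) :
    Tendsto (fun k => stepFn (pole (lam k)) t) atTop (𝓝 (limitPole f t)) := by
  obtain ⟨H, hH⟩ := hf.exists_abs_limitPole_le
  refine tendsto_stepFn_of_weak hν (fun k => (pole_strictAnti (hlam k)).antitone)
    (antitoneOn_limitPole hanti) hf.continuousOn (fun ψ hψ h01 => ?_) ht
  have h1 := tendsto_mean_sub_mean_of_weak hν (h.tendsto_meanDiff hν)
    (fun k j => hH _ (grid_mem j)) hψ h01
  have h2 := tendsto_mean_grid hν (hψ.comp_continuousOn hf.continuousOn)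
  have h3 := h1.add h2
  rw [zero_add] at h3
  exact h3.congr fun k => by simp

theorem refined_asymptotics_complex {ν : ℕ → ℕ} (hν : Tendsto ν atTop atTop)
    {lam : ∀ k, Fin (ν k) → ℤ} (hlam : ∀ k, Antitone (lam k)) {f : ℝ → ℝ}
    (hf : TwiceDifferentiable f) (hanti : AntitoneOn f (Set.Icc 0 1)) {y w₀ : ℂ} {γ : ℝ → ℂ}
    (hcrit : IsCriticalPoint f y w₀) (hγ : IsSteepestDescentContour f y w₀ γ)
    (hdef : DeformableTo lam y γ) {M : Set ℂ} {g : ℂ → ℂ} (hM : IsOpen M) (hw₀ : w₀ ∈ M)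
    (hQ : TendstoUniformlyOn (fun k w => Complex.exp (Q (lam k) f w)) g atTop M) (hg : g w₀ ≠ 0) :
    ∃ r : ℂ, IsBranchOfRoot f w₀ (deriv γ 0) r ∧
      Tendsto (fun k => normSchur (lam k) (Complex.exp y) / complexMainTerm (ν k) f g y w₀ r)
        atTop (𝓝 1) := by
  obtain ⟨⟨d, hd, hdist⟩, hsame⟩ := hdef
  have hd₀ : ∀ᶠ k in atTop, ∀ j, d ≤ ‖w₀ - pole (lam k) j‖ := hdist.mono fun k hk j => by
    rw [← hγ.base]; exact hk 0 j
  have hwp : ∀ᶠ k in atTop, ∀ j, w₀ ≠ pole (lam k) j := hd₀.mono fun k hk j =>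
    sub_ne_zero.mp (norm_pos_iff.mp (hd.trans_le (hk j)))
  have hwh : ∀ t ∈ Set.Icc (0 : ℝ) 1, w₀ ≠ limitPole f t := fun t ht =>
    hf.ne_limitPole_of_antitoneOn hanti hcrit ht
  obtain ⟨ρ, hball⟩ := exists_refinedBall hν hf hM hQ hw₀ hg hwh hwp
  obtain ⟨H, hH⟩ := hf.exists_abs_limitPole_le
  have hU := hball.tendsto_mean_log hf hν
  have hsaddle := hball.tendsto_mean_inv hf hν tendsto_id (tendsto_const_nhds (x := w₀))
  rw [hcrit.2] at hsaddle
  obtain ⟨c, hc, hvc, hv, hlim⟩ := tendsto_contour_integral hν hγ hd hdist (hsame.mono fun k hk => hk.1)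
    (fun η hη => le_mean_log_of_tendsto_stepFn hν
      (hf.continuousOn.intervalIntegrable_of_Icc zero_le_one)
      (fun t ht => hball.tendsto_stepFn_pole hf hanti hν hlam ht) hH hd hd₀ hU hd hdist hη)
    tendsto_const_nhds hU hsaddle
    (hball.tendsto_mean_inv_sq hf hν tendsto_id (tendsto_const_nhds (x := w₀)))
  set v := deriv γ 0 with hvdef
  have hc0 : (0 : ℝ) < |c| := abs_pos.mpr hc
  have hcC : ((|c| : ℝ) : ℂ) ≠ 0 := Complex.ofReal_ne_zero.mpr hc0.ne'
  have h2π : (0 : ℝ) < √(2 * Real.pi) := Real.sqrt_pos.mpr Real.two_pi_pos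
  have h2πC : ((√(2 * Real.pi) : ℝ) : ℂ) ≠ 0 := Complex.ofReal_ne_zero.mpr h2π.ne'
  have hsq : ((√(2 * Real.pi) : ℝ) : ℂ) * ((√(2 * Real.pi) : ℝ) : ℂ) = 2 * Real.pi := by
    rw [← Complex.ofReal_mul, Real.mul_self_sqrt Real.two_pi_pos.le]
    push_cast; rfl
  have hV : √(2 * Real.pi / c ^ 2) = √(2 * Real.pi) / |c| := by
    rw [Real.sqrt_div Real.two_pi_pos.le, Real.sqrt_sq_eq_abs]
  rw [hV, Complex.ofReal_div] at hlim
  have hlim0 : v * (((√(2 * Real.pi) : ℝ) : ℂ) / ((|c| : ℝ) : ℂ)) ≠ 0 :=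
    mul_ne_zero hv (div_ne_zero h2πC hcC)
  set J := fun k => ∫ s, integrand (lam k) y (γ s) * deriv γ s with hJ
  have hJ0 : ∀ᶠ k in atTop, J k ≠ 0 := by
    filter_upwards [hlim.eventually_ne hlim0] with k hk h
    simp only [hJ] at h
    exact hk (by rw [h, zero_div, mul_zero])
  obtain ⟨hy, hS⟩ := normSchur_eq_contour_integral hν hlam hsame hJ0
  have hy' : Complex.exp y - 1 ≠ 0 := sub_ne_zero.mpr hy
  set E := Complex.exp ((Complex.log (w₀ - f 0 - 1) - Complex.log (w₀ - f 1)) / 2) with hE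
  have hE0 : E ≠ 0 := Complex.exp_ne_zero _
  set σ : ℂ := Complex.I * ((|c| : ℝ) : ℂ) / v with hσ
  have hσ0 : σ ≠ 0 := div_ne_zero (mul_ne_zero Complex.I_ne_zero hcC) hv
  have hvσ : v * σ = Complex.I * ((|c| : ℝ) : ℂ) := mul_div_cancel₀ _ hv
  refine ⟨E / σ, ⟨σ, ?_, ?_, rfl⟩, ?_⟩
  · have h1 : d2F f w₀ = ((c ^ 2 : ℝ) : ℂ) / v ^ 2 := by
      rw [← hvc, mul_div_cancel_left₀ _ (pow_ne_zero 2 hv)]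
    rw [h1, hσ, div_pow, mul_pow, Complex.I_sq, ← Complex.ofReal_pow, sq_abs]
    ring
  · rw [hvσ]
    simpa using hc
  · have hfac : Tendsto (fun k => ((factorialRatio (ν k) * Real.exp (ν k) / √(ν k) : ℝ) : ℂ)) atTop
        (𝓝 ((√(2 * Real.pi) : ℝ) : ℂ)) :=
      (Complex.continuous_ofReal.tendsto _).comp (tendsto_factorialRatio.comp hν)
    have hprod := tendsto_prod_mul_exp_F_complex hν hf hwh
    have e0 : w₀ - limitPole f 0 = w₀ - f 0 - 1 := by rw [limitPole]; push_cast; ring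
    have e1 : w₀ - limitPole f 1 = w₀ - f 1 := by rw [limitPole]; push_cast; ring
    have hE' : Complex.exp ((Complex.log (w₀ - limitPole f 1) - Complex.log (w₀ - limitPole f 0)) / 2)
        = E⁻¹ := by
      rw [e0, e1, hE, ← Complex.exp_neg]
      congr 1; ring
    rw [hE'] at hprod
    have hpr := hball.tendsto_poleRatio tendsto_id (tendsto_const_nhds (x := w₀))
    have hall := (((hfac.mul hlim).mul (hprod.inv₀ (inv_ne_zero hE0))).mul
      ((tendsto_const_nhds (x := g w₀)).div hpr hg)).mul_const
        ((2 * Real.pi * Complex.I)⁻¹ * (E / σ)⁻¹)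
    have hπ : (Real.pi : ℂ) ≠ 0 := Complex.ofReal_ne_zero.mpr Real.pi_ne_zero
    have hone : ((√(2 * Real.pi) : ℝ) : ℂ) * (v * (((√(2 * Real.pi) : ℝ) : ℂ) / ((|c| : ℝ) : ℂ))) *
        (E⁻¹)⁻¹ * (g w₀ / g w₀) * ((2 * Real.pi * Complex.I)⁻¹ * (E / σ)⁻¹) = 1 := by
      have e : ((√(2 * Real.pi) : ℝ) : ℂ) * (v * (((√(2 * Real.pi) : ℝ) : ℂ) / ((|c| : ℝ) : ℂ))) *
          (E⁻¹)⁻¹ * (g w₀ / g w₀) * ((2 * Real.pi * Complex.I)⁻¹ * (E / σ)⁻¹) =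
          (((√(2 * Real.pi) : ℝ) : ℂ) * ((√(2 * Real.pi) : ℝ) : ℂ)) * (v * σ) /
            (((|c| : ℝ) : ℂ) * (2 * Real.pi * Complex.I)) := by
        rw [div_self hg]
        field_simp
      have hI := Complex.I_ne_zero
      rw [e, hsq, hvσ]
      field_simp
    rw [hone] at hall
    refine hall.congr' ?_
    filter_upwards [hS, hwp, hν.eventually_gt_atTop 0] with k hSk hpk h0
    have hpos : (0 : ℝ) < ν k := by exact_mod_cast h0
    have hsq0 : ((√(ν k : ℝ) : ℝ) : ℂ) ≠ 0 := Complex.ofReal_ne_zero.mpr (Real.sqrt_pos.mpr hpos).ne'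
    have hA0 : ∏ j, (w₀ - pole (lam k) j) ≠ 0 :=
      Finset.prod_ne_zero_iff.mpr fun j _ => sub_ne_zero.mpr (hpk j)
    have hB0 : ∏ j : Fin (ν k), (w₀ - limitPole f (((j : ℕ) + 1 : ℝ) / ν k)) ≠ 0 :=
      Finset.prod_ne_zero_iff.mpr fun j _ => sub_ne_zero.mpr (hwh _ (grid_mem j))
    simp only [Pi.div_apply, id]
    rw [hSk, complexMainTerm, poleRatio, Finset.prod_div_distrib, integrand,
      show ((ν k : ℕ) : ℤ) - 1 = ((ν k - 1 : ℕ) : ℤ) by omega, zpow_natCast,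
      show (ν k : ℂ) * (y * w₀ - F f w₀) = ν k * y * w₀ + -(ν k * F f w₀) by ring, Complex.exp_add]
    push_cast
    have := pow_ne_zero (ν k - 1) hy'
    have := Complex.exp_ne_zero (ν k * y * w₀)
    have := Complex.exp_ne_zero (-(ν k * F f w₀))
    have := Complex.exp_ne_zero (ν k)
    have hI := Complex.I_ne_zero
    field_simp

end SchurAsymp

theorem proposition4p2
    -- signatures `lam k` of size `N = ν k → ∞`
    (ν : ℕ → ℕ) (hν : StrictMono ν) (lam : ∀ k, Fin (ν k) → ℤ) (hlam : ∀ k, Antitone (lam k))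
    (f : ℝ → ℝ) :
    -- logarithmic asymptotics, real `y`
    (SchurAsymp.PiecewiseContinuous f →
      BddAbove (Set.range fun k => SchurAsymp.Rinf (lam k) f) →
      Tendsto (fun k => SchurAsymp.R1 (lam k) f / (ν k : ℝ)) atTop (𝓝 0) →
      ∀ y w₀ : ℝ, y ≠ 0 → SchurAsymp.IsCriticalPoint f y w₀ →
        (∀ᶠ k in atTop, w₀ ∉ SchurAsymp.sigInterval (lam k)) →
        (∀ᶠ k in atTop, 0 < SchurAsymp.normSchur (lam k) (Real.exp y)) ∧
        Tendsto (fun k => Real.log (SchurAsymp.normSchur (lam k) (Real.exp y)) / (ν k : ℝ)) atTop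
          (𝓝 (y * w₀ - (SchurAsymp.F f w₀).re - 1 - Real.log |Real.exp y - 1|))) ∧
    -- refined asymptotics, real `y`, uniformly over compact sets of `y`
    (SchurAsymp.TwiceDifferentiable f →
      ∀ (M : Set ℂ) (g : ℂ → ℂ), IsOpen M →
        TendstoUniformlyOn (fun k w => Complex.exp (SchurAsymp.Q (lam k) f w)) g atTop M →
      ∀ (K : Set ℝ) (w₀ : ℝ → ℝ), IsCompact K →
        (∀ y ∈ K, y ≠ 0 ∧ SchurAsymp.IsCriticalPoint f y (w₀ y) ∧
          (∀ᶠ k in atTop, w₀ y ∉ SchurAsymp.sigInterval (lam k)) ∧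
          (w₀ y : ℂ) ∈ M ∧ g (w₀ y) ≠ 0 ∧ SchurAsymp.d2F f (w₀ y) ≠ 0) →
        TendstoUniformlyOn
          (fun k y => ((SchurAsymp.normSchur (lam k) (Real.exp y) : ℝ) : ℂ) /
            SchurAsymp.realMainTerm (ν k) f g y (w₀ y))
          (fun _ => 1) atTop K) ∧
    -- complex `y` with a steepest descent contour
    (AntitoneOn f (Set.Icc 0 1) →
      ∀ (y w₀ : ℂ) (γ : ℝ → ℂ), SchurAsymp.IsCriticalPoint f y w₀ →
        (∀ᶠ k in atTop, w₀ ∉ Complex.ofReal '' SchurAsymp.sigInterval (lam k)) →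
        SchurAsymp.IsSteepestDescentContour f y w₀ γ →
        SchurAsymp.DeformableTo lam y γ →
        -- logarithmic asymptotics, for suitable values of `ln S`
        ((SchurAsymp.PiecewiseContinuous f →
          BddAbove (Set.range fun k => SchurAsymp.Rinf (lam k) f) →
          Tendsto (fun k => SchurAsymp.R1 (lam k) f / (ν k : ℝ)) atTop (𝓝 0) →
          ∃ ℓ : ℕ → ℂ,
            (∀ᶠ k in atTop,
              Complex.exp (ℓ k) = SchurAsymp.normSchur (lam k) (Complex.exp y)) ∧
            Tendsto (fun k => ℓ k / (ν k : ℂ)) atTop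
              (𝓝 (y * w₀ - SchurAsymp.F f w₀ - 1 - Complex.log (Complex.exp y - 1)))) ∧
        -- refined asymptotics
        (SchurAsymp.TwiceDifferentiable f →
          ∀ (M : Set ℂ) (g : ℂ → ℂ), IsOpen M → w₀ ∈ M →
            TendstoUniformlyOn (fun k w => Complex.exp (SchurAsymp.Q (lam k) f w)) g atTop M →
            g w₀ ≠ 0 →
          ∃ r : ℂ, SchurAsymp.IsBranchOfRoot f w₀ (deriv γ 0) r ∧
            Tendsto
              (fun k => SchurAsymp.normSchur (lam k) (Complex.exp y) /
                SchurAsymp.complexMainTerm (ν k) f g y w₀ r)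
              atTop (𝓝 1)))) := by
  refine ⟨fun hf hRinf hR y w₀ hy hcrit hadm =>
      SchurAsymp.log_asymptotics_real hν hlam hf hRinf hR hy hcrit hadm,
    fun hf M g hM hQ K w₀ hK h =>
      SchurAsymp.refined_asymptotics_real hν.tendsto_atTop hlam hf hM hQ hK h,
    fun hanti y w₀ γ hcrit _ hγ hdef => ⟨fun hf _ hR =>
      SchurAsymp.log_asymptotics_complex hν.tendsto_atTop hlam hf hR hcrit hγ hdef,
    fun hf M g hM hw₀ hQ hg =>
      SchurAsymp.refined_asymptotics_complex hν.tendsto_atTop hlam hf hanti hcrit hγ hdef hM hw₀ hQ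
        hg⟩⟩
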